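/- Theorem (Gundlach). Let $F=\mathbb{Q}(\sqrt5)$ with ring of integers $\mathcal{O}_F$, let $x\mapsto x'$ denote its nontrivial automorphism, let $\mathbb{H}$ be the complex upper half plane, and let $\Gamma_F=\mathrm{SL}_2(\mathcal{O}_F)$ act on $\mathbb{H}^2$ by $\begin{pmatrix}a&b\\c&d\end{pmatrix}(z_1,z_2)=\left(\frac{az_1+b}{cz_1+d},\frac{a'z_2+b'}{c'z_2+d'}\right)$. Write $N(cz+d)=(cz_1+d)(c'z_2+d')$. For $k\in\mathbb{Z}$ let $M_k^{\mathrm{sym}}(\Gamma_F)$ be the complex vector space of symmetric holomorphic Hilbert modular forms of weight $k$, that is, of the holomorphic functions $f:\mathbb{H}^2\to\mathbb{C}$ with $f(\gamma z)=N(cz+d)^k f(z)$ for all $\gamma=\begin{pmatrix}a&b\\c&d\end{pmatrix}\in\Gamma_F$ and $z\in\mathbb{H}^2$, and with $f(z_1,z_2)=f(z_2,z_1)$. For even $k\ge 2$ let $g_k=\zeta_F(k)^{-1}G_k$ be the Eisenstein series of weight $k$ normalized to have constant term $1$; here $\zeta_F$ is the Dedekind zeta function of $F$ and $$G_k(z)=\sum_{(c,d)}N(cz+d)^{-k}\quad(k>2),\qquad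 G_2(z)=\lim_{s\to0^+}\sum_{(c,d)}N(cz+d)^{-2}\,|N(cz+d)|^{-2s},$$ where $(c,d)$ runs over $\left(\mathcal{O}_F^2\setminus\{(0,0)\}\right)/\mathcal{O}_F^*$, the units acting diagonally. Then the series defining $G_6$ and $G_{10}$, and for every $s>0$ the series in the definition of $G_2$, converge absolutely at every $z\in\mathbb{H}^2$, the limit defining $G_2(z)$ exists, and $g_2,g_6,g_{10}$ belong to $M_2^{\mathrm{sym}}(\Gamma_F)$, $M_6^{\mathrm{sym}}(\Gamma_F)$, $M_{10}^{\mathrm{sym}}(\Gamma_F)$ respectively. The graded algebra $$M_{2*}^{\mathrm{sym}}(\Gamma_F)=\bigoplus_{m\in\mathbb{Z}}M_{2m}^{\mathrm{sym}}(\Gamma_F)$$ of symmetric holomorphic Hilbert modular forms of even weight is the weighted polynomial ring $\mathbb{C}[g_2,g_6,g_{10}]$: there is an isomorphism of $\mathbb{C}$-algebras $\mathbb{C}[X_0,X_1,X_2]\to M_{2*}^{\mathrm{sym}}(\Gamma_F)$ with $X_0\mapsto g_2$, $X_1\mapsto g_6$, $X_2\mapsto g_{10}$, and when $X_0,X_1,X_2$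 are given the weights $2,6,10$, it maps the weighted homogeneous polynomials of weight $2m$ onto $M_{2m}^{\mathrm{sym}}(\Gamma_F)$ for every $m\ge 0$. -/

import Mathlib

open scoped UpperHalfPlane NumberField MatrixGroups DirectSum Topology

noncomputable section

namespace HilbertModular

/-! Throughout, `F` is a real quadratic field, `𝓞 F` is its ring of integers and `σ₁`, `σ₂` are
its two real embeddings. -/

variable {F : Type*} [Field F]

/-- A real embedding of `F`, restricted to the ring of integers. -/
def intEmb (σ : F →+* ℝ) : 𝓞 F →+* ℝ := σ.comp (algebraMap (𝓞 F) F)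

/-- The action of the Hilbert modular group `SL₂(𝓞 F)` on `ℍ × ℍ` by fractional linear
transformations, through the embedding `(σ₁, σ₂)` into `SL₂(ℝ) × SL₂(ℝ)`. -/
def act (σ₁ σ₂ : F →+* ℝ) (γ : SL(2, 𝓞 F)) (z : ℍ × ℍ) : ℍ × ℍ :=
  (Matrix.SpecialLinearGroup.map (intEmb σ₁) γ • z.1,
    Matrix.SpecialLinearGroup.map (intEmb σ₂) γ • z.2)

/-- `N(c z + d) = (σ₁(c) z₁ + σ₁(d)) (σ₂(c) z₂ + σ₂(d))`. -/
def normFactor (σ₁ σ₂ : F →+* ℝ) (c d : 𝓞 F) (z : ℍ × ℍ) : ℂ :=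
  ((intEmb σ₁ c : ℝ) * (z.1 : ℂ) + (intEmb σ₁ d : ℝ)) *
    ((intEmb σ₂ c : ℝ) * (z.2 : ℂ) + (intEmb σ₂ d : ℝ))

/-- A function on `ℍ × ℍ` is holomorphic if it is complex differentiable in the two variables
jointly, on the open subset `ℍ × ℍ` of `ℂ × ℂ`. -/
def IsHolomorphic (f : ℍ × ℍ → ℂ) : Prop :=
  DifferentiableOn ℂ
    (fun w : ℂ × ℂ => f (UpperHalfPlane.ofComplex w.1, UpperHalfPlane.ofComplex w.2))
    {w : ℂ × ℂ | 0 < w.1.im ∧ 0 < w.2.im}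

/-- The space `M_k(Γ_F)` of holomorphic Hilbert modular forms of parallel weight `k` for
`Γ_F = SL₂(𝓞 F)`. No condition at the cusps is imposed. -/
def modularForms (σ₁ σ₂ : F →+* ℝ) (k : ℤ) : Submodule ℂ (ℍ × ℍ → ℂ) where
  carrier := {f | IsHolomorphic f ∧ ∀ (γ : SL(2, 𝓞 F)) (z : ℍ × ℍ),
    f (act σ₁ σ₂ γ z) = normFactor σ₁ σ₂ (γ 1 0) (γ 1 1) z ^ k * f z}
  add_mem' := by
    rintro f g ⟨hf, hf'⟩ ⟨hg, hg'⟩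
    refine ⟨hf.add hg, fun γ z => ?_⟩
    simp only [Pi.add_apply, hf', hg', mul_add]
  zero_mem' := ⟨differentiableOn_const 0, fun _ _ => by simp⟩
  smul_mem' := by
    rintro a f ⟨hf, hf'⟩
    refine ⟨hf.const_smul a, fun γ z => ?_⟩
    simp only [Pi.smul_apply, hf', smul_eq_mul]
    ring

/-- The space of symmetric holomorphic Hilbert modular forms of weight `k` for `SL₂(𝓞 F)`:
those with `f(z₂, z₁) = f(z₁, z₂)`. -/
def symForms (σ₁ σ₂ : F →+* ℝ) (k : ℤ) : Submodule ℂ (ℍ × ℍ → ℂ) where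
  carrier := {f | f ∈ modularForms σ₁ σ₂ k ∧ ∀ z₁ z₂ : ℍ, f (z₂, z₁) = f (z₁, z₂)}
  add_mem' := by
    rintro f g ⟨hf, hf'⟩ ⟨hg, hg'⟩
    exact ⟨add_mem hf hg, fun z₁ z₂ => by simp only [Pi.add_apply, hf', hg']⟩
  zero_mem' := ⟨zero_mem _, fun _ _ => rfl⟩
  smul_mem' := by
    rintro a f ⟨hf, hf'⟩
    exact ⟨Submodule.smul_mem _ a hf, fun z₁ z₂ => by simp only [Pi.smul_apply, hf']⟩

/-- The degree `m` piece of the algebra of even weight forms: the symmetric forms of weight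
`2 m`. -/
def evenSymForms (σ₁ σ₂ : F →+* ℝ) (m : ℤ) : Submodule ℂ (ℍ × ℍ → ℂ) :=
  symForms σ₁ σ₂ (2 * m)

/-- `(c, d) ≠ (0, 0)` implies that `N(c z + d)` does not vanish. -/
theorem normFactor_ne_zero (σ₁ σ₂ : F →+* ℝ) (c d : 𝓞 F) (h : (c, d) ≠ 0) (z : ℍ × ℍ) :
    normFactor σ₁ σ₂ c d z ≠ 0 := by
  have key : ∀ (σ : F →+* ℝ) (w : ℍ),
      ((intEmb σ c : ℝ) * (w : ℂ) + (intEmb σ d : ℝ) : ℂ) ≠ 0 := by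
    intro σ w h0
    have inj : Function.Injective (intEmb σ) := by
      intro x y hxy
      exact NumberField.RingOfIntegers.ext (σ.injective hxy)
    have him := congrArg Complex.im h0
    have hre := congrArg Complex.re h0
    simp only [Complex.add_im, Complex.mul_im, Complex.ofReal_re, Complex.ofReal_im, zero_mul,
      add_zero, Complex.zero_im, UpperHalfPlane.coe_im, mul_eq_zero, w.im_pos.ne', or_false]
      at him
    rw [him] at hre
    simp only [Complex.ofReal_zero, zero_mul, zero_add, Complex.ofReal_re, Complex.zero_re] at hre
    exact h (Prod.ext (inj (by simpa using him)) (inj (by simpa using hre)))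
  exact mul_ne_zero (key σ₁ z.1) (key σ₂ z.2)

theorem row_ne_zero (γ : SL(2, 𝓞 F)) : ((γ 1 0, γ 1 1) : 𝓞 F × 𝓞 F) ≠ 0 := by
  intro h
  have h0 : γ 1 0 = 0 := congrArg Prod.fst h
  have h1 : γ 1 1 = 0 := congrArg Prod.snd h
  have hdet := γ.det_coe
  rw [Matrix.det_fin_two, h0, h1] at hdet
  simp at hdet

instance (σ₁ σ₂ : F →+* ℝ) : SetLike.GradedMonoid (evenSymForms σ₁ σ₂) where
  one_mem := by
    refine ⟨⟨differentiableOn_const 1, fun _ _ => ?_⟩, fun _ _ => rfl⟩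
    simp
  mul_mem := by
    rintro i j f g ⟨⟨hf, hf'⟩, hf''⟩ ⟨⟨hg, hg'⟩, hg''⟩
    refine ⟨⟨hf.mul hg, fun γ z => ?_⟩, fun z₁ z₂ => ?_⟩
    · simp only [Pi.mul_apply, hf', hg']
      rw [mul_add, zpow_add₀ (normFactor_ne_zero σ₁ σ₂ _ _ (row_ne_zero γ) z)]
      ring
    · simp only [Pi.mul_apply, hf'', hg'']

/-- The graded algebra `⨁ₘ M_{2m}^{sym}(Γ_F)` of symmetric holomorphic Hilbert modular forms of
even weight; multiplication is induced by multiplication of functions. -/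
abbrev EvenSymAlgebra (σ₁ σ₂ : F →+* ℝ) : Type := ⨁ m : ℤ, evenSymForms σ₁ σ₂ m

/-- The index set `(𝓞 F)ˣ \ ((𝓞 F × 𝓞 F) ∖ {(0, 0)})` of the Eisenstein series, where units act
diagonally: the orbits other than that of `(0, 0)`. -/
abbrev EisIndex (F : Type*) [Field F] : Type _ :=
  {q : MulAction.orbitRel.Quotient (𝓞 F)ˣ (𝓞 F × 𝓞 F) // q ≠ Quotient.mk _ 0}

/-- The sum `∑ N(cz+d)^{-k} |N(cz+d)|^{-2s}` over the nonzero `(c, d)` in `𝓞 F × 𝓞 F` modulo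
units. For even `k` the summand does not depend on the representative of the orbit of `(c, d)`,
because units have norm `±1`. -/
def eisTerm (σ₁ σ₂ : F →+* ℝ) (k : ℕ) (s : ℝ) (z : ℍ × ℍ) (q : EisIndex F) : ℂ :=
  (normFactor σ₁ σ₂ q.1.out.1 q.1.out.2 z ^ k)⁻¹ *
    ((‖normFactor σ₁ σ₂ q.1.out.1 q.1.out.2 z‖ ^ (-(2 * s)) : ℝ) : ℂ)

/-- The Eisenstein series `G_k` of even weight `k ≥ 2` for `SL₂(𝓞 F)` (attached to the trivial
ideal class). For `k > 2` it is the sum of `N(cz+d)^{-k}`. For `k = 2` it is defined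
by Hecke summation, as the limit for `s → 0⁺` of the sums of `N(cz+d)^{-2} |N(cz+d)|^{-2s}`. -/
def eisG (σ₁ σ₂ : F →+* ℝ) (k : ℕ) (z : ℍ × ℍ) : ℂ :=
  if 2 < k then ∑' q, eisTerm σ₁ σ₂ k 0 z q
  else Filter.limUnder (𝓝[>] (0 : ℝ)) fun s => ∑' q, eisTerm σ₁ σ₂ k s z q

/-- The normalized Eisenstein series `g_k = ζ_F(k)⁻¹ G_k`, with constant term `1`. -/
def eisg [NumberField F] (σ₁ σ₂ : F →+* ℝ) (k : ℕ) (z : ℍ × ℍ) : ℂ :=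
  (NumberField.dedekindZeta F k)⁻¹ * eisG σ₁ σ₂ k z

end HilbertModular

end

/-! ### Fourier series of periodic functions of one and two real variables. -/

section

open Complex MeasureTheory Filter Set Function intervalIntegral
open scoped Real goldenRatio

namespace HilbertModular

/-! The proof reads a form off its leading term along the diagonal. If f of weight k vanishes to
order N on z₁ = z₂, then f(z + w, z) = g(z) w^N + o(w^N), where g is a modular form of weight 2k +
2N for SL₂(ℤ). All Fourier coefficients of f of trace less than N vanish: the lower Taylor
coefficients give N moment equations for the coefficients of each trace, unit invariance leaves at
most N unknowns, and a Vandermonde matrix decides (`IsHMF.fcoef_eq_zero_of_lt`). Hence g = Δ^N Q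
with Q of weight 2k − 10N (`IsHMF.exists_lead_eq`), and f = 0 once k < 5N.

For symmetric f the leading coefficient of odd order is zero (`IsHMF.lead_odd`). With k = 2m and N =
2c the form Q has weight 4(m − 5c), so it is a polynomial in E₄ and Δ. Three symmetric forms of
weights 2, 6, 10 with leading terms E₄ and c₁Δ in order 0 and c₂Δ² in order 2, c₁c₂ ≠ 0, therefore
realise every possible leading term. Subtracting monomials raises the order until the form is zero
(`mem_span_mono`), and the monomials are independent because their leading terms are
(`eq_zero_of_sum_mono`).

Up to normalisation such forms are g₂, g₆ − g₂³ and g₁₀ − αg₂²g₆ − (1 − α)g₂⁵ (`exists_leads`). Four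
Fourier coefficients of each Eisenstein series are needed, and they are known up to one scalar C.
Comparing the restriction to the diagonal with forms of level one determines C, so no zeta value is
computed. The form of weight 10 is nonzero because its restriction to another line has a nonzero
coefficient. A triangular change of variables returns from these forms to the Eisenstein series.

Weight 2 needs Hecke summation. Modulo units, the series is a zeta value plus a sum over
representatives c of lattice sums `pSum` at cz. Each lattice sum differs from its mean over a
lattice cell by an amount summable over c, uniformly in s. The mean is a product of two line
integrals of size O(s), while the sum over c grows at most like 1/s, so the means contribute nothing
in the limit (`Rep.tendsto_tsum_pSum`). The limit is an iterated sum, and its Fourier expansion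
shows that it is holomorphic (`hasSum_eis`, `differentiableOn_eis`). -/

/-- The exponential `e(z) = exp (2πiz)`. -/
noncomputable def ee (z : ℂ) : ℂ := cexp (2 * π * I * z)

lemma ee_add (x y : ℂ) : ee (x + y) = ee x * ee y := by
  simp only [ee, mul_add, Complex.exp_add]

lemma ee_zero : ee 0 = 1 := by simp [ee]

lemma ee_neg (x : ℂ) : ee (-x) = (ee x)⁻¹ := by
  simp [ee, ← Complex.exp_neg]

lemma ee_int (n : ℤ) : ee n = 1 := by
  rw [ee, Complex.exp_eq_one_iff]
  exact ⟨n, by ring⟩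

lemma norm_ee (z : ℂ) : ‖ee z‖ = Real.exp (-2 * π * z.im) := by
  rw [ee, Complex.norm_exp]
  congr 1
  simp [Complex.mul_re, Complex.mul_im]

lemma continuous_ee : Continuous ee := by unfold ee; fun_prop

lemma differentiable_ee : Differentiable ℂ ee := by unfold ee; fun_prop

lemma hasSum_fourier_of_continuous {k : ℝ → ℂ} (hk : Continuous k) (hper : Periodic k 1)
    (hs : Summable fun n : ℤ => ∫ t in (0:ℝ)..1, k t * ee (-(n * t))) (x : ℝ) :
    HasSum (fun n : ℤ => (∫ t in (0:ℝ)..1, k t * ee (-(n * t))) * ee (n * x)) (k x) := by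
  have hcont : Continuous hper.lift := by
    refine Continuous.quotient_liftOn' hk _
  let g : C(AddCircle (1:ℝ), ℂ) := ⟨hper.lift, hcont⟩
  have hcoef : ∀ n : ℤ, fourierCoeff g n = ∫ t in (0:ℝ)..1, k t * ee (-(n * t)) := by
    intro n
    rw [fourierCoeff_eq_intervalIntegral g n 0]
    simp only [zero_add, div_one, one_smul]
    refine intervalIntegral.integral_congr fun t _ => ?_
    simp only [smul_eq_mul]
    rw [mul_comm, fourier_coe_apply]
    congr 1
    rw [ee]; congr 1; push_cast; ring
  have h1 : Summable (fourierCoeff g) := by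
    refine hs.congr fun n => (hcoef n).symm
  have h2 := has_pointwise_sum_fourier_series_of_summable h1 (x : AddCircle (1:ℝ))
  refine (h2.congr_fun ?_ : _)
  intro n
  rw [hcoef, smul_eq_mul, fourier_coe_apply]
  congr 1
  rw [ee]; congr 1; push_cast; ring

/-- The Fourier coefficient of a function of two real variables of period one. -/
noncomputable def fc2 (k : ℝ → ℝ → ℂ) (ν : ℤ × ℤ) : ℂ :=
  ∫ v in (0:ℝ)..1, ∫ u in (0:ℝ)..1, k u v * ee (-(ν.1 * u + ν.2 * v))

lemma fc2_eq (k : ℝ → ℝ → ℂ) (p r : ℤ) : fc2 k (p, r) =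
    ∫ v in (0:ℝ)..1, (∫ u in (0:ℝ)..1, k u v * ee (-(p * u))) * ee (-(r * v)) := by
  unfold fc2
  refine intervalIntegral.integral_congr fun v _ => ?_
  rw [← intervalIntegral.integral_mul_const]
  refine intervalIntegral.integral_congr fun u _ => ?_
  rw [neg_add, ee_add, mul_assoc]

/-- Iterated one-variable inversion: the partial coefficient `cp p` is again continuous and periodic
in `v`. Summability of the double family supplies the hypotheses of both inversions and the
interchange. -/
lemma hasSum_fourier_two {k : ℝ → ℝ → ℂ} (hk : Continuous (uncurry k))
    (hu : ∀ u v, k (u + 1) v = k u v) (hv : ∀ u v, k u (v + 1) = k u v)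
    (hs : Summable (fc2 k)) (u v : ℝ) :
    HasSum (fun ν : ℤ × ℤ => fc2 k ν * ee (ν.1 * u + ν.2 * v)) (k u v) := by
  set cp : ℤ → ℝ → ℂ := fun p v => ∫ u in (0:ℝ)..1, k u v * ee (-(p * u)) with hcp
  have hcont : ∀ p, Continuous (cp p) := by
    intro p
    refine intervalIntegral.continuous_parametric_intervalIntegral_of_continuous' ?_ 0 1
    have h1 : Continuous fun x : ℝ × ℝ => k x.2 x.1 := hk.comp continuous_swap
    have h2 : Continuous fun x : ℝ × ℝ => ee (-(p * x.2)) := continuous_ee.comp (by fun_prop)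
    exact h1.mul h2
  have hper : ∀ p, Periodic (cp p) 1 := by
    intro p v; simp only [hcp, hv]
  have hsn : Summable fun ν => ‖fc2 k ν‖ := hs.norm
  have hnorm : ∀ (ν : ℤ × ℤ) (u v : ℝ), ‖fc2 k ν * ee (ν.1 * u + ν.2 * v)‖ = ‖fc2 k ν‖ := by
    intro ν u v
    rw [norm_mul, norm_ee]
    simp
  have hsr : ∀ p, Summable fun r : ℤ => fc2 k (p, r) := fun p =>
    hs.comp_injective (i := fun r : ℤ => (p, r)) fun a b h => by simpa using h
  have hin : ∀ (p : ℤ) (v : ℝ), HasSum (fun r : ℤ => fc2 k (p, r) * ee (r * v)) (cp p v) := by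
    intro p v
    have h := hasSum_fourier_of_continuous (hcont p) (hper p)
      ((hsr p).congr fun r => fc2_eq k p r) v
    refine h.congr_fun ?_
    intro r; rw [fc2_eq]
  have hcpsum : ∀ v, Summable fun p => cp p v := by
    intro v
    refine Summable.of_norm_bounded (hsn.prod) fun p => ?_
    rw [← (hin p v).tsum_eq]
    refine (norm_tsum_le_tsum_norm ?_).trans_eq ?_
    · refine ((hsr p).norm).congr fun r => ?_
      rw [norm_mul, norm_ee]; simp
    · refine tsum_congr fun r => ?_
      rw [norm_mul, norm_ee]; simp
  have hout : HasSum (fun p => cp p v * ee (p * u)) (k u v) :=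
    hasSum_fourier_of_continuous (k := fun u : ℝ => k u v)
      (hk.comp (by fun_prop : Continuous fun u : ℝ => (u, v))) (fun u => hu u v) (hcpsum v) u
  have hS : Summable fun ν : ℤ × ℤ => fc2 k ν * ee (ν.1 * u + ν.2 * v) :=
    Summable.of_norm (hsn.congr fun ν => (hnorm ν u v).symm)
  have h3 := hS.hasSum.prod_fiberwise (g := fun p => cp p v * ee (p * u)) (fun p => by
    refine ((hin p v).mul_right (ee (p * u))).congr_fun ?_
    intro r
    rw [ee_add]; ring)
  rw [hout.unique h3]
  exact hS.hasSum

lemma integral_ee_int_mul (n : ℤ) (c : ℂ) :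
    ∫ u in (0:ℝ)..1, ee (n * u + c) = if n = 0 then ee c else 0 := by
  split_ifs with h
  · simp [h]
  · have h1 : ∀ u ∈ Set.uIcc (0:ℝ) 1,
        HasDerivAt (fun u : ℝ => (2 * π * I * n)⁻¹ * ee (n * u + c)) (ee (n * u + c)) u := by
      intro u _
      have h2 : HasDerivAt (fun u : ℝ => 2 * π * I * (n * (u:ℂ) + c)) (2 * π * I * n) u := by
        simpa using (((hasDerivAt_id (u:ℂ)).const_mul (n:ℂ)).add_const c).const_mul
          (2 * π * I) |>.comp_ofReal
      have h3 := h2.cexp.const_mul (2 * π * I * n)⁻¹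
      have h0 : (2 * π * I * n : ℂ) ≠ 0 := by simp [h, Real.pi_ne_zero]
      have h4 : HasDerivAt (fun u : ℝ => (2 * π * I * n)⁻¹ * ee (n * u + c)) _ u := h3
      exact h4.congr_deriv (by rw [mul_comm (cexp _), inv_mul_cancel_left₀ h0, ee])
    rw [intervalIntegral.integral_eq_sub_of_hasDerivAt h1
      ((continuous_ee.comp (by fun_prop)).intervalIntegrable _ _)]
    simp only [ofReal_one, mul_one, ofReal_zero, mul_zero, zero_add]
    rw [ee_add, ee_int, one_mul, sub_self]

/-- Uniqueness of the coefficients: an absolutely summable trigonometric series may be integrated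
term by term against a character. -/
lemma fc2_of_hasSum {k : ℝ → ℝ → ℂ} {a : ℤ × ℤ → ℂ} (ha : Summable a)
    (h : ∀ u v : ℝ, HasSum (fun ν : ℤ × ℤ => a ν * ee (ν.1 * u + ν.2 * v)) (k u v)) (μ : ℤ × ℤ) :
    fc2 k μ = a μ := by
  have hn := ha.norm
  have hnorm : ∀ (n m : ℤ) (u v : ℝ), ‖ee (n * u + m * v)‖ = 1 := by
    intro n m u v
    rw [norm_ee]; simp
  have h1 : ∀ v : ℝ, HasSum (fun ν : ℤ × ℤ =>
      ∫ u in (0:ℝ)..1, a ν * ee (((ν.1 - μ.1 : ℤ) : ℂ) * u + ((ν.2 - μ.2 : ℤ) : ℂ) * v))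
      (∫ u in (0:ℝ)..1, k u v * ee (-(μ.1 * u + μ.2 * v))) := by
    intro v
    refine intervalIntegral.hasSum_integral_of_dominated_convergence (fun ν _ => ‖a ν‖)
      (fun ν => ?_) (fun ν => ?_) ?_ ?_ ?_
    · exact (continuous_const.mul (continuous_ee.comp (by fun_prop))).aestronglyMeasurable
    · refine Eventually.of_forall fun u _ => ?_
      rw [norm_mul, hnorm, mul_one]
    · exact Eventually.of_forall fun _ _ => hn
    · exact intervalIntegrable_const
    · refine Eventually.of_forall fun u _ => ?_
      refine ((h u v).mul_right (ee (-(μ.1 * u + μ.2 * v)))).congr_fun fun ν => ?_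
      rw [mul_assoc, ← ee_add]
      congr 2; push_cast; ring
  have h2 : HasSum (fun ν : ℤ × ℤ => ∫ v in (0:ℝ)..1,
      ∫ u in (0:ℝ)..1, a ν * ee (((ν.1 - μ.1 : ℤ) : ℂ) * u + ((ν.2 - μ.2 : ℤ) : ℂ) * v))
      (fc2 k μ) := by
    refine intervalIntegral.hasSum_integral_of_dominated_convergence (fun ν _ => ‖a ν‖)
      (fun ν => ?_) (fun ν => ?_) ?_ ?_ ?_
    · refine (intervalIntegral.continuous_parametric_intervalIntegral_of_continuous'
        ?_ 0 1).aestronglyMeasurable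
      exact continuous_const.mul (continuous_ee.comp (by fun_prop))
    · refine Eventually.of_forall fun v _ => ?_
      refine (intervalIntegral.norm_integral_le_of_norm_le_const (C := ‖a ν‖) fun u _ => ?_).trans
        (by simp)
      rw [norm_mul, hnorm, mul_one]
    · exact Eventually.of_forall fun _ _ => hn
    · exact intervalIntegrable_const
    · exact Eventually.of_forall fun v _ => h1 v
  refine h2.unique ?_
  convert hasSum_ite_eq μ (a μ) using 2 with ν
  simp only [intervalIntegral.integral_const_mul, integral_ee_int_mul]
  by_cases hp : ν.1 = μ.1
  · have h0 := integral_ee_int_mul (ν.2 - μ.2) 0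
    simp only [add_zero, ee_zero] at h0
    simp only [hp, sub_self, if_true, h0]
    by_cases hr : ν.2 = μ.2
    · have : ν = μ := Prod.ext hp hr
      simp [this]
    · have h3 : ν ≠ μ := fun h => hr (congrArg Prod.snd h)
      simp [h3, sub_eq_zero, hr]
  · have h3 : ν ≠ μ := fun h => hp (congrArg Prod.fst h)
    simp [h3, sub_eq_zero, hp]

end HilbertModular

end

/-! ### Fourier expansion of periodic holomorphic functions on a tube domain. -/

section

open Complex MeasureTheory Filter Set Function intervalIntegral
open scoped Real goldenRatio Interval

namespace HilbertModular

/-- A function on the tube `{(u, v) | (im u, im v) ∈ U}` that is continuous, holomorphic in each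
variable and of period one in each variable. -/
structure TubeHol (U : Set (ℝ × ℝ)) (g : ℂ → ℂ → ℂ) : Prop where
  cont : ContinuousOn (uncurry g) {w | (w.1.im, w.2.im) ∈ U}
  hol1 : ∀ u v : ℂ, (u.im, v.im) ∈ U → DifferentiableAt ℂ (fun u => g u v) u
  hol2 : ∀ u v : ℂ, (u.im, v.im) ∈ U → DifferentiableAt ℂ (fun v => g u v) v
  per1 : ∀ u v : ℂ, (u.im, v.im) ∈ U → g (u + 1) v = g u v
  per2 : ∀ u v : ℂ, (u.im, v.im) ∈ U → g u (v + 1) = g u v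

/-- The Fourier coefficient of a function on a tube, computed at height `(α, β)`. -/
noncomputable def tubeC (g : ℂ → ℂ → ℂ) (α β : ℝ) (ν : ℤ × ℤ) : ℂ :=
  fc2 (fun u v => g (u + α * I) (v + β * I)) ν * ee (-(ν.1 * (α * I) + ν.2 * (β * I)))

/-- Cauchy's theorem on the rectangle of width one; the two vertical sides cancel by periodicity. -/
lemma integral_shift {h : ℂ → ℂ} {a b : ℝ}
    (hd : ∀ z : ℂ, z.im ∈ [[a, b]] → DifferentiableAt ℂ h z)
    (hp : ∀ z : ℂ, z.im ∈ [[a, b]] → h (z + 1) = h z) :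
    ∫ t in (0:ℝ)..1, h (t + a * I) = ∫ t in (0:ℝ)..1, h (t + b * I) := by
  have h1 := Complex.integral_boundary_rect_eq_zero_of_differentiableOn h (a * I) (1 + b * I)
    (fun z hz => (hd z (by simpa using hz.2)).differentiableWithinAt)
  simp only [mul_re, ofReal_re, I_re, mul_zero, ofReal_im, I_im, mul_one, sub_self, add_re, one_re,
    add_zero, mul_im, zero_add, add_im, one_im, ofReal_one, ofReal_zero] at h1
  have h2 : ∫ y in a..b, h (1 + y * I) = ∫ y in a..b, h (0 + y * I) := by
    refine intervalIntegral.integral_congr fun y hy => ?_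
    have := hp (y * I) (by simpa using hy)
    rw [zero_add, add_comm, this]
  simp only [zero_add] at h1 h2
  rw [h2] at h1
  simpa [sub_eq_zero] using h1

lemma continuous_tube {U : Set (ℝ × ℝ)} {g : ℂ → ℂ → ℂ} (hg : TubeHol U g) {α β : ℝ}
    (h : (α, β) ∈ U) : Continuous (uncurry fun u v : ℝ => g (u + α * I) (v + β * I)) := by
  have h1 : Continuous fun x : ℝ × ℝ => ((x.1 : ℂ) + α * I, (x.2 : ℂ) + β * I) := by fun_prop
  exact hg.cont.comp_continuous h1 fun x => by simpa using h

lemma fc2_swap {k : ℝ → ℝ → ℂ} (hk : Continuous (uncurry k)) (p r : ℤ) :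
    fc2 k (p, r) = fc2 (fun v u => k u v) (r, p) := by
  unfold fc2
  simp only [intervalIntegral.integral_of_le zero_le_one]
  rw [integral_integral_swap]
  · simp only [add_comm]
  · have h1 : Continuous (uncurry fun v u : ℝ => k u v * ee (-(p * u + r * v))) :=
      (hk.comp continuous_swap).mul (continuous_ee.comp (by fun_prop))
    rw [Measure.prod_restrict]
    exact (h1.continuousOn.integrableOn_compact (isCompact_Icc.prod isCompact_Icc)).mono_set
      (Set.prod_mono Ioc_subset_Icc_self Ioc_subset_Icc_self)

lemma tubeC_eq (g : ℂ → ℂ → ℂ) (α β : ℝ) (ν : ℤ × ℤ) : tubeC g α β ν =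
    ∫ v in (0:ℝ)..1, ∫ u in (0:ℝ)..1, g (u + α * I) (v + β * I) *
      ee (-(ν.1 * (u + α * I) + ν.2 * (v + β * I))) := by
  unfold tubeC fc2
  simp only [← intervalIntegral.integral_mul_const]
  refine intervalIntegral.integral_congr fun v _ => ?_
  refine intervalIntegral.integral_congr fun u _ => ?_
  rw [mul_assoc, ← ee_add]
  congr 2; ring

lemma ee_add_int (z : ℂ) (n : ℤ) : ee (z + n) = ee z := by rw [ee_add, ee_int, mul_one]

lemma tubeC_shift_left {U : Set (ℝ × ℝ)} {g : ℂ → ℂ → ℂ} (hg : TubeHol U g) {α α' β : ℝ}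
    (h : ∀ t ∈ [[α, α']], (t, β) ∈ U) (ν : ℤ × ℤ) : tubeC g α β ν = tubeC g α' β ν := by
  rw [tubeC_eq, tubeC_eq]
  refine intervalIntegral.integral_congr fun v _ => ?_
  refine integral_shift (h := fun z => g z (v + β * I) * ee (-(ν.1 * z + ν.2 * (v + β * I))))
    (fun z hz => ?_) (fun z hz => ?_)
  · refine (hg.hol1 _ _ (by simpa using h _ hz)).mul ?_
    exact (differentiable_ee _).comp z (by fun_prop)
  · rw [hg.per1 _ _ (by simpa using h _ hz), ← ee_add_int (-(_ * (z + 1) + _)) ν.1]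
    congr 2; ring

/-- Exchanging the variables turns statements about the first variable into statements about the
second, so contour shifts need only one proof. -/
lemma TubeHol.flip {U : Set (ℝ × ℝ)} {g : ℂ → ℂ → ℂ} (hg : TubeHol U g) :
    TubeHol (Prod.swap ⁻¹' U) (fun u v => g v u) where
  cont := hg.cont.comp continuous_swap.continuousOn fun _ hw => hw
  hol1 u v h := hg.hol2 v u h
  hol2 u v h := hg.hol1 v u h
  per1 u v h := hg.per2 v u h
  per2 u v h := hg.per1 v u h

lemma tubeC_flip {U : Set (ℝ × ℝ)} {g : ℂ → ℂ → ℂ} (hg : TubeHol U g) {α β : ℝ}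
    (h : (α, β) ∈ U) (ν : ℤ × ℤ) : tubeC g α β ν = tubeC (fun u v => g v u) β α ν.swap := by
  unfold tubeC
  rw [fc2_swap (continuous_tube hg h)]
  congr 2
  simp [add_comm]

lemma tubeC_shift_right {U : Set (ℝ × ℝ)} {g : ℂ → ℂ → ℂ} (hg : TubeHol U g) {α β β' : ℝ}
    (h : ∀ t ∈ [[β, β']], (α, t) ∈ U) (ν : ℤ × ℤ) : tubeC g α β ν = tubeC g α β' ν := by
  rw [tubeC_flip hg (h _ left_mem_uIcc), tubeC_flip hg (h _ right_mem_uIcc)]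
  exact tubeC_shift_left hg.flip h _

lemma norm_tubeC_le {g : ℂ → ℂ → ℂ} {α β M : ℝ}
    (hM : ∀ u v : ℝ, ‖g (u + α * I) (v + β * I)‖ ≤ M) (ν : ℤ × ℤ) :
    ‖tubeC g α β ν‖ ≤ M * Real.exp (2 * π * (ν.1 * α + ν.2 * β)) := by
  unfold tubeC
  rw [norm_mul, norm_ee]
  have h1 : ‖fc2 (fun u v => g (u + α * I) (v + β * I)) ν‖ ≤ M := by
    unfold fc2
    refine (intervalIntegral.norm_integral_le_of_norm_le_const (C := M) fun v _ => ?_).trans_eq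
      (by simp)
    refine (intervalIntegral.norm_integral_le_of_norm_le_const (C := M) fun u _ => ?_).trans_eq
      (by simp)
    rw [norm_mul, norm_ee]
    simpa using hM u v
  refine (mul_le_mul_of_nonneg_right h1 (Real.exp_pos _).le).trans_eq ?_
  congr 2
  simp
  ring

/-- The coefficient does not depend on the height, so each height may be moved by `δ` in the
direction opposite to the sign of the frequency. This gains the exponential factor that makes the
coefficients summable. -/
lemma norm_tubeC_le_strip {U : Set (ℝ × ℝ)} {g : ℂ → ℂ → ℂ} (hg : TubeHol U g) {α β δ M : ℝ}
    (hδ : 0 ≤ δ) (hU : ∀ s t, |s - α| ≤ δ → |t - β| ≤ δ → (s, t) ∈ U)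
    (hM : ∀ u v : ℂ, |u.im - α| ≤ δ → |v.im - β| ≤ δ → ‖g u v‖ ≤ M) (ν : ℤ × ℤ) :
    ‖tubeC g α β ν‖ ≤ M * Real.exp (-(2 * π * δ) * (|(ν.1 : ℝ)| + |(ν.2 : ℝ)|)) *
      Real.exp (2 * π * (ν.1 * α + ν.2 * β)) := by
  have key : ∀ n : ℤ, ∃ s : ℝ, |s| ≤ δ ∧ n * s = -(δ * |(n : ℝ)|) := by
    intro n
    rcases le_total 0 (n : ℝ) with h | h
    · exact ⟨-δ, by rw [abs_neg, abs_of_nonneg hδ], by rw [abs_of_nonneg h]; ring⟩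
    · exact ⟨δ, by rw [abs_of_nonneg hδ], by rw [abs_of_nonpos h]; ring⟩
  obtain ⟨s, hs, hs'⟩ := key ν.1
  obtain ⟨t, ht, ht'⟩ := key ν.2
  have habs : ∀ {a b c : ℝ}, |b| ≤ δ → c ∈ [[a, a + b]] → |c - a| ≤ δ := by
    intro a b c hb hc
    refine (Set.abs_sub_left_of_mem_uIcc hc).trans ?_
    simpa using hb
  have h1 : tubeC g α β ν = tubeC g (α + s) (β + t) ν := by
    rw [tubeC_shift_left hg (α' := α + s) (fun c hc => hU _ _ (habs hs hc) (by simpa using hδ)),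
      tubeC_shift_right hg (β' := β + t) (fun c hc => hU _ _ (by simpa using hs) (habs ht hc))]
  rw [h1]
  refine (norm_tubeC_le (M := M) (fun u v => hM _ _ ?_ ?_) ν).trans_eq ?_
  · simpa using hs
  · simpa using ht
  · rw [mul_assoc M, ← Real.exp_add]
    congr 2
    linear_combination 2 * π * hs' + 2 * π * ht'

lemma summable_exp_neg_abs {c : ℝ} (hc : 0 < c) :
    Summable fun ν : ℤ × ℤ => Real.exp (-c * (|(ν.1 : ℝ)| + |(ν.2 : ℝ)|)) := by
  have h1 : Summable fun n : ℤ => Real.exp (-c * |(n : ℝ)|) := by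
    have h0 : Summable fun n : ℕ => Real.exp (-c * n) := by
      have := Real.summable_exp_nat_mul_iff.mpr (neg_neg_of_pos hc)
      exact this.congr fun n => by ring_nf
    refine Summable.of_nat_of_neg ?_ ?_ <;> simpa using h0
  have h2 := h1.mul_of_nonneg h1 (fun _ => (Real.exp_pos _).le) fun _ => (Real.exp_pos _).le
  refine h2.congr fun ν => ?_
  rw [← Real.exp_add]; congr 1; ring

lemma hasSum_tubeC {U : Set (ℝ × ℝ)} {g : ℂ → ℂ → ℂ} (hg : TubeHol U g) {α β δ M : ℝ}
    (hδ : 0 < δ) (hU : ∀ s t, |s - α| ≤ δ → |t - β| ≤ δ → (s, t) ∈ U)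
    (hM : ∀ u v : ℂ, |u.im - α| ≤ δ → |v.im - β| ≤ δ → ‖g u v‖ ≤ M) (u v : ℝ) :
    (Summable fun ν : ℤ × ℤ =>
      ‖tubeC g α β ν * ee (ν.1 * (u + α * I) + ν.2 * (v + β * I))‖) ∧
    HasSum (fun ν : ℤ × ℤ => tubeC g α β ν * ee (ν.1 * (u + α * I) + ν.2 * (v + β * I)))
      (g (u + α * I) (v + β * I)) := by
  have h0 : (α, β) ∈ U := hU _ _ (by simpa using hδ.le) (by simpa using hδ.le)
  set k : ℝ → ℝ → ℂ := fun u v => g (u + α * I) (v + β * I) with hk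
  have e1 : ∀ (u v : ℝ) (ν : ℤ × ℤ), fc2 k ν * ee (ν.1 * u + ν.2 * v) =
      tubeC g α β ν * ee (ν.1 * (u + α * I) + ν.2 * (v + β * I)) := by
    intro u v ν
    unfold tubeC
    rw [mul_assoc, ← ee_add]
    congr 2; ring
  have hn : ∀ (u v : ℝ) (ν : ℤ × ℤ), ‖fc2 k ν * ee (ν.1 * u + ν.2 * v)‖ = ‖fc2 k ν‖ := by
    intro u v ν
    rw [norm_mul, norm_ee]; simp
  have hs : Summable fun ν => ‖fc2 k ν‖ := by
    refine Summable.of_nonneg_of_le (fun _ => norm_nonneg _) (fun ν => ?_)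
      ((summable_exp_neg_abs (c := 2 * π * δ) (by positivity)).mul_left M)
    have h2 := norm_tubeC_le_strip hg hδ.le hU hM ν
    unfold tubeC at h2
    rw [norm_mul, norm_ee] at h2
    have e2 : Real.exp (-2 * π * (-((ν.1 : ℂ) * (α * I) + ν.2 * (β * I))).im) =
        Real.exp (2 * π * (ν.1 * α + ν.2 * β)) := by
      congr 1; simp; ring
    rw [e2] at h2
    exact le_of_mul_le_mul_right h2 (Real.exp_pos _)
  have h3 := hasSum_fourier_two (k := k) (continuous_tube hg h0)
    (fun u v => by
      have := hg.per1 (u + α * I) (v + β * I) (by simpa using h0)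
      simpa [hk, add_right_comm] using this)
    (fun u v => by
      have := hg.per2 (u + α * I) (v + β * I) (by simpa using h0)
      simpa [hk, add_right_comm] using this) hs.of_norm u v
  constructor
  · exact hs.congr fun ν => by rw [← e1, hn]
  · exact h3.congr_fun fun ν => (e1 u v ν).symm

/-- Periodicity brings the real parts into `[0, 1]`, leaving a compact set of arguments. -/
lemma TubeHol.exists_bound {U : Set (ℝ × ℝ)} {g : ℂ → ℂ → ℂ} (hg : TubeHol U g) {K : Set (ℝ × ℝ)}
    (hK : IsCompact K) (hU : K ⊆ U) :
    ∃ M, ∀ u v : ℂ, (u.im, v.im) ∈ K → ‖g u v‖ ≤ M := by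
  let m : (ℝ × ℝ) × (ℝ × ℝ) → ℂ × ℂ := fun x => (x.1.1 + x.2.1 * I, x.1.2 + x.2.2 * I)
  have hm : Continuous m := by fun_prop
  have hc : IsCompact (m '' ((Icc 0 1 ×ˢ Icc 0 1) ×ˢ K)) :=
    ((isCompact_Icc.prod isCompact_Icc).prod hK).image hm
  have hsub : m '' ((Icc 0 1 ×ˢ Icc 0 1) ×ˢ K) ⊆ {w | (w.1.im, w.2.im) ∈ U} := by
    rintro _ ⟨x, hx, rfl⟩
    simpa [m] using hU hx.2
  obtain ⟨M, hM⟩ := hc.exists_bound_of_continuousOn (hg.cont.mono hsub)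
  refine ⟨M, fun u v huv => ?_⟩
  have p1 : ∀ (n : ℤ) (u v : ℂ), (u.im, v.im) ∈ U → g (u + n) v = g u v := by
    intro n u v h
    have hper : Periodic (fun t : ℝ => g (t + u.im * I) v) 1 := by
      intro t
      have := hg.per1 (t + u.im * I) v (by simpa using h)
      simpa [add_right_comm] using this
    have := hper.int_mul n u.re
    simpa [add_right_comm, Complex.re_add_im] using this
  have p2 : ∀ (n : ℤ) (u v : ℂ), (u.im, v.im) ∈ U → g u (v + n) = g u v := by
    intro n u v h
    have hper : Periodic (fun t : ℝ => g u (t + v.im * I)) 1 := by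
      intro t
      have := hg.per2 u (t + v.im * I) (by simpa using h)
      simpa [add_right_comm] using this
    have := hper.int_mul n v.re
    simpa [add_right_comm, Complex.re_add_im] using this
  have e1 := p1 (-⌊u.re⌋) u v (hU huv)
  have e2 := p2 (-⌊v.re⌋) (u + (-⌊u.re⌋ : ℤ)) v (by simpa using hU huv)
  rw [← e1, ← e2]
  refine hM (_, _) ⟨((Int.fract u.re, Int.fract v.re), (u.im, v.im)), ⟨⟨?_, ?_⟩, huv⟩, ?_⟩
  · exact ⟨Int.fract_nonneg _, (Int.fract_lt_one _).le⟩
  · exact ⟨Int.fract_nonneg _, (Int.fract_lt_one _).le⟩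
  · simp only [m]
    refine Prod.ext ?_ ?_ <;> apply Complex.ext <;> simp [Int.fract, sub_eq_add_neg]

end HilbertModular

end

/-! ### The lattice of integers of ℚ(√5), its dual, and Fourier expansions on ℍ². -/

section

open Complex MeasureTheory Filter Set Function intervalIntegral
open scoped Real goldenRatio Interval

namespace HilbertModular

lemma sqrt_five_ne_zero : (√5 : ℝ) ≠ 0 := by positivity

lemma goldenRatio_sub_goldenConj' : φ - ψ = √5 := Real.goldenRatio_sub_goldenConj

/-- First embedding of `a + b (1 + √5) / 2`. -/
noncomputable def latt1 (d : ℤ × ℤ) : ℝ := d.1 + d.2 * φ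

/-- Second embedding of `a + b (1 + √5) / 2`. -/
noncomputable def latt2 (d : ℤ × ℤ) : ℝ := d.1 + d.2 * ψ

/-- First embedding of the element `ν` of the inverse different with `Tr ν = p` and
`Tr (ν (1 + √5) / 2) = r`. -/
noncomputable def dual1 (ν : ℤ × ℤ) : ℝ := (ν.2 - ν.1 * ψ) / √5

/-- Second embedding of the element `ν` of the inverse different with `Tr ν = p` and
`Tr (ν (1 + √5) / 2) = r`. -/
noncomputable def dual2 (ν : ℤ × ℤ) : ℝ := (ν.1 * φ - ν.2) / √5

lemma dual1_add_dual2 (ν : ℤ × ℤ) : dual1 ν + dual2 ν = ν.1 := by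
  unfold dual1 dual2
  rw [← add_div, div_eq_iff sqrt_five_ne_zero, ← goldenRatio_sub_goldenConj']
  ring

lemma dual1_mul_add_dual2_mul (ν : ℤ × ℤ) : dual1 ν * φ + dual2 ν * ψ = ν.2 := by
  unfold dual1 dual2
  rw [div_mul_eq_mul_div, div_mul_eq_mul_div, ← add_div, div_eq_iff sqrt_five_ne_zero,
    ← goldenRatio_sub_goldenConj']
  ring

/-- The trace pairing between the inverse different and the integers takes integral values; this
makes `gexp ν` invariant under translation by integers. -/
lemma dual_mul_latt (ν d : ℤ × ℤ) :
    dual1 ν * latt1 d + dual2 ν * latt2 d = ν.1 * d.1 + ν.2 * d.2 := by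
  rw [← dual1_add_dual2, ← dual1_mul_add_dual2_mul, latt1, latt2]
  ring

/-- The product of two upper half planes in `ℂ × ℂ`. -/
def H2 : Set (ℂ × ℂ) := {w | 0 < w.1.im ∧ 0 < w.2.im}

/-- The exponential `e(ν₁ z₁ + ν₂ z₂)`. -/
noncomputable def gexp (ν : ℤ × ℤ) (z : ℂ × ℂ) : ℂ := ee (dual1 ν * z.1 + dual2 ν * z.2)

lemma norm_gexp (ν : ℤ × ℤ) (z : ℂ × ℂ) :
    ‖gexp ν z‖ = Real.exp (-2 * π * (dual1 ν * z.1.im + dual2 ν * z.2.im)) := by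
  rw [gexp, norm_ee]
  simp

/-- The function in coordinates with respect to the lattice basis `1, (1 + √5) / 2`. -/
noncomputable def inBasis (f : ℂ × ℂ → ℂ) (u v : ℂ) : ℂ :=
  f (u + (φ : ℝ) * v, u + (ψ : ℝ) * v)

/-- The cone of imaginary parts in lattice coordinates. -/
def coneUV : Set (ℝ × ℝ) := {x | 0 < x.1 + φ * x.2 ∧ 0 < x.1 + ψ * x.2}

/-- The Fourier coefficients of a periodic function on `ℍ²`. -/
noncomputable def fcoef (f : ℂ × ℂ → ℂ) (ν : ℤ × ℤ) : ℂ := tubeC (inBasis f) 1 0 ν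

/-- Functions on `ℍ²` that are continuous, holomorphic in each of the two lattice coordinates and
periodic for the lattice of integers of `ℚ(√5)`. -/
def PerHol (f : ℂ × ℂ → ℂ) : Prop := TubeHol coneUV (inBasis f)

lemma isOpen_H2 : IsOpen H2 := by
  have h1 : Continuous fun w : ℂ × ℂ => w.1.im := by fun_prop
  have h2 : Continuous fun w : ℂ × ℂ => w.2.im := by fun_prop
  exact (isOpen_lt continuous_const h1).inter (isOpen_lt continuous_const h2)

lemma inBasis_mem {u v : ℂ} (h : (u.im, v.im) ∈ coneUV) :
    (u + (φ : ℝ) * v, u + (ψ : ℝ) * v) ∈ H2 := by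
  constructor
  · simpa using h.1
  · simpa using h.2

lemma PerHol.of_differentiableOn {f : ℂ × ℂ → ℂ} (hd : DifferentiableOn ℂ f H2)
    (per1 : ∀ z₁ z₂ : ℂ, (z₁, z₂) ∈ H2 → f (z₁ + 1, z₂ + 1) = f (z₁, z₂))
    (per2 : ∀ z₁ z₂ : ℂ, (z₁, z₂) ∈ H2 → f (z₁ + (φ : ℝ), z₂ + (ψ : ℝ)) = f (z₁, z₂)) :
    PerHol f where
  cont := hd.continuousOn.comp
    (by fun_prop : ContinuousOn (fun w : ℂ × ℂ => (w.1 + (φ : ℝ) * w.2, w.1 + (ψ : ℝ) * w.2)) _)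
    fun w hw => inBasis_mem hw
  hol1 u v h := DifferentiableAt.comp (g := f) u
    (hd.differentiableAt (isOpen_H2.mem_nhds (inBasis_mem h))) (by fun_prop)
  hol2 u v h := DifferentiableAt.comp (g := f) v
    (hd.differentiableAt (isOpen_H2.mem_nhds (inBasis_mem h))) (by fun_prop)
  per1 u v h := by
    have := per1 _ _ (inBasis_mem h)
    simp only [inBasis, add_right_comm _ (1 : ℂ), this]
  per2 u v h := by
    have := per2 _ _ (inBasis_mem h)
    simp only [inBasis, mul_add, mul_one, ← add_assoc, this]

/-- Lattice coordinates of a point. -/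
lemma basis_coord (x₁ x₂ : ℝ) :
    (φ * x₂ - ψ * x₁) / √5 + φ * ((x₁ - x₂) / √5) = x₁ ∧
    (φ * x₂ - ψ * x₁) / √5 + ψ * ((x₁ - x₂) / √5) = x₂ := by
  have h := sqrt_five_ne_zero
  constructor <;> rw [mul_div_assoc', ← add_div, div_eq_iff h, ← goldenRatio_sub_goldenConj'] <;>
    ring

lemma exists_coord (x₁ x₂ : ℝ) : ∃ u v : ℝ, u + φ * v = x₁ ∧ u + ψ * v = x₂ :=
  ⟨_, _, basis_coord x₁ x₂⟩

lemma gexp_coord (ν : ℤ × ℤ) (u v : ℂ) :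
    gexp ν (u + (φ : ℝ) * v, u + (ψ : ℝ) * v) = ee (ν.1 * u + ν.2 * v) := by
  rw [gexp]
  congr 1
  have h1 : ((dual1 ν : ℝ) : ℂ) + (dual2 ν : ℝ) = ν.1 := by
    rw [← ofReal_add, dual1_add_dual2]; simp
  have h2 : ((dual1 ν : ℝ) : ℂ) * (φ : ℝ) + (dual2 ν : ℝ) * (ψ : ℝ) = ν.2 := by
    rw [← ofReal_mul, ← ofReal_mul, ← ofReal_add, dual1_mul_add_dual2_mul]; simp
  linear_combination u * h1 + v * h2

lemma coneUV_strip {α β : ℝ} (h : (α, β) ∈ coneUV) :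
    ∃ δ > 0, ∀ s t, |s - α| ≤ δ → |t - β| ≤ δ → (s, t) ∈ coneUV := by
  have h1 : 0 < α + φ * β := h.1
  have h2 : 0 < α + ψ * β := h.2
  have hm : 0 < min (α + φ * β) (α + ψ * β) := lt_min h1 h2
  -- Moving both coordinates by at most `δ` changes either linear form by less than `3δ`, since φ
  -- and |ψ| are below 2; a quarter of the minimum is therefore safe.
  refine ⟨min (α + φ * β) (α + ψ * β) / 4, by positivity, fun s t hs ht => ?_⟩
  have g1 := min_le_left (α + φ * β) (α + ψ * β)
  have g2 := min_le_right (α + φ * β) (α + ψ * β)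
  set m := min (α + φ * β) (α + ψ * β)
  have p1 := Real.goldenRatio_lt_two
  have p2 := Real.goldenRatio_pos
  have p3 := Real.goldenConj_neg
  have p4 := Real.neg_one_lt_goldenConj
  rw [abs_le] at hs ht
  constructor <;> simp only
  · nlinarith
  · nlinarith

/-- Independence of the height on the whole cone, along an axis-parallel path: out to a large first
coordinate `A > 2|β|`, across to `β`, back to `α`. Since φ and |ψ| are below 2, the path stays in
the cone. -/
lemma tubeC_coneUV {g : ℂ → ℂ → ℂ} (hg : TubeHol coneUV g) {α β : ℝ} (h : (α, β) ∈ coneUV)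
    (ν : ℤ × ℤ) : tubeC g 1 0 ν = tubeC g α β ν := by
  have p1 := Real.goldenRatio_lt_two
  have p2 := Real.goldenRatio_pos
  have p3 := Real.goldenConj_neg
  have p4 := Real.neg_one_lt_goldenConj
  set A : ℝ := max (max 1 α) (2 * |β| + 1)
  have a1 : 1 ≤ A := (le_max_left 1 α).trans (le_max_left _ _)
  have a2 : α ≤ A := (le_max_right 1 α).trans (le_max_left _ _)
  have a3 : 2 * |β| + 1 ≤ A := le_max_right _ _
  have h1 : 0 < α + φ * β := h.1
  have h2 : 0 < α + ψ * β := h.2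
  rw [tubeC_shift_left hg (α' := A), tubeC_shift_right hg (β' := β),
    tubeC_shift_left hg (α := A) (α' := α)]
  · intro t ht
    rw [uIcc_of_ge a2] at ht
    constructor <;> simp only <;> linarith [ht.1]
  · intro t ht
    have : |t| ≤ |β| := by
      have := Set.abs_sub_left_of_mem_uIcc ht
      simpa using this
    rw [abs_le] at this
    constructor <;> simp only <;> nlinarith
  · intro t ht
    rw [uIcc_of_le a1] at ht
    constructor <;> simp only <;> linarith [ht.1]

lemma fcoef_eq_tubeC {f : ℂ × ℂ → ℂ} (hf : PerHol f) {α β : ℝ} (h : (α, β) ∈ coneUV)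
    (ν : ℤ × ℤ) : fcoef f ν = tubeC (inBasis f) α β ν := tubeC_coneUV hf h ν

lemma PerHol.summable_hasSum {f : ℂ × ℂ → ℂ} (hf : PerHol f) {z : ℂ × ℂ} (hz : z ∈ H2) :
    (Summable fun ν => ‖fcoef f ν * gexp ν z‖) ∧ HasSum (fun ν => fcoef f ν * gexp ν z) (f z) := by
  obtain ⟨u, v, h1, h2⟩ := exists_coord z.1.re z.2.re
  obtain ⟨α, β, h3, h4⟩ := exists_coord z.1.im z.2.im
  have hc : (α, β) ∈ coneUV := by
    constructor <;> simp only
    · rw [h3]; exact hz.1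
    · rw [h4]; exact hz.2
  obtain ⟨δ, hδ, hU⟩ := coneUV_strip hc
  obtain ⟨M, hM⟩ := TubeHol.exists_bound hf (K := Icc (α - δ) (α + δ) ×ˢ Icc (β - δ) (β + δ))
    (isCompact_Icc.prod isCompact_Icc) (fun x hx => hU _ _
      (abs_le.mpr ⟨by linarith [hx.1.1], by linarith [hx.1.2]⟩)
      (abs_le.mpr ⟨by linarith [hx.2.1], by linarith [hx.2.2]⟩))
  have h5 := hasSum_tubeC hf hδ hU (M := M) (fun u v hu hv => hM _ _ (by
    rw [abs_le] at hu hv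
    exact ⟨⟨by linarith [hu.1], by linarith [hu.2]⟩, ⟨by linarith [hv.1], by linarith [hv.2]⟩⟩))
    u v
  have e1 : z = ((u + α * I : ℂ) + (φ : ℝ) * (v + β * I), (u + α * I : ℂ) + (ψ : ℝ) * (v + β * I)) := by
    refine Prod.ext ?_ ?_ <;> apply Complex.ext <;> simp [h1, h2, h3, h4]
  have e2 : ∀ ν, tubeC (inBasis f) α β ν * ee (ν.1 * (u + α * I) + ν.2 * (v + β * I)) =
      fcoef f ν * gexp ν z := by
    intro ν
    rw [fcoef_eq_tubeC hf hc, e1, gexp_coord]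
  simp only [e2] at h5
  refine ⟨h5.1, ?_⟩
  convert h5.2 using 1
  rw [inBasis, ← e1]

lemma PerHol.norm_fcoef_le {f : ℂ × ℂ → ℂ} (hf : PerHol f) {y₁ y₂ M : ℝ} (h1 : 0 < y₁)
    (h2 : 0 < y₂) (hM : ∀ x₁ x₂ : ℝ, ‖f (x₁ + y₁ * I, x₂ + y₂ * I)‖ ≤ M) (ν : ℤ × ℤ) :
    ‖fcoef f ν‖ ≤ M * Real.exp (2 * π * (dual1 ν * y₁ + dual2 ν * y₂)) := by
  obtain ⟨α, β, h3, h4⟩ := exists_coord y₁ y₂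
  have hc : (α, β) ∈ coneUV := by
    constructor <;> simp only
    · rwa [h3]
    · rwa [h4]
  rw [fcoef_eq_tubeC hf hc]
  refine (norm_tubeC_le (M := M) (fun u v => ?_) ν).trans_eq ?_
  · convert hM (u + φ * v) (u + ψ * v) using 2
    rw [inBasis, ← h3, ← h4]
    congr 2 <;> · push_cast; ring
  · congr 2
    rw [← h3, ← h4, ← dual1_add_dual2, ← dual1_mul_add_dual2_mul]
    ring

/-- Uniqueness of the expansion. One height `(y₁, y₂)` is enough, because `fcoef` may be computed at
any height in the cone. -/
lemma PerHol.fcoef_eq {f : ℂ × ℂ → ℂ} (hf : PerHol f) {y₁ y₂ : ℝ} (h1 : 0 < y₁)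
    (h2 : 0 < y₂) {a : ℤ × ℤ → ℂ}
    (ha : Summable fun ν => ‖a ν * gexp ν (y₁ * I, y₂ * I)‖)
    (h : ∀ x₁ x₂ : ℝ, HasSum (fun ν => a ν * gexp ν (x₁ + y₁ * I, x₂ + y₂ * I))
      (f (x₁ + y₁ * I, x₂ + y₂ * I))) : fcoef f = a := by
  obtain ⟨α, β, h3, h4⟩ := exists_coord y₁ y₂
  have hc : (α, β) ∈ coneUV := by
    constructor <;> simp only
    · rwa [h3]
    · rwa [h4]
  have e0 : ∀ u v : ℝ, ((u + α * I : ℂ) + (φ : ℝ) * (v + β * I),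
      (u + α * I : ℂ) + (ψ : ℝ) * (v + β * I)) =
      (((u + φ * v : ℝ) : ℂ) + y₁ * I, ((u + ψ * v : ℝ) : ℂ) + y₂ * I) := by
    intro u v
    rw [← h3, ← h4]
    push_cast
    refine Prod.ext ?_ ?_ <;> ring
  have e1 : ∀ (u v : ℝ) ν, a ν * gexp ν (((u + φ * v : ℝ) : ℂ) + y₁ * I,
      ((u + ψ * v : ℝ) : ℂ) + y₂ * I) =
      (a ν * ee (ν.1 * (α * I) + ν.2 * (β * I))) * ee (ν.1 * u + ν.2 * v) := by
    intro u v ν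
    rw [← e0, gexp_coord, mul_assoc, ← ee_add]
    congr 2; ring
  funext ν
  rw [fcoef_eq_tubeC hf hc, tubeC, fc2_of_hasSum (a := fun ν => a ν *
    ee (ν.1 * (α * I) + ν.2 * (β * I))), mul_assoc, ← ee_add, add_neg_cancel, ee_zero, mul_one]
  · refine Summable.of_norm (ha.congr fun ν => ?_)
    have := e1 0 0 ν
    simp only [mul_zero, add_zero, ofReal_zero, zero_add, ee_zero, mul_one] at this
    rw [this]
  · intro u v
    have := h (u + φ * v) (u + ψ * v)
    simp only [e1] at this
    convert this using 1
    rw [inBasis, e0]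

end HilbertModular

end

/-! ### Unit invariance, the Götzky–Koecher principle and conjugation of Fourier coefficients. -/

section

open Complex MeasureTheory Filter Set Function
open scoped Real goldenRatio Interval

namespace HilbertModular

/-- Functions on `ℍ²` that behave like a Hilbert modular form of even weight `k` for `ℚ(√5)` under
translations, under the square of the fundamental unit and under the inversion. -/
structure IsHMF (f : ℂ × ℂ → ℂ) (k : ℤ) : Prop where
  hol : DifferentiableOn ℂ f H2
  per1 : ∀ z₁ z₂ : ℂ, (z₁, z₂) ∈ H2 → f (z₁ + 1, z₂ + 1) = f (z₁, z₂)
  per2 : ∀ z₁ z₂ : ℂ, (z₁, z₂) ∈ H2 → f (z₁ + (φ : ℝ), z₂ + (ψ : ℝ)) = f (z₁, z₂)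
  unit : ∀ z₁ z₂ : ℂ, (z₁, z₂) ∈ H2 →
    f ((φ ^ 2 : ℝ) * z₁, (ψ ^ 2 : ℝ) * z₂) = f (z₁, z₂)
  inv : ∀ z₁ z₂ : ℂ, (z₁, z₂) ∈ H2 → f (-1 / z₁, -1 / z₂) = (z₁ * z₂) ^ k * f (z₁, z₂)

lemma IsHMF.perHol {f : ℂ × ℂ → ℂ} {k : ℤ} (hf : IsHMF f k) : PerHol f :=
  .of_differentiableOn hf.hol hf.per1 hf.per2

lemma mem_H2 {z₁ z₂ : ℂ} (h1 : 0 < z₁.im) (h2 : 0 < z₂.im) : (z₁, z₂) ∈ H2 := ⟨h1, h2⟩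

lemma PerHol.fcoef_eq_of_hasSum {f : ℂ × ℂ → ℂ} (hf : PerHol f) {a : ℤ × ℤ → ℂ}
    (h : ∀ z ∈ H2, HasSum (fun ν => a ν * gexp ν z) (f z)) : fcoef f = a := by
  refine hf.fcoef_eq one_pos one_pos (h _ (mem_H2 ?_ ?_)).summable.norm fun x₁ x₂ =>
    h _ (mem_H2 ?_ ?_) <;> simp

lemma PerHol.hasSum {f : ℂ × ℂ → ℂ} (hf : PerHol f) {z : ℂ × ℂ} (hz : z ∈ H2) :
    HasSum (fun ν => fcoef f ν * gexp ν z) (f z) := (hf.summable_hasSum hz).2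

/-- Multiplication by the square of the fundamental unit on the inverse different. -/
def unitSq : ℤ × ℤ ≃ ℤ × ℤ where
  toFun ν := (ν.1 + ν.2, ν.1 + 2 * ν.2)
  invFun ν := (2 * ν.1 - ν.2, ν.2 - ν.1)
  left_inv ν := by ext <;> simp <;> ring
  right_inv ν := by ext <;> simp <;> ring

lemma dual1_unitSq (ν : ℤ × ℤ) : dual1 (unitSq ν) = φ ^ 2 * dual1 ν := by
  simp only [dual1, unitSq, Equiv.coe_fn_mk]
  push_cast
  refine Eq.trans ?_ (mul_div_assoc _ _ _)
  congr 1
  have h1 := Real.goldenRatio_sq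
  have h2 := Real.goldenRatio_add_goldenConj
  have h3 : ψ = 1 - φ := by linarith
  rw [h3]
  linear_combination (-(ν.1 : ℝ) * φ - ν.2) * h1

lemma dual2_unitSq (ν : ℤ × ℤ) : dual2 (unitSq ν) = ψ ^ 2 * dual2 ν := by
  simp only [dual2, unitSq, Equiv.coe_fn_mk]
  push_cast
  refine Eq.trans ?_ (mul_div_assoc _ _ _)
  congr 1
  have h1 := Real.goldenConj_sq
  have h2 := Real.goldenRatio_add_goldenConj
  have h3 : φ = 1 - ψ := by linarith
  rw [h3]
  linear_combination (ν.1 * ψ + ν.2) * h1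

lemma gexp_unitSq (ν : ℤ × ℤ) (z : ℂ × ℂ) :
    gexp (unitSq ν) z = gexp ν ((φ ^ 2 : ℝ) * z.1, (ψ ^ 2 : ℝ) * z.2) := by
  simp only [gexp, dual1_unitSq, dual2_unitSq]
  congr 1; push_cast; ring

lemma unit_mem_H2 {z₁ z₂ : ℂ} (hz : (z₁, z₂) ∈ H2) :
    (((φ ^ 2 : ℝ) : ℂ) * z₁, ((ψ ^ 2 : ℝ) : ℂ) * z₂) ∈ H2 := by
  have h1 : 0 < φ ^ 2 := by have := Real.goldenRatio_pos; positivity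
  have h2 : 0 < ψ ^ 2 := by have := Real.goldenConj_ne_zero; positivity
  refine mem_H2 ?_ ?_
  · rw [im_ofReal_mul]; exact mul_pos h1 hz.1
  · rw [im_ofReal_mul]; exact mul_pos h2 hz.2

lemma PerHol.fcoef_unitSq {f : ℂ × ℂ → ℂ} (hf : PerHol f)
    (hu : ∀ z₁ z₂ : ℂ, (z₁, z₂) ∈ H2 → f ((φ ^ 2 : ℝ) * z₁, (ψ ^ 2 : ℝ) * z₂) = f (z₁, z₂))
    (ν : ℤ × ℤ) : fcoef f (unitSq ν) = fcoef f ν := by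
  have h : fcoef f = fun μ => fcoef f (unitSq.symm μ) := by
    refine hf.fcoef_eq_of_hasSum fun z hz => ?_
    have h1 := hf.hasSum (unit_mem_H2 hz)
    rw [hu _ _ hz] at h1
    rw [← unitSq.hasSum_iff]
    refine h1.congr_fun fun ν => ?_
    simp only [comp_apply, Equiv.symm_apply_apply, gexp_unitSq]
  rw [congrFun h (unitSq ν), Equiv.symm_apply_apply]

lemma dual1_eq_zero {ν : ℤ × ℤ} (h : dual1 ν = 0) : ν = 0 := by
  rw [dual1, div_eq_zero_iff, or_iff_left sqrt_five_ne_zero, sub_eq_zero] at h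
  by_cases h1 : ν.1 = 0
  · rw [h1] at h
    simp at h
    exact Prod.ext h1 h
  · exfalso
    refine (Real.goldenConj_irrational.intCast_mul h1).ne_int ν.2 h.symm

lemma dual2_eq_zero {ν : ℤ × ℤ} (h : dual2 ν = 0) : ν = 0 := by
  rw [dual2, div_eq_zero_iff, or_iff_left sqrt_five_ne_zero, sub_eq_zero] at h
  by_cases h1 : ν.1 = 0
  · rw [h1] at h
    simp at h
    exact Prod.ext h1 (by exact_mod_cast h.symm)
  · exfalso
    refine (Real.goldenRatio_irrational.intCast_mul h1).ne_int ν.2 h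

lemma exists_bound_of_summable {a : ℤ × ℤ → ℂ} {z : ℂ × ℂ}
    (h : Summable fun ν => ‖a ν * gexp ν z‖) : ∃ B, ∀ ν, ‖a ν‖ ≤
      B * Real.exp (2 * π * (dual1 ν * z.1.im + dual2 ν * z.2.im)) := by
  refine ⟨∑' ν, ‖a ν * gexp ν z‖, fun ν => ?_⟩
  have h1 := h.le_tsum ν fun _ _ => norm_nonneg _
  rw [norm_mul, norm_gexp] at h1
  rw [← div_le_iff₀ (Real.exp_pos _), div_eq_mul_inv, ← Real.exp_neg, ← neg_mul, ← neg_mul]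
  refine le_trans (by simp) h1

/-- The bound decays doubly exponentially along powers of `ε`; it is applied with `ε` the square of
the fundamental unit. -/
lemma eq_zero_of_le_exp {x B C D : ℝ} (hx : 0 ≤ x) (hD : 0 < D) {ε : ℝ} (hε : 1 < ε)
    (h : ∀ n : ℕ, x ≤ B * Real.exp (C - D * ε ^ n)) : x = 0 := by
  have h1 : Tendsto (fun n : ℕ => C + -(D * ε ^ n)) atTop atBot :=
    tendsto_atBot_add_const_left _ _
      (tendsto_neg_atTop_atBot.comp ((tendsto_pow_atTop_atTop_of_one_lt hε).const_mul_atTop hD))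
  have h2 := (Real.tendsto_exp_atBot.comp h1).const_mul B
  rw [mul_zero] at h2
  exact le_antisymm (ge_of_tendsto' h2 fun n => by simpa [sub_eq_add_neg] using h n) hx

/-- The Götzky–Koecher principle. -/
lemma PerHol.koecher {f : ℂ × ℂ → ℂ} (hf : PerHol f)
    (hu : ∀ z₁ z₂ : ℂ, (z₁, z₂) ∈ H2 → f ((φ ^ 2 : ℝ) * z₁, (ψ ^ 2 : ℝ) * z₂) = f (z₁, z₂))
    {ν : ℤ × ℤ} (h : fcoef f ν ≠ 0) : ν = 0 ∨ (0 < dual1 ν ∧ 0 < dual2 ν) := by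
  obtain ⟨B, hB⟩ := exists_bound_of_summable (hf.summable_hasSum (z := (I, I))
    (mem_H2 (by simp) (by simp))).1
  simp only [I_im, mul_one] at hB
  have hB0 : 0 ≤ B := by
    have := (norm_nonneg _).trans (hB 0)
    exact nonneg_of_mul_nonneg_left this (Real.exp_pos _)
  have g1 : 1 < φ ^ 2 := by have := Real.one_lt_goldenRatio; nlinarith
  have g2 : 0 < ψ ^ 2 := by have := Real.goldenConj_ne_zero; positivity
  have g3 : ψ ^ 2 < 1 := by
    have := Real.goldenConj_neg; have := Real.neg_one_lt_goldenConj; nlinarith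
  have g4 : φ ^ 2 * ψ ^ 2 = 1 := by
    rw [← mul_pow, Real.goldenRatio_mul_goldenConj]; norm_num
  have key : ∀ ν, fcoef f ν ≠ 0 → 0 ≤ dual1 ν ∧ 0 ≤ dual2 ν := by
    intro ν h
    constructor
    · by_contra! hneg
      -- Multiplication by powers of the unit fixes the coefficient, drives the negative first
      -- embedding to −∞ like `φ^(2n)`, and keeps the second embedding bounded. The convergence of
      -- the series at `(i, i)` then forces the coefficient to vanish.
      refine h (norm_eq_zero.mp (eq_zero_of_le_exp (B := B) (C := 2 * π * |dual2 ν|)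
        (D := 2 * π * (-dual1 ν)) (norm_nonneg _) (by have := Real.pi_pos; nlinarith) g1 fun n => ?_))
      have e1 : ∀ n : ℕ, fcoef f (unitSq^[n] ν) = fcoef f ν ∧
          dual1 (unitSq^[n] ν) = (φ ^ 2) ^ n * dual1 ν ∧
          dual2 (unitSq^[n] ν) = (ψ ^ 2) ^ n * dual2 ν := by
        intro n
        induction n with
        | zero => simp
        | succ n ih =>
          rw [iterate_succ_apply', hf.fcoef_unitSq hu, dual1_unitSq, dual2_unitSq, ih.1, ih.2.1,
            ih.2.2]
          refine ⟨rfl, ?_, ?_⟩ <;> ring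
      obtain ⟨h1, h2, h3⟩ := e1 n
      have h4 := hB (unitSq^[n] ν)
      rw [h1, h2, h3] at h4
      refine h4.trans (mul_le_mul_of_nonneg_left (Real.exp_le_exp.mpr ?_) hB0)
      have h5 : (ψ ^ 2) ^ n * dual2 ν ≤ |dual2 ν| := by
        refine (le_abs_self _).trans ?_
        rw [abs_mul, abs_of_nonneg (by positivity)]
        exact mul_le_of_le_one_left (abs_nonneg _) (pow_le_one₀ g2.le g3.le)
      have := Real.pi_pos
      nlinarith
    · by_contra! hneg
      -- The mirror argument, along powers of the inverse unit.
      refine h (norm_eq_zero.mp (eq_zero_of_le_exp (B := B) (C := 2 * π * |dual1 ν|)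
        (D := 2 * π * (-dual2 ν)) (norm_nonneg _) (by have := Real.pi_pos; nlinarith) g1 fun n => ?_))
      have e1 : ∀ n : ℕ, fcoef f (unitSq.symm^[n] ν) = fcoef f ν ∧
          dual1 (unitSq.symm^[n] ν) = (ψ ^ 2) ^ n * dual1 ν ∧
          dual2 (unitSq.symm^[n] ν) = (φ ^ 2) ^ n * dual2 ν := by
        intro n
        induction n with
        | zero => simp
        | succ n ih =>
          rw [iterate_succ_apply']
          set μ := unitSq.symm^[n] ν
          have e2 := hf.fcoef_unitSq hu (unitSq.symm μ)
          have e3 := dual1_unitSq (unitSq.symm μ)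
          have e4 := dual2_unitSq (unitSq.symm μ)
          rw [Equiv.apply_symm_apply] at e2 e3 e4
          rw [ih.1] at e2
          rw [ih.2.1] at e3
          rw [ih.2.2] at e4
          refine ⟨e2.symm, ?_, ?_⟩
          · linear_combination (-ψ ^ 2) * e3 - dual1 (unitSq.symm μ) * g4
          · linear_combination (-φ ^ 2) * e4 - dual2 (unitSq.symm μ) * g4
      obtain ⟨h1, h2, h3⟩ := e1 n
      have h4 := hB (unitSq.symm^[n] ν)
      rw [h1, h2, h3] at h4
      refine h4.trans (mul_le_mul_of_nonneg_left (Real.exp_le_exp.mpr ?_) hB0)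
      have h5 : (ψ ^ 2) ^ n * dual1 ν ≤ |dual1 ν| := by
        refine (le_abs_self _).trans ?_
        rw [abs_mul, abs_of_nonneg (by positivity)]
        exact mul_le_of_le_one_left (abs_nonneg _) (pow_le_one₀ g2.le g3.le)
      have := Real.pi_pos
      nlinarith
  by_cases h0 : ν = 0
  · exact Or.inl h0
  · refine Or.inr ⟨lt_of_le_of_ne (key ν h).1 fun h1 => h0 (dual1_eq_zero h1.symm),
      lt_of_le_of_ne (key ν h).2 fun h1 => h0 (dual2_eq_zero h1.symm)⟩

/-- Conjugation replaces (1 + √5)/2 by one minus itself, so the second trace `r` becomes `p − r` and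
`p` is unchanged. -/
lemma dual1_swap (p r : ℤ) : dual1 (p, p - r) = dual2 (p, r) := by
  simp only [dual1, dual2]
  congr 1
  have h2 := Real.goldenRatio_add_goldenConj
  push_cast
  linear_combination (-(p : ℝ)) * h2

lemma dual2_swap (p r : ℤ) : dual2 (p, p - r) = dual1 (p, r) := by
  simp only [dual1, dual2]
  congr 1
  have h2 := Real.goldenRatio_add_goldenConj
  push_cast
  linear_combination (p : ℝ) * h2

/-- Conjugation on the inverse different. -/
def dualSwap : ℤ × ℤ ≃ ℤ × ℤ where
  toFun ν := (ν.1, ν.1 - ν.2)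
  invFun ν := (ν.1, ν.1 - ν.2)
  left_inv ν := by ext <;> simp
  right_inv ν := by ext <;> simp

lemma PerHol.fcoef_swap {f : ℂ × ℂ → ℂ} (hf : PerHol f)
    (hs : ∀ z₁ z₂ : ℂ, (z₁, z₂) ∈ H2 → f (z₂, z₁) = f (z₁, z₂)) (p r : ℤ) :
    fcoef f (p, p - r) = fcoef f (p, r) := by
  have h : fcoef f = fun μ => fcoef f (dualSwap μ) := by
    refine hf.fcoef_eq_of_hasSum fun z hz => ?_
    have h1 := hf.hasSum (z := (z.2, z.1)) (mem_H2 hz.2 hz.1)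
    rw [hs _ _ (mem_H2 hz.1 hz.2)] at h1
    rw [← dualSwap.hasSum_iff]
    refine h1.congr_fun fun ν => ?_
    have e1 : dualSwap (dualSwap ν) = ν := dualSwap.left_inv ν
    simp only [comp_apply, e1]
    congr 1
    simp only [gexp, dualSwap, Equiv.coe_fn_mk, dual1_swap, dual2_swap]
    congr 1; ring
  exact (congrFun h (p, r)).symm

end HilbertModular

end

/-! ### Leading terms and Taylor expansion along the diagonal. -/

section

open Complex MeasureTheory Filter Set Function
open scoped Real goldenRatio Interval

namespace HilbertModular

/-- `f(z + w, z) = φ(z) w ^ N + o(w ^ N)` for `w → 0`. -/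
def HasLead (f : ℂ × ℂ → ℂ) (N : ℕ) (g : ℍ → ℂ) : Prop :=
  ∀ z : ℍ, Tendsto (fun w : ℂ => f (z + w, z) / w ^ N) (𝓝[≠] 0) (𝓝 (g z))

lemma HasLead.mul {f g : ℂ × ℂ → ℂ} {N M : ℕ} {a b : ℍ → ℂ} (hf : HasLead f N a)
    (hg : HasLead g M b) : HasLead (f * g) (N + M) (a * b) := fun z => by
  refine ((hf z).mul (hg z)).congr fun w => ?_
  simp only [Pi.mul_apply, pow_add]
  rw [div_mul_div_comm]

lemma HasLead.add {f g : ℂ × ℂ → ℂ} {N : ℕ} {a b : ℍ → ℂ} (hf : HasLead f N a)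
    (hg : HasLead g N b) : HasLead (f + g) N (a + b) := fun z => by
  refine ((hf z).add (hg z)).congr fun w => ?_
  simp only [Pi.add_apply, add_div]

lemma HasLead.smul {f : ℂ × ℂ → ℂ} {N : ℕ} {a : ℍ → ℂ} (c : ℂ) (hf : HasLead f N a) :
    HasLead (c • f) N (c • a) := fun z => by
  refine ((hf z).const_mul c).congr fun w => ?_
  simp only [Pi.smul_apply, smul_eq_mul, mul_div_assoc]

lemma HasLead.sub {f g : ℂ × ℂ → ℂ} {N : ℕ} {a b : ℍ → ℂ} (hf : HasLead f N a)
    (hg : HasLead g N b) : HasLead (f - g) N (a - b) := fun z => by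
  refine ((hf z).sub (hg z)).congr fun w => ?_
  simp only [Pi.sub_apply, sub_div]

lemma hasLead_one : HasLead 1 0 1 := fun z => by simp

lemma hasLead_zero (N : ℕ) : HasLead 0 N 0 := fun z => by simp

lemma HasLead.pow {f : ℂ × ℂ → ℂ} {N : ℕ} {a : ℍ → ℂ} (hf : HasLead f N a) (n : ℕ) :
    HasLead (f ^ n) (n * N) (a ^ n) := by
  induction n with
  | zero => simpa using hasLead_one
  | succ n ih => simpa [pow_succ, Nat.succ_mul] using ih.mul hf

lemma HasLead.unique {f : ℂ × ℂ → ℂ} {N : ℕ} {a b : ℍ → ℂ} (hf : HasLead f N a)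
    (hg : HasLead f N b) : a = b := funext fun z => tendsto_nhds_unique (hf z) (hg z)

lemma HasLead.of_lt {f : ℂ × ℂ → ℂ} {N M : ℕ} {a : ℍ → ℂ} (hf : HasLead f N a) (h : M < N) :
    HasLead f M 0 := fun z => by
  have h1 : Tendsto (fun w : ℂ => w ^ (N - M)) (𝓝[≠] 0) (𝓝 0) := by
    have : Tendsto (fun w : ℂ => w ^ (N - M)) (𝓝 0) (𝓝 (0 ^ (N - M))) :=
      (continuous_pow _).tendsto 0
    rw [zero_pow (by omega)] at this
    exact this.mono_left nhdsWithin_le_nhds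
  have h2 := (hf z).mul h1
  rw [mul_zero] at h2
  refine h2.congr' ?_
  filter_upwards [self_mem_nhdsWithin] with w hw
  have hw' : w ≠ 0 := hw
  rw [div_mul_eq_mul_div, div_eq_div_iff (pow_ne_zero _ hw') (pow_ne_zero _ hw'), mul_assoc,
    ← pow_add, Nat.sub_add_cancel h.le]

lemma tendsto_div_pow_of_hasSum {F : ℂ → ℂ} {b : ℕ → ℂ} {ρ : ℝ} (hρ : 0 < ρ)
    (h : ∀ w : ℂ, ‖w‖ < ρ → HasSum (fun i => b i * w ^ i) (F w)) {N : ℕ}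
    (hN : ∀ i < N, b i = 0) : Tendsto (fun w => F w / w ^ N) (𝓝[≠] 0) (𝓝 (b N)) := by
  have h1 : ∀ w : ℂ, ‖w‖ < ρ → w ≠ 0 →
      HasSum (fun j => b (j + N) * w ^ j) (F w / w ^ N) := by
    intro w hw hw0
    have h2 := (hasSum_nat_add_iff' N).mpr (h w hw)
    rw [Finset.sum_eq_zero fun i hi => by rw [hN i (Finset.mem_range.mp hi), zero_mul],
      sub_zero] at h2
    refine (h2.div_const (w ^ N)).congr_fun fun j => ?_
    rw [pow_add, ← mul_assoc, mul_div_cancel_right₀ _ (pow_ne_zero _ hw0)]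
  have hs : Summable fun j => ‖b (j + N)‖ * (ρ / 2) ^ j := by
    have h3 := (h1 ((ρ / 2 : ℝ) : ℂ) (by simp [abs_of_pos hρ]; linarith)
      (by simp [hρ.ne'])).summable.norm
    refine h3.congr fun j => ?_
    rw [norm_mul, norm_pow, norm_real, Real.norm_of_nonneg (by positivity)]
  have h4 : Tendsto (fun w : ℂ => ∑' j, b (j + N) * w ^ j) (𝓝[≠] 0)
      (𝓝 (∑' j, b (j + N) * 0 ^ j)) := by
    refine tendsto_tsum_of_dominated_convergence hs (fun j => ?_) ?_
    · exact (((continuous_pow j).const_mul _).tendsto 0).mono_left nhdsWithin_le_nhds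
    · have : ∀ᶠ w : ℂ in 𝓝[≠] 0, ‖w‖ < ρ / 2 := by
        have := (continuous_norm (E := ℂ)).tendsto 0
        rw [norm_zero] at this
        exact (this.eventually_lt_const (by positivity)).filter_mono nhdsWithin_le_nhds
      filter_upwards [this] with w hw j
      rw [norm_mul, norm_pow]
      gcongr
  rw [tsum_eq_single 0 (fun j hj => by simp [hj])] at h4
  simp only [zero_add, pow_zero, mul_one] at h4
  refine h4.congr' ?_
  have : ∀ᶠ w : ℂ in 𝓝[≠] 0, ‖w‖ < ρ := by
    have := (continuous_norm (E := ℂ)).tendsto 0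
    rw [norm_zero] at this
    exact (this.eventually_lt_const (by positivity)).filter_mono nhdsWithin_le_nhds
  filter_upwards [this, self_mem_nhdsWithin] with w hw hw0
  exact (h1 w hw hw0).tsum_eq

lemma coeff_eq_zero_of_tendsto {F : ℂ → ℂ} {b : ℕ → ℂ} {ρ : ℝ} (hρ : 0 < ρ)
    (h : ∀ w : ℂ, ‖w‖ < ρ → HasSum (fun i => b i * w ^ i) (F w)) {N : ℕ} {c : ℂ}
    (hN : Tendsto (fun w => F w / w ^ N) (𝓝[≠] 0) (𝓝 c)) (i : ℕ) (hi : i < N) : b i = 0 := by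
  induction i using Nat.strong_induction_on with
  | _ i ih =>
    have h1 := tendsto_div_pow_of_hasSum hρ h (N := i) fun j hj => ih j hj (hj.trans hi)
    have h2 : Tendsto (fun w : ℂ => w ^ (N - i)) (𝓝[≠] 0) (𝓝 0) := by
      have : Tendsto (fun w : ℂ => w ^ (N - i)) (𝓝 0) (𝓝 (0 ^ (N - i))) :=
        (continuous_pow _).tendsto 0
      rw [zero_pow (by omega)] at this
      exact this.mono_left nhdsWithin_le_nhds
    have h3 := hN.mul h2
    rw [mul_zero] at h3
    refine tendsto_nhds_unique h1 (h3.congr' ?_)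
    filter_upwards [self_mem_nhdsWithin] with w hw
    have hw' : w ≠ 0 := hw
    rw [div_mul_eq_mul_div, div_eq_div_iff (pow_ne_zero _ hw') (pow_ne_zero _ hw'), mul_assoc,
      ← pow_add, Nat.sub_add_cancel hi.le]

/-- The sums `∑ ν₁ ^ i a_ν e(Tr ν z)`. -/
noncomputable def diagSum (f : ℂ × ℂ → ℂ) (i : ℕ) (z : ℂ) : ℂ :=
  ∑' ν, fcoef f ν * (dual1 ν : ℂ) ^ i * gexp ν (z, z)

section

variable {f : ℂ × ℂ → ℂ} {k : ℤ}

lemma IsHMF.koecher (hf : IsHMF f k) {ν : ℤ × ℤ} (h : fcoef f ν ≠ 0) :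
    ν = 0 ∨ (0 < dual1 ν ∧ 0 < dual2 ν) := hf.perHol.koecher hf.unit h

lemma dual1_zero : dual1 0 = 0 := by simp [dual1]

lemma dual2_zero : dual2 0 = 0 := by simp [dual2]

lemma IsHMF.dual_nonneg (hf : IsHMF f k) {ν : ℤ × ℤ} (h : fcoef f ν ≠ 0) :
    0 ≤ dual1 ν ∧ 0 ≤ dual2 ν := by
  rcases hf.koecher h with rfl | h
  · simp [dual1_zero, dual2_zero]
  · exact ⟨h.1.le, h.2.le⟩

lemma gexp_add_left (ν : ℤ × ℤ) (z w : ℂ) :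
    gexp ν (z + w, z) = gexp ν (z, z) * ee (dual1 ν * w) := by
  rw [gexp, gexp, ← ee_add]; congr 1; ring

lemma hasSum_ee (x : ℂ) : HasSum (fun i : ℕ => (2 * π * I * x) ^ i / (i.factorial : ℂ)) (ee x) := by
  rw [ee, Complex.exp_eq_exp_ℂ]
  exact NormedSpace.expSeries_div_hasSum_exp _

/-- Expand the exponential in `w` inside the Fourier series and exchange the two sums. The absolute
values sum to the Fourier series at another point of ℍ², because the Koecher principle makes the
first embedding of the frequencies nonnegative. -/
lemma IsHMF.taylor (hf : IsHMF f k) {z : ℂ} (hz : 0 < z.im) :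
    (∀ i, Summable fun ν => fcoef f ν * (dual1 ν : ℂ) ^ i * gexp ν (z, z)) ∧
    ∀ w : ℂ, ‖w‖ < z.im →
      HasSum (fun i => (2 * π * I) ^ i / (i.factorial : ℂ) * diagSum f i z * w ^ i)
        (f (z + w, z)) := by
  have key : ∀ w : ℂ, ‖w‖ < z.im →
      Summable fun x : (ℤ × ℤ) × ℕ => fcoef f x.1 * gexp x.1 (z, z) *
        ((2 * π * I * (dual1 x.1 * w)) ^ x.2 / (x.2.factorial : ℂ)) := by
    intro w hw
    refine Summable.of_norm ?_
    have e1 : ∀ x : (ℤ × ℤ) × ℕ, ‖fcoef f x.1 * gexp x.1 (z, z) *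
        ((2 * π * I * (dual1 x.1 * w)) ^ x.2 / (x.2.factorial : ℂ))‖ =
        ‖fcoef f x.1 * gexp x.1 (z, z)‖ * ((2 * π * (|dual1 x.1| * ‖w‖)) ^ x.2 / x.2.factorial) := by
      intro x
      simp [abs_of_pos Real.pi_pos]
    simp only [e1]
    have e2 : ∀ ν, HasSum (fun i : ℕ => ‖fcoef f ν * gexp ν (z, z)‖ *
        ((2 * π * (|dual1 ν| * ‖w‖)) ^ i / i.factorial))
        (‖fcoef f ν * gexp ν (z, z)‖ * Real.exp (2 * π * (|dual1 ν| * ‖w‖))) := by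
      intro ν
      refine HasSum.mul_left _ ?_
      rw [Real.exp_eq_exp_ℝ]
      exact NormedSpace.expSeries_div_hasSum_exp _
    rw [summable_prod_of_nonneg (fun x => by positivity)]
    refine ⟨fun ν => (e2 ν).summable, ?_⟩
    simp only [fun ν => (e2 ν).tsum_eq]
    -- Lowering the first coordinate by `‖w‖` produces exactly the factor `exp(2π ν₁ ‖w‖)`.
    have h1 := (hf.perHol.summable_hasSum (z := (z - ‖w‖ * I, z)) (mem_H2 (by simpa using hw) hz)).1
    refine h1.congr fun ν => ?_
    by_cases h0 : fcoef f ν = 0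
    · simp [h0]
    rw [norm_mul, norm_mul, mul_assoc, norm_gexp, norm_gexp, ← Real.exp_add,
      abs_of_nonneg (hf.dual_nonneg h0).1]
    congr 2
    simp
    ring
  have e3 : ∀ (w : ℂ) (i : ℕ) (ν : ℤ × ℤ), fcoef f ν * gexp ν (z, z) *
        ((2 * π * I * (dual1 ν * w)) ^ i / (i.factorial : ℂ)) =
        ((2 * π * I) ^ i / (i.factorial : ℂ) * w ^ i) *
          (fcoef f ν * (dual1 ν : ℂ) ^ i * gexp ν (z, z)) := by
    intro w i ν
    rw [mul_pow, mul_pow]; ring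
  have hsum : ∀ i, Summable fun ν => fcoef f ν * (dual1 ν : ℂ) ^ i * gexp ν (z, z) := by
    intro i
    -- Any nonzero `w` in the disc would do: the slice of the double sum at `i` is a nonzero
    -- multiple of the wanted series.
    have h1 := (key ((z.im / 2 : ℝ) : ℂ) (by
      rw [norm_real, Real.norm_of_nonneg (by positivity)]; linarith)).prod_symm.prod_factor i
    simp only [Prod.swap_prod_mk, e3] at h1
    refine (summable_mul_left_iff ?_).mp h1
    have : (I : ℂ) ≠ 0 := I_ne_zero
    have : (z.im : ℂ) ≠ 0 := by exact_mod_cast hz.ne'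
    simp [Real.pi_ne_zero, Nat.factorial_ne_zero, this]
  refine ⟨hsum, fun w hw => ?_⟩
  have hK := (key w hw).hasSum
  have hfib := hK.prod_fiberwise (g := fun ν => fcoef f ν * gexp ν (z + w, z)) fun ν => by
    have h := (hasSum_ee (dual1 ν * w)).mul_left (fcoef f ν * gexp ν (z, z))
    rwa [mul_assoc (fcoef f ν) (gexp ν (z, z)) (ee _), ← gexp_add_left] at h
  have hval := hf.perHol.hasSum (z := (z + w, z)) (mem_H2 (by
    have := abs_le.mp ((abs_im_le_norm w).trans hw.le)
    have h2 := (abs_im_le_norm w).trans_lt hw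
    have := (abs_lt.mp h2).1
    simp only [add_im]; linarith) hz)
  rw [hval.unique hfib]
  have hK2 := (Equiv.prodComm ℕ (ℤ × ℤ)).hasSum_iff.mpr hK
  refine hK2.prod_fiberwise fun i => ?_
  simp only [comp_apply, Equiv.prodComm_apply, Prod.swap_prod_mk, e3]
  have h5 := ((hsum i).hasSum).mul_left ((2 * π * I) ^ i / (i.factorial : ℂ) * w ^ i)
  have e4 : (2 * π * I) ^ i / (i.factorial : ℂ) * diagSum f i z * w ^ i =
      ((2 * π * I) ^ i / (i.factorial : ℂ) * w ^ i) *
        ∑' ν, fcoef f ν * (dual1 ν : ℂ) ^ i * gexp ν (z, z) := by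
    unfold diagSum; ring
  rw [e4]
  exact h5

lemma IsHMF.hasLead_of_forall (hf : IsHMF f k) {N : ℕ}
    (h : ∀ i < N, ∀ z : ℂ, 0 < z.im → diagSum f i z = 0) :
    HasLead f N fun z => (2 * π * I) ^ N / (N.factorial : ℂ) * diagSum f N z := fun z =>
  tendsto_div_pow_of_hasSum (F := fun w => f (z + w, z)) z.im_pos (hf.taylor z.im_pos).2
    fun i hi => by rw [h i hi _ z.im_pos, mul_zero]

lemma IsHMF.diagSum_eq_zero (hf : IsHMF f k) {N : ℕ} {g : ℍ → ℂ} (h : HasLead f N g) {i : ℕ}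
    (hi : i < N) {z : ℂ} (hz : 0 < z.im) : diagSum f i z = 0 := by
  have h1 := coeff_eq_zero_of_tendsto (F := fun w => f (z + w, z)) hz (hf.taylor hz).2
    (h ⟨z, hz⟩) i hi
  have : ((2 * π * I) ^ i / (i.factorial : ℂ)) ≠ 0 := by
    simp [Real.pi_ne_zero, Nat.factorial_ne_zero]
  exact (mul_eq_zero.mp h1).resolve_left this

lemma IsHMF.lead_eq (hf : IsHMF f k) {N : ℕ} {g : ℍ → ℂ} (h : HasLead f N g) :
    g = fun z : ℍ => (2 * π * I) ^ N / (N.factorial : ℂ) * diagSum f N z :=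
  h.unique (hf.hasLead_of_forall fun _ hi _ hz => hf.diagSum_eq_zero h hi hz)

end

end HilbertModular

end

/-! ### Moments of the Fourier coefficients of fixed trace, and vanishing order. -/

section

open Complex MeasureTheory Filter Set Function
open scoped Real goldenRatio Manifold

namespace HilbertModular

/-- The moments of the Fourier coefficients of trace `n`. -/
noncomputable def tcoef (f : ℂ × ℂ → ℂ) (i n : ℕ) : ℂ :=
  ∑ r ∈ Finset.Icc (-n : ℤ) (2 * n), fcoef f (n, r) * (dual1 (n, r) : ℂ) ^ i

lemma hasSum_group {c : ℤ × ℤ → ℂ} {s : ℕ → Finset ℤ} {q S : ℂ}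
    (h : HasSum (fun x : ℤ × ℤ => c x * q ^ x.1) S)
    (hs : ∀ n m, c (n, m) ≠ 0 → 0 ≤ n ∧ m ∈ s n.toNat) :
    HasSum (fun n : ℕ => (∑ m ∈ s n, c (n, m)) * q ^ n) S := by
  have h0 : ∀ n : ℤ, HasSum (fun m => c (n, m) * q ^ n)
      ((∑ m ∈ s n.toNat, c (n, m)) * q ^ n) := by
    intro n
    have h2 : HasSum (fun m => c (n, m)) (∑ m ∈ s n.toNat, c (n, m)) := by
      apply hasSum_sum_of_ne_finset_zero
      intro m hm
      by_contra h0
      exact hm (hs n m h0).2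
    exact h2.mul_right _
  have h1 := h.prod_fiberwise (g := fun n : ℤ => (∑ m ∈ s n.toNat, c (n, m)) * q ^ n) h0
  rw [← (Nat.cast_injective (R := ℤ)).hasSum_iff] at h1
  · simpa using! h1
  · intro n hn
    have hneg : n < 0 := by
      by_contra! h0
      exact hn ⟨n.toNat, Int.toNat_of_nonneg h0⟩
    rw [Finset.sum_eq_zero, zero_mul]
    intro m _
    by_contra h0
    exact absurd (hs n m h0).1 (not_le.mpr hneg)

lemma cone_bounds {p r : ℤ} (h1 : 0 ≤ dual1 (p, r)) (h2 : 0 ≤ dual2 (p, r)) :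
    p * ψ ≤ r ∧ r ≤ p * φ ∧ 0 ≤ p := by
  have h5 : (0:ℝ) < √5 := by positivity
  refine ⟨?_, ?_, ?_⟩
  · rw [dual1, le_div_iff₀ h5] at h1; simpa using h1
  · rw [dual2, le_div_iff₀ h5] at h2; simpa using h2
  · have := add_nonneg h1 h2
    rw [dual1_add_dual2] at this
    exact_mod_cast this

/-- A given trace admits finitely many frequencies in the cone; the range used in `tcoef` comes from
−1 < ψ and φ < 2. -/
lemma cone_mem_Icc {p r : ℤ} (h1 : 0 ≤ dual1 (p, r)) (h2 : 0 ≤ dual2 (p, r)) :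
    0 ≤ p ∧ r ∈ Finset.Icc (-(p.toNat : ℤ)) (2 * p.toNat) := by
  obtain ⟨a, b, c⟩ := cone_bounds h1 h2
  refine ⟨c, ?_⟩
  rw [Int.toNat_of_nonneg c, Finset.mem_Icc]
  have p1 := Real.goldenRatio_lt_two
  have p4 := Real.neg_one_lt_goldenConj
  have c' : (0:ℝ) ≤ p := by exact_mod_cast c
  constructor
  · have : (-p : ℝ) ≤ r := by nlinarith
    exact_mod_cast this
  · have : (r : ℝ) ≤ 2 * p := by nlinarith
    exact_mod_cast this

lemma ee_int_mul (n : ℤ) (z : ℂ) : ee (n * z) = ee z ^ n := by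
  rw [ee, ee, ← Complex.exp_int_mul]
  congr 1; ring

lemma gexp_diag (ν : ℤ × ℤ) (z : ℂ) : gexp ν (z, z) = ee z ^ ν.1 := by
  rw [gexp, ← ee_int_mul, ← add_mul, ← ofReal_add, dual1_add_dual2]
  simp

section

variable {f : ℂ × ℂ → ℂ} {k : ℤ}

lemma IsHMF.hasSum_tcoef (hf : IsHMF f k) (i : ℕ) {z : ℂ} (hz : 0 < z.im) :
    HasSum (fun n : ℕ => tcoef f i n * ee z ^ n) (diagSum f i z) := by
  have h := ((hf.taylor hz).1 i).hasSum
  simp only [gexp_diag] at h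
  have := hasSum_group (c := fun ν => fcoef f ν * (dual1 ν : ℂ) ^ i)
    (s := fun n => Finset.Icc (-n : ℤ) (2 * n)) h fun p r h0 => by
      have h1 := hf.dual_nonneg (left_ne_zero_of_mul h0)
      exact cone_mem_Icc h1.1 h1.2
  rw [diagSum]
  simp only [gexp_diag]
  exact this

lemma qParam_one (z : ℂ) : Periodic.qParam 1 z = ee z := by
  simp [Periodic.qParam, ee]

/-- The `i`-th diagonal sum is identically zero, so this is uniqueness of the q-expansion of the
zero modular form. -/
lemma IsHMF.tcoef_eq_zero (hf : IsHMF f k) {N : ℕ} {g : ℍ → ℂ} (h : HasLead f N g) {i : ℕ}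
    (hi : i < N) (n : ℕ) : tcoef f i n = 0 := by
  have h1 : ∀ τ : ℍ, HasSum (fun m => tcoef f i m • Periodic.qParam 1 τ ^ m)
      ((0 : ModularForm 𝒮ℒ 0) τ) := by
    intro τ
    have := hf.hasSum_tcoef i τ.im_pos
    have e : diagSum f i τ = 0 := hf.diagSum_eq_zero h hi τ.im_pos
    rw [e] at this
    simpa [qParam_one] using this
  have := ModularFormClass.qExpansion_coeff_unique one_pos one_mem_strictPeriods_SL h1 n
  rw [this]
  simp [UpperHalfPlane.qExpansion_zero]

/-- Vanishing to order `N` on the diagonal kills all coefficients of trace below `N`. By induction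
on the trace `p`, unit invariance confines the unknown coefficients to `0 ≤ r ≤ p`; these `p + 1 ≤
N` unknowns satisfy `p + 1` moment equations with distinct nodes. -/
lemma IsHMF.fcoef_eq_zero_of_lt (hf : IsHMF f k) {N : ℕ} {g : ℍ → ℂ} (h : HasLead f N g) (p : ℕ)
    (hp : p < N) (r : ℤ) : fcoef f (p, r) = 0 := by
  induction p using Nat.strong_induction_on generalizing r with
  | _ p ih =>
    have ih' : ∀ p' r' : ℤ, p' < p → fcoef f (p', r') = 0 := by
      intro p' r' hlt
      by_contra h0
      obtain ⟨a, b⟩ := hf.dual_nonneg h0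
      obtain ⟨m, rfl⟩ := Int.eq_ofNat_of_zero_le (cone_mem_Icc a b).1
      exact h0 (ih m (by exact_mod_cast hlt) (by omega) r')
    -- Multiplication by the squared unit changes the trace to `p + r`, and by its inverse to `2p −
    -- r`; one of these is below `p` when `r` lies outside `[0, p]`.
    have hsupp : ∀ r : ℤ, r ∉ Finset.Icc (0:ℤ) p → fcoef f (p, r) = 0 := by
      intro r hr
      rw [Finset.mem_Icc, not_and_or, not_le, not_le] at hr
      rcases hr with hr | hr
      · rw [← hf.perHol.fcoef_unitSq hf.unit]
        exact ih' _ _ (by omega)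
      · have := hf.perHol.fcoef_unitSq hf.unit (unitSq.symm (p, r))
        rw [Equiv.apply_symm_apply] at this
        rw [this]
        exact ih' _ _ (by omega)
    have hsum : ∀ i < p + 1, ∑ j : Fin (p + 1), fcoef f (p, (j : ℕ)) *
        (dual1 ((p : ℤ), ((j : ℕ) : ℤ)) : ℂ) ^ i = 0 := by
      intro i hi
      have h1 := hf.tcoef_eq_zero h (i := i) (by omega) p
      rw [Fin.sum_univ_eq_sum_range
        (fun j : ℕ => fcoef f (p, (j : ℤ)) * (dual1 ((p : ℤ), (j : ℤ)) : ℂ) ^ i)]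
      rw [← h1, tcoef]
      have h2 : Finset.Icc (0:ℤ) p ⊆ Finset.Icc (-p : ℤ) (2 * p) :=
        Finset.Icc_subset_Icc (by omega) (by omega)
      rw [← Finset.sum_subset h2 fun r _ hr => by rw [hsupp r hr, zero_mul] ]
      refine Finset.sum_bij (fun j _ => (j : ℤ)) (fun j hj => ?_) (fun a _ b _ hab => by
        exact_mod_cast hab) (fun r hr => ?_) fun _ _ => rfl
      · simp at hj ⊢; omega
      · rw [Finset.mem_Icc] at hr
        exact ⟨r.toNat, by simp; omega, by simp; omega⟩
    have hinj : Function.Injective fun j : Fin (p + 1) =>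
        (dual1 ((p : ℤ), ((j : ℕ) : ℤ)) : ℂ) := by
      intro a b hab
      have : dual1 ((p : ℤ), ((a : ℕ) : ℤ)) = dual1 ((p : ℤ), ((b : ℕ) : ℤ)) := by
        exact ofReal_injective hab
      rw [dual1, dual1, div_left_inj' sqrt_five_ne_zero] at this
      simp at this
      exact Fin.ext this
    -- Invertibility of the Vandermonde matrix: the nodes `dual1 (p, j)` are pairwise distinct.
    have hv := Matrix.eq_zero_of_forall_pow_sum_mul_pow_eq_zero
      (v := fun j : Fin (p + 1) => fcoef f (p, (j : ℕ))) hinj fun i => hsum i i.2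
    by_cases hr : r ∈ Finset.Icc (0:ℤ) p
    · rw [Finset.mem_Icc] at hr
      have := congrFun hv ⟨r.toNat, by omega⟩
      simpa [Int.toNat_of_nonneg hr.1] using this
    · exact hsupp r hr

lemma IsHMF.eq_zero (hf : IsHMF f k) (h : ∀ N, ∃ g, HasLead f N g) {z : ℂ × ℂ} (hz : z ∈ H2) :
    f z = 0 := by
  have h1 : ∀ ν, fcoef f ν = 0 := by
    intro ν
    by_contra h0
    obtain ⟨a, b⟩ := hf.dual_nonneg h0
    obtain ⟨m, hm⟩ := Int.eq_ofNat_of_zero_le (cone_mem_Icc (p := ν.1) (r := ν.2) a b).1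
    obtain ⟨g, hg⟩ := h (m + 1)
    refine h0 ?_
    have := hf.fcoef_eq_zero_of_lt hg m (Nat.lt_succ_self m) ν.2
    rwa [← hm] at this
  have := hf.perHol.hasSum hz
  simp only [h1, zero_mul] at this
  exact this.unique hasSum_zero

lemma IsHMF.tcoef_lead (hf : IsHMF f k) {N : ℕ} {g : ℍ → ℂ} (h : HasLead f N g) {n : ℕ}
    (hn : n < N) : tcoef f N n = 0 :=
  Finset.sum_eq_zero fun r _ => by rw [hf.fcoef_eq_zero_of_lt h n hn, zero_mul]

lemma IsHMF.hasSum_lead (hf : IsHMF f k) {N : ℕ} {g : ℍ → ℂ} (h : HasLead f N g) (τ : ℍ) :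
    HasSum (fun n => ((2 * π * I) ^ N / (N.factorial : ℂ) * tcoef f N n) *
      Periodic.qParam 1 τ ^ n) (g τ) := by
  rw [hf.lead_eq h]
  refine ((hf.hasSum_tcoef N τ.im_pos).mul_left ((2 * π * I) ^ N / (N.factorial : ℂ))).congr_fun
    fun n => ?_
  rw [qParam_one]; ring

/-- Near `z` the terms are dominated by those at height `z.im / 2`, so the series converges locally
uniformly. -/
lemma mdifferentiable_of_hasSum {g : ℍ → ℂ} {c : ℕ → ℂ}
    (h : ∀ τ : ℍ, HasSum (fun n => c n * Periodic.qParam 1 τ ^ n) (g τ)) : MDiff g := by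
  rw [UpperHalfPlane.mdifferentiable_iff]
  intro z hz
  have hz' : 0 < z.im := hz
  set U : Set ℂ := {w | z.im / 2 < w.im} with hU
  have hUo : IsOpen U := isOpen_lt continuous_const Complex.continuous_im
  have h0 : 0 < ((z.im / 2 : ℝ) * I : ℂ).im := by simpa using hz'
  have hs := (h ⟨_, h0⟩).summable.norm
  have hd : DifferentiableOn ℂ (fun w : ℂ => ∑' n, c n * Periodic.qParam 1 w ^ n) U := by
    refine Complex.differentiableOn_tsum_of_summable_norm hs (fun n => ?_) hUo fun n w hw => ?_
    · simp only [qParam_one]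
      exact ((differentiable_ee.pow n).const_mul _).differentiableOn
    · rw [norm_mul, norm_mul, norm_pow, norm_pow]
      simp only [qParam_one, norm_ee]
      gcongr ?_ * Real.exp ?_ ^ n
      have : z.im / 2 < w.im := hw
      have hp := Real.pi_pos
      simp
      nlinarith
  have hmem : U ∈ 𝓝 z := hUo.mem_nhds (by simp only [hU, Set.mem_ofPred_eq]; linarith)
  refine ((hd.differentiableAt hmem).congr_of_eventuallyEq ?_).differentiableWithinAt
  filter_upwards [hmem] with w hw
  have hw' : 0 < w.im := lt_trans (by positivity) hw
  rw [comp_apply, UpperHalfPlane.ofComplex_apply_of_im_pos hw', ← (h ⟨w, hw'⟩).tsum_eq]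

end

end HilbertModular

end

/-! ### The leading coefficient as a modular form of level one, divisible by a power of Δ. -/

section

open Complex MeasureTheory Filter Set Function
open scoped Real goldenRatio Manifold

namespace HilbertModular

open ModularForm ModularGroup

section

variable {f : ℂ × ℂ → ℂ} {k : ℤ}

lemma eventually_im_pos (z : ℍ) : ∀ᶠ w : ℂ in 𝓝[≠] 0, 0 < (z + w : ℂ).im := by
  have h : Tendsto (fun w : ℂ => (z + w : ℂ).im) (𝓝 0) (𝓝 ((z + 0 : ℂ).im)) :=
    (Complex.continuous_im.comp (continuous_const.add continuous_id)).tendsto 0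
  have h0 : 0 < (z + 0 : ℂ).im := by simpa using z.im_pos
  exact (h.eventually_const_lt h0).filter_mono nhdsWithin_le_nhds

/-- The inversion sends `(z + w, z)` to `(−1/z + w', −1/z)` with `w' = w / (z (z + w))`. The form
contributes `z^(2k)` in the limit, and the change from `w` to `w'` contributes `z^(2N)`. -/
lemma IsHMF.lead_S (hf : IsHMF f k) {N : ℕ} {g : ℍ → ℂ} (h : HasLead f N g) (z : ℍ) :
    g (S • z) = (z : ℂ) ^ (2 * k + 2 * N) * g z := by
  have hz : (z : ℂ) ≠ 0 := z.ne_zero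
  have hev := eventually_im_pos z
  have hne : ∀ w : ℂ, 0 < (z + w : ℂ).im → (z + w : ℂ) ≠ 0 := fun w hw h0 => by
    rw [h0] at hw; simp at hw
  have hcont : Tendsto (fun w : ℂ => (z : ℂ) * (z + w)) (𝓝[≠] 0) (𝓝 ((z : ℂ) * z)) := by
    have : Tendsto (fun w : ℂ => (z : ℂ) * (z + w)) (𝓝 0) (𝓝 ((z : ℂ) * (z + 0))) :=
      (continuous_const.mul (continuous_const.add continuous_id)).tendsto 0
    rw [add_zero] at this
    exact this.mono_left nhdsWithin_le_nhds
  have hw' : Tendsto (fun w : ℂ => w / ((z : ℂ) * (z + w))) (𝓝[≠] 0) (𝓝[≠] 0) := by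
    refine tendsto_nhdsWithin_iff.mpr ⟨?_, ?_⟩
    · have h1 : Tendsto (fun w : ℂ => w) (𝓝[≠] 0) (𝓝 0) := tendsto_id.mono_left nhdsWithin_le_nhds
      have := h1.div hcont (mul_ne_zero hz hz)
      rwa [zero_div] at this
    · filter_upwards [hev, self_mem_nhdsWithin] with w hw hw0
      exact div_ne_zero hw0 (mul_ne_zero hz (hne w hw))
  have h1 := (h (S • z)).comp hw'
  have h2 : Tendsto (fun w : ℂ => ((z : ℂ) * (z + w)) ^ (k + N) * (f (z + w, z) / w ^ N)) (𝓝[≠] 0)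
      (𝓝 (((z : ℂ) * z) ^ (k + N) * g z)) :=
    (hcont.zpow₀ _ (Or.inl (mul_ne_zero hz hz))).mul (h z)
  have h3 := tendsto_nhds_unique (h1.congr' ?_) h2
  · rw [h3]
    congr 1
    rw [← pow_two, ← zpow_natCast, ← zpow_mul]
    congr 1
    push_cast; ring
  · filter_upwards [hev, self_mem_nhdsWithin] with w hw hw0
    have hzw := hne w hw
    have hS : ((S • z : ℍ) : ℂ) = -1 / z := by
      rw [UpperHalfPlane.modular_S_smul]
      simp [neg_div, inv_neg]
    have e1 : (-1 / (z : ℂ) + w / ((z : ℂ) * (z + w))) = -1 / (z + w) := by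
      field_simp; ring
    rw [comp_apply, hS, e1, hf.inv _ _ (mem_H2 hw z.im_pos), zpow_add₀ (mul_ne_zero hz hzw),
      zpow_natCast, div_pow, mul_comm ((z : ℂ) + w) z]
    have hw1 : w ≠ 0 := hw0
    field_simp

lemma IsHMF.lead_T (hf : IsHMF f k) {N : ℕ} {g : ℍ → ℂ} (h : HasLead f N g) (z : ℍ) :
    g (T • z) = g z := by
  refine tendsto_nhds_unique ((h (T • z)).congr' ?_) (h z)
  filter_upwards [eventually_im_pos z] with w hw
  have hT : ((T • z : ℍ) : ℂ) = z + 1 := by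
    rw [UpperHalfPlane.modular_T_smul]; simp [add_comm]
  rw [hT, ← hf.per1 _ _ (mem_H2 hw z.im_pos), add_right_comm]

/-- The leading coefficient of a form along the diagonal is a modular form for `SL₂(ℤ)`. -/
lemma IsHMF.exists_lead_form (hf : IsHMF f k) {N : ℕ} {g : ℍ → ℂ} (h : HasLead f N g) :
    ∃ G : ModularForm 𝒮ℒ (2 * k + 2 * N), ⇑G = g ∧
      ∀ n, (UpperHalfPlane.qExpansion 1 g).coeff n =
        (2 * π * I) ^ N / (N.factorial : ℂ) * tcoef f N n := by
  have hslash : ∀ γ : SL(2, ℤ), g ∣[2 * k + 2 * (N : ℤ)] γ = g := by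
    refine SlashInvariantForm.slash_action_generators_SL2Z ?_ ?_
    · ext z
      rw [ModularForm.SL_slash_apply, hf.lead_S h, denom_S, zpow_neg]
      have := zpow_ne_zero (2 * k + 2 * (N : ℤ)) z.ne_zero
      field_simp
    · ext z
      rw [ModularForm.SL_slash_apply, hf.lead_T h]
      have hd : UpperHalfPlane.denom (T : GL (Fin 2) ℝ) z = 1 := by
        rw [ModularGroup.denom_apply]
        simp [T]
      rw [hd, one_zpow, mul_one]
  have hbdd : UpperHalfPlane.IsBoundedAtImInfty g :=
    UpperHalfPlane.isBoundedAtImInfty_of_hasSum_qExpansion one_pos fun τ => by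
      simpa using hf.hasSum_lead h τ
  let G : ModularForm 𝒮ℒ (2 * k + 2 * N) :=
    { toFun := g
      slash_action_eq' := fun _ ⟨γ, hγ⟩ => hγ ▸ hslash γ
      holo' := mdifferentiable_of_hasSum (hf.hasSum_lead h)
      bdd_at_cusps' := fun {c} hc => by
        rw [Subgroup.IsArithmetic.isCusp_iff_isCusp_SL2Z] at hc
        rw [OnePoint.isBoundedAt_iff_forall_SL2Z hc]
        intro γ _
        rw [hslash γ]
        exact hbdd }
  refine ⟨G, rfl, fun n => ?_⟩
  refine (ModularFormClass.qExpansion_coeff_unique (f := G) one_pos one_mem_strictPeriods_SL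
    (c := fun n => (2 * π * I) ^ N / (N.factorial : ℂ) * tcoef f N n) (fun τ => ?_) n).symm
  simp only [smul_eq_mul]
  exact hf.hasSum_lead h τ

/-- Divide by Δ repeatedly. Since Δ = q + ⋯ has a simple zero at the cusp and none in ℍ, each
division lowers the order of vanishing at the cusp by exactly one and the weight by 12. -/
lemma exists_discriminant_pow_mul (N : ℕ) {w : ℤ} (G : ModularForm 𝒮ℒ w)
    (h : ∀ n < N, (UpperHalfPlane.qExpansion 1 G).coeff n = 0) :
    ∃ Q : ModularForm 𝒮ℒ (w - 12 * N), ⇑G = discriminant ^ N * ⇑Q := by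
  induction N generalizing w with
  | zero => exact ⟨ModularForm.mcast (by simp) G, by simp⟩
  | succ N ih =>
    have h0 := h 0 (by omega)
    have h1 := qExpansion_eq_qExpansion_discriminant_mul G h0
    have h2 := discriminant_mul_discriminantEquiv (toCuspForm G h0)
    set R := CuspForm.discriminantEquiv (toCuspForm G h0)
    obtain ⟨Q, hQ⟩ := ih R fun n hn => by
      -- With Δ = X · D and D(0) = 1, the coefficient of index `n + 1` of the product is the
      -- coefficient `n` of the quotient plus terms with lower coefficients, already known to
      -- vanish.
      obtain ⟨D, hD⟩ : ∃ D : PowerSeries ℂ,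
          UpperHalfPlane.qExpansion 1 discriminant = PowerSeries.X * D :=
        PowerSeries.X_dvd_iff.mpr (by
          have := discriminant_qExpansion_order
          rw [← PowerSeries.coeff_zero_eq_constantCoeff_apply]
          exact PowerSeries.coeff_of_lt_order _ (by rw [this]; simp))
      have hD0 : PowerSeries.constantCoeff D = 1 := by
        have := discriminant_qExpansion_coeff_one
        rw [hD, PowerSeries.coeff_succ_X_mul] at this
        simpa using this
      induction n using Nat.strong_induction_on with
      | _ n ihn =>
        have h3 := h (n + 1) (by omega)
        rw [h1, hD, mul_assoc, PowerSeries.coeff_succ_X_mul, PowerSeries.coeff_mul,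
          Finset.sum_eq_single (0, n)] at h3
        · simpa [hD0] using h3
        · rintro ⟨a, b⟩ hab hne
          have hab := Finset.HasAntidiagonal.mem_antidiagonal.mp hab
          simp only at hab ⊢
          have : b < n := by
            rcases Nat.eq_zero_or_pos a with rfl | ha
            · exact absurd (by simp_all) hne
            · omega
          rw [ihn b this (by omega), mul_zero]
        · intro h5; simp at h5
    refine ⟨ModularForm.mcast (by push_cast; ring) Q, ?_⟩
    have h4 : (toCuspForm G h0 : ℍ → ℂ) = G := rfl
    rw [← h4, ← h2, hQ, ModularForm.coe_mcast, pow_succ']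
    ring

/-- The leading coefficient of order `N` is divisible by the `N`-th power of the discriminant. -/
lemma IsHMF.exists_lead_eq (hf : IsHMF f k) {N : ℕ} {g : ℍ → ℂ} (h : HasLead f N g) :
    ∃ Q : ModularForm 𝒮ℒ (2 * k - 10 * N), g = discriminant ^ N * ⇑Q := by
  obtain ⟨G, rfl, hG⟩ := hf.exists_lead_form h
  obtain ⟨Q, hQ⟩ := exists_discriminant_pow_mul N G fun n hn => by
    rw [hG, hf.tcoef_lead h hn, mul_zero]
  exact ⟨ModularForm.mcast (by ring) Q, by rw [hQ, ModularForm.coe_mcast]⟩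

lemma IsHMF.exists_lead_zero (hf : IsHMF f k) : ∃ g, HasLead f 0 g :=
  ⟨_, hf.hasLead_of_forall fun _ hi => absurd hi (Nat.not_lt_zero _)⟩

lemma IsHMF.exists_lead_succ (hf : IsHMF f k) {N : ℕ} (h : HasLead f N 0) :
    ∃ g, HasLead f (N + 1) g := by
  refine ⟨_, hf.hasLead_of_forall fun i hi z hz => ?_⟩
  rcases Nat.lt_succ_iff_lt_or_eq.mp hi with hi | rfl
  · exact hf.diagSum_eq_zero h hi hz
  · have h1 := congrFun (hf.lead_eq h) ⟨z, hz⟩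
    have : ((2 * π * I) ^ i / (i.factorial : ℂ)) ≠ 0 := by
      simp [Real.pi_ne_zero, Nat.factorial_ne_zero]
    exact (mul_eq_zero.mp h1.symm).resolve_left this

/-- By symmetry the moment of order `N` is unchanged when `ν₁` is replaced by `n − ν₁`. Expanding
binomially, all lower moments vanish, so the moment equals `(−1)^N` times itself. -/
lemma IsHMF.lead_odd (hf : IsHMF f k)
    (hs : ∀ z₁ z₂, (z₁, z₂) ∈ H2 → f (z₂, z₁) = f (z₁, z₂)) {N : ℕ} (hN : Odd N) {g : ℍ → ℂ}
    (h : HasLead f N g) : g = 0 := by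
  have key : ∀ n, tcoef f N n = 0 := by
    intro n
    have h1 : tcoef f N n = ∑ r ∈ Finset.Icc (-n : ℤ) (2 * n),
        fcoef f (n, r) * ((n : ℂ) - dual1 (n, r)) ^ N := by
      refine Finset.sum_nbij' (fun r => n - r) (fun r => n - r) (fun r hr => ?_) (fun r hr => ?_)
        (fun r _ => by ring) (fun r _ => by ring) fun r _ => ?_
      · rw [Finset.mem_Icc] at hr ⊢; omega
      · rw [Finset.mem_Icc] at hr ⊢; omega
      · have h2 : dual1 ((n : ℤ), r) = n - dual1 ((n : ℤ), (n : ℤ) - r) := by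
          have := dual1_add_dual2 ((n : ℤ), r)
          rw [dual1_swap]
          simp only [Int.cast_natCast] at this
          linarith
        rw [hf.perHol.fcoef_swap hs, h2]
        push_cast; ring
    have h2 : tcoef f N n = ∑ i ∈ Finset.range (N + 1),
        ((-1) ^ i * (n : ℂ) ^ (N - i) * (N.choose i : ℂ)) * tcoef f i n := by
      rw [h1]
      simp only [tcoef, Finset.mul_sum]
      rw [Finset.sum_comm]
      refine Finset.sum_congr rfl fun r _ => ?_
      rw [sub_eq_neg_add, add_pow, Finset.mul_sum]
      refine Finset.sum_congr rfl fun i _ => ?_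
      rw [neg_pow]
      ring
    rw [Finset.sum_range_succ, Finset.sum_eq_zero fun i hi => by
      rw [hf.tcoef_eq_zero h (Finset.mem_range.mp hi), mul_zero]] at h2
    simp only [hN.neg_one_pow, Nat.sub_self, pow_zero, Nat.choose_self] at h2
    push_cast at h2
    linear_combination h2 / 2
  ext τ
  have h3 := hf.hasSum_lead h τ
  simp only [key, mul_zero, zero_mul] at h3
  exact h3.unique hasSum_zero

end

end HilbertModular

end

/-! ### q-expansions of level-one forms, and forms of weight divisible by 4. -/

section

open Complex MeasureTheory Filter Set Function
open scoped Real goldenRatio Manifold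

namespace HilbertModular

open ModularForm ModularGroup EisensteinSeries

/-- `F` is given on the upper half plane by the power series `P` in `q = e(τ)`. -/
def HasQ (F : ℍ → ℂ) (P : PowerSeries ℂ) : Prop :=
  ∀ τ : ℍ, HasSum (fun n => P.coeff n * ee τ ^ n) (F τ)

lemma HasQ.add {F G : ℍ → ℂ} {P Q : PowerSeries ℂ} (hF : HasQ F P) (hG : HasQ G Q) :
    HasQ (F + G) (P + Q) := fun τ => by
  refine ((hF τ).add (hG τ)).congr_fun fun n => ?_
  rw [map_add, add_mul]

lemma HasQ.smul {F : ℍ → ℂ} {P : PowerSeries ℂ} (c : ℂ) (hF : HasQ F P) :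
    HasQ (c • F) (c • P) := fun τ => by
  refine ((hF τ).mul_left c).congr_fun fun n => ?_
  rw [PowerSeries.coeff_smul, smul_eq_mul, mul_assoc]

lemma HasQ.mul {F G : ℍ → ℂ} {P Q : PowerSeries ℂ} (hF : HasQ F P) (hG : HasQ G Q) :
    HasQ (F * G) (P * Q) := fun τ => by
  have h1 := (hF τ).summable.norm
  have h2 := (hG τ).summable.norm
  have h3 := tsum_mul_tsum_eq_tsum_sum_antidiagonal_of_summable_norm h1 h2
  rw [(hF τ).tsum_eq, (hG τ).tsum_eq] at h3
  have h4 := (summable_norm_sum_mul_antidiagonal_of_summable_norm h1 h2).of_norm.hasSum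
  rw [← h3] at h4
  refine h4.congr_fun fun n => ?_
  rw [PowerSeries.coeff_mul, Finset.sum_mul]
  refine Finset.sum_congr rfl fun x hx => ?_
  rw [← Finset.HasAntidiagonal.mem_antidiagonal.mp hx, pow_add]
  ring

lemma hasQ_one : HasQ 1 1 := fun τ => by
  have := hasSum_single (f := fun n => (1 : PowerSeries ℂ).coeff n * ee τ ^ n) 0 fun n hn => by
    rw [PowerSeries.coeff_one, if_neg hn, zero_mul]
  simpa using this

lemma HasQ.pow {F : ℍ → ℂ} {P : PowerSeries ℂ} (hF : HasQ F P) (n : ℕ) :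
    HasQ (F ^ n) (P ^ n) := by
  induction n with
  | zero => simpa using hasQ_one
  | succ n ih => simpa only [pow_succ] using ih.mul hF

lemma HasQ.unique {F : ℍ → ℂ} {P Q : PowerSeries ℂ} (hF : HasQ F P) (hG : HasQ F Q) : P = Q := by
  have h : HasQ 0 (P + (-1 : ℂ) • Q) := by
    have := hF.add (hG.smul (-1))
    simpa using this
  have h1 : ∀ n, (P + (-1 : ℂ) • Q).coeff n = 0 := fun n => by
    have := ModularFormClass.qExpansion_coeff_unique (f := (0 : ModularForm 𝒮ℒ 0)) one_pos
      one_mem_strictPeriods_SL (c := fun n => (P + (-1 : ℂ) • Q).coeff n) (fun τ => by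
        simp only [qParam_one, smul_eq_mul]
        exact h τ) n
    rw [this]
    simp [UpperHalfPlane.qExpansion_zero]
  ext n
  have := h1 n
  rw [map_add, PowerSeries.coeff_smul, smul_eq_mul] at this
  linear_combination this

lemma hasQ_modularForm {k : ℤ} (G : ModularForm 𝒮ℒ k) :
    HasQ G (UpperHalfPlane.qExpansion 1 G) := fun τ => by
  have := ModularForm.hasSum_qExpansion G one_pos one_mem_strictPeriods_SL τ
  simpa only [qParam_one, smul_eq_mul] using this

/-- The `q`-expansion of `E₄`. -/
noncomputable def qE : PowerSeries ℂ := UpperHalfPlane.qExpansion 1 E₄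

/-- The `q`-expansion of the discriminant. -/
noncomputable def qD : PowerSeries ℂ := UpperHalfPlane.qExpansion 1 discriminant

lemma hasQ_E₄ : HasQ E₄ qE := hasQ_modularForm E₄

lemma hasQ_discriminant : HasQ discriminant qD := fun τ => by
  have := ModularForm.hasSum_qExpansion CuspForm.discriminant one_pos
    one_mem_strictPeriods_SL τ
  simp only [qParam_one] at this
  exact this

lemma coeff_qE : qE.coeff 0 = 1 ∧ qE.coeff 1 = 240 ∧ qE.coeff 2 = 2160 := by
  have h : bernoulli 4 = -1 / 30 := by decide +kernel
  refine ⟨?_, ?_, ?_⟩ <;> rw [qE, E_qExpansion_coeff _ ⟨2, rfl⟩, h]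
  · simp
  · norm_num
  · have : ArithmeticFunction.sigma 3 2 = 9 := by decide +kernel
    norm_num [this]

lemma coeff_qD_zero_one : qD.coeff 0 = 0 ∧ qD.coeff 1 = 1 := by
  refine ⟨?_, discriminant_qExpansion_coeff_one⟩
  exact CuspFormClass.qExpansion_coeff_zero CuspForm.discriminant one_pos one_mem_strictPeriods_SL

lemma coeff_mul_at_zero (P Q : PowerSeries ℂ) : (P * Q).coeff 0 = P.coeff 0 * Q.coeff 0 := by
  simp [PowerSeries.coeff_mul]

lemma coeff_mul_at_one (P Q : PowerSeries ℂ) : (P * Q).coeff 1 =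
    P.coeff 0 * Q.coeff 1 + P.coeff 1 * Q.coeff 0 := by
  simp [PowerSeries.coeff_mul, Finset.Nat.antidiagonal_succ]

lemma coeff_mul_at_two (P Q : PowerSeries ℂ) : (P * Q).coeff 2 =
    P.coeff 0 * Q.coeff 2 + P.coeff 1 * Q.coeff 1 + P.coeff 2 * Q.coeff 0 := by
  simp [PowerSeries.coeff_mul, Finset.Nat.antidiagonal_succ]
  ring

/-- Read from 1728 Δ = E₄³ − E₆², the first coefficients of E₄ and E₆ being given by Bernoulli
numbers and divisor sums. -/
lemma coeff_qD_two : qD.coeff 2 = -24 := by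
  have h6 : bernoulli 6 = 1 / 42 := by decide +kernel
  have h : HasQ ((1728 : ℂ) • (discriminant : ℍ → ℂ))
      (qE ^ 3 + (-1 : ℂ) • (UpperHalfPlane.qExpansion 1 E₆) ^ 2) := by
    have e : ((1728 : ℂ) • (discriminant : ℍ → ℂ)) = (E₄ : ℍ → ℂ) ^ 3 + (-1 : ℂ) • (E₆ : ℍ → ℂ) ^ 2 := by
      ext τ
      simp only [Pi.smul_apply, Pi.add_apply, Pi.pow_apply, smul_eq_mul,
        discriminant_eq_E₄_cube_sub_E₆_sq]
      ring
    rw [e]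
    exact (hasQ_E₄.pow 3).add (((hasQ_modularForm E₆).pow 2).smul _)
  have h2 := congrArg (PowerSeries.coeff 2) ((hasQ_discriminant.smul 1728).unique h)
  have a0 : (UpperHalfPlane.qExpansion 1 E₆).coeff 0 = 1 := by
    rw [E_qExpansion_coeff _ ⟨3, rfl⟩]; simp
  have a1 : (UpperHalfPlane.qExpansion 1 E₆).coeff 1 = -504 := by
    rw [E_qExpansion_coeff _ ⟨3, rfl⟩, h6]; norm_num
  have a2 : (UpperHalfPlane.qExpansion 1 E₆).coeff 2 = -16632 := by
    have : ArithmeticFunction.sigma 5 2 = 33 := by decide +kernel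
    rw [E_qExpansion_coeff _ ⟨3, rfl⟩, h6]; norm_num [this]
  obtain ⟨b0, b1, b2⟩ := coeff_qE
  rw [map_add, PowerSeries.coeff_smul, PowerSeries.coeff_smul, pow_succ, sq, sq,
    coeff_mul_at_two, coeff_mul_at_two, coeff_mul_at_two, coeff_mul_at_one,
    coeff_mul_at_zero, b0, b1, b2, a0, a1, a2] at h2
  simp only [smul_eq_mul] at h2
  linear_combination h2 / 1728

lemma weight_zero_const {w : ℤ} (hw : w = 0) (G : ModularForm 𝒮ℒ w) :
    ∃ c : ℂ, ⇑G = fun _ => c := by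
  subst hw
  exact ModularFormClass.levelOne_weight_zero_const G

/-- The modular forms for `SL₂(ℤ)` whose weight is divisible by `4`. -/
lemma exists_eq_sum_E₄_discriminant (n : ℤ) {w : ℤ} (hw : w = 4 * n) (G : ModularForm 𝒮ℒ w) :
    ∃ (x : ℕ → ℂ) (B : ℕ), (∀ b < B, 3 * (b : ℤ) ≤ n) ∧
      ⇑G = ∑ b ∈ Finset.range B, x b • ((E₄ : ℍ → ℂ) ^ (n - 3 * b).toNat * discriminant ^ b) := by
  rcases lt_or_ge n 0 with hn | hn
  · refine ⟨0, 0, by simp, ?_⟩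
    rw [Finset.range_zero, Finset.sum_empty]
    exact ModularFormClass.levelOne_neg_weight_eq_zero (by omega) G
  · obtain ⟨m, rfl⟩ := Int.eq_ofNat_of_zero_le hn
    induction m using Nat.strong_induction_on generalizing w with
    | _ m ih =>
      set c := (UpperHalfPlane.qExpansion 1 G).coeff 0 with hc
      -- E₄^m has the same weight and constant term 1, so the difference is a cusp form; dividing it
      -- by Δ lowers `m` by 3.
      let G' : ModularForm 𝒮ℒ w := G - c • ModularForm.mcast (by subst hw; ring) (E₄.pow m)
      have hG' : ⇑G' = ⇑G + (-c) • (E₄ : ℍ → ℂ) ^ m := by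
        ext τ; simp [G']; ring
      obtain ⟨Q, hQ⟩ := exists_discriminant_pow_mul 1 G' fun i hi => by
        obtain rfl : i = 0 := by omega
        have h1 := (hasQ_modularForm G).add ((hasQ_E₄.pow m).smul (-c))
        rw [← hG'] at h1
        rw [(hasQ_modularForm G').unique h1, map_add, PowerSeries.coeff_smul, ← hc,
          PowerSeries.coeff_zero_eq_constantCoeff_apply, map_pow,
          ← PowerSeries.coeff_zero_eq_constantCoeff_apply, coeff_qE.1]
        simp
      have hGQ : ⇑G = c • (E₄ : ℍ → ℂ) ^ m + discriminant * ⇑Q := by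
        rw [pow_one] at hQ
        rw [← hQ, hG', neg_smul]; abel
      by_cases h3 : m < 3
      -- The quotient by Δ has negative weight, hence is zero.
      · refine ⟨fun _ => c, 1, by simp, ?_⟩
        rw [hGQ, ModularFormClass.levelOne_neg_weight_eq_zero (by omega) Q]
        simp
      · obtain ⟨x, B, hB, hx⟩ := ih (m - 3) (by omega) Q (by omega) (by omega)
        -- The coefficient of E₄^m is put in front; multiplication by Δ shifts the other indices by
        -- one.
        refine ⟨fun b => Nat.casesOn b c x, B + 1, fun b hb => ?_, ?_⟩
        · rcases b with _ | b
          · simp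
          · have := hB b (by omega)
            push_cast; omega
        · rw [hGQ, Finset.sum_range_succ', hx, Finset.mul_sum, add_comm]
          congr 1
          · refine Finset.sum_congr rfl fun b _ => ?_
            have e : ((m : ℤ) - 3 * ((b + 1 : ℕ) : ℤ)).toNat = (((m - 3 : ℕ) : ℤ) - 3 * b).toNat := by
              omega
            rw [e, pow_succ, mul_smul_comm]
            congr 1
            ring
          · simp

end HilbertModular

end

/-! ### Spanning and linear independence of the monomials in three forms with prescribed leading
terms. -/

section

open Complex MeasureTheory Filter Set Function
open scoped Real goldenRatio Manifold

namespace HilbertModular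

open ModularForm ModularGroup EisensteinSeries

/-- Extension of a function on `ℍ × ℍ` to `ℂ × ℂ`. -/
noncomputable def lift (f : ℍ × ℍ → ℂ) : ℂ × ℂ → ℂ :=
  fun w => f (UpperHalfPlane.ofComplex w.1, UpperHalfPlane.ofComplex w.2)

lemma lift_coe (f : ℍ × ℍ → ℂ) (z : ℍ × ℍ) : lift f ((z.1 : ℂ), (z.2 : ℂ)) = f z := by
  simp [lift, UpperHalfPlane.ofComplex_apply]

/-- Symmetric forms. -/
structure IsSymHMF (f : ℂ × ℂ → ℂ) (k : ℤ) : Prop extends IsHMF f k where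
  swap : ∀ z₁ z₂ : ℂ, (z₁, z₂) ∈ H2 → f (z₂, z₁) = f (z₁, z₂)

lemma HasLead.sum {ι : Type*} (s : Finset ι) {f : ι → ℂ × ℂ → ℂ} {N : ℕ} {g : ι → ℍ → ℂ}
    (h : ∀ i ∈ s, HasLead (f i) N (g i)) : HasLead (∑ i ∈ s, f i) N (∑ i ∈ s, g i) := by
  intro z
  have := tendsto_finsetSum s fun i hi => h i hi z
  simpa only [Finset.sum_apply, Finset.sum_div] using this

lemma lift_sum {ι : Type*} (s : Finset ι) (f : ι → ℍ × ℍ → ℂ) :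
    lift (∑ i ∈ s, f i) = ∑ i ∈ s, lift (f i) := by
  ext w
  simp [lift, Finset.sum_apply]

/-- The cofactor of Δ^N in the leading coefficient has weight 2k − 10N < 0, so it vanishes. The same
applies to every higher order, and the form vanishes to infinite order on the diagonal. -/
lemma IsHMF.exists_lead_of_large {f : ℂ × ℂ → ℂ} {k : ℤ} (hf : IsHMF f k) {N : ℕ} {g : ℍ → ℂ}
    (h : HasLead f N g) (hN : k < 5 * N) {z : ℂ × ℂ} (hz : z ∈ H2) : f z = 0 := by
  have h1 : ∀ M : ℕ, ∃ g, HasLead f (N + M) g := by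
    intro M
    induction M with
    | zero => exact ⟨g, h⟩
    | succ M ih =>
      obtain ⟨g', hg'⟩ := ih
      obtain ⟨Q, hQ⟩ := hf.exists_lead_eq hg'
      have hQ0 : ⇑Q = 0 :=
        ModularFormClass.levelOne_neg_weight_eq_zero (by push_cast; omega) Q
      rw [hQ0, mul_zero] at hQ
      exact hf.exists_lead_succ (hQ ▸ hg')
  refine hf.eq_zero (fun M => ?_) hz
  rcases lt_or_ge M N with hM | hM
  · exact ⟨0, h.of_lt hM⟩
  · obtain ⟨j, rfl⟩ := Nat.exists_eq_add_of_le hM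
    exact h1 j

section

variable {V : ℤ → Submodule ℂ (ℍ × ℍ → ℂ)} [SetLike.GradedMonoid V] {e₀ e₁ e₂ : ℍ × ℍ → ℂ}

lemma mono_mem (h₀ : e₀ ∈ V 1) (h₁ : e₁ ∈ V 3) (h₂ : e₂ ∈ V 5) {a b c : ℕ} {m : ℤ}
    (h : (a : ℤ) + 3 * b + 5 * c = m) : e₀ ^ a * e₁ ^ b * e₂ ^ c ∈ V m := by
  have := SetLike.mul_mem_graded (SetLike.mul_mem_graded (SetLike.pow_mem_graded a h₀)
    (SetLike.pow_mem_graded b h₁)) (SetLike.pow_mem_graded c h₂)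
  convert this using 2
  simp only [nsmul_eq_mul]
  rw [← h]; ring

lemma mono_lead {c₁ c₂ : ℂ} (l₀ : HasLead (lift e₀) 0 E₄)
    (l₁ : HasLead (lift e₁) 0 (c₁ • (discriminant : ℍ → ℂ)))
    (l₂ : HasLead (lift e₂) 2 (c₂ • (discriminant : ℍ → ℂ) ^ 2)) (a b c : ℕ) :
    HasLead (lift (e₀ ^ a * e₁ ^ b * e₂ ^ c)) (2 * c)
      ((c₁ ^ b * c₂ ^ c) • ((discriminant : ℍ → ℂ) ^ (2 * c) * (E₄ ^ a * discriminant ^ b))) := by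
  have h := ((l₀.pow a).mul (l₁.pow b)).mul (l₂.pow c)
  have e : a * 0 + b * 0 + c * 2 = 2 * c := by ring
  rw [e] at h
  have e' : (c₁ ^ b * c₂ ^ c) • ((discriminant : ℍ → ℂ) ^ (2 * c) * (E₄ ^ a * discriminant ^ b)) =
      (E₄ : ℍ → ℂ) ^ a * (c₁ • (discriminant : ℍ → ℂ)) ^ b *
        (c₂ • (discriminant : ℍ → ℂ) ^ 2) ^ c := by
    ext τ
    simp only [Pi.smul_apply, Pi.mul_apply, Pi.pow_apply, smul_eq_mul]
    ring
  rw [e']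
  exact h

/-- Subtract a combination of monomials with the same leading term; the order of vanishing
increases, and it cannot increase beyond the bound of `exists_lead_of_large` unless the form is
zero. -/
theorem mem_span_mono (hV : ∀ m, ∀ f ∈ V m, IsSymHMF (lift f) (2 * m))
    (h₀ : e₀ ∈ V 1) (h₁ : e₁ ∈ V 3) (h₂ : e₂ ∈ V 5) {c₁ c₂ : ℂ}
    (hc₁ : c₁ ≠ 0) (hc₂ : c₂ ≠ 0) (l₀ : HasLead (lift e₀) 0 E₄)
    (l₁ : HasLead (lift e₁) 0 (c₁ • (discriminant : ℍ → ℂ)))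
    (l₂ : HasLead (lift e₂) 2 (c₂ • (discriminant : ℍ → ℂ) ^ 2)) {m : ℤ} {f : ℍ × ℍ → ℂ}
    (hf : f ∈ V m) :
    f ∈ Submodule.span ℂ {g | ∃ a b c : ℕ, (a : ℤ) + 3 * b + 5 * c = m ∧
      g = e₀ ^ a * e₁ ^ b * e₂ ^ c} := by
  set W := Submodule.span ℂ {g | ∃ a b c : ℕ, (a : ℤ) + 3 * b + 5 * c = m ∧
      g = e₀ ^ a * e₁ ^ b * e₂ ^ c} with hW
  -- Here `N` is the current order and `M` the number of remaining steps. At `M = 0` the inequality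
  -- gives `2m < 5N`, which forces the form to vanish.
  have key : ∀ (M N : ℕ) (f : ℍ × ℍ → ℂ) (g : ℍ → ℂ), m.toNat + 1 ≤ N + M → f ∈ V m →
      HasLead (lift f) N g → f ∈ W := by
    intro M
    induction M with
    | zero =>
      intro N f g hN hf hg
      have : f = 0 := by
        ext z
        rw [← lift_coe f z]
        exact (hV m f hf).exists_lead_of_large hg (by omega) (mem_H2 z.1.im_pos z.2.im_pos)
      rw [this]
      exact zero_mem W
    | succ M ih =>
      intro N f g hN hf hg
      rcases Nat.even_or_odd' N with ⟨c, rfl | rfl⟩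
      · obtain ⟨Q, hQ⟩ := (hV m f hf).exists_lead_eq hg
        -- The weight of `Q` is 2(2m) − 10(2c) = 4(m − 5c); divisibility by 4 is what allows E₆ to
        -- be dispensed with.
        obtain ⟨x, B, hB, hx⟩ := exists_eq_sum_E₄_discriminant (m - 5 * c)
          (by push_cast; ring) Q
        -- Dividing by `c₁ ^ b * c₂ ^ c` normalises the leading terms of the monomials, so the sum
        -- of the `t b` has leading coefficient `g`.
        set t : ℕ → ℍ × ℍ → ℂ := fun b => (x b * (c₁ ^ b * c₂ ^ c)⁻¹) •
          (e₀ ^ (m - 5 * c - 3 * b).toNat * e₁ ^ b * e₂ ^ c) with ht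
        have hdeg : ∀ b < B, (((m - 5 * c - 3 * b).toNat : ℕ) : ℤ) + 3 * b + 5 * c = m := by
          intro b hb
          have := hB b hb
          rw [Int.toNat_of_nonneg (by omega)]; ring
        have htV : ∑ b ∈ Finset.range B, t b ∈ V m := Submodule.sum_mem _ fun b hb =>
          Submodule.smul_mem _ _ (mono_mem h₀ h₁ h₂ (hdeg b (Finset.mem_range.mp hb)))
        have htW : ∑ b ∈ Finset.range B, t b ∈ W := Submodule.sum_mem _ fun b hb =>
          Submodule.smul_mem _ _ (Submodule.subset_span
            ⟨_, b, c, hdeg b (Finset.mem_range.mp hb), rfl⟩)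
        have htl : HasLead (lift (∑ b ∈ Finset.range B, t b)) (2 * c) g := by
          have e : g = ∑ b ∈ Finset.range B, (x b * (c₁ ^ b * c₂ ^ c)⁻¹) •
              ((c₁ ^ b * c₂ ^ c) • ((discriminant : ℍ → ℂ) ^ (2 * c) *
                ((E₄ : ℍ → ℂ) ^ (m - 5 * c - 3 * b).toNat * discriminant ^ b))) := by
            rw [hQ, hx, Finset.mul_sum]
            refine Finset.sum_congr rfl fun b _ => ?_
            rw [smul_smul, mul_assoc, inv_mul_cancel₀ (mul_ne_zero (pow_ne_zero _ hc₁)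
              (pow_ne_zero _ hc₂)), mul_one, mul_smul_comm]
          rw [e, lift_sum]
          exact HasLead.sum _ fun b _ => (mono_lead l₀ l₁ l₂ _ b c).smul _
        have hsub : f - ∑ b ∈ Finset.range B, t b ∈ V m := sub_mem hf htV
        have hl0 : HasLead (lift (f - ∑ b ∈ Finset.range B, t b)) (2 * c) 0 := by
          have := hg.sub htl
          rwa [sub_self] at this
        obtain ⟨g', hg'⟩ := (hV m _ hsub).exists_lead_succ hl0
        have := ih (2 * c + 1) _ g' (by omega) hsub hg'
        simpa using add_mem this htW
      · have h0 := (hV m f hf).lead_odd (hV m f hf).swap ⟨c, rfl⟩ hg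
        obtain ⟨g', hg'⟩ := (hV m f hf).exists_lead_succ (h0 ▸ hg)
        exact ih _ f g' (by omega) hf hg'
  obtain ⟨g, hg⟩ := (hV m f hf).exists_lead_zero
  exact key (m.toNat + 1) 0 f g (by omega) hf hg

end

lemma HasQ.sum {ι : Type*} (s : Finset ι) {F : ι → ℍ → ℂ} {P : ι → PowerSeries ℂ}
    (h : ∀ i, HasQ (F i) (P i)) : HasQ (∑ i ∈ s, F i) (∑ i ∈ s, P i) := fun τ => by
  have := hasSum_sum fun i (_ : i ∈ s) => h i τ
  rw [Finset.sum_apply]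
  refine this.congr_fun fun n => ?_
  rw [map_sum, Finset.sum_mul]

/-- At the cusp E₄ is 1 and Δ is 0, so the constant term isolates `x 0`; dividing the rest by Δ
continues the argument. The exponents of E₄ are arbitrary, since no homogeneity is used. -/
lemma eq_zero_of_sum_E₄_discriminant (a : ℕ → ℕ) (x : ℕ → ℂ) (B : ℕ)
    (h : ∀ τ : ℍ, ∑ b ∈ Finset.range B, x b * (E₄ τ ^ a b * discriminant τ ^ b) = 0) :
    ∀ b < B, x b = 0 := by
  induction B generalizing a x with
  | zero => intro b hb; omega
  | succ B ih =>
    have h0 : x 0 = 0 := by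
      have h1 := HasQ.sum (Finset.range (B + 1)) fun b =>
        ((hasQ_E₄.pow (a b)).mul (hasQ_discriminant.pow b)).smul (x b)
      have e : ∑ b ∈ Finset.range (B + 1),
          x b • ((E₄ : ℍ → ℂ) ^ a b * discriminant ^ b) = (0 : ℂ) • (1 : ℍ → ℂ) := by
        ext τ
        simpa using h τ
      rw [e] at h1
      have h2 := congrArg (PowerSeries.constantCoeff) (h1.unique (hasQ_one.smul 0))
      have hE := coeff_qE.1
      have hD := coeff_qD_zero_one.1
      rw [PowerSeries.coeff_zero_eq_constantCoeff_apply] at hE hD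
      rw [Finset.sum_range_succ'] at h2
      simpa [hE, hD] using h2
    have h3 := ih (fun b => a (b + 1)) (fun b => x (b + 1)) fun τ => by
      have h4 := h τ
      rw [Finset.sum_range_succ', h0, zero_mul, add_zero] at h4
      refine (mul_eq_zero.mp (?_ : _ * discriminant τ = 0)).resolve_right
        (discriminant_ne_zero τ)
      rw [← h4, Finset.sum_mul]
      refine Finset.sum_congr rfl fun b _ => ?_
      rw [pow_succ]; ring
    intro b hb
    rcases b with _ | b
    · exact h0
    · exact h3 b (by omega)

/-- The monomials with the smallest power of `e₂` have the smallest order on the diagonal. Their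
leading terms must cancel among themselves, which reduces to independence in level one. The shift
`j` records how many powers of `e₂` have been passed. -/
theorem eq_zero_of_sum_mono {e₀ e₁ e₂ : ℍ × ℍ → ℂ} {c₁ c₂ : ℂ}
    (hc₁ : c₁ ≠ 0) (hc₂ : c₂ ≠ 0) (l₀ : HasLead (lift e₀) 0 E₄)
    (l₁ : HasLead (lift e₁) 0 (c₁ • (discriminant : ℍ → ℂ)))
    (l₂ : HasLead (lift e₂) 2 (c₂ • (discriminant : ℍ → ℂ) ^ 2)) (a : ℕ → ℕ → ℕ)
    (x : ℕ → ℕ → ℂ) (B : ℕ) (j C : ℕ)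
    (h : ∑ c ∈ Finset.range C, ∑ b ∈ Finset.range B,
      x b c • (e₀ ^ a b c * e₁ ^ b * e₂ ^ (c + j)) = 0) : ∀ c < C, ∀ b < B, x b c = 0 := by
  induction C generalizing a x j with
  | zero => intro c hc; omega
  | succ C ih =>
    have hl : ∀ c b, HasLead (lift (x b c • (e₀ ^ a b c * e₁ ^ b * e₂ ^ (c + j)))) (2 * (c + j))
        (x b c • ((c₁ ^ b * c₂ ^ (c + j)) • ((discriminant : ℍ → ℂ) ^ (2 * (c + j)) *
          (E₄ ^ a b c * discriminant ^ b)))) := fun c b => (mono_lead l₀ l₁ l₂ _ b _).smul _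
    rw [Finset.sum_range_succ'] at h
    have h1 : HasLead (lift (∑ c ∈ Finset.range C, ∑ b ∈ Finset.range B,
        x b (c + 1) • (e₀ ^ a b (c + 1) * e₁ ^ b * e₂ ^ (c + 1 + j)))) (2 * j) 0 := by
      rw [lift_sum]
      have := HasLead.sum (Finset.range C) (N := 2 * j) (g := fun _ => 0)
        (f := fun c => lift (∑ b ∈ Finset.range B,
          x b (c + 1) • (e₀ ^ a b (c + 1) * e₁ ^ b * e₂ ^ (c + 1 + j)))) fun c _ => by
        rw [lift_sum]
        exact (HasLead.sum _ fun b _ => hl (c + 1) b).of_lt (by omega)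
      simpa using this
    have h2 := HasLead.sum (Finset.range B) fun b _ => hl 0 b
    rw [← lift_sum, zero_add] at h2
    have h3 := h1.add h2
    have e : lift (∑ c ∈ Finset.range C, ∑ b ∈ Finset.range B,
        x b (c + 1) • (e₀ ^ a b (c + 1) * e₁ ^ b * e₂ ^ (c + 1 + j))) +
        lift (∑ b ∈ Finset.range B, x b 0 • (e₀ ^ a b 0 * e₁ ^ b * e₂ ^ j)) = 0 := by
      ext w
      have := congrFun h (UpperHalfPlane.ofComplex w.1, UpperHalfPlane.ofComplex w.2)
      simpa [lift] using this
    rw [e] at h3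
    have h4 := h3.unique (hasLead_zero _)
    have h5 := eq_zero_of_sum_E₄_discriminant (fun b => a b 0)
      (fun b => x b 0 * (c₁ ^ b * c₂ ^ j)) B fun τ => by
        have h6 := congrFun h4 τ
        simp only [Pi.add_apply, Pi.zero_apply, zero_add, Finset.sum_apply, Pi.smul_apply,
          Pi.mul_apply, Pi.pow_apply, smul_eq_mul] at h6
        refine (mul_eq_zero.mp (?_ : _ * discriminant τ ^ (2 * j) = 0)).resolve_right
          (pow_ne_zero _ (discriminant_ne_zero τ))
        rw [← h6, Finset.sum_mul]
        exact Finset.sum_congr rfl fun b _ => by ring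
    have h7 : ∀ b < B, x b 0 = 0 := fun b hb =>
      (mul_eq_zero.mp (h5 b hb)).resolve_right
        (mul_ne_zero (pow_ne_zero _ hc₁) (pow_ne_zero _ hc₂))
    have h8 := ih (fun b c => a b (c + 1)) (fun b c => x b (c + 1)) (j + 1) (by
      rw [Finset.sum_eq_zero (s := Finset.range B) fun b hb => by
        rw [h7 b (Finset.mem_range.mp hb), zero_smul], add_zero] at h
      rw [← h]
      refine Finset.sum_congr rfl fun c _ => Finset.sum_congr rfl fun b _ => ?_
      rw [add_right_comm, add_assoc])
    intro c hc
    rcases c with _ | c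
    · exact h7
    · exact h8 c (by omega)

end HilbertModular

end

/-! ### Restricting Eisenstein series to the diagonal, and the cusp forms of weights 6 and 10. -/

section

open Complex MeasureTheory Filter Set Function
open scoped Real goldenRatio Manifold

namespace HilbertModular

open ModularForm ModularGroup EisensteinSeries

/-- The first Fourier coefficients of an Eisenstein series of weight `k`. -/
structure EisCoef (f : ℂ × ℂ → ℂ) (k : ℕ) (C : ℂ) : Prop where
  zero : fcoef f (0, 0) = 1
  one : fcoef f (1, 0) = C
  four : fcoef f (2, 0) = C * (1 + 4 ^ (k - 1))
  five : fcoef f (2, 1) = C * (1 + 5 ^ (k - 1))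

lemma goldenRatio_lt : φ < 1.62 := by
  have : √5 < 2.24 := by
    rw [Real.sqrt_lt' (by norm_num)]; norm_num
  rw [Real.goldenRatio]; linarith

/-- The rational bound φ < 1.62 replaces the irrational cone condition by an integer inequality,
sharp enough for the small traces needed. -/
lemma IsHMF.fcoef_eq_zero {f : ℂ × ℂ → ℂ} {k : ℤ} (hf : IsHMF f k) {p r : ℤ}
    (h : 162 * p < 100 * r ∨ 100 * r < -62 * p) : fcoef f (p, r) = 0 := by
  by_contra h0
  obtain ⟨a, b⟩ := hf.dual_nonneg h0
  obtain ⟨h1, h2, h3⟩ := cone_bounds a b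
  have h4 := goldenRatio_lt
  have h5 : ψ = 1 - φ := by have := Real.goldenRatio_add_goldenConj; linarith
  have h3' : (0 : ℝ) ≤ p := by exact_mod_cast h3
  rcases h with h | h
  · have : (162 * p : ℝ) < 100 * r := by exact_mod_cast h
    nlinarith
  · have : (100 * r : ℝ) < -62 * p := by exact_mod_cast h
    rw [h5] at h1
    nlinarith

section

variable {f : ℂ × ℂ → ℂ} {k : ℕ} {C : ℂ}

lemma EisCoef.one_one (h : EisCoef f k C) (hf : IsSymHMF f k) : fcoef f (1, 1) = C := by
  rw [← h.one, ← hf.perHol.fcoef_swap hf.swap]; rfl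

lemma EisCoef.two_two (h : EisCoef f k C) (hf : IsSymHMF f k) :
    fcoef f (2, 2) = C * (1 + 4 ^ (k - 1)) := by
  rw [← h.four, ← hf.perHol.fcoef_swap hf.swap]; rfl

/-- The squared unit maps `(2, -1)` to `(1, 0)`. With conjugation this reduces all coefficients of
trace at most 2 to the four listed in `EisCoef`. -/
lemma EisCoef.two_neg_one (h : EisCoef f k C) (hf : IsSymHMF f k) : fcoef f (2, -1) = C := by
  rw [← h.one, ← hf.perHol.fcoef_unitSq hf.unit]; rfl

lemma EisCoef.two_three (h : EisCoef f k C) (hf : IsSymHMF f k) : fcoef f (2, 3) = C := by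
  rw [← h.two_neg_one hf, ← hf.perHol.fcoef_swap hf.swap]; rfl

lemma EisCoef.tcoef_zero (h : EisCoef f k C) : tcoef f 0 0 = 1 := by
  simp [tcoef, h.zero]

lemma EisCoef.tcoef_one (h : EisCoef f k C) (hf : IsSymHMF f k) : tcoef f 0 1 = 2 * C := by
  have e : Finset.Icc (-((1 : ℕ) : ℤ)) (2 * (1 : ℕ)) = {-1, 0, 1, 2} := by decide
  rw [tcoef, e]
  have z1 : fcoef f (1, -1) = 0 := hf.fcoef_eq_zero (by norm_num)
  have z2 : fcoef f (1, 2) = 0 := hf.fcoef_eq_zero (by norm_num)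
  simp [z1, z2, h.one, h.one_one hf]
  ring

lemma EisCoef.tcoef_two (h : EisCoef f k C) (hf : IsSymHMF f k) :
    tcoef f 0 2 = C * (2 + 2 * (1 + 4 ^ (k - 1)) + (1 + 5 ^ (k - 1))) := by
  have e : Finset.Icc (-((2 : ℕ) : ℤ)) (2 * (2 : ℕ)) = {-2, -1, 0, 1, 2, 3, 4} := by decide
  rw [tcoef, e]
  have z1 : fcoef f (2, -2) = 0 := hf.fcoef_eq_zero (by norm_num)
  have z2 : fcoef f (2, 4) = 0 := hf.fcoef_eq_zero (by norm_num)
  simp [z1, z2, h.four, h.five, h.two_two hf, h.two_neg_one hf, h.two_three hf]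
  ring

/-- The coefficients of the restriction of `f` to the line `((2 + φ) τ, (2 + ψ) τ)`. -/
noncomputable def lineCoef (f : ℂ × ℂ → ℂ) (n : ℕ) : ℂ :=
  ∑ p ∈ Finset.Icc (0 : ℤ) n, fcoef f (p, n - 2 * p)

/-- The line is directed by the totally positive integer 2 + φ, so the exponent of q is Tr(ν(2 + φ))
= 2ν₁ + ν₂, where ν₁ and ν₂ are the integer coordinates of ν. -/
lemma IsHMF.hasQ_line {k : ℤ} (hf : IsHMF f k) :
    HasQ (fun τ => f ((2 + φ : ℝ) * (τ : ℂ), (2 + ψ : ℝ) * (τ : ℂ)))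
      (PowerSeries.mk (lineCoef f)) := fun τ => by
  have h1 : (0 : ℝ) < 2 + φ := by have := Real.goldenRatio_pos; linarith
  have h2 : (0 : ℝ) < 2 + ψ := by have := Real.neg_one_lt_goldenConj; linarith
  have h := hf.perHol.hasSum (z := ((2 + φ : ℝ) * (τ : ℂ), (2 + ψ : ℝ) * (τ : ℂ))) (mem_H2
    (by rw [im_ofReal_mul]; exact mul_pos h1 τ.im_pos)
    (by rw [im_ofReal_mul]; exact mul_pos h2 τ.im_pos))
  have hg : ∀ ν : ℤ × ℤ, gexp ν ((2 + φ : ℝ) * (τ : ℂ), (2 + ψ : ℝ) * (τ : ℂ)) =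
      ee τ ^ (2 * ν.1 + ν.2) := by
    intro ν
    rw [gexp, ← ee_int_mul]
    congr 1
    have e : dual1 ν * (2 + φ) + dual2 ν * (2 + ψ) = ((2 * ν.1 + ν.2 : ℤ) : ℝ) := by
      push_cast
      rw [← dual1_add_dual2, ← dual1_mul_add_dual2_mul]
      ring
    have e' : (dual1 ν * (2 + φ) + dual2 ν * (2 + ψ) : ℂ) = ((2 * ν.1 + ν.2 : ℤ) : ℂ) := by
      exact_mod_cast congrArg (fun x : ℝ => (x : ℂ)) e
    rw [← e']
    push_cast
    ring
  simp only [hg] at h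
  let e : ℤ × ℤ ≃ ℤ × ℤ :=
    { toFun := fun x => (x.2, x.1 - 2 * x.2)
      invFun := fun ν => (2 * ν.1 + ν.2, ν.1)
      left_inv := fun x => by simp
      right_inv := fun x => by simp }
  have h3 := e.hasSum_iff.mpr h
  have h4 := hasSum_group (c := fun x => fcoef f (x.2, x.1 - 2 * x.2))
    (s := fun n => Finset.Icc (0 : ℤ) n) (q := ee τ) (h3.congr_fun fun x => by
      simp only [comp_apply, e, Equiv.coe_fn_mk]
      congr 2
      ring) fun n p h0 => by
    have h5 : ¬ (162 * p < 100 * (n - 2 * p) ∨ 100 * (n - 2 * p) < -62 * p) :=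
      fun h6 => h0 (hf.fcoef_eq_zero h6)
    obtain ⟨a, b⟩ := hf.dual_nonneg h0
    have := (cone_bounds a b).2.2
    rw [Finset.mem_Icc]
    omega
  refine h4.congr_fun fun n => ?_
  rw [PowerSeries.coeff_mk, lineCoef]

/-- Power series `1 + a q² + * q³ + b q⁴ + …`. -/
structure Even4 (P : PowerSeries ℂ) (a b : ℂ) : Prop where
  c0 : P.coeff 0 = 1
  c1 : P.coeff 1 = 0
  c2 : P.coeff 2 = a
  c4 : P.coeff 4 = b

/-- The coefficients of q³ may remain unknown: in the coefficient of q⁴ they meet only coefficients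
of q, which vanish. -/
lemma Even4.mul {P Q : PowerSeries ℂ} {a b a' b' : ℂ} (h : Even4 P a b) (h' : Even4 Q a' b') :
    Even4 (P * Q) (a + a') (b + b' + a * a') where
  c0 := by rw [coeff_mul_at_zero, h.c0, h'.c0, one_mul]
  c1 := by rw [coeff_mul_at_one, h.c1, h'.c1]; simp
  c2 := by rw [coeff_mul_at_two, h.c0, h'.c0, h.c1, h'.c1, h.c2, h'.c2]; ring
  c4 := by
    have e : (P * Q).coeff 4 = P.coeff 0 * Q.coeff 4 + P.coeff 1 * Q.coeff 3 +
        P.coeff 2 * Q.coeff 2 + P.coeff 3 * Q.coeff 1 + P.coeff 4 * Q.coeff 0 := by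
      simp [PowerSeries.coeff_mul, Finset.Nat.antidiagonal_succ]
      ring
    rw [e, h.c0, h'.c0, h.c1, h'.c1, h.c2, h'.c2, h.c4, h'.c4]; ring

/-- Among the frequencies in the cone, only `(1, 0)` has 2ν₁ + ν₂ = 2, only `(2, 0)` has it equal to
4, and none has it equal to 1. -/
lemma EisCoef.even4 (h : EisCoef f k C) (hf : IsSymHMF f k) :
    Even4 (PowerSeries.mk (lineCoef f)) C (C * (1 + 4 ^ (k - 1))) where
  c0 := by simp [lineCoef, h.zero]
  c1 := by
    have e : Finset.Icc (0 : ℤ) (1 : ℕ) = {0, 1} := by decide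
    rw [PowerSeries.coeff_mk, lineCoef, e]
    have z1 : fcoef f (0, 1) = 0 := hf.fcoef_eq_zero (by norm_num)
    have z2 : fcoef f (1, -1) = 0 := hf.fcoef_eq_zero (by norm_num)
    simp [z1, z2]
  c2 := by
    have e : Finset.Icc (0 : ℤ) (2 : ℕ) = {0, 1, 2} := by decide
    rw [PowerSeries.coeff_mk, lineCoef, e]
    have z1 : fcoef f (0, 2) = 0 := hf.fcoef_eq_zero (by norm_num)
    have z2 : fcoef f (2, -2) = 0 := hf.fcoef_eq_zero (by norm_num)
    simp [z1, z2, h.one]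
  c4 := by
    have e : Finset.Icc (0 : ℤ) (4 : ℕ) = {0, 1, 2, 3, 4} := by decide
    rw [PowerSeries.coeff_mk, lineCoef, e]
    have z1 : fcoef f (0, 4) = 0 := hf.fcoef_eq_zero (by norm_num)
    have z2 : fcoef f (1, 2) = 0 := hf.fcoef_eq_zero (by norm_num)
    have z3 : fcoef f (3, -2) = 0 := hf.fcoef_eq_zero (by norm_num)
    have z4 : fcoef f (4, -4) = 0 := hf.fcoef_eq_zero (by norm_num)
    simp [z1, z2, z3, z4, h.four]

end

/-- The restriction to the diagonal is a level-one form of weight 4m, hence a combination of E₄^(m −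
3b) Δ^b. The common bound `M` on `b` makes the number of unknowns explicit. -/
lemma IsHMF.exists_lead_zero_eq {f : ℂ × ℂ → ℂ} {m : ℤ} (hf : IsHMF f (2 * m)) (M : ℕ)
    (hM : ∀ b : ℕ, 3 * (b : ℤ) ≤ m → b < M) : ∃ x : ℕ → ℂ,
    HasLead f 0 (∑ b ∈ Finset.range M, x b • ((E₄ : ℍ → ℂ) ^ (m - 3 * b).toNat * discriminant ^ b)) ∧
    PowerSeries.mk (tcoef f 0) =
      ∑ b ∈ Finset.range M, x b • (qE ^ (m - 3 * b).toNat * qD ^ b) := by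
  obtain ⟨g, hg⟩ := hf.exists_lead_zero
  obtain ⟨Q, hQ⟩ := hf.exists_lead_eq hg
  obtain ⟨x, B, hB, hx⟩ := exists_eq_sum_E₄_discriminant m (by push_cast; ring) Q
  have hBM : B ≤ M := by
    rcases B with _ | B
    · omega
    · exact hM B (hB B (by omega))
  have e : g = ∑ b ∈ Finset.range M, (if b < B then x b else 0) •
      ((E₄ : ℍ → ℂ) ^ (m - 3 * b).toNat * discriminant ^ b) := by
    rw [hQ, pow_zero, one_mul, hx]
    rw [← Finset.sum_subset (Finset.range_mono hBM) fun b _ hb => by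
      rw [if_neg (by simpa using hb), zero_smul] ]
    exact Finset.sum_congr rfl fun b hb => by rw [if_pos (Finset.mem_range.mp hb)]
  refine ⟨fun b => if b < B then x b else 0, e ▸ hg, ?_⟩
  have h1 : HasQ g (PowerSeries.mk (tcoef f 0)) := fun τ => by
    have := hf.hasSum_lead hg τ
    simp only [qParam_one, pow_zero, Nat.factorial_zero, Nat.cast_one, div_one, one_mul] at this
    simpa only [PowerSeries.coeff_mk] using this
  refine h1.unique ?_
  rw [e]
  exact HasQ.sum _ fun b => ((hasQ_E₄.pow _).mul (hasQ_discriminant.pow b)).smul _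

lemma coeff_qE_pow_three : (qE ^ 3).coeff 0 = 1 ∧ (qE ^ 3).coeff 1 = 720 ∧
    (qE ^ 3).coeff 2 = 179280 := by
  obtain ⟨a0, a1, a2⟩ := coeff_qE
  simp only [pow_succ, pow_zero, one_mul, coeff_mul_at_zero, coeff_mul_at_one, coeff_mul_at_two,
    a0, a1, a2]
  norm_num

lemma coeff_qE_pow_five : (qE ^ 5).coeff 0 = 1 ∧ (qE ^ 5).coeff 1 = 1200 ∧
    (qE ^ 5).coeff 2 = 586800 := by
  obtain ⟨a0, a1, a2⟩ := coeff_qE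
  simp only [pow_succ, pow_zero, one_mul, coeff_mul_at_zero, coeff_mul_at_one, coeff_mul_at_two,
    a0, a1, a2]
  norm_num

lemma coeff_qE_sq_mul_qD : (qE ^ 2 * qD).coeff 0 = 0 ∧ (qE ^ 2 * qD).coeff 1 = 1 ∧
    (qE ^ 2 * qD).coeff 2 = 456 := by
  obtain ⟨a0, a1, a2⟩ := coeff_qE
  obtain ⟨b0, b1⟩ := coeff_qD_zero_one
  simp only [pow_succ, pow_zero, one_mul, coeff_mul_at_zero, coeff_mul_at_one, coeff_mul_at_two,
    a0, a1, a2, b0, b1, coeff_qD_two]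
  norm_num

lemma EisCoef.weight_two {f : ℂ × ℂ → ℂ} {C : ℂ} (h : EisCoef f 2 C) (hf : IsSymHMF f 2) :
    C = 120 ∧ HasLead f 0 E₄ := by
  obtain ⟨x, hx, hq⟩ := IsHMF.exists_lead_zero_eq (m := 1) hf.toIsHMF 1 (by omega)
  simp only [Finset.sum_range_one, Nat.cast_zero, mul_zero, sub_zero, Int.toNat_one, pow_one,
    pow_zero, mul_one] at hx hq
  have h0 := congrArg (PowerSeries.coeff 0) hq
  have h1 := congrArg (PowerSeries.coeff 1) hq
  obtain ⟨a0, a1, a2⟩ := coeff_qE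
  simp only [PowerSeries.coeff_mk, PowerSeries.coeff_smul, a0, a1, smul_eq_mul, h.tcoef_zero,
    h.tcoef_one hf] at h0 h1
  have hx0 : x 0 = 1 := by simpa using h0.symm
  rw [hx0] at h1 hx
  exact ⟨by linear_combination h1 / 2, by simpa using hx⟩

/-- The restriction is a combination of E₄³ and Δ. The coefficients of 1, q and q² give three
equations for the two unknown coefficients and for `C`, which is thereby determined. -/
lemma EisCoef.weight_six {f : ℂ × ℂ → ℂ} {C : ℂ} (h : EisCoef f 6 C) (hf : IsSymHMF f 6) :
    C = 2520 / 67 ∧ HasLead f 0 ((E₄ : ℍ → ℂ) ^ 3 + (2 * C - 720) • discriminant) := by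
  obtain ⟨x, hx, hq⟩ := IsHMF.exists_lead_zero_eq (m := 3) hf.toIsHMF 2 (by omega)
  have e0 : ((3 : ℤ) - 3 * (0 : ℕ)).toNat = 3 := by decide
  have e1 : ((3 : ℤ) - 3 * (1 : ℕ)).toNat = 0 := by decide
  simp only [Finset.sum_range_succ, Finset.sum_range_zero, zero_add, e0, e1, pow_zero, mul_one,
    one_mul, pow_one] at hx hq
  have h0 := congrArg (PowerSeries.coeff 0) hq
  have h1 := congrArg (PowerSeries.coeff 1) hq
  have h2 := congrArg (PowerSeries.coeff 2) hq
  obtain ⟨a0, a1, a2⟩ := coeff_qE_pow_three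
  obtain ⟨b0, b1⟩ := coeff_qD_zero_one
  simp only [PowerSeries.coeff_mk, map_add, PowerSeries.coeff_smul, a0, a1, a2, b0, b1,
    coeff_qD_two, smul_eq_mul, h.tcoef_zero, h.tcoef_one hf, h.tcoef_two hf] at h0 h1 h2
  have hx0 : x 0 = 1 := by linear_combination -h0
  have hx1 : x 1 = 2 * C - 720 := by rw [hx0] at h1; linear_combination -h1
  rw [hx0, hx1] at h2 hx
  refine ⟨?_, by simpa using hx⟩
  norm_num at h2
  linear_combination h2 / 5226

lemma EisCoef.weight_ten {f : ℂ × ℂ → ℂ} {C : ℂ} (h : EisCoef f 10 C) (hf : IsSymHMF f 10) :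
    C = 6600 / 412751 ∧ HasLead f 0 ((E₄ : ℍ → ℂ) ^ 5 +
      (2 * C - 1200) • ((E₄ : ℍ → ℂ) ^ 2 * discriminant)) := by
  obtain ⟨x, hx, hq⟩ := IsHMF.exists_lead_zero_eq (m := 5) hf.toIsHMF 2 (by omega)
  have e0 : ((5 : ℤ) - 3 * (0 : ℕ)).toNat = 5 := by decide
  have e1 : ((5 : ℤ) - 3 * (1 : ℕ)).toNat = 2 := by decide
  simp only [Finset.sum_range_succ, Finset.sum_range_zero, zero_add, e0, e1, pow_zero, mul_one,
    pow_one] at hx hq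
  have h0 := congrArg (PowerSeries.coeff 0) hq
  have h1 := congrArg (PowerSeries.coeff 1) hq
  have h2 := congrArg (PowerSeries.coeff 2) hq
  obtain ⟨a0, a1, a2⟩ := coeff_qE_pow_five
  obtain ⟨b0, b1, b2⟩ := coeff_qE_sq_mul_qD
  simp only [PowerSeries.coeff_mk, map_add, PowerSeries.coeff_smul, a0, a1, a2, b0, b1, b2,
    smul_eq_mul, h.tcoef_zero, h.tcoef_one hf, h.tcoef_two hf] at h0 h1 h2
  have hx0 : x 0 = 1 := by linear_combination -h0
  have hx1 : x 1 = 2 * C - 1200 := by rw [hx0] at h1; linear_combination -h1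
  rw [hx0, hx1] at h2 hx
  refine ⟨?_, by simpa using hx⟩
  norm_num at h2
  linear_combination h2 / 2476506

section

variable {V : ℤ → Submodule ℂ (ℍ × ℍ → ℂ)} [SetLike.GradedMonoid V] {e₀ e₁ e₂ : ℍ × ℍ → ℂ}

/-- The cusp forms of weight `6` and `10` built from the Eisenstein series, and their leading
coefficients along the diagonal. -/
theorem exists_leads (hV : ∀ m, ∀ f ∈ V m, IsSymHMF (lift f) (2 * m))
    (h₀ : e₀ ∈ V 1) (h₁ : e₁ ∈ V 3) (h₂ : e₂ ∈ V 5) {C₀ C₁ C₂ : ℂ} (H₀ : EisCoef (lift e₀) 2 C₀)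
    (H₁ : EisCoef (lift e₁) 6 C₁) (H₂ : EisCoef (lift e₂) 10 C₂) :
    HasLead (lift e₀) 0 E₄ ∧
    (∃ c : ℂ, c ≠ 0 ∧ HasLead (lift (e₁ - e₀ ^ 3)) 0 (c • (discriminant : ℍ → ℂ))) ∧
    ∃ α β c : ℂ, c ≠ 0 ∧ HasLead (lift (e₂ - (α • (e₀ ^ 2 * e₁) + β • e₀ ^ 5))) 2
      (c • (discriminant : ℍ → ℂ) ^ 2) := by
  have F₀ : IsSymHMF (lift e₀) 2 := hV 1 _ h₀
  have F₁ : IsSymHMF (lift e₁) 6 := hV 3 _ h₁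
  have F₂ : IsSymHMF (lift e₂) 10 := hV 5 _ h₂
  obtain ⟨rfl, l₀⟩ := H₀.weight_two F₀
  obtain ⟨hC₁, l₁⟩ := H₁.weight_six F₁
  obtain ⟨hC₂, l₂⟩ := H₂.weight_ten F₂
  have hc₁ : 2 * C₁ - 720 ≠ 0 := by rw [hC₁]; norm_num
  refine ⟨l₀, ⟨2 * C₁ - 720, hc₁, ?_⟩, ?_⟩
  · have := l₁.sub (l₀.pow 3)
    rwa [add_sub_cancel_left] at this
  -- On the diagonal the E₄⁵ terms cancel because the two scalars add to 1, and the E₄²Δ terms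
  -- cancel by this choice of `α`.
  set α : ℂ := (2 * C₂ - 1200) / (2 * C₁ - 720) with hα
  set s : ℍ × ℍ → ℂ := e₂ - (α • (e₀ ^ 2 * e₁) + (1 - α) • e₀ ^ 5) with hs
  have hsV : s ∈ V 5 := by
    refine sub_mem h₂ (add_mem (Submodule.smul_mem _ _ ?_) (Submodule.smul_mem _ _ ?_))
    · simpa using mono_mem h₀ h₁ h₂ (a := 2) (b := 1) (c := 0) (m := 5) (by norm_num)
    · simpa using mono_mem h₀ h₁ h₂ (a := 5) (b := 0) (c := 0) (m := 5) (by norm_num)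
  have F := hV 5 s hsV
  have k₀ : HasLead (lift s) 0 0 := by
    have := l₂.sub ((((l₀.pow 2).mul l₁).smul α).add ((l₀.pow 5).smul (1 - α)))
    convert! this using 1
    ext τ
    simp only [Pi.zero_apply, Pi.sub_apply, Pi.add_apply, Pi.smul_apply, Pi.mul_apply,
      Pi.pow_apply, smul_eq_mul]
    rw [hα]
    field_simp
    ring
  -- Order 1 is excluded by symmetry, so vanishing on the diagonal means vanishing to order at least
  -- 2.
  obtain ⟨g, k₁⟩ := F.exists_lead_succ k₀
  rw [F.lead_odd F.swap (by decide) k₁] at k₁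
  obtain ⟨g, k₂⟩ := F.exists_lead_succ k₁
  obtain ⟨Q, rfl⟩ := F.exists_lead_eq k₂
  -- The cofactor of Δ² has weight 2·10 − 10·2 = 0, hence is constant.
  obtain ⟨c, hc⟩ := weight_zero_const (by norm_num) Q
  have e : (discriminant : ℍ → ℂ) ^ 2 * ⇑Q = c • (discriminant : ℍ → ℂ) ^ 2 := by
    ext τ; simp [hc, mul_comm]
  rw [e] at k₂
  refine ⟨α, 1 - α, c, ?_, k₂⟩
  -- If the constant were zero the form would have order at least 3 and vanish identically, since 10
  -- < 5·3. The relation between the Eisenstein series would then hold on the line directed by 2 +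
  -- φ.
  rintro rfl
  rw [zero_smul] at k₂
  obtain ⟨g, k₃⟩ := F.exists_lead_succ k₂
  have hzero : ∀ z ∈ H2, lift s z = 0 := fun z hz =>
    F.exists_lead_of_large k₃ (by norm_num) hz
  have h1 : (0 : ℝ) < 2 + φ := by have := Real.goldenRatio_pos; linarith
  have h2 : (0 : ℝ) < 2 + ψ := by have := Real.neg_one_lt_goldenConj; linarith
  have P₀ := F₀.hasQ_line
  have P₁ := F₁.hasQ_line
  have P₂ := F₂.hasQ_line
  have R := ((((P₀.mul P₀).mul P₁).smul α).add ((((P₀.mul P₀).mul (P₀.mul P₀)).mul P₀).smul (1 - α)))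
  have E₀ := H₀.even4 F₀
  have E₁ := H₁.even4 F₁
  have E₂ := H₂.even4 F₂
  have T₁ := (E₀.mul E₀).mul E₁
  have T₂ := ((E₀.mul E₀).mul (E₀.mul E₀)).mul E₀
  have heq := P₂.unique (Q := _) (by
    convert! R using 1
    ext τ
    have := hzero ((2 + φ : ℝ) * (τ : ℂ), (2 + ψ : ℝ) * (τ : ℂ)) (mem_H2
      (by rw [im_ofReal_mul]; exact mul_pos h1 τ.im_pos)
      (by rw [im_ofReal_mul]; exact mul_pos h2 τ.im_pos))
    have e' : lift s = lift e₂ - (α • (lift e₀ ^ 2 * lift e₁) + (1 - α) • lift e₀ ^ 5) := rfl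
    rw [e'] at this
    simp only [Pi.sub_apply, Pi.add_apply, Pi.smul_apply, Pi.mul_apply, Pi.pow_apply,
      smul_eq_mul] at this ⊢
    linear_combination this)
  -- With the explicit values of the constants, the two coefficients of q⁴ are different rational
  -- numbers.
  have h4 := congrArg (PowerSeries.coeff 4) heq
  simp only [map_add, PowerSeries.coeff_smul, smul_eq_mul, E₂.c4, T₁.c4, T₂.c4] at h4
  rw [hα, hC₁, hC₂] at h4
  norm_num at h4

end

end HilbertModular

end

/-! ### The ring of integers of ℚ(√5) is ℤ[(1 + √5)/2]. -/

section

open Complex Filter Set Function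
open scoped Real goldenRatio

namespace HilbertModular

variable {F : Type*} [Field F]

lemma intEmb_injective (σ : F →+* ℝ) : Function.Injective (intEmb σ) := fun _ _ h =>
  NumberField.RingOfIntegers.ext (σ.injective h)

/-- A parametrization `(a, b) ↦ a + b ω` of the ring of integers of `ℚ(√5)`. -/
structure Coords (σ₁ σ₂ : F →+* ℝ) where
  O : ℤ × ℤ ≃ 𝓞 F
  h1 : ∀ d, intEmb σ₁ (O d) = latt1 d
  h2 : ∀ d, intEmb σ₂ (O d) = latt2 d

lemma exists_rat_coords [NumberField F] (hF : Module.finrank ℚ F = 2) {x : F} (hx : x ^ 2 = 5)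
    (c : F) : ∃ u v : ℚ, c = u + v * x := by
  have hli : LinearIndependent ℚ ![(1 : F), x] := by
    rw [LinearIndependent.pair_iff]
    intro s t h
    by_cases ht : t = 0
    · subst ht
      simp [Algebra.smul_def] at h
      exact ⟨h, rfl⟩
    · exfalso
      have h1 : x = ((-s / t : ℚ) : F) := by
        simp only [Algebra.smul_def, mul_one, eq_ratCast] at h
        have : (t : F) ≠ 0 := by exact_mod_cast ht
        push_cast
        field_simp
        linear_combination h
      rw [h1] at hx
      have h2 : (-s / t) ^ 2 = (5 : ℚ) := by exact_mod_cast hx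
      have h3 : IsSquare (5 : ℚ) := ⟨-s / t, by rw [← h2]; ring⟩
      have h4 : IsSquare (5 : ℕ) := by
        have : IsSquare ((5 : ℕ) : ℚ) := by exact_mod_cast h3
        rwa [Rat.isSquare_natCast_iff] at this
      obtain ⟨r, hr⟩ := h4
      have : r < 3 := by nlinarith
      interval_cases r <;> omega
  have hs := hli.span_eq_top_of_card_eq_finrank (by simp [hF])
  have hc : c ∈ Submodule.span ℚ (Set.range ![(1 : F), x]) := hs ▸ Submodule.mem_top
  rw [Matrix.range_cons, Matrix.range_cons, Matrix.range_empty, Set.union_empty,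
    Set.singleton_union, Submodule.mem_span_pair] at hc
  obtain ⟨u, v, h⟩ := hc
  exact ⟨u, v, by rw [← h]; simp [Algebra.smul_def]⟩

lemma int_of_isIntegral {q : ℚ} (h : IsIntegral ℤ (q : ℝ)) : ∃ n : ℤ, q = n := by
  have h1 : IsIntegral ℤ q := by
    have : IsIntegral ℤ (algebraMap ℚ ℝ q) := by simpa using h
    exact (isIntegral_algebraMap_iff (algebraMap ℚ ℝ).injective).mp this
  obtain ⟨n, hn⟩ := IsIntegrallyClosed.isIntegral_iff.mp h1
  exact ⟨n, by simpa using hn.symm⟩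

/-- Here `5q` is integral, and its square is divisible by 5; as 5 is prime, so is `5q`. -/
lemma int_of_five_mul_sq {q : ℚ} {n : ℤ} (h : 5 * q ^ 2 = n) : ∃ m : ℤ, q = m := by
  have h1 : IsIntegral ℤ (5 * q) := by
    refine ⟨Polynomial.X ^ 2 - Polynomial.C (5 * n), Polynomial.monic_X_pow_sub_C _ two_ne_zero, ?_⟩
    rw [Polynomial.eval₂_sub, Polynomial.eval₂_X_pow, Polynomial.eval₂_C]
    simp only [eq_intCast, Int.cast_mul, Int.cast_ofNat]
    linear_combination 5 * h
  obtain ⟨m, hm⟩ := IsIntegrallyClosed.isIntegral_iff.mp h1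
  have hm' : (m : ℚ) = 5 * q := by simpa using hm
  have h2 : m ^ 2 = 5 * n := by
    have : (m : ℚ) ^ 2 = 5 * n := by rw [hm']; linear_combination 5 * h
    exact_mod_cast this
  have h3 : (5 : ℤ) ∣ m := Int.Prime.dvd_pow' (p := 5) (by norm_num) (n := m) (k := 2) ⟨n, by
    rw [h2]; rfl⟩
  obtain ⟨l, rfl⟩ := h3
  refine ⟨l, ?_⟩
  push_cast at hm'
  linarith

/-- Write an integer as `u + v√5`. Its trace `2u` and norm `u² − 5v²` are integers, which makes `2v`
an integer of the same parity as `2u`. -/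
theorem exists_coords [NumberField F] (hF : Module.finrank ℚ F = 2) (h5 : ∃ x : F, x ^ 2 = 5)
    {σ₁ σ₂ : F →+* ℝ} (hσ : σ₁ ≠ σ₂) : Nonempty (Coords σ₁ σ₂) := by
  obtain ⟨x, hx, hx1, hx2⟩ : ∃ x : F, x ^ 2 = 5 ∧ σ₁ x = √5 ∧ σ₂ x = -√5 := by
    obtain ⟨x, hx⟩ := h5
    have h : ∀ σ : F →+* ℝ, σ x = √5 ∨ σ x = -√5 := fun σ => by
      have h1 : σ x ^ 2 = 5 := by rw [← map_pow, hx]; exact map_ofNat σ 5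
      have h2 : √5 ^ 2 = (5 : ℝ) := Real.sq_sqrt (by norm_num)
      rw [← h2] at h1
      exact sq_eq_sq_iff_eq_or_eq_neg.mp h1
    have hne : σ₁ x ≠ σ₂ x := fun he => hσ (RingHom.ext fun c => by
      obtain ⟨u, v, rfl⟩ := exists_rat_coords hF hx c
      simp [he])
    -- The two embeddings take opposite values on the square root of 5; its sign is chosen so that
    -- `σ₁` gives the positive one.
    rcases h σ₁ with h1 | h1 <;> rcases h σ₂ with h2 | h2
    · exact absurd (h1.trans h2.symm) hne
    · exact ⟨x, hx, h1, h2⟩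
    · exact ⟨-x, by rw [neg_sq, hx], by rw [map_neg, h1, neg_neg], by rw [map_neg, h2]⟩
    · exact absurd (h1.trans h2.symm) hne
  have hint : IsIntegral ℤ ((1 + x) / 2) := by
    refine ⟨Polynomial.X ^ 2 - Polynomial.X - 1, ?_, ?_⟩
    · monicity!
    · simp
      linear_combination hx / 4
  let ω : 𝓞 F := ⟨(1 + x) / 2, hint⟩
  have hω1 : intEmb σ₁ ω = φ := by
    change σ₁ ((1 + x) / 2) = φ
    rw [map_div₀, map_add, map_one, map_ofNat σ₁ 2, hx1, Real.goldenRatio]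
  have hω2 : intEmb σ₂ ω = ψ := by
    change σ₂ ((1 + x) / 2) = ψ
    rw [map_div₀, map_add, map_one, map_ofNat σ₂ 2, hx2, Real.goldenConj, sub_eq_add_neg]
  let g : ℤ × ℤ → 𝓞 F := fun d => d.1 + d.2 * ω
  have g1 : ∀ d, intEmb σ₁ (g d) = latt1 d := fun d => by
    simp [g, latt1, hω1]
  have g2 : ∀ d, intEmb σ₂ (g d) = latt2 d := fun d => by
    simp [g, latt2, hω2]
  have hbij : Function.Bijective g := by
    constructor
    · intro d e h
      have e1 := congrArg (intEmb σ₁) h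
      have e2 := congrArg (intEmb σ₂) h
      rw [g1, g1] at e1
      rw [g2, g2] at e2
      simp only [latt1, latt2] at e1 e2
      have h3 : ((d.2 : ℝ) - e.2) * (φ - ψ) = 0 := by linear_combination e1 - e2
      have h4 : φ - ψ ≠ 0 := by
        rw [Real.goldenRatio_sub_goldenConj]; exact sqrt_five_ne_zero
      have h5 : (d.2 : ℝ) = e.2 := by linarith [(mul_eq_zero.mp h3).resolve_right h4]
      have h6 : (d.1 : ℝ) = e.1 := by rw [h5] at e1; linarith
      exact Prod.ext (by exact_mod_cast h6) (by exact_mod_cast h5)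
    · intro c
      obtain ⟨u, v, huv⟩ := exists_rat_coords hF hx (c : F)
      have i1 : IsIntegral ℤ (σ₁ c) := by
        exact c.isIntegral_coe.map (σ₁ : F →+* ℝ).toIntAlgHom
      have i2 : IsIntegral ℤ (σ₂ c) := by
        exact c.isIntegral_coe.map (σ₂ : F →+* ℝ).toIntAlgHom
      have s1 : σ₁ c = u + v * √5 := by rw [huv]; simp [hx1]
      have s2 : σ₂ c = u - v * √5 := by rw [huv]; simp [hx2, sub_eq_add_neg]
      have hsq : √5 * √5 = (5 : ℝ) := Real.mul_self_sqrt (by norm_num)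
      obtain ⟨m, hm⟩ := int_of_isIntegral (q := 2 * u) (by
        have := i1.add i2
        rw [s1, s2] at this
        have e : ((2 * u : ℚ) : ℝ) = u + v * √5 + (u - v * √5) := by push_cast; ring
        rwa [e])
      obtain ⟨n, hn⟩ := int_of_isIntegral (q := u ^ 2 - 5 * v ^ 2) (by
        have := i1.mul i2
        rw [s1, s2] at this
        have e : ((u ^ 2 - 5 * v ^ 2 : ℚ) : ℝ) = (u + v * √5) * (u - v * √5) := by
          push_cast; linear_combination (v : ℝ) ^ 2 * hsq
        rwa [e])
      obtain ⟨l, hl⟩ := int_of_five_mul_sq (q := 2 * v) (n := m ^ 2 - 4 * n) (by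
        push_cast
        rw [← hm, ← hn]; ring)
      have hml : m ^ 2 - 4 * n = 5 * l ^ 2 := by
        have : (m : ℚ) ^ 2 - 4 * n = 5 * l ^ 2 := by
          rw [← hm, ← hn, ← hl]; ring
        exact_mod_cast this
      -- Reduce m² − 4n = 5l² modulo 2. The element is then (m − l)/2 + lω.
      have hpar : (m - l) % 2 = 0 := by
        have h1 : (m ^ 2 - 4 * n) % 2 = (5 * l ^ 2) % 2 := by rw [hml]
        rcases Int.emod_two_eq_zero_or_one m with h2 | h2 <;>
          rcases Int.emod_two_eq_zero_or_one l with h3 | h3 <;>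
          simp [pow_two, Int.sub_emod, Int.mul_emod, h2, h3] at h1 ⊢
      obtain ⟨a, ha⟩ := Int.dvd_of_emod_eq_zero hpar
      refine ⟨(a, l), NumberField.RingOfIntegers.ext ?_⟩
      change ((a : 𝓞 F) + (l : 𝓞 F) * ω : 𝓞 F).val = (c : F)
      have e1 : ((a : 𝓞 F) + (l : 𝓞 F) * ω : 𝓞 F).val = (a : F) + l * ((1 + x) / 2) := by
        change algebraMap (𝓞 F) F (a + l * ω) = _
        rw [map_add, map_mul, map_intCast, map_intCast]
        rfl
      have hm' : (2 * u : F) = m := by exact_mod_cast congrArg (fun q : ℚ => (q : F)) hm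
      have hl' : (2 * v : F) = l := by exact_mod_cast congrArg (fun q : ℚ => (q : F)) hl
      have ha' : (m - l : F) = 2 * a := by exact_mod_cast congrArg (fun q : ℤ => (q : F)) ha
      rw [e1, huv]
      linear_combination (-1/2 : F) * ha' - (1/2 : F) * hm' + ((1 / 2 : F) - (1 + x) / 2) * hl' 
  exact ⟨⟨Equiv.ofBijective g hbij, g1, g2⟩⟩

end HilbertModular

end

/-! ### The transformation laws under translations, units and inversion. -/

section

open Complex Filter Set Function
open scoped Real goldenRatio

namespace HilbertModular

variable {F : Type*} [Field F] {σ₁ σ₂ : F →+* ℝ}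

lemma coe_map_smul (σ : F →+* ℝ) (γ : SL(2, 𝓞 F)) (τ : ℍ) :
    ((Matrix.SpecialLinearGroup.map (intEmb σ) γ • τ : ℍ) : ℂ) =
      ((intEmb σ (γ 0 0) : ℝ) * (τ : ℂ) + (intEmb σ (γ 0 1) : ℝ)) /
        ((intEmb σ (γ 1 0) : ℝ) * (τ : ℂ) + (intEmb σ (γ 1 1) : ℝ)) := by
  rw [UpperHalfPlane.specialLinearGroup_apply]
  rfl

lemma lift_apply_of_mem {f : ℍ × ℍ → ℂ} {z₁ z₂ : ℂ} (hz : (z₁, z₂) ∈ H2) :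
    lift f (z₁, z₂) = f (⟨z₁, hz.1⟩, ⟨z₂, hz.2⟩) := by
  have := lift_coe f (⟨z₁, hz.1⟩, ⟨z₂, hz.2⟩)
  exact this

/-- The transformation law in terms of the extension to `ℂ × ℂ`. -/
lemma lift_act {f : ℍ × ℍ → ℂ} {k : ℤ} (hf : f ∈ modularForms σ₁ σ₂ k) (γ : SL(2, 𝓞 F))
    {z₁ z₂ w₁ w₂ : ℂ} (hz : (z₁, z₂) ∈ H2)
    (h1 : w₁ = ((intEmb σ₁ (γ 0 0) : ℝ) * z₁ + (intEmb σ₁ (γ 0 1) : ℝ)) /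
        ((intEmb σ₁ (γ 1 0) : ℝ) * z₁ + (intEmb σ₁ (γ 1 1) : ℝ)))
    (h2 : w₂ = ((intEmb σ₂ (γ 0 0) : ℝ) * z₂ + (intEmb σ₂ (γ 0 1) : ℝ)) /
        ((intEmb σ₂ (γ 1 0) : ℝ) * z₂ + (intEmb σ₂ (γ 1 1) : ℝ))) :
    lift f (w₁, w₂) = (((intEmb σ₁ (γ 1 0) : ℝ) * z₁ + (intEmb σ₁ (γ 1 1) : ℝ)) *
      ((intEmb σ₂ (γ 1 0) : ℝ) * z₂ + (intEmb σ₂ (γ 1 1) : ℝ))) ^ k * lift f (z₁, z₂) := by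
  have h := hf.2 γ (⟨z₁, hz.1⟩, ⟨z₂, hz.2⟩)
  rw [lift_apply_of_mem hz, ← lift_coe f (act σ₁ σ₂ γ _)] at *
  have e1 : (((act σ₁ σ₂ γ (⟨z₁, hz.1⟩, ⟨z₂, hz.2⟩)).1 : ℍ) : ℂ) = w₁ := by
    rw [h1]; exact coe_map_smul σ₁ γ _
  have e2 : (((act σ₁ σ₂ γ (⟨z₁, hz.1⟩, ⟨z₂, hz.2⟩)).2 : ℍ) : ℂ) = w₂ := by
    rw [h2]; exact coe_map_smul σ₂ γ _
  rw [e1, e2] at h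
  exact h

lemma latt1_zero_one : latt1 (0, 1) = φ := by simp [latt1]

lemma latt2_zero_one : latt2 (0, 1) = ψ := by simp [latt2]

/-- Apply the modular law to the translations, to diag(φ, φ⁻¹), which acts by the squared unit, and
to the inversion. The element with coordinates `(-1, 1)` is φ − 1 = φ⁻¹. -/
theorem isSymHMF_lift (K : Coords σ₁ σ₂) {m : ℤ} {f : ℍ × ℍ → ℂ} (hf : f ∈ evenSymForms σ₁ σ₂ m) :
    IsSymHMF (lift f) (2 * m) := by
  obtain ⟨hf, hs⟩ := hf
  have htrans : ∀ (d : ℤ × ℤ) (z₁ z₂ : ℂ), (z₁, z₂) ∈ H2 →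
      lift f (z₁ + (latt1 d : ℝ), z₂ + (latt2 d : ℝ)) = lift f (z₁, z₂) := by
    intro d z₁ z₂ hz
    have := lift_act hf ⟨!![1, K.O d; 0, 1], by simp [Matrix.det_fin_two]⟩ hz
      (w₁ := z₁ + (latt1 d : ℝ)) (w₂ := z₂ + (latt2 d : ℝ)) (by simp [K.h1]) (by simp [K.h2])
    simpa using this
  refine ⟨⟨hf.1, fun z₁ z₂ hz => ?_, fun z₁ z₂ hz => ?_, fun z₁ z₂ hz => ?_, fun z₁ z₂ hz => ?_⟩,
    fun z₁ z₂ hz => ?_⟩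
  · simpa [latt1, latt2] using htrans (1, 0) z₁ z₂ hz
  · simpa [latt1_zero_one, latt2_zero_one] using htrans (0, 1) z₁ z₂ hz
  · have hdet : K.O (0, 1) * K.O (-1, 1) = 1 := by
      apply intEmb_injective σ₁
      rw [map_mul, K.h1, K.h1, map_one, latt1_zero_one, latt1]
      have := Real.goldenRatio_sq
      push_cast
      linear_combination this
    have h1 : φ * latt1 (-1, 1) = 1 := by
      rw [← latt1_zero_one, ← K.h1, ← K.h1, ← map_mul, hdet, map_one]
    have h2 : ψ * latt2 (-1, 1) = 1 := by
      rw [← latt2_zero_one, ← K.h2, ← K.h2, ← map_mul, hdet, map_one]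
    have := lift_act hf ⟨!![K.O (0, 1), 0; 0, K.O (-1, 1)], by simp [Matrix.det_fin_two, hdet]⟩ hz
      (w₁ := (φ ^ 2 : ℝ) * z₁) (w₂ := (ψ ^ 2 : ℝ) * z₂) (by
        have e : (latt1 (-1, 1) : ℂ) ≠ 0 := by
          exact_mod_cast right_ne_zero_of_mul_eq_one h1
        simp only [Matrix.of_apply, Matrix.cons_val', Matrix.cons_val_zero,
          Matrix.cons_val_one, Matrix.cons_val_fin_one, map_zero, ofReal_zero, add_zero,
          zero_mul, zero_add, K.h1, latt1_zero_one]
        rw [eq_div_iff e]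
        have h1' : (φ : ℂ) * (latt1 (-1, 1) : ℂ) = 1 := by exact_mod_cast h1
        rw [ofReal_pow]
        linear_combination (φ : ℂ) * z₁ * h1') (by
        have e : (latt2 (-1, 1) : ℂ) ≠ 0 := by
          exact_mod_cast right_ne_zero_of_mul_eq_one h2
        simp only [Matrix.of_apply, Matrix.cons_val', Matrix.cons_val_zero,
          Matrix.cons_val_one, Matrix.cons_val_fin_one, map_zero, ofReal_zero, add_zero,
          zero_mul, zero_add, K.h2, latt2_zero_one]
        rw [eq_div_iff e]
        have h2' : (ψ : ℂ) * (latt2 (-1, 1) : ℂ) = 1 := by exact_mod_cast h2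
        rw [ofReal_pow]
        linear_combination (ψ : ℂ) * z₂ * h2')
    rw [this]
    have e : latt1 (-1, 1) * latt2 (-1, 1) = -1 := by
      simp only [latt1, latt2]
      have a := Real.goldenRatio_mul_goldenConj
      have b := Real.goldenRatio_add_goldenConj
      push_cast
      linear_combination a - b
    have e' : (latt1 (-1, 1) : ℂ) * (latt2 (-1, 1) : ℂ) = -1 := by exact_mod_cast e
    simp only [Matrix.of_apply, Matrix.cons_val', Matrix.cons_val_zero,
      Matrix.cons_val_one, Matrix.cons_val_fin_one, map_zero, ofReal_zero, zero_mul, zero_add,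
      K.h1, K.h2, e']
    -- The automorphy factor is N(φ⁻¹)^(2m) = (−1)^(2m), equal to 1 because the weight is even.
    rw [zpow_mul]
    norm_num
  · have := lift_act hf ⟨!![0, -1; 1, 0], by simp [Matrix.det_fin_two]⟩ hz
      (w₁ := -1 / z₁) (w₂ := -1 / z₂) (by simp) (by simp)
    simpa using this
  · rw [lift_apply_of_mem hz, lift_apply_of_mem (z₁ := z₂) (z₂ := z₁) ⟨hz.2, hz.1⟩]
    exact hs _ _

end HilbertModular

end

/-! ### From monomials in functions to the graded algebra. -/

section

open Complex Filter Set Function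
open scoped Real goldenRatio

namespace HilbertModular

open MvPolynomial

/-- Identifies homogeneous elements whose degrees are only propositionally equal. -/
lemma of_congr {V : ℤ → Submodule ℂ (ℍ × ℍ → ℂ)} {i j : ℤ} (h : i = j) {x : V i} {y : V j}
    (hxy : (x : ℍ × ℍ → ℂ) = y) :
    DirectSum.of (fun m => V m) i x = DirectSum.of (fun m => V m) j y := by
  subst h
  rw [Subtype.ext hxy]

section

variable {V : ℤ → Submodule ℂ (ℍ × ℍ → ℂ)} [SetLike.GradedMonoid V] {e₀ e₁ e₂ : ℍ × ℍ → ℂ}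

lemma of_mono (h₀ : e₀ ∈ V 1) (h₁ : e₁ ∈ V 3) (h₂ : e₂ ∈ V 5) (a b c : ℕ) :
    DirectSum.of (fun m => V m) 1 ⟨e₀, h₀⟩ ^ a * DirectSum.of (fun m => V m) 3 ⟨e₁, h₁⟩ ^ b *
      DirectSum.of (fun m => V m) 5 ⟨e₂, h₂⟩ ^ c =
    DirectSum.of (fun m => V m) (a + 3 * b + 5 * c)
      ⟨e₀ ^ a * e₁ ^ b * e₂ ^ c, mono_mem h₀ h₁ h₂ rfl⟩ := by
  rw [DirectSum.ofPow, DirectSum.ofPow, DirectSum.ofPow, DirectSum.of_mul_of, DirectSum.of_mul_of]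
  refine of_congr ?_ ?_
  · simp only [nsmul_eq_mul]; ring
  · rfl

/-- The homomorphism from the polynomial ring given by three forms of weights `2`, `6`, `10`. -/
noncomputable def evalForms (h₀ : e₀ ∈ V 1) (h₁ : e₁ ∈ V 3) (h₂ : e₂ ∈ V 5) :
    MvPolynomial (Fin 3) ℂ →ₐ[ℂ] ⨁ m, V m :=
  aeval ![DirectSum.of (fun m => V m) 1 ⟨e₀, h₀⟩, DirectSum.of (fun m => V m) 3 ⟨e₁, h₁⟩,
    DirectSum.of (fun m => V m) 5 ⟨e₂, h₂⟩]

variable (h₀ : e₀ ∈ V 1) (h₁ : e₁ ∈ V 3) (h₂ : e₂ ∈ V 5)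

lemma evalForms_eq_sum (p : MvPolynomial (Fin 3) ℂ) : evalForms h₀ h₁ h₂ p =
    ∑ d ∈ p.support, coeff d p • DirectSum.of (fun m => V m) (d 0 + 3 * d 1 + 5 * d 2)
      ⟨e₀ ^ d 0 * e₁ ^ d 1 * e₂ ^ d 2, mono_mem h₀ h₁ h₂ rfl⟩ := by
  rw [evalForms, aeval_def, eval₂_eq']
  refine Finset.sum_congr rfl fun d _ => ?_
  rw [Fin.prod_univ_three, ← of_mono h₀ h₁ h₂]
  exact (Algebra.smul_def _ _).symm

lemma coe_evalForms (p : MvPolynomial (Fin 3) ℂ) (m : ℤ) :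
    ((evalForms h₀ h₁ h₂ p m : V m) : ℍ × ℍ → ℂ) =
    ∑ d ∈ p.support, if (d 0 + 3 * d 1 + 5 * d 2 : ℤ) = m then
      coeff d p • (e₀ ^ d 0 * e₁ ^ d 1 * e₂ ^ d 2) else 0 := by
  rw [evalForms_eq_sum]
  rw [DFinsupp.finsetSum_apply, AddSubmonoidClass.coe_finsetSum]
  refine Finset.sum_congr rfl fun d _ => ?_
  rw [DirectSum.smul_apply]
  split_ifs with h
  · subst h
    rw [DirectSum.of_eq_same]
    rfl
  · rw [DirectSum.of_eq_of_ne _ _ _ (Ne.symm h)]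
    simp

lemma evalForms_mem_range {p : MvPolynomial (Fin 3) ℂ} {m : ℕ}
    (hp : p ∈ weightedHomogeneousSubmodule ℂ (![2, 6, 10] : Fin 3 → ℕ) (2 * m)) :
    evalForms h₀ h₁ h₂ p ∈ LinearMap.range (DirectSum.lof ℂ ℤ (fun m : ℤ => V m) (m : ℤ)) := by
  rw [evalForms_eq_sum]
  refine Submodule.sum_mem _ fun d hd => Submodule.smul_mem _ _ ?_
  have hw := hp (mem_support_iff.mp hd)
  rw [Finsupp.weight_apply, Finsupp.sum_fintype _ _ (by simp), Fin.sum_univ_three] at hw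
  simp at hw
  have e : (d 0 + 3 * d 1 + 5 * d 2 : ℤ) = m := by omega
  refine ⟨⟨e₀ ^ d 0 * e₁ ^ d 1 * e₂ ^ d 2, mono_mem h₀ h₁ h₂ e⟩, ?_⟩
  exact of_congr e.symm rfl

/-- Look at one degree at a time: the component of degree `m` of the image is a sum over the
monomials of that degree, where independence of monomials applies. -/
lemma evalForms_injective {c₁ c₂ : ℂ} (hc₁ : c₁ ≠ 0) (hc₂ : c₂ ≠ 0)
    (l₀ : HasLead (lift e₀) 0 ModularForm.E₄)
    (l₁ : HasLead (lift e₁) 0 (c₁ • (ModularForm.discriminant : ℍ → ℂ)))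
    (l₂ : HasLead (lift e₂) 2 (c₂ • (ModularForm.discriminant : ℍ → ℂ) ^ 2)) :
    Function.Injective (evalForms h₀ h₁ h₂) := by
  rw [injective_iff_map_eq_zero]
  intro p hp
  ext d
  rw [coeff_zero]
  set m : ℕ := d 0 + 3 * d 1 + 5 * d 2 with hm
  have h := coe_evalForms h₀ h₁ h₂ p (m : ℤ)
  rw [hp] at h
  let D : ℕ → ℕ → (Fin 3 →₀ ℕ) := fun b c =>
    Finsupp.equivFunOnFinite.symm ![m - 3 * b - 5 * c, b, c]
  have hD : ∀ b c, D b c 0 = m - 3 * b - 5 * c ∧ D b c 1 = b ∧ D b c 2 = c := fun b c =>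
    ⟨rfl, rfl, rfl⟩
  -- Monomials of degree `m` are indexed by `(b, c)`, the exponent of `e₀` being `m − 3b − 5c`. The
  -- truncated subtraction is harmless, since the coefficient is set to zero when `3b + 5c > m`.
  have key := eq_zero_of_sum_mono hc₁ hc₂ l₀ l₁ l₂ (fun b c => m - 3 * b - 5 * c)
    (fun b c => if 3 * b + 5 * c ≤ m then coeff (D b c) p else 0) (m + 1) 0 (m + 1) (by
      rw [← Finset.sum_product']
      have h' : (0 : ℍ × ℍ → ℂ) = _ := h
      rw [h', ← Finset.sum_filter]
      symm
      have hfil : ∀ d' : Fin 3 →₀ ℕ, d' ∈ p.support.filter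
          (fun d => (d 0 + 3 * d 1 + 5 * d 2 : ℤ) = m) →
          d' ∈ p.support ∧ D (d' 1) (d' 2) = d' ∧ 3 * d' 1 + 5 * d' 2 ≤ m := by
        intro d' hd'
        obtain ⟨h3, h4⟩ := Finset.mem_filter.mp hd'
        refine ⟨h3, ?_, by omega⟩
        ext i
        fin_cases i
        · have := (hD (d' 1) (d' 2)).1
          simp only [Fin.zero_eta]
          omega
        · rfl
        · rfl
      refine Finset.sum_of_injOn (fun d => (d 2, d 1)) ?_ ?_ ?_ ?_
      · intro d' hd' d'' hd'' he
        simp only [Prod.mk.injEq] at he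
        rw [← (hfil d' hd').2.1, ← (hfil d'' hd'').2.1, he.1, he.2]
      · intro d' hd'
        have := (hfil d' hd').2.2
        simp only [Finset.coe_product, Set.mem_prod, Finset.coe_range, Set.mem_Iio]
        omega
      · rintro ⟨c, b⟩ hcb hnot
        simp only
        split_ifs with hle
        · have h0 : coeff (D b c) p = 0 := by
            by_contra hne
            refine hnot ⟨D b c, ?_, rfl⟩
            rw [Finset.mem_coe, Finset.mem_filter]
            obtain ⟨i0, i1, i2⟩ := hD b c
            exact ⟨mem_support_iff.mpr hne, by rw [i0, i1, i2]; omega⟩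
          rw [h0, zero_smul]
        · rw [zero_smul]
      · intro d' hd'
        obtain ⟨a1, a2, a3⟩ := hfil d' hd'
        simp only
        rw [if_pos a3, a2, add_zero]
        congr 4
        have := (hD (d' 1) (d' 2)).1
        rw [a2] at this
        exact this)
  have := key (d 2) (by omega) (d 1) (by omega)
  rw [if_pos (by omega)] at this
  rw [← this]
  congr 1
  ext i
  fin_cases i
  · have := (hD (d 1) (d 2)).1
    simp only [Fin.zero_eta]
    omega
  · rfl
  · rfl

lemma evalForms_surjective (hV : ∀ m, ∀ f ∈ V m, IsSymHMF (lift f) (2 * m))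
    {c₁ c₂ : ℂ} (hc₁ : c₁ ≠ 0) (hc₂ : c₂ ≠ 0)
    (l₀ : HasLead (lift e₀) 0 ModularForm.E₄)
    (l₁ : HasLead (lift e₁) 0 (c₁ • (ModularForm.discriminant : ℍ → ℂ)))
    (l₂ : HasLead (lift e₂) 2 (c₂ • (ModularForm.discriminant : ℍ → ℂ) ^ 2)) :
    Function.Surjective (evalForms h₀ h₁ h₂) := by
  intro y
  change y ∈ (evalForms h₀ h₁ h₂).range
  induction y using DirectSum.induction_on with
  | zero => exact zero_mem _
  | add x y hx hy => exact add_mem hx hy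
  | of m f =>
    obtain ⟨f, hf⟩ := f
    have hf' := mem_span_mono hV h₀ h₁ h₂ hc₁ hc₂ l₀ l₁ l₂ hf
    have hle : Submodule.span ℂ {g | ∃ a b c : ℕ, (a : ℤ) + 3 * b + 5 * c = m ∧
        g = e₀ ^ a * e₁ ^ b * e₂ ^ c} ≤ ((Subalgebra.toSubmodule (evalForms h₀ h₁ h₂).range).comap
          (DirectSum.lof ℂ ℤ (fun m : ℤ => V m) m)).map (V m).subtype := by
      rw [Submodule.span_le]
      rintro _ ⟨a, b, c, habc, rfl⟩
      refine ⟨⟨_, mono_mem h₀ h₁ h₂ habc⟩, ?_, rfl⟩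
      refine ⟨X 0 ^ a * X 1 ^ b * X 2 ^ c, ?_⟩
      simp only [evalForms, RingHom.coe_coe, map_mul, map_pow, aeval_X, AlgHom.toRingHom_eq_coe]
      refine (of_mono h₀ h₁ h₂ a b c).trans ?_
      exact of_congr habc rfl
    obtain ⟨g, hg, hgf⟩ := hle hf'
    have : g = ⟨f, hf⟩ := Subtype.ext hgf
    rw [this] at hg
    exact hg

end

end HilbertModular

end

/-! ### Changing generators from the cusp forms back to the Eisenstein series. -/

section

open Complex Filter Set Function
open scoped Real goldenRatio

namespace HilbertModular

open MvPolynomial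

/-- A triangular automorphism of the polynomial ring. -/
noncomputable def triAut {t₀ t₁ t₂ : ℂ} (h₀ : t₀ ≠ 0) (h₁ : t₁ ≠ 0) (h₂ : t₂ ≠ 0) (α β : ℂ) :
    MvPolynomial (Fin 3) ℂ ≃ₐ[ℂ] MvPolynomial (Fin 3) ℂ :=
  AlgEquiv.ofAlgHom
    (aeval ![C t₀ * X 0, C t₁ * (X 1 + X 0 ^ 3),
      C t₂ * (X 2 + (C α * (X 0 ^ 2 * (X 1 + X 0 ^ 3)) + C β * X 0 ^ 5))])
    (aeval ![C t₀⁻¹ * X 0, C t₁⁻¹ * X 1 - (C t₀⁻¹ * X 0) ^ 3,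
      C t₂⁻¹ * X 2 - (C α * ((C t₀⁻¹ * X 0) ^ 2 * (C t₁⁻¹ * X 1)) +
        C β * (C t₀⁻¹ * X 0) ^ 5)])
    (by
      have e₀ : (C t₀⁻¹ : MvPolynomial (Fin 3) ℂ) * C t₀ = 1 := by
        rw [← C_mul, inv_mul_cancel₀ h₀, C_1]
      have e₁ : (C t₁⁻¹ : MvPolynomial (Fin 3) ℂ) * C t₁ = 1 := by
        rw [← C_mul, inv_mul_cancel₀ h₁, C_1]
      have e₂ : (C t₂⁻¹ : MvPolynomial (Fin 3) ℂ) * C t₂ = 1 := by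
        rw [← C_mul, inv_mul_cancel₀ h₂, C_1]
      ext i : 1
      fin_cases i
      · simp [algebraMap_eq, ← mul_assoc, e₀]
      · simp [algebraMap_eq, ← mul_assoc, e₀, e₁]
      · simp [algebraMap_eq, ← mul_assoc, e₀, e₂]
        linear_combination (-(C α * X 0 ^ 2 * (X 1 + X 0 ^ 3))) * e₁)
    (by
      have e₀ : (C t₀ : MvPolynomial (Fin 3) ℂ) * C t₀⁻¹ = 1 := by
        rw [← C_mul, mul_inv_cancel₀ h₀, C_1]
      have e₁ : (C t₁ : MvPolynomial (Fin 3) ℂ) * C t₁⁻¹ = 1 := by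
        rw [← C_mul, mul_inv_cancel₀ h₁, C_1]
      have e₂ : (C t₂ : MvPolynomial (Fin 3) ℂ) * C t₂⁻¹ = 1 := by
        rw [← C_mul, mul_inv_cancel₀ h₂, C_1]
      ext i : 1
      fin_cases i
      · simp [algebraMap_eq, ← mul_assoc, e₀]
      · simp [algebraMap_eq, ← mul_assoc, e₁]
      · simp [algebraMap_eq, ← mul_assoc, e₂])

/-- The nonzero scalars `t₀, t₁, t₂` decouple the normalisation used for Fourier coefficients from
the one by the Dedekind zeta function. -/
theorem exists_algEquiv {V : ℤ → Submodule ℂ (ℍ × ℍ → ℂ)} [SetLike.GradedMonoid V]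
    (hV : ∀ m, ∀ f ∈ V m, IsSymHMF (lift f) (2 * m)) {e₀ e₁ e₂ : ℍ × ℍ → ℂ}
    (h₀ : e₀ ∈ V 1) (h₁ : e₁ ∈ V 3) (h₂ : e₂ ∈ V 5) {C₀ C₁ C₂ : ℂ} (H₀ : EisCoef (lift e₀) 2 C₀)
    (H₁ : EisCoef (lift e₁) 6 C₁) (H₂ : EisCoef (lift e₂) 10 C₂) {t₀ t₁ t₂ : ℂ}
    (ht₀ : t₀ ≠ 0) (ht₁ : t₁ ≠ 0) (ht₂ : t₂ ≠ 0) {E₀ E₁ E₂ : ℍ × ℍ → ℂ}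
    (k₀ : E₀ ∈ V 1) (k₁ : E₁ ∈ V 3) (k₂ : E₂ ∈ V 5)
    (hE₀ : E₀ = t₀ • e₀) (hE₁ : E₁ = t₁ • e₁) (hE₂ : E₂ = t₂ • e₂) :
    ∃ Φ : MvPolynomial (Fin 3) ℂ ≃ₐ[ℂ] ⨁ m, V m,
      Φ (X 0) = DirectSum.of (fun m => V m) 1 ⟨E₀, k₀⟩ ∧
      Φ (X 1) = DirectSum.of (fun m => V m) 3 ⟨E₁, k₁⟩ ∧
      Φ (X 2) = DirectSum.of (fun m => V m) 5 ⟨E₂, k₂⟩ ∧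
      ∀ m : ℕ, (weightedHomogeneousSubmodule ℂ (![2, 6, 10] : Fin 3 → ℕ) (2 * m)).map
          Φ.toLinearMap = LinearMap.range (DirectSum.lof ℂ ℤ (fun m : ℤ => V m) (m : ℤ)) := by
  obtain ⟨l₀, ⟨c₁, hc₁, l₁⟩, α, β, c₂, hc₂, l₂⟩ := exists_leads hV h₀ h₁ h₂ H₀ H₁ H₂
  have hs₁ : e₁ - e₀ ^ 3 ∈ V 3 := by
    refine sub_mem h₁ ?_
    simpa using mono_mem h₀ h₁ h₂ (a := 3) (b := 0) (c := 0) (m := 3) (by norm_num)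
  have hs₂ : e₂ - (α • (e₀ ^ 2 * e₁) + β • e₀ ^ 5) ∈ V 5 := by
    refine sub_mem h₂ (add_mem (Submodule.smul_mem _ _ ?_) (Submodule.smul_mem _ _ ?_))
    · simpa using mono_mem h₀ h₁ h₂ (a := 2) (b := 1) (c := 0) (m := 5) (by norm_num)
    · simpa using mono_mem h₀ h₁ h₂ (a := 5) (b := 0) (c := 0) (m := 5) (by norm_num)
  let Ψ := AlgEquiv.ofBijective (evalForms h₀ hs₁ hs₂)
    ⟨evalForms_injective h₀ hs₁ hs₂ hc₁ hc₂ l₀ l₁ l₂,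
      evalForms_surjective h₀ hs₁ hs₂ hV hc₁ hc₂ l₀ l₁ l₂⟩
  have hX0 : evalForms h₀ hs₁ hs₂ (X 0) = DirectSum.of (fun m => V m) 1 ⟨e₀, h₀⟩ := by
    simp [evalForms]
  have hX1 : evalForms h₀ hs₁ hs₂ (X 1) = DirectSum.of (fun m => V m) 3 ⟨_, hs₁⟩ := by
    simp [evalForms]
  have hX2 : evalForms h₀ hs₁ hs₂ (X 2) = DirectSum.of (fun m => V m) 5 ⟨_, hs₂⟩ := by
    simp [evalForms]
  have hC : ∀ (c : ℂ) (p : MvPolynomial (Fin 3) ℂ),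
      evalForms h₀ hs₁ hs₂ (C c * p) = c • evalForms h₀ hs₁ hs₂ p := fun c p => by
    rw [← smul_eq_C_mul, map_smul]
  have hsm : ∀ (c : ℂ) (i : ℤ) (f : V i), c • DirectSum.of (fun m => V m) i f =
      DirectSum.of (fun m => V m) i (c • f) := fun c i f =>
    (DirectSum.lof ℂ ℤ (fun m : ℤ => V m) i).map_smul c f |>.symm
  -- `Ψ` sends the variables to `e₀` and the two forms with prescribed leading terms. The triangular
  -- automorphism undoes the passage to these forms and inserts the scalars.
  let Φ := (triAut ht₀ ht₁ ht₂ α β).trans Ψ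
  have hΦ0 : Φ (X 0) = DirectSum.of (fun m => V m) 1 ⟨E₀, k₀⟩ := by
    change evalForms h₀ hs₁ hs₂ (aeval _ (X 0)) = _
    rw [aeval_X]
    simp only [Matrix.cons_val_zero]
    rw [hC, hX0, hsm]
    exact of_congr rfl hE₀.symm
  have hpow : ∀ n : ℕ, DirectSum.of (fun m => V m) 1 ⟨e₀, h₀⟩ ^ n =
      DirectSum.of (fun m => V m) n ⟨e₀ ^ n, by
        simpa using mono_mem h₀ h₁ h₂ (a := n) (b := 0) (c := 0) (m := n) (by simp)⟩ := fun n => by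
    rw [DirectSum.ofPow]
    exact of_congr (by simp) rfl
  have hprod : DirectSum.of (fun m => V m) 1 ⟨e₀, h₀⟩ ^ 2 * DirectSum.of (fun m => V m) 3 ⟨e₁, h₁⟩ =
      DirectSum.of (fun m => V m) 5 ⟨e₀ ^ 2 * e₁, by
        simpa using mono_mem h₀ h₁ h₂ (a := 2) (b := 1) (c := 0) (m := 5) (by norm_num)⟩ := by
    rw [hpow, DirectSum.of_mul_of]
    exact of_congr (by norm_num) rfl
  have hadd : evalForms h₀ hs₁ hs₂ (X 1 + X 0 ^ 3) = DirectSum.of (fun m => V m) 3 ⟨e₁, h₁⟩ := by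
    rw [map_add, map_pow, hX1, hX0, hpow]
    refine (map_add (DirectSum.of (fun m => V m) 3) _ _).symm.trans ?_
    refine of_congr rfl ?_
    simp
  have hΦ1 : Φ (X 1) = DirectSum.of (fun m => V m) 3 ⟨E₁, k₁⟩ := by
    change evalForms h₀ hs₁ hs₂ (aeval _ (X 1)) = _
    rw [aeval_X]
    simp only [Matrix.cons_val_one, Matrix.cons_val_zero]
    rw [hC, hadd, hsm]
    exact of_congr rfl hE₁.symm
  have hΦ2 : Φ (X 2) = DirectSum.of (fun m => V m) 5 ⟨E₂, k₂⟩ := by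
    change evalForms h₀ hs₁ hs₂ (aeval _ (X 2)) = _
    rw [aeval_X]
    simp only [Matrix.cons_val]
    rw [hC, map_add, map_add, hC, hC, map_mul, map_pow, map_pow, hadd, hX0, hX2, hprod,
      hpow, hsm, hsm]
    refine (congrArg (fun x => t₂ • x) (congrArg _ (map_add (DirectSum.of (fun m => V m) 5)
      _ _).symm)).trans ?_
    refine (congrArg (fun x => t₂ • x) (map_add (DirectSum.of (fun m => V m) 5)
      _ _).symm).trans ?_
    rw [hsm]
    refine of_congr rfl ?_
    refine Eq.trans ?_ hE₂.symm
    simp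
  refine ⟨Φ, hΦ0, hΦ1, hΦ2, fun m => ?_⟩
  have hΦ : ∀ p, Φ p = evalForms k₀ k₁ k₂ p := by
    have : (Φ : MvPolynomial (Fin 3) ℂ →ₐ[ℂ] ⨁ m, V m) = evalForms k₀ k₁ k₂ := by
      ext i : 1
      fin_cases i
      · exact hΦ0.trans (by simp [evalForms])
      · exact hΦ1.trans (by simp [evalForms])
      · exact hΦ2.trans (by simp [evalForms])
    exact fun p => DFunLike.congr_fun this p
  refine le_antisymm ?_ ?_
  · rintro _ ⟨p, hp, rfl⟩
    change Φ p ∈ _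
    rw [hΦ]
    exact evalForms_mem_range k₀ k₁ k₂ hp
  · rintro _ ⟨f, rfl⟩
    obtain ⟨p, hp⟩ := Φ.surjective (DirectSum.lof ℂ ℤ (fun m : ℤ => V m) m f)
    -- Evaluation respects the gradings, so the component of weight `2m` of any preimage has the
    -- same image in degree `m`, and the other components do not contribute.
    refine ⟨weightedHomogeneousComponent (![2, 6, 10] : Fin 3 → ℕ) (2 * m) p,
      weightedHomogeneousComponent_mem _ _ _, ?_⟩
    change Φ _ = _
    rw [hΦ] at hp ⊢
    obtain ⟨g, hg⟩ := evalForms_mem_range k₀ k₁ k₂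
      (weightedHomogeneousComponent_mem (![2, 6, 10] : Fin 3 → ℕ) p (2 * m))
    rw [← hg]
    congr 1
    have e1 := coe_evalForms k₀ k₁ k₂ p m
    have e2 := coe_evalForms k₀ k₁ k₂
      (weightedHomogeneousComponent (![2, 6, 10] : Fin 3 → ℕ) (2 * m) p) m
    rw [← hg] at e2
    rw [hp] at e1
    have f1 : (((DirectSum.lof ℂ ℤ (fun m : ℤ => V m) m f) m : V m) : ℍ × ℍ → ℂ) = f := by
      rw [DirectSum.lof_apply]
    have f2 : (((DirectSum.lof ℂ ℤ (fun m : ℤ => V m) m g) m : V m) : ℍ × ℍ → ℂ) = g := by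
      rw [DirectSum.lof_apply]
    rw [f1] at e1
    rw [f2] at e2
    apply Subtype.ext
    rw [e1, e2]
    have hc : ∀ d, coeff d (weightedHomogeneousComponent (![2, 6, 10] : Fin 3 → ℕ) (2 * m) p) =
        if (d 0 + 3 * d 1 + 5 * d 2 : ℤ) = m then coeff d p else 0 := by
      intro d
      rw [coeff_weightedHomogeneousComponent]
      congr 1
      rw [Finsupp.weight_apply, Finsupp.sum_fintype _ _ (by simp), Fin.sum_univ_three]
      simp
      omega
    rw [Finset.sum_subset (s₂ := p.support) (fun d hd => ?_) (fun d _ hd => ?_)]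
    · refine Finset.sum_congr rfl fun d _ => ?_
      rw [hc]
      split_ifs <;> rfl
    · rw [mem_support_iff, hc] at hd
      rw [mem_support_iff]
      intro h0
      rw [h0, ite_self] at hd
      exact hd rfl
    · rw [notMem_support_iff.mp hd, zero_smul, ite_self]

end HilbertModular

end

/-! ### Uniform bounds for sums over the lattice of integers. -/

section

open Complex MeasureTheory Filter Set Function
open scoped Real goldenRatio

namespace HilbertModular

lemma latt_mul (d : ℤ × ℤ) :
    latt1 d * latt2 d = ((d.1 ^ 2 + d.1 * d.2 - d.2 ^ 2 : ℤ) : ℝ) := by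
  simp only [latt1, latt2]
  have a := Real.goldenRatio_mul_goldenConj
  have b := Real.goldenRatio_add_goldenConj
  push_cast
  linear_combination (d.2 : ℝ) ^ 2 * a + (d.1 : ℝ) * d.2 * b

lemma latt2_eq_zero {d : ℤ × ℤ} (h : latt2 d = 0) : d = 0 := by
  have h1 := dual1_eq_zero (ν := (-d.2, d.1)) (by
    rw [dual1]
    rw [latt2] at h
    rw [div_eq_zero_iff]
    left
    push_cast
    linear_combination h)
  rw [Prod.ext_iff] at h1 ⊢
  simp only [Prod.fst_zero, Prod.snd_zero] at h1 ⊢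
  omega

lemma latt1_eq_zero {d : ℤ × ℤ} (h : latt1 d = 0) : d = 0 := by
  have h1 := dual2_eq_zero (ν := (-d.2, d.1)) (by
    rw [dual2]
    rw [latt1] at h
    rw [div_eq_zero_iff]
    left
    push_cast
    linear_combination -h)
  rw [Prod.ext_iff] at h1 ⊢
  simp only [Prod.fst_zero, Prod.snd_zero] at h1 ⊢
  omega

lemma one_le_abs_latt_mul {d : ℤ × ℤ} (h : d ≠ 0) : 1 ≤ |latt1 d * latt2 d| := by
  have h0 : latt1 d * latt2 d ≠ 0 :=
    mul_ne_zero (fun h1 => h (latt1_eq_zero h1)) fun h1 => h (latt2_eq_zero h1)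
  rw [latt_mul] at h0 ⊢
  have h1 : d.1 ^ 2 + d.1 * d.2 - d.2 ^ 2 ≠ 0 := fun h2 => h0 (by rw [h2]; simp)
  exact_mod_cast Int.one_le_abs h1

lemma latt1_sub (d e : ℤ × ℤ) : latt1 (d - e) = latt1 d - latt1 e := by
  simp only [latt1, Prod.fst_sub, Prod.snd_sub]; push_cast; ring

lemma latt2_sub (d e : ℤ × ℤ) : latt2 (d - e) = latt2 d - latt2 e := by
  simp only [latt2, Prod.fst_sub, Prod.snd_sub]; push_cast; ring

lemma latt1_add (d e : ℤ × ℤ) : latt1 (d + e) = latt1 d + latt1 e := by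
  simp only [latt1, Prod.fst_add, Prod.snd_add]; push_cast; ring

lemma latt2_add (d e : ℤ × ℤ) : latt2 (d + e) = latt2 d + latt2 e := by
  simp only [latt2, Prod.fst_add, Prod.snd_add]; push_cast; ring

/-- A nonzero integer has norm at least 1 in absolute value, so two distinct lattice points cannot
lie in the same unit box. -/
lemma floor_latt_injective (ξ₁ ξ₂ : ℝ) :
    Function.Injective fun d : ℤ × ℤ => (⌊ξ₁ + latt1 d⌋, ⌊ξ₂ + latt2 d⌋) := by
  intro d e h
  obtain ⟨h1, h2⟩ := Prod.ext_iff.mp h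
  by_contra hne
  have h3 := one_le_abs_latt_mul (sub_ne_zero.mpr hne)
  have h4 := Int.abs_sub_lt_one_of_floor_eq_floor h1
  have h5 := Int.abs_sub_lt_one_of_floor_eq_floor h2
  rw [add_sub_add_left_eq_sub, ← latt1_sub] at h4
  rw [add_sub_add_left_eq_sub, ← latt2_sub] at h5
  rw [abs_mul] at h3
  nlinarith [abs_nonneg (latt1 (d - e)), abs_nonneg (latt2 (d - e))]

/-- `max 1 |n|`. -/
def absOne (n : ℤ) : ℝ := max 1 |(n : ℝ)|

lemma one_le_absOne (n : ℤ) : 1 ≤ absOne n := le_max_left _ _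

lemma absOne_pos (n : ℤ) : 0 < absOne n := zero_lt_one.trans_le (one_le_absOne n)

lemma summable_absOne {ρ : ℝ} (hρ : 1 < ρ) : Summable fun n : ℤ => absOne n ^ (-ρ) := by
  refine ((Real.summable_abs_int_rpow hρ).add (hasSum_ite_eq (0 : ℤ) (1 : ℝ)).summable).of_nonneg_of_le
    (fun n => by have := absOne_pos n; positivity) fun n => ?_
  by_cases hn : n = 0
  · subst hn
    simp only [absOne, Int.cast_zero, abs_zero, if_true]
    rw [max_eq_left zero_le_one, Real.one_rpow]
    have : (0 : ℝ) ≤ 0 ^ (-ρ) := by positivity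
    linarith
  · rw [if_neg hn, add_zero, absOne, max_eq_right]
    exact_mod_cast Int.one_le_abs hn

/-- The bound for the lattice sums. -/
noncomputable def lattBound (ρ : ℝ) : ℝ :=
  ∑' x : ℤ × ℤ, absOne x.1 ^ (-ρ) * absOne x.2 ^ (-ρ)

lemma summable_absOne_prod {ρ : ℝ} (hρ : 1 < ρ) :
    Summable fun x : ℤ × ℤ => absOne x.1 ^ (-ρ) * absOne x.2 ^ (-ρ) :=
  (summable_absOne hρ).mul_of_nonneg (summable_absOne hρ)
    (fun n => by have := absOne_pos n; positivity) (fun n => by have := absOne_pos n; positivity)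

lemma lattBound_nonneg (ρ : ℝ) : 0 ≤ lattBound ρ := tsum_nonneg fun x => by
  have := absOne_pos x.1
  have := absOne_pos x.2
  positivity

lemma summable_tsum_comp_le {f : ℤ × ℤ → ℝ} (hf : Summable f) (h0 : ∀ x, 0 ≤ f x)
    {i : ℤ × ℤ → ℤ × ℤ} (hi : Function.Injective i) :
    Summable (fun d => f (i d)) ∧ ∑' d, f (i d) ≤ ∑' x, f x := by
  have h1 : Summable fun d => f (i d) := hf.comp_injective hi
  exact ⟨h1, h1.tsum_le_tsum_of_inj i hi (fun c _ => h0 c) (fun _ => le_rfl) hf⟩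

/-- Injectivity of the floors compares the lattice sum with a sum over ℤ². The bound therefore does
not depend on the shift `(ξ₁, ξ₂)`. -/
lemma lattice_sum {ρ : ℝ} (hρ : 1 < ρ) (ξ₁ ξ₂ : ℝ) :
    Summable (fun d : ℤ × ℤ =>
      absOne ⌊ξ₁ + latt1 d⌋ ^ (-ρ) * absOne ⌊ξ₂ + latt2 d⌋ ^ (-ρ)) ∧
    ∑' d : ℤ × ℤ, absOne ⌊ξ₁ + latt1 d⌋ ^ (-ρ) * absOne ⌊ξ₂ + latt2 d⌋ ^ (-ρ) ≤ lattBound ρ := by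
  have h := summable_tsum_comp_le (f := fun x : ℤ × ℤ => absOne x.1 ^ (-ρ) * absOne x.2 ^ (-ρ))
    (summable_absOne_prod hρ) (fun x => mul_nonneg (Real.rpow_nonneg (absOne_pos _).le _)
      (Real.rpow_nonneg (absOne_pos _).le _)) (floor_latt_injective ξ₁ ξ₂)
  exact h

/-- The additive error `B + 1` between `|w.re|` and `|⌊x⌋|` is absorbed into a multiple of `‖w‖`,
which is at least `η`. -/
lemma absOne_floor_le {η B : ℝ} (hη : 0 < η) (hB : 0 ≤ B) {w : ℂ} {x : ℝ} (hw : η ≤ w.im)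
    (hx : |w.re - x| ≤ B) : (1 + (B + 1) / η)⁻¹ * absOne ⌊x⌋ ≤ ‖w‖ := by
  have h1 : |(⌊x⌋ : ℝ)| ≤ |w.re| + (B + 1) := by
    have a := Int.floor_le x
    have b := Int.lt_floor_add_one x
    have c := abs_le.mp hx
    have d := le_abs_self w.re
    have e := neg_abs_le w.re
    rw [abs_le]
    constructor <;> linarith
  have h2 : absOne ⌊x⌋ ≤ |w.re| + (B + 1) :=
    max_le (by have := abs_nonneg w.re; linarith) h1
  have h3 := abs_re_le_norm w
  have h4 : η ≤ ‖w‖ := hw.trans ((le_abs_self _).trans (abs_im_le_norm w))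
  rw [inv_mul_le_iff₀ (by positivity)]
  have h5 : B + 1 ≤ (B + 1) / η * ‖w‖ := by
    rw [div_mul_eq_mul_div, le_div_iff₀ hη]
    gcongr
  linarith

/-- The summand `w ^ (-k) |w| ^ (-2s)`. -/
noncomputable def eterm (k : ℕ) (s : ℝ) (w : ℂ) : ℂ :=
  (w ^ k)⁻¹ * ((‖w‖ ^ (-(2 * s)) : ℝ) : ℂ)

lemma eterm_mul (k : ℕ) (s : ℝ) (w v : ℂ) : eterm k s (w * v) = eterm k s w * eterm k s v := by
  rw [eterm, eterm, eterm, norm_mul, Real.mul_rpow (norm_nonneg _) (norm_nonneg _), mul_pow,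
    mul_inv]
  push_cast
  ring

lemma norm_eterm (k : ℕ) (s : ℝ) {w : ℂ} (hw : w ≠ 0) :
    ‖eterm k s w‖ = ‖w‖ ^ (-(k + 2 * s)) := by
  have h : 0 < ‖w‖ := norm_pos_iff.mpr hw
  rw [eterm, norm_mul, norm_inv, norm_pow, norm_real, Real.norm_of_nonneg (by positivity),
    neg_add, Real.rpow_add h, Real.rpow_neg h.le (k : ℝ), Real.rpow_natCast]

lemma eterm_zero_right (k : ℕ) (w : ℂ) : eterm k 0 w = (w ^ k)⁻¹ := by
  simp [eterm]

end HilbertModular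

end

/-! ### Representatives of integers modulo units, and sums over their norms. -/

section

open Complex MeasureTheory Filter Set Function
open scoped Real goldenRatio

namespace HilbertModular

/-- Representatives of the nonzero integers modulo units: the totally positive `c` with
`c₂ ≤ c₁ < φ⁴ c₂`. -/
def Rep : Type := {c : ℤ × ℤ // 0 < latt2 c ∧ latt2 c ≤ latt1 c ∧ latt1 c < φ ^ 4 * latt2 c}

namespace Rep

variable (c : Rep)

/-- The first embedding. -/
noncomputable def l1 : ℝ := latt1 c.1

/-- The second embedding. -/
noncomputable def l2 : ℝ := latt2 c.1

/-- The norm. -/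
noncomputable def nm : ℝ := c.l1 * c.l2

lemma l2_pos : 0 < c.l2 := c.2.1

lemma l2_le_l1 : c.l2 ≤ c.l1 := c.2.2.1

lemma l1_pos : 0 < c.l1 := c.l2_pos.trans_le c.l2_le_l1

lemma goldenRatio_pow_four_lt : φ ^ 4 < 7 := by
  have h := Real.goldenRatio_sq
  have h1 := goldenRatio_lt
  have : φ ^ 4 = 3 * φ + 2 := by linear_combination (φ ^ 2 + φ + 2) * h
  linarith

lemma l1_lt : c.l1 < 7 * c.l2 :=
  c.2.2.2.trans (mul_lt_mul_of_pos_right goldenRatio_pow_four_lt c.l2_pos)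

lemma ne_zero : c.1 ≠ 0 := fun h => by
  have := c.l2_pos
  rw [l2, h] at this
  simp [latt2] at this

lemma one_le_nm : 1 ≤ c.nm := by
  have h := one_le_abs_latt_mul c.ne_zero
  rwa [show latt1 c.1 * latt2 c.1 = c.l1 * c.l2 from rfl,
    abs_of_pos (mul_pos c.l1_pos c.l2_pos)] at h

lemma nm_pos : 0 < c.nm := zero_lt_one.trans_le c.one_le_nm

/-- From 1 ≤ l₁l₂ < 7l₂² and 7/9 < 1. -/
lemma third_le_l2 : 1 / 3 ≤ c.l2 := by
  have h := c.one_le_nm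
  have h1 := c.l1_lt
  have h2 := c.l2_pos
  rw [nm] at h
  by_contra! h3
  nlinarith

lemma third_le_l1 : 1 / 3 ≤ c.l1 := c.third_le_l2.trans c.l2_le_l1

lemma absOne_floor_le_of_third {x : ℝ} (hx : 1 / 3 ≤ x) : absOne ⌊x⌋ ≤ 3 * x := by
  refine max_le (by linarith) ?_
  rw [abs_of_nonneg (by exact_mod_cast Int.floor_nonneg.mpr (by linarith))]
  linarith [Int.floor_le x]

lemma absOne_mul_le : absOne ⌊0 + c.l1⌋ * absOne ⌊0 + c.l2⌋ ≤ 9 * c.nm := by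
  rw [zero_add, zero_add]
  refine (mul_le_mul (absOne_floor_le_of_third c.third_le_l1)
    (absOne_floor_le_of_third c.third_le_l2) (absOne_pos _).le
    (by have := c.l1_pos; positivity)).trans_eq ?_
  rw [nm]; ring

lemma summable_nm {τ : ℝ} (hτ : 1 < τ) : Summable fun c : Rep => c.nm ^ (-τ) := by
  have h := ((lattice_sum hτ 0 0).1.mul_left (9 ^ τ)).comp_injective
    (i := fun c : Rep => c.1) Subtype.val_injective
  refine h.of_nonneg_of_le (fun c => Real.rpow_nonneg c.nm_pos.le _) fun c => ?_
  have h1 := absOne_pos ⌊0 + c.l1⌋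
  have h2 := absOne_pos ⌊0 + c.l2⌋
  change c.nm ^ (-τ) ≤ 9 ^ τ * (absOne ⌊0 + c.l1⌋ ^ (-τ) * absOne ⌊0 + c.l2⌋ ^ (-τ))
  rw [← Real.mul_rpow h1.le h2.le]
  have h3 := Real.rpow_le_rpow_of_nonpos (mul_pos h1 h2) c.absOne_mul_le
    (by linarith : -τ ≤ 0)
  rw [Real.mul_rpow (by norm_num) c.nm_pos.le, Real.rpow_neg (by norm_num)] at h3
  rwa [inv_mul_le_iff₀ (by positivity)] at h3

/-- The ratio of the two embeddings is bounded, so each is comparable with the square root of the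
norm. -/
lemma inv_l2_le : c.l2⁻¹ ≤ 3 * c.nm ^ (-(1 / 2) : ℝ) := by
  have h := c.l2_pos
  have h1 := c.l1_lt
  have h2 : √c.nm ≤ 3 * c.l2 := by
    rw [Real.sqrt_le_left (by positivity), nm]
    nlinarith
  have h3 : 0 < √c.nm := Real.sqrt_pos.mpr c.nm_pos
  rw [Real.rpow_neg c.nm_pos.le, ← Real.sqrt_eq_rpow, ← div_eq_mul_inv, le_div_iff₀ h3,
    inv_mul_le_iff₀ h]
  linarith

lemma inv_l1_le : c.l1⁻¹ ≤ 3 * c.nm ^ (-(1 / 2) : ℝ) :=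
  (inv_anti₀ c.l2_pos c.l2_le_l1).trans c.inv_l2_le

lemma floor_mem : 0 ≤ ⌊0 + c.l2⌋ ∧ ⌊0 + c.l2⌋ ≤ ⌊0 + c.l1⌋ := by
  rw [zero_add, zero_add]
  exact ⟨Int.floor_nonneg.mpr c.l2_pos.le, Int.floor_le_floor c.l2_le_l1⟩

/-- The floors of the two embeddings embed the representatives into the triangle `0 ≤ m ≤ n`, and
the norm is bounded below by a multiple of `n²`. The at most `2 · absOne n` points above `n` leave a
one-dimensional sum, so the pole at `s = 0` is at most simple. -/
lemma tsum_nm_le {s : ℝ} (hs : 0 < s) (hs1 : s ≤ 1) :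
    ∑' c : Rep, c.nm ^ (-(1 + 2 * s)) ≤ 2 * 63 ^ 3 * ∑' n : ℤ, absOne n ^ (-(1 + 4 * s)) := by
  have hsum := summable_absOne (ρ := 1 + 4 * s) (by linarith)
  set g : ℤ × ℤ → ℝ := fun x =>
    if 0 ≤ x.2 ∧ x.2 ≤ x.1 then absOne x.1 ^ (-(2 + 4 * s)) else 0 with hg
  have hg0 : ∀ x, 0 ≤ g x := fun x => by
    simp only [hg]
    split_ifs
    exacts [Real.rpow_nonneg (absOne_pos _).le _, le_rfl]
  have hrow : ∀ n : ℤ, HasSum (fun m => g (n, m))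
      (∑ m ∈ Finset.Icc 0 n, absOne n ^ (-(2 + 4 * s))) := fun n => by
    have : HasSum (fun m => g (n, m)) (∑ m ∈ Finset.Icc 0 n, g (n, m)) :=
      hasSum_sum_of_ne_finset_zero fun m hm => by
        simp only [hg]
        rw [if_neg]
        simpa using hm
    convert this using 1
    refine Finset.sum_congr rfl fun m hm => ?_
    simp only [hg]
    rw [if_pos]
    simpa using hm
  have hrow' : ∀ n : ℤ, ∑ m ∈ Finset.Icc 0 n, absOne n ^ (-(2 + 4 * s)) ≤
      2 * absOne n ^ (-(1 + 4 * s)) := fun n => by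
    have h1 := absOne_pos n
    rw [Finset.sum_const, nsmul_eq_mul, Int.card_Icc]
    have h2 : (((n + 1 - 0).toNat : ℕ) : ℝ) ≤ 2 * absOne n := by
      have h3 : ((n + 1 - 0).toNat : ℤ) ≤ |n| + 1 := by
        have := le_abs_self n
        have := abs_nonneg n
        omega
      have h4 : (((n + 1 - 0).toNat : ℕ) : ℝ) ≤ |(n : ℝ)| + 1 := by exact_mod_cast h3
      have h5 : |(n : ℝ)| ≤ absOne n := le_max_right _ _
      linarith [one_le_absOne n]
    calc _ ≤ 2 * absOne n * absOne n ^ (-(2 + 4 * s)) := by gcongr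
      _ = 2 * absOne n ^ (-(1 + 4 * s)) := by
        rw [mul_assoc, ← Real.rpow_one_add' h1.le (by linarith)]
        congr 2; ring
  have hgs : Summable g := by
    rw [summable_prod_of_nonneg hg0]
    refine ⟨fun n => (hrow n).summable, ?_⟩
    refine (hsum.mul_left 2).of_nonneg_of_le (fun n => tsum_nonneg fun m => hg0 _) fun n => ?_
    rw [(hrow n).tsum_eq]
    exact hrow' n
  have hgt : ∑' x, g x ≤ 2 * ∑' n : ℤ, absOne n ^ (-(1 + 4 * s)) := by
    rw [hgs.tsum_prod, ← tsum_mul_left]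
    refine Summable.tsum_le_tsum (fun n => ?_) hgs.prod (hsum.mul_left 2)
    rw [(hrow n).tsum_eq]
    exact hrow' n
  have hb := summable_tsum_comp_le hgs hg0 (floor_latt_injective 0 0)
  have hinj : Function.Injective fun c : Rep => c.1 := Subtype.val_injective
  calc ∑' c : Rep, c.nm ^ (-(1 + 2 * s))
      ≤ ∑' d : ℤ × ℤ, 63 ^ 3 * g (⌊0 + latt1 d⌋, ⌊0 + latt2 d⌋) := by
        refine (summable_nm (by linarith)).tsum_le_tsum_of_inj _ hinj
          (fun d _ => mul_nonneg (by norm_num) (hg0 _)) (fun c => ?_) (hb.1.mul_left _)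
        change _ ≤ 63 ^ 3 * g (⌊0 + c.l1⌋, ⌊0 + c.l2⌋)
        simp only [hg]
        rw [if_pos c.floor_mem]
        have h1 := absOne_pos ⌊0 + c.l1⌋
        -- The constant is 9 · 7: the floor costs a factor 3 before squaring, and l₁ < 7l₂.
        have h2 : absOne ⌊0 + c.l1⌋ ^ (2 : ℝ) ≤ 63 * c.nm := by
          have h3 := absOne_floor_le_of_third c.third_le_l1
          rw [zero_add] at h1 ⊢
          rw [Real.rpow_two, nm]
          have := c.l1_lt
          have := c.l1_pos
          nlinarith
        have h3 := Real.rpow_le_rpow_of_nonpos (by positivity) h2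
          (by linarith : -(1 + 2 * s) ≤ 0)
        rw [Real.mul_rpow (by norm_num) c.nm_pos.le, ← Real.rpow_mul h1.le,
          Real.rpow_neg (by norm_num), inv_mul_le_iff₀ (by positivity)] at h3
        refine h3.trans ?_
        rw [show 2 * -(1 + 2 * s) = -(2 + 4 * s) by ring]
        refine mul_le_mul_of_nonneg_right ?_ (by positivity)
        -- For `s ≤ 1` the power 63^(1 + 2s) is at most 63³, uniformly in `s`.
        rw [← Real.rpow_natCast]
        exact Real.rpow_le_rpow_of_exponent_le (by norm_num) (by push_cast; linarith)
    _ ≤ 63 ^ 3 * (2 * ∑' n : ℤ, absOne n ^ (-(1 + 4 * s))) := by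
        rw [tsum_mul_left]
        gcongr
        exact hb.2.trans hgt
    _ = _ := by ring

lemma tsum_absOne_eq {ρ : ℝ} (hρ : 1 < ρ) :
    ∑' n : ℤ, absOne n ^ (-ρ) = 1 + 2 * ∑' n : ℕ, 1 / ((n : ℝ) + 1) ^ ρ := by
  have h := summable_absOne hρ
  have he : ∀ n : ℕ, absOne ((n : ℤ) + 1) ^ (-ρ) = 1 / ((n : ℝ) + 1) ^ ρ := fun n => by
    have h1 : absOne ((n : ℤ) + 1) = (n : ℝ) + 1 := by
      rw [absOne]
      push_cast
      rw [abs_of_nonneg (by positivity), max_eq_right (by simp)]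
    rw [h1, Real.rpow_neg (by positivity), one_div]
  have he' : ∀ n : ℕ, absOne (-((n : ℤ) + 1)) = absOne ((n : ℤ) + 1) := fun n => by
    simp only [absOne, Int.cast_neg, abs_neg]
  rw [tsum_of_add_one_of_neg_add_one]
  · simp only [he', he]
    have : absOne 0 = 1 := by simp [absOne]
    rw [this, Real.one_rpow]
    ring
  · exact h.comp_injective (i := fun n : ℕ => (n : ℤ) + 1) fun a b h => by simpa using h
  · exact h.comp_injective (i := fun n : ℕ => -((n : ℤ) + 1)) fun a b h => by simpa using h

/-- The sum over norms is O(1/s) by comparison with the Riemann zeta function near 1, so a double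
zero in `s` annihilates it. -/
lemma tendsto_sq_mul_tsum_nm :
    Tendsto (fun s : ℝ => s ^ 2 * ∑' c : Rep, c.nm ^ (-(1 + 2 * s))) (𝓝[>] 0) (𝓝 0) := by
  have h1 : Tendsto (fun s : ℝ => 1 + 4 * s) (𝓝[>] 0) (𝓝[>] 1) := by
    refine tendsto_nhdsWithin_iff.mpr ⟨?_, ?_⟩
    · have : Tendsto (fun s : ℝ => 1 + 4 * s) (𝓝 0) (𝓝 (1 + 4 * 0)) :=
        Continuous.tendsto (by fun_prop) 0
      simpa using this.mono_left nhdsWithin_le_nhds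
    · filter_upwards [self_mem_nhdsWithin] with s hs
      simp only [Set.mem_Ioi] at hs ⊢
      linarith
  have h2 := tendsto_sub_mul_tsum_nat_rpow.comp h1
  have h3 : Tendsto (fun s : ℝ => s) (𝓝[>] (0 : ℝ)) (𝓝 0) := nhdsWithin_le_nhds
  have h4 : Tendsto (fun s : ℝ => 2 * 63 ^ 3 * (s ^ 2 + s / 2 *
      ((1 + 4 * s - 1) * ∑' n : ℕ, 1 / (n : ℝ) ^ (1 + 4 * s)))) (𝓝[>] 0)
      (𝓝 (2 * 63 ^ 3 * (0 ^ 2 + 0 / 2 * 1))) :=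
    ((h3.pow 2).add ((h3.div_const 2).mul h2)).const_mul _
  rw [show (2 * 63 ^ 3 * (0 ^ 2 + 0 / 2 * 1) : ℝ) = 0 by norm_num] at h4
  refine squeeze_zero' ?_ ?_ h4
  · exact Eventually.of_forall fun s => mul_nonneg (sq_nonneg s)
      (tsum_nonneg fun c => Real.rpow_nonneg c.nm_pos.le _)
  · filter_upwards [Ioc_mem_nhdsGT (zero_lt_one' ℝ)] with s hs
    refine (mul_le_mul_of_nonneg_left (tsum_nm_le hs.1 hs.2) (sq_nonneg s)).trans_eq ?_
    have hρ : 1 < 1 + 4 * s := by linarith [hs.1]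
    have hz : ∑' n : ℕ, 1 / (n : ℝ) ^ (1 + 4 * s) = ∑' n : ℕ, 1 / ((n : ℝ) + 1) ^ (1 + 4 * s) := by
      rw [(Real.summable_one_div_nat_rpow.mpr hρ).tsum_eq_zero_add]
      simp [Real.zero_rpow (by linarith : 1 + 4 * s ≠ 0)]
    rw [tsum_absOne_eq hρ, hz]
    ring

end Rep

end HilbertModular

end

/-! ### Majorants for the lattice sums in the Eisenstein series. -/

section

open Complex MeasureTheory Filter Set Function
open scoped Real goldenRatio

namespace HilbertModular

/-- The exponent is split: a part `ρ` is spent on summability over the lattice, the rest on decay in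
the height. -/
lemma rpow_neg_le {A Y x σ ρ : ℝ} (hA : 0 < A) (hY : 0 < Y) (hAx : A ≤ x) (hYx : Y ≤ x)
    (hρ : 0 ≤ ρ) (hσ : ρ ≤ σ) : x ^ (-σ) ≤ A ^ (-ρ) * Y ^ (-(σ - ρ)) := by
  have hx := hA.trans_le hAx
  rw [show -σ = -ρ + -(σ - ρ) by ring, Real.rpow_add hx]
  exact mul_le_mul (Real.rpow_le_rpow_of_nonpos hA hAx (by linarith))
    (Real.rpow_le_rpow_of_nonpos hY hYx (by linarith)) (by positivity) (by positivity)

/-- The constant in the lower bound for `‖w‖` in terms of the floor of the real part. -/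
noncomputable def floorConst (η B : ℝ) : ℝ := (1 + (B + 1) / η)⁻¹

lemma floorConst_pos {η B : ℝ} (hη : 0 < η) (hB : 0 ≤ B) : 0 < floorConst η B := by
  unfold floorConst; positivity

section

variable {η B Y σ ρ x : ℝ} {w : ℂ}

lemma norm_rpow_le (hη : 0 < η) (hB : 0 ≤ B) (hY : η ≤ Y) (hw : Y ≤ w.im)
    (hx : |w.re - x| ≤ B) (hρ : 0 ≤ ρ) (hσ : ρ ≤ σ) :
    ‖w‖ ^ (-σ) ≤ floorConst η B ^ (-ρ) * (absOne ⌊x⌋ ^ (-ρ) * Y ^ (-(σ - ρ))) := by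
  have h1 := floorConst_pos hη hB
  have h2 := absOne_pos ⌊x⌋
  rw [← mul_assoc, ← Real.mul_rpow h1.le h2.le]
  exact rpow_neg_le (mul_pos h1 h2) (hη.trans_le hY)
    (absOne_floor_le hη hB (hY.trans hw) hx) (hw.trans (im_le_norm w)) hρ hσ

lemma ne_zero_of_im {w : ℂ} (hw : 0 < w.im) : w ≠ 0 := fun h => by simp [h] at hw

lemma norm_eterm_le {k : ℕ} {s : ℝ} (hη : 0 < η) (hB : 0 ≤ B) (hY : η ≤ Y) (hw : Y ≤ w.im)
    (hx : |w.re - x| ≤ B) (hρ : 0 ≤ ρ) (hσ : ρ ≤ k + 2 * s) :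
    ‖eterm k s w‖ ≤ floorConst η B ^ (-ρ) * (absOne ⌊x⌋ ^ (-ρ) * Y ^ (-(k + 2 * s - ρ))) := by
  rw [norm_eterm k s (ne_zero_of_im (hη.trans_le (hY.trans hw)))]
  exact norm_rpow_le hη hB hY hw hx hρ hσ

end

/-- The summand of the Eisenstein series for the second row `(1, d)`. -/
noncomputable def pterm (k : ℕ) (s : ℝ) (z : ℂ × ℂ) (d : ℤ × ℤ) : ℂ :=
  eterm k s (z.1 + latt1 d) * eterm k s (z.2 + latt2 d)

/-- The terms of the lattice sums. -/
noncomputable def lterm (ρ ξ₁ ξ₂ : ℝ) (d : ℤ × ℤ) : ℝ :=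
  absOne ⌊ξ₁ + latt1 d⌋ ^ (-ρ) * absOne ⌊ξ₂ + latt2 d⌋ ^ (-ρ)

lemma summable_lterm {ρ : ℝ} (hρ : 1 < ρ) (ξ₁ ξ₂ : ℝ) : Summable (lterm ρ ξ₁ ξ₂) :=
  (lattice_sum hρ ξ₁ ξ₂).1

lemma tsum_lterm_le {ρ : ℝ} (hρ : 1 < ρ) (ξ₁ ξ₂ : ℝ) : ∑' d, lterm ρ ξ₁ ξ₂ d ≤ lattBound ρ :=
  (lattice_sum hρ ξ₁ ξ₂).2

/-- The real parts may vary within `B` of fixed `ξ₁, ξ₂` while the lattice majorant stays the same;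
this gives locally uniform convergence. -/
lemma norm_pterm_le {k : ℕ} {s η B Y₁ Y₂ ρ ξ₁ ξ₂ : ℝ} {z : ℂ × ℂ} (hη : 0 < η) (hB : 0 ≤ B)
    (hY₁ : η ≤ Y₁) (hY₂ : η ≤ Y₂) (h1 : Y₁ ≤ z.1.im) (h2 : Y₂ ≤ z.2.im)
    (hx₁ : |z.1.re - ξ₁| ≤ B) (hx₂ : |z.2.re - ξ₂| ≤ B) (hρ : 0 ≤ ρ) (hσ : ρ ≤ k + 2 * s)
    (d : ℤ × ℤ) :
    ‖pterm k s z d‖ ≤ (floorConst η B ^ (-ρ)) ^ 2 * (Y₁ * Y₂) ^ (-(k + 2 * s - ρ)) *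
      lterm ρ ξ₁ ξ₂ d := by
  have a := norm_eterm_le (k := k) (s := s) (w := z.1 + latt1 d) (x := ξ₁ + latt1 d) hη hB hY₁
    (by simpa using h1) (by simpa using hx₁) hρ hσ
  have b := norm_eterm_le (k := k) (s := s) (w := z.2 + latt2 d) (x := ξ₂ + latt2 d) hη hB hY₂
    (by simpa using h2) (by simpa using hx₂) hρ hσ
  rw [pterm, norm_mul, Real.mul_rpow (hη.le.trans hY₁) (hη.le.trans hY₂), lterm]
  refine (mul_le_mul a b (norm_nonneg _) ((norm_nonneg _).trans a)).trans_eq ?_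
  ring

/-- The sum of `pterm` over the lattice. -/
noncomputable def pSum (k : ℕ) (s : ℝ) (z : ℂ × ℂ) : ℂ := ∑' d, pterm k s z d

lemma summable_pterm {k : ℕ} {s : ℝ} (h : 1 < k + 2 * s) {z : ℂ × ℂ} (hz : z ∈ H2) :
    Summable fun d => ‖pterm k s z d‖ := by
  set η := min z.1.im z.2.im
  have hη : 0 < η := lt_min hz.1 hz.2
  refine ((summable_lterm h z.1.re z.2.re).mul_left _).of_nonneg_of_le (fun d => norm_nonneg _)
    (norm_pterm_le hη le_rfl (min_le_left _ _) (min_le_right _ _) le_rfl le_rfl (by simp)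
      (by simp) (by linarith) le_rfl)

lemma tsum_norm_pterm_le {k : ℕ} {s η ρ : ℝ} {z : ℂ × ℂ} (hη : 0 < η)
    (h1 : η ≤ z.1.im) (h2 : η ≤ z.2.im) (hρ : 1 < ρ) (hσ : ρ ≤ k + 2 * s) :
    ∑' d, ‖pterm k s z d‖ ≤ (floorConst η 0 ^ (-ρ)) ^ 2 * lattBound ρ *
      (z.1.im * z.2.im) ^ (-(k + 2 * s - ρ)) := by
  have hz : z ∈ H2 := ⟨hη.trans_le h1, hη.trans_le h2⟩
  calc _ ≤ ∑' d, (floorConst η 0 ^ (-ρ)) ^ 2 * (z.1.im * z.2.im) ^ (-(k + 2 * s - ρ)) *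
        lterm ρ z.1.re z.2.re d :=
        (summable_pterm (by linarith) hz).tsum_le_tsum
          (norm_pterm_le hη le_rfl h1 h2 le_rfl le_rfl (by simp) (by simp) (by linarith) hσ)
          ((summable_lterm hρ _ _).mul_left _)
    _ ≤ _ := by
        rw [tsum_mul_left]
        refine (mul_le_mul_of_nonneg_left (tsum_lterm_le hρ _ _) ?_).trans_eq (by ring)
        have := hz.1
        have := hz.2
        positivity

lemma norm_pSum_le {k : ℕ} {s η ρ : ℝ} {z : ℂ × ℂ} (hη : 0 < η)
    (h1 : η ≤ z.1.im) (h2 : η ≤ z.2.im) (hρ : 1 < ρ) (hσ : ρ ≤ k + 2 * s) :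
    ‖pSum k s z‖ ≤ (floorConst η 0 ^ (-ρ)) ^ 2 * lattBound ρ *
      (z.1.im * z.2.im) ^ (-(k + 2 * s - ρ)) :=
  (norm_tsum_le_tsum_norm (summable_pterm (by linarith)
    ⟨hη.trans_le h1, hη.trans_le h2⟩)).trans (tsum_norm_pterm_le hη h1 h2 hρ hσ)

namespace Rep

/-- Multiplication of a point of `ℍ²` by a totally positive integer. -/
noncomputable def mulPt (c : Rep) (z : ℂ × ℂ) : ℂ × ℂ := ((c.l1 : ℂ) * z.1, (c.l2 : ℂ) * z.2)

variable (c : Rep) {z : ℂ × ℂ}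

lemma mulPt_fst_im (z : ℂ × ℂ) : (c.mulPt z).1.im = c.l1 * z.1.im := by simp [mulPt]

lemma mulPt_snd_im (z : ℂ × ℂ) : (c.mulPt z).2.im = c.l2 * z.2.im := by simp [mulPt]

lemma mulPt_mem (hz : z ∈ H2) : c.mulPt z ∈ H2 :=
  ⟨by rw [mulPt_fst_im]; exact mul_pos c.l1_pos hz.1, by
    rw [mulPt_snd_im]; exact mul_pos c.l2_pos hz.2⟩

/-- A lower bound for the imaginary parts of all multiples of a point. -/
noncomputable def minIm (z : ℂ × ℂ) : ℝ := min z.1.im z.2.im / 3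

lemma minIm_pos (hz : z ∈ H2) : 0 < minIm z := div_pos (lt_min hz.1 hz.2) (by norm_num)

lemma minIm_le_fst (hz : z ∈ H2) : minIm z ≤ (c.mulPt z).1.im := by
  rw [mulPt_fst_im, minIm]
  have h1 := min_le_left z.1.im z.2.im
  have h2 := c.third_le_l1
  have := hz.1
  nlinarith

lemma minIm_le_snd (hz : z ∈ H2) : minIm z ≤ (c.mulPt z).2.im := by
  rw [mulPt_snd_im, minIm]
  have h1 := min_le_right z.1.im z.2.im
  have h2 := c.third_le_l2
  have := hz.2
  nlinarith

lemma im_mul_im : (c.mulPt z).1.im * (c.mulPt z).2.im = c.nm * (z.1.im * z.2.im) := by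
  rw [mulPt_fst_im, mulPt_snd_im, nm]; ring

lemma tsum_norm_pterm_mulPt_le {k : ℕ} {s ρ : ℝ} (hz : z ∈ H2) (hρ : 1 < ρ)
    (hσ : ρ ≤ k + 2 * s) :
    ∑' d, ‖pterm k s (c.mulPt z) d‖ ≤ (floorConst (minIm z) 0 ^ (-ρ)) ^ 2 * lattBound ρ *
      (z.1.im * z.2.im) ^ (-(k + 2 * s - ρ)) * c.nm ^ (-(k + 2 * s - ρ)) := by
  refine (tsum_norm_pterm_le (minIm_pos hz) (c.minIm_le_fst hz) (c.minIm_le_snd hz) hρ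
    hσ).trans_eq ?_
  have h1 : 0 ≤ c.nm := c.nm_pos.le
  have h2 : 0 ≤ z.1.im * z.2.im := mul_nonneg hz.1.le hz.2.le
  rw [im_mul_im, Real.mul_rpow h1 h2]
  ring

lemma summable_pterm_mulPt {k : ℕ} {s : ℝ} (hz : z ∈ H2) (h : 2 < k + 2 * s) :
    Summable fun x : Rep × (ℤ × ℤ) => ‖pterm k s (x.1.mulPt z) x.2‖ := by
  rw [summable_prod_of_nonneg fun x => norm_nonneg _]
  have h1 : ∀ c : Rep, Summable fun d => ‖pterm k s (c.mulPt z) d‖ := fun c =>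
    summable_pterm (by linarith) (c.mulPt_mem hz)
  refine ⟨h1, ?_⟩
  -- Half of the exponent makes the sum over `d` converge, the other half the sum over `c`.
  have h2 : 1 < (k + 2 * s) / 2 := by linarith
  have h3 := fun c : Rep => c.tsum_norm_pterm_mulPt_le (k := k) (s := s) hz h2 (by linarith)
  simp only [sub_half] at h3
  exact ((summable_nm h2).mul_left _).of_nonneg_of_le
    (fun c => tsum_nonneg fun d => norm_nonneg _) h3

end Rep

end HilbertModular

end

/-! ### Unfolding sums over the lattice into integrals over the plane. -/

section

open Complex MeasureTheory Filter Set Function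
open scoped Real goldenRatio

namespace HilbertModular

/-- The unit square. -/
def unitCell : Set (ℝ × ℝ) := Ioc 0 1 ×ˢ Ioc 0 1

/-- The map from coordinates with respect to `1, (1 + √5) / 2` to the pair of embeddings. -/
noncomputable def coordMap : ℝ × ℝ →ₗ[ℝ] ℝ × ℝ :=
  Matrix.toLin (Module.Basis.finTwoProd ℝ) (Module.Basis.finTwoProd ℝ) !![1, φ; 1, ψ]

lemma coordMap_apply (x : ℝ × ℝ) : coordMap x = (x.1 + φ * x.2, x.1 + ψ * x.2) := by
  rw [coordMap, Matrix.toLin_finTwoProd_apply]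
  simp

lemma det_coordMap : LinearMap.det coordMap = -√5 := by
  rw [coordMap, LinearMap.det_toLin, Matrix.det_fin_two]
  simp only [Matrix.of_apply, Matrix.cons_val', Matrix.cons_val_zero, Matrix.cons_val_one,
    Matrix.cons_val_fin_one]
  linarith [goldenRatio_sub_goldenConj']

lemma det_coordMap_ne_zero : LinearMap.det coordMap ≠ 0 := by
  rw [det_coordMap]; exact neg_ne_zero.mpr sqrt_five_ne_zero

lemma measurableEmbedding_coordMap : MeasurableEmbedding coordMap :=
  (LinearMap.equivOfDetNeZero coordMap
    det_coordMap_ne_zero).toContinuousLinearEquiv.toHomeomorph.measurableEmbedding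

lemma map_coordMap : (volume : Measure (ℝ × ℝ)).map coordMap =
    ENNReal.ofReal (√5)⁻¹ • volume := by
  rw [Measure.map_linearMap_addHaar_eq_smul_addHaar _ det_coordMap_ne_zero, det_coordMap]
  congr 2
  rw [abs_inv, abs_neg, abs_of_nonneg (Real.sqrt_nonneg 5)]

section

variable {𝕜 : Type*} [RCLike 𝕜] {G H : ℝ → 𝕜}

lemma integrable_mul_coordMap (hG : Integrable G) (hH : Integrable H) :
    Integrable fun x : ℝ × ℝ => G (x.1 + φ * x.2) * H (x.1 + ψ * x.2) := by
  have h1 : Integrable (fun x : ℝ × ℝ => G x.1 * H x.2) (volume.map coordMap) := by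
    rw [map_coordMap]
    exact (hG.mul_prod hH).smul_measure ENNReal.ofReal_ne_top
  rw [measurableEmbedding_coordMap.integrable_map_iff] at h1
  refine h1.congr (Eventually.of_forall fun x => ?_)
  simp [coordMap_apply]

lemma integral_mul_coordMap (G H : ℝ → 𝕜) :
    ∫ x : ℝ × ℝ, G (x.1 + φ * x.2) * H (x.1 + ψ * x.2) =
      ((√5)⁻¹ : ℝ) • ((∫ x, G x) * ∫ x, H x) := by
  have h1 := measurableEmbedding_coordMap.integral_map (μ := volume)
    (fun x : ℝ × ℝ => G x.1 * H x.2)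
  rw [map_coordMap, integral_smul_measure, ENNReal.toReal_ofReal (by positivity)] at h1
  have h2 : ∫ x : ℝ × ℝ, G x.1 * H x.2 = (∫ x, G x) * ∫ x, H x := integral_prod_mul G H
  rw [← h2, h1]
  refine integral_congr_ae (Eventually.of_forall fun x => ?_)
  simp [coordMap_apply]

/-- The lattice translates of the unit square. -/
def cellAt (d : ℤ × ℤ) : Set (ℝ × ℝ) := Ioc (d.1 : ℝ) (d.1 + 1) ×ˢ Ioc (d.2 : ℝ) (d.2 + 1)

lemma measurableSet_cellAt (d : ℤ × ℤ) : MeasurableSet (cellAt d) :=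
  measurableSet_Ioc.prod measurableSet_Ioc

lemma measurableSet_unitCell : MeasurableSet unitCell := measurableSet_Ioc.prod measurableSet_Ioc

lemma mem_cellAt {d : ℤ × ℤ} {x : ℝ × ℝ} :
    x ∈ cellAt d ↔ d = (⌈x.1⌉ - 1, ⌈x.2⌉ - 1) := by
  have key : ∀ (n : ℤ) (t : ℝ), (t ∈ Ioc (n : ℝ) (n + 1)) ↔ n = ⌈t⌉ - 1 := fun n t => by
    rw [eq_sub_iff_add_eq, eq_comm, Int.ceil_eq_iff, Set.mem_Ioc]
    push_cast
    rw [add_sub_cancel_right]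
  rw [cellAt, Set.mem_prod, key, key, Prod.ext_iff]

lemma iUnion_cellAt : ⋃ d, cellAt d = univ := by
  refine eq_univ_of_forall fun x => mem_iUnion.mpr ⟨_, mem_cellAt.mpr rfl⟩

lemma disjoint_cellAt : Pairwise (Disjoint on cellAt) := fun _ _ hde =>
  Set.disjoint_left.mpr fun _ h1 h2 => hde ((mem_cellAt.mp h1).trans (mem_cellAt.mp h2).symm)

lemma preimage_cellAt (d : ℤ × ℤ) :
    (fun x : ℝ × ℝ => x + ((d.1 : ℝ), (d.2 : ℝ))) ⁻¹' cellAt d = unitCell := by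
  ext x
  simp only [cellAt, unitCell, Set.mem_preimage, Set.mem_prod, Prod.fst_add, Prod.snd_add,
    Set.mem_Ioc]
  constructor <;> rintro ⟨⟨a, b⟩, c, d⟩ <;> refine ⟨⟨?_, ?_⟩, ?_, ?_⟩ <;> linarith

lemma coord_add (x : ℝ × ℝ) (d : ℤ × ℤ) :
    (x.1 + d.1) + φ * (x.2 + d.2) = x.1 + φ * x.2 + latt1 d ∧
    (x.1 + d.1) + ψ * (x.2 + d.2) = x.1 + ψ * x.2 + latt2 d := by
  simp only [latt1, latt2]
  constructor <;> ring

lemma integrableOn_unitCell (hG : Integrable G) (hH : Integrable H) (d : ℤ × ℤ) :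
    IntegrableOn (fun x : ℝ × ℝ => G (x.1 + φ * x.2 + latt1 d) * H (x.1 + ψ * x.2 + latt2 d))
      unitCell := by
  have h := (measurePreserving_add_right (volume : Measure (ℝ × ℝ))
    ((d.1 : ℝ), (d.2 : ℝ))).integrable_comp_of_integrable (integrable_mul_coordMap hG hH)
  refine (h.congr (Eventually.of_forall fun x => ?_)).integrableOn
  simp only [comp_apply, Prod.fst_add, Prod.snd_add, (coord_add x d).1, (coord_add x d).2]

/-- The translates of the unit cell tile the plane; the embeddings form a linear map with
determinant −√5, after which the integral is a product. -/
lemma hasSum_unitCell (hG : Integrable G) (hH : Integrable H) :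
    HasSum (fun d : ℤ × ℤ => ∫ x in unitCell,
      G (x.1 + φ * x.2 + latt1 d) * H (x.1 + ψ * x.2 + latt2 d))
      (((√5)⁻¹ : ℝ) • ((∫ x, G x) * ∫ x, H x)) := by
  have h := hasSum_integral_iUnion measurableSet_cellAt disjoint_cellAt
    (integrable_mul_coordMap hG hH).integrableOn
  rw [iUnion_cellAt, setIntegral_univ, integral_mul_coordMap] at h
  refine h.congr_fun fun d => ?_
  have e := (measurePreserving_add_right (volume : Measure (ℝ × ℝ))
    ((d.1 : ℝ), (d.2 : ℝ))).setIntegral_preimage_emb (measurableEmbedding_addRight _)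
    (fun x : ℝ × ℝ => G (x.1 + φ * x.2) * H (x.1 + ψ * x.2)) (cellAt d)
  rw [← e, preimage_cellAt]
  refine setIntegral_congr_fun measurableSet_unitCell fun x _ => ?_
  simp only [Prod.fst_add, Prod.snd_add, (coord_add x d).1, (coord_add x d).2]

end

/-- Unfolding a sum over the lattice of integers of `ℚ(√5)`. -/
lemma integral_tsum_unitCell {G H : ℝ → ℂ} (hG : Integrable G) (hH : Integrable H) :
    ∫ x in unitCell, ∑' d : ℤ × ℤ, G (x.1 + φ * x.2 + latt1 d) * H (x.1 + ψ * x.2 + latt2 d) =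
      ((√5)⁻¹ : ℝ) • ((∫ x, G x) * ∫ x, H x) := by
  refine ((hasSum_integral_of_summable_integral_norm (integrableOn_unitCell hG hH) ?_).unique
    (hasSum_unitCell hG hH))
  simpa only [norm_mul] using (hasSum_unitCell hG.norm hH.norm).summable

end HilbertModular

end

/-! ### Integrals of the Hecke summand along horizontal lines. -/

section

open Complex MeasureTheory Filter Set Function
open scoped Real goldenRatio

namespace HilbertModular

lemma norm_add_mul_I_rpow (x Y s : ℝ) :
    ‖(x + Y * I : ℂ)‖ ^ (-(2 * s)) = (x ^ 2 + Y ^ 2) ^ (-s) := by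
  rw [show -(2 * s) = 2 * -s by ring, Real.rpow_mul (norm_nonneg _), Real.rpow_two,
    Complex.sq_norm, normSq_add_mul_I]

section

variable {Y : ℝ}

lemma hasDerivAt_eterm (k : ℕ) (s : ℝ) (hY : 0 < Y) (x : ℝ) :
    HasDerivAt (fun x : ℝ => eterm k s (x + Y * I))
      (-(k * eterm (k + 1) s (x + Y * I)) - 2 * s * x * eterm k (s + 1) (x + Y * I)) x := by
  have hpos : 0 < x ^ 2 + Y ^ 2 := by positivity
  have hw : (x + Y * I : ℂ) ≠ 0 := ne_zero_of_im (by simpa)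
  have h1 : HasDerivAt (fun x : ℝ => (x + Y * I : ℂ)) 1 x :=
    (hasDerivAt_id (x : ℂ)).comp_ofReal.add_const _
  have h2 : HasDerivAt (fun x : ℝ => ((x + Y * I : ℂ) ^ k)⁻¹) _ x :=
    (h1.pow k).inv (pow_ne_zero k hw)
  have h3 : HasDerivAt (fun x : ℝ => x ^ 2 + Y ^ 2) (2 * x) x := by
    simpa using (hasDerivAt_pow 2 x).add_const (Y ^ 2)
  have h4 := (h3.rpow_const (p := -s) (Or.inl hpos.ne')).ofReal_comp
  have h5 := h2.mul h4
  simp only [eterm, norm_add_mul_I_rpow]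
  refine h5.congr_deriv ?_
  rw [show -s - 1 = -(s + 1) by ring]
  push_cast
  rcases k with _ | k
  · simp only [Pi.pow_apply, Nat.cast_zero, pow_zero]
    ring
  · simp only [Nat.add_sub_cancel, Pi.pow_apply]
    field_simp
    push_cast
    ring

lemma norm_deriv_eterm_le (k : ℕ) {s : ℝ} (hs : 0 ≤ s) (hY : 0 < Y) (x : ℝ) :
    ‖-(k * eterm (k + 1) s (x + Y * I)) - 2 * s * x * eterm k (s + 1) (x + Y * I)‖ ≤
      (k + 2 * s) * ‖(x + Y * I : ℂ)‖ ^ (-(k + 1 + 2 * s)) := by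
  have hw : (x + Y * I : ℂ) ≠ 0 := ne_zero_of_im (by simpa)
  have hn := norm_pos_iff.mpr hw
  have hx : |x| ≤ ‖(x + Y * I : ℂ)‖ := by simpa using abs_re_le_norm (x + Y * I : ℂ)
  refine (norm_sub_le _ _).trans ?_
  rw [norm_neg, norm_mul, norm_mul, norm_eterm _ _ hw, norm_eterm _ _ hw, add_mul]
  simp only [norm_mul, norm_natCast, Complex.norm_ofNat, norm_real, Real.norm_eq_abs,
    abs_of_nonneg hs]
  push_cast
  refine add_le_add le_rfl ?_
  have e : ‖(x + Y * I : ℂ)‖ ^ (-(k + 1 + 2 * s)) =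
      ‖(x + Y * I : ℂ)‖ * ‖(x + Y * I : ℂ)‖ ^ (-(k + 2 * (s + 1))) := by
    nth_rewrite 2 [← Real.rpow_one ‖(x + Y * I : ℂ)‖]
    rw [← Real.rpow_add hn]
    congr 1; ring
  rw [e, ← mul_assoc]
  gcongr

lemma continuous_eterm (k : ℕ) (s : ℝ) (hY : 0 < Y) :
    Continuous fun x : ℝ => eterm k s (x + Y * I) :=
  continuous_iff_continuousAt.mpr fun x => (hasDerivAt_eterm k s hY x).continuousAt

lemma integrable_inv_sq_add_sq (hY : 0 < Y) : Integrable fun x : ℝ => (x ^ 2 + Y ^ 2)⁻¹ := by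
  have h := (integrable_inv_one_add_sq.comp_div hY.ne').const_mul (Y ^ 2)⁻¹
  refine h.congr (Eventually.of_forall fun x => ?_)
  simp only
  rw [← mul_inv]
  congr 1
  field_simp
  ring

lemma integral_inv_sq_add_sq (hY : 0 < Y) : ∫ x : ℝ, (x ^ 2 + Y ^ 2)⁻¹ = π / Y := by
  have h : ∀ x : ℝ, (x ^ 2 + Y ^ 2)⁻¹ = (Y ^ 2)⁻¹ * (1 + (x / Y) ^ 2)⁻¹ := fun x => by
    rw [← mul_inv]
    congr 1
    field_simp
    ring
  simp only [h]
  rw [integral_const_mul, Measure.integral_comp_div (fun x : ℝ => (1 + x ^ 2)⁻¹) Y,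
    integral_univ_inv_one_add_sq, abs_of_pos hY, smul_eq_mul]
  field_simp

lemma norm_rpow_two_le {s : ℝ} (hs : 0 ≤ s) (hY : 0 < Y) (x : ℝ) :
    ‖(x + Y * I : ℂ)‖ ^ (-(2 + 2 * s)) ≤ Y ^ (-(2 * s)) * (x ^ 2 + Y ^ 2)⁻¹ := by
  have hw : (x + Y * I : ℂ) ≠ 0 := ne_zero_of_im (by simpa)
  have hn := norm_pos_iff.mpr hw
  rw [neg_add, Real.rpow_add hn, mul_comm]
  refine mul_le_mul ?_ ?_ (by positivity) (by positivity)
  · exact Real.rpow_le_rpow_of_nonpos hY (by simpa using im_le_norm (x + Y * I : ℂ))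
      (by linarith)
  · have := norm_add_mul_I_rpow x Y 1
    rw [mul_one] at this
    rw [this, Real.rpow_neg_one]

lemma integrable_eterm {k : ℕ} {s : ℝ} (hk : 2 ≤ k) (hs : 0 ≤ s) (hY : 0 < Y) :
    Integrable fun x : ℝ => eterm k s (x + Y * I) := by
  have hk' : (2 : ℝ) ≤ k := by exact_mod_cast hk
  refine ((integrable_inv_sq_add_sq hY).const_mul (Y ^ (-(2 * ((k - 2) / 2 + s))))).mono'
    (continuous_eterm k s hY).aestronglyMeasurable (Eventually.of_forall fun x => ?_)
  rw [norm_eterm _ _ (ne_zero_of_im (by simpa))]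
  refine Eq.trans_le ?_ (norm_rpow_two_le (s := (k - 2) / 2 + s) (by linarith) hY x)
  congr 1
  ring

lemma tendsto_eterm_one {s : ℝ} (hs : 0 ≤ s) (hY : 0 < Y) {l : Filter ℝ}
    (hl : Tendsto (fun x : ℝ => |x|) l atTop) :
    Tendsto (fun x : ℝ => eterm 1 s (x + Y * I)) l (𝓝 0) := by
  have h1 := (hl.inv_tendsto_atTop).mul_const (Y ^ (-(2 * s)))
  rw [zero_mul] at h1
  refine squeeze_zero_norm' ?_ h1
  filter_upwards [hl.eventually_gt_atTop 0] with x hx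
  have hn := norm_pos_iff.mpr (ne_zero_of_im (w := x + Y * I) (by simpa))
  rw [norm_eterm _ _ (ne_zero_of_im (by simpa)), Nat.cast_one, neg_add, Real.rpow_add hn,
    Real.rpow_neg_one]
  refine mul_le_mul ?_ ?_ (by positivity) (by simp)
  · refine inv_anti₀ hx ?_
    simpa using abs_re_le_norm (x + Y * I : ℂ)
  · exact Real.rpow_le_rpow_of_nonpos hY (by simpa using im_le_norm (x + Y * I : ℂ))
      (by linarith)

/-- Integrate the derivative of `eterm 1 s`, whose total integral is zero. It is `−eterm 2 s` plus
an explicitly integrable term carrying a factor `s`, so the integral of `eterm 2 s` is O(s). -/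
lemma norm_integral_eterm_le {s : ℝ} (hs : 0 ≤ s) (hY : 0 < Y) :
    ‖∫ x : ℝ, eterm 2 s (x + Y * I)‖ ≤ 2 * π * s * Y ^ (-(1 + 2 * s)) := by
  have hb : ∀ x : ℝ, ‖(2 * s * x * eterm 1 (s + 1) (x + Y * I) : ℂ)‖ ≤
      2 * s * (Y ^ (-(2 * s)) * (x ^ 2 + Y ^ 2)⁻¹) := fun x => by
    have hw : (x + Y * I : ℂ) ≠ 0 := ne_zero_of_im (by simpa)
    have hn := norm_pos_iff.mpr hw
    have hx : |x| ≤ ‖(x + Y * I : ℂ)‖ := by simpa using abs_re_le_norm (x + Y * I : ℂ)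
    simp only [norm_mul, Complex.norm_ofNat, norm_real, Real.norm_eq_abs, abs_of_nonneg hs,
      norm_eterm _ _ hw]
    rw [mul_assoc]
    refine mul_le_mul_of_nonneg_left (le_trans ?_ (norm_rpow_two_le hs hY x)) (by positivity)
    have e : ‖(x + Y * I : ℂ)‖ ^ (-(2 + 2 * s)) =
        ‖(x + Y * I : ℂ)‖ * ‖(x + Y * I : ℂ)‖ ^ (-((1 : ℕ) + 2 * (s + 1))) := by
      nth_rewrite 2 [← Real.rpow_one ‖(x + Y * I : ℂ)‖]
      rw [← Real.rpow_add hn]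
      congr 1; push_cast; ring
    rw [e]
    gcongr
  have hbi := ((integrable_inv_sq_add_sq hY).const_mul (Y ^ (-(2 * s)))).const_mul (2 * s)
  have hR : Integrable fun x : ℝ => (2 * s * x * eterm 1 (s + 1) (x + Y * I) : ℂ) := by
    refine hbi.mono' ?_ (Eventually.of_forall hb)
    exact ((by fun_prop : Continuous fun x : ℝ => (2 * s * x : ℂ)).mul
      (continuous_eterm 1 (s + 1) hY)).aestronglyMeasurable
  have hE := integrable_eterm le_rfl hs hY
  have hN : Integrable fun x : ℝ => -eterm 2 s (x + Y * I) := hE.neg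
  have h0 := integral_of_hasDerivAt_of_tendsto (hasDerivAt_eterm 1 s hY)
    (by simp only [Nat.cast_one, one_mul]; exact hN.sub hR)
    (tendsto_eterm_one hs hY tendsto_abs_atBot_atTop)
    (tendsto_eterm_one hs hY tendsto_abs_atTop_atTop)
  have h1 : ∫ x : ℝ, eterm 2 s (x + Y * I) =
      -∫ x : ℝ, (2 * s * x * eterm 1 (s + 1) (x + Y * I) : ℂ) := by
    rw [integral_sub (by simpa using hN) hR] at h0
    simp only [Nat.cast_one, one_mul, Nat.reduceAdd, integral_neg, sub_zero] at h0
    linear_combination -h0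
  rw [h1, norm_neg]
  refine (norm_integral_le_of_norm_le hbi (Eventually.of_forall hb)).trans_eq ?_
  rw [integral_const_mul, integral_const_mul, integral_inv_sq_add_sq hY, neg_add,
    Real.rpow_add hY, Real.rpow_neg_one]
  ring

end

end HilbertModular

end

/-! ### Comparing a lattice sum with its mean value over a cell. -/

section

open Complex MeasureTheory Filter Set Function
open scoped Real goldenRatio

namespace HilbertModular

section

variable {s η ρ : ℝ} {w : ℂ}

/-- By the mean value inequality a bounded shift gains a factor 1/Y, since differentiation raises
the exponent by one. The bound 3 on the shift covers one lattice cell. -/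
lemma norm_eterm_sub_le {k : ℕ} (hs : 0 ≤ s) (hη : 0 < η) (hw : η ≤ w.im) (hρ : 0 ≤ ρ)
    (hσ : ρ ≤ k + 2 * s) {t : ℝ} (ht : |t| ≤ 3) :
    ‖eterm k s (w + t) - eterm k s w‖ ≤ 3 * (k + 2 * s) * (floorConst η 3 ^ (-ρ) *
      (absOne ⌊w.re⌋ ^ (-ρ) * (w.im ^ (-(k + 2 * s - ρ)) * w.im⁻¹))) := by
  have hY : 0 < w.im := hη.trans_le hw
  have hb : ∀ x ∈ Icc (w.re - 3) (w.re + 3),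
      ‖-(k * eterm (k + 1) s (x + w.im * I)) - 2 * s * x * eterm k (s + 1) (x + w.im * I)‖ ≤
      (k + 2 * s) * (floorConst η 3 ^ (-ρ) *
      (absOne ⌊w.re⌋ ^ (-ρ) * (w.im ^ (-(k + 2 * s - ρ)) * w.im⁻¹))) := fun x hx => by
    refine (norm_deriv_eterm_le k hs hY x).trans ?_
    have h1 := norm_rpow_le (w := x + w.im * I) (x := w.re) (σ := k + 1 + 2 * s) hη
      (by norm_num : (0 : ℝ) ≤ 3) hw (by simp)
      (by simpa using abs_le.mpr ⟨by linarith [hx.1], by linarith [hx.2]⟩) hρ (by linarith)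
    rw [show -(k + 1 + 2 * s - ρ) = -(k + 2 * s - ρ) + -1 by ring, Real.rpow_add hY,
      Real.rpow_neg_one] at h1
    gcongr
  have ht' := abs_le.mp ht
  have h := Convex.norm_image_sub_le_of_norm_hasDerivWithin_le
    (fun x _ => (hasDerivAt_eterm k s hY x).hasDerivWithinAt) hb (convex_Icc _ _)
    (x := w.re) (y := w.re + t) ⟨by linarith, by linarith⟩ ⟨by linarith, by linarith⟩
  rw [add_sub_cancel_left, Real.norm_eq_abs] at h
  have e : (((w.re + t : ℝ) : ℂ) + w.im * I) = w + t := by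
    nth_rewrite 3 [← Complex.re_add_im w]
    push_cast; ring
  rw [e, Complex.re_add_im] at h
  refine h.trans ?_
  have h0 : 0 < floorConst η 3 := floorConst_pos hη (by norm_num)
  have h1 := absOne_pos ⌊w.re⌋
  rw [mul_comm, mul_assoc 3]
  exact mul_le_mul_of_nonneg_right ht (by positivity)

lemma norm_pterm_sub_le {z : ℂ × ℂ} (hs : 0 ≤ s) (hη : 0 < η) (h1 : η ≤ z.1.im)
    (h2 : η ≤ z.2.im) {k : ℕ} (hρ : 0 ≤ ρ) (hσ : ρ ≤ k + 2 * s) {t₁ t₂ : ℝ} (ht₁ : |t₁| ≤ 3)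
    (ht₂ : |t₂| ≤ 3) (d : ℤ × ℤ) :
    ‖pterm k s z d - pterm k s (z.1 + t₁, z.2 + t₂) d‖ ≤
      3 * (k + 2 * s) * (floorConst η 3 ^ (-ρ)) ^ 2 * (z.1.im * z.2.im) ^ (-(k + 2 * s - ρ)) *
        (z.1.im⁻¹ + z.2.im⁻¹) * lterm ρ z.1.re z.2.re d := by
  have a := norm_eterm_sub_le (k := k) (w := z.1 + latt1 d) hs hη (by simpa using h1) hρ hσ ht₁
  have b := norm_eterm_sub_le (k := k) (w := z.2 + latt2 d) hs hη (by simpa using h2) hρ hσ ht₂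
  have c := norm_eterm_le (k := k) (s := s) (w := z.1 + latt1 d) (x := z.1.re + latt1 d) hη
    (by norm_num : (0 : ℝ) ≤ 3) h1 (by simp) (by simp) hρ hσ
  have e := norm_eterm_le (k := k) (s := s) (w := z.2 + latt2 d + t₂) (x := z.2.re + latt2 d) hη
    (by norm_num : (0 : ℝ) ≤ 3) h2 (by simp) (by simpa using ht₂) hρ hσ
  simp only [add_im, ofReal_im, add_zero, add_re, ofReal_re] at a b
  have e1 : pterm k s z d - pterm k s (z.1 + t₁, z.2 + t₂) d =
      -(eterm k s (z.1 + latt1 d) * (eterm k s (z.2 + latt2 d + t₂) - eterm k s (z.2 + latt2 d))) -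
      (eterm k s (z.1 + latt1 d + t₁) - eterm k s (z.1 + latt1 d)) *
        eterm k s (z.2 + latt2 d + t₂) := by
    rw [pterm, pterm]
    simp only [add_right_comm _ (t₁ : ℂ), add_right_comm _ (t₂ : ℂ)]
    ring
  rw [e1]
  refine (norm_sub_le _ _).trans ?_
  rw [norm_neg, norm_mul, norm_mul]
  refine (add_le_add (mul_le_mul c b (norm_nonneg _) ((norm_nonneg _).trans c))
    (mul_le_mul a e (norm_nonneg _) ((norm_nonneg _).trans a))).trans_eq ?_
  rw [Real.mul_rpow (hη.le.trans h1) (hη.le.trans h2), lterm]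
  ring

end

/-- The mean value of `pSum` over a cell of the lattice. -/
noncomputable def pMean (k : ℕ) (s : ℝ) (z : ℂ × ℂ) : ℂ :=
  ((√5)⁻¹ : ℝ) • ((∫ x : ℝ, eterm k s (x + z.1.im * I)) * ∫ x : ℝ, eterm k s (x + z.2.im * I))

lemma integral_eterm_shift (k : ℕ) (s : ℝ) (w : ℂ) :
    ∫ x : ℝ, eterm k s (w + x) = ∫ x : ℝ, eterm k s (x + w.im * I) := by
  rw [← integral_add_left_eq_self (μ := volume) (fun x : ℝ => eterm k s (x + w.im * I)) w.re]
  refine integral_congr_ae (Eventually.of_forall fun x => ?_)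
  simp only
  congr 1
  nth_rewrite 1 [← Complex.re_add_im w]
  push_cast
  ring

lemma integrable_eterm_shift {k : ℕ} {s : ℝ} (hk : 2 ≤ k) (hs : 0 ≤ s) {w : ℂ} (hw : 0 < w.im) :
    Integrable fun x : ℝ => eterm k s (w + x) := by
  have h := (integrable_eterm hk hs hw).comp_add_left w.re
  refine h.congr (Eventually.of_forall fun x => ?_)
  simp only
  congr 1
  rw [ofReal_add]
  linear_combination Complex.re_add_im w

lemma volume_unitCell : volume unitCell = 1 := by
  rw [unitCell, Measure.volume_eq_prod, Measure.prod_prod]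
  simp

lemma abs_coord_le {x : ℝ × ℝ} (hx : x ∈ unitCell) :
    |x.1 + φ * x.2| ≤ 3 ∧ |x.1 + ψ * x.2| ≤ 3 := by
  obtain ⟨⟨a, b⟩, c, d⟩ := hx
  have p1 := Real.goldenRatio_lt_two
  have p2 := Real.goldenRatio_pos
  have p3 := Real.goldenConj_neg
  have p4 := Real.neg_one_lt_goldenConj
  constructor <;> rw [abs_le] <;> constructor <;> nlinarith

/-- By unfolding, the mean is the sum of the cell averages of the terms. Each term differs from its
average by the gain of `norm_pterm_sub_le`, and the sum over the lattice is uniformly bounded. -/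
lemma norm_pSum_sub_pMean_le {k : ℕ} {s η ρ : ℝ} {z : ℂ × ℂ} (hk : 2 ≤ k) (hs : 0 ≤ s)
    (hη : 0 < η) (h1 : η ≤ z.1.im) (h2 : η ≤ z.2.im) (hρ : 1 < ρ) (hσ : ρ ≤ k + 2 * s) :
    ‖pSum k s z - pMean k s z‖ ≤ 3 * (k + 2 * s) * (floorConst η 3 ^ (-ρ)) ^ 2 * lattBound ρ *
      (z.1.im * z.2.im) ^ (-(k + 2 * s - ρ)) * (z.1.im⁻¹ + z.2.im⁻¹) := by
  have hz1 : 0 < z.1.im := hη.trans_le h1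
  have hz2 : 0 < z.2.im := hη.trans_le h2
  have hP : HasSum (pterm k s z) (pSum k s z) :=
    (summable_pterm (by linarith) ⟨hz1, hz2⟩).of_norm.hasSum
  have hA : HasSum (fun d : ℤ × ℤ => ∫ x in unitCell,
      pterm k s (z.1 + ((x.1 + φ * x.2 : ℝ) : ℂ), z.2 + ((x.1 + ψ * x.2 : ℝ) : ℂ)) d)
      (pMean k s z) := by
    have h := hasSum_unitCell (integrable_eterm_shift hk hs hz1)
      (integrable_eterm_shift hk hs hz2)
    rw [integral_eterm_shift, integral_eterm_shift] at h
    refine h.congr_fun fun d => ?_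
    refine setIntegral_congr_fun measurableSet_unitCell fun x _ => ?_
    simp only [pterm]
    push_cast
    simp only [add_assoc]
  have hI : ∀ d : ℤ × ℤ, IntegrableOn (fun x : ℝ × ℝ =>
      pterm k s (z.1 + ((x.1 + φ * x.2 : ℝ) : ℂ), z.2 + ((x.1 + ψ * x.2 : ℝ) : ℂ)) d) unitCell :=
    fun d => by
    refine (integrableOn_unitCell (integrable_eterm_shift hk hs hz1)
      (integrable_eterm_shift hk hs hz2) d).congr_fun (fun x _ => ?_) measurableSet_unitCell
    simp only [pterm]
    push_cast
    simp only [add_assoc]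
  have hbs := (summable_lterm hρ z.1.re z.2.re).mul_left
    (3 * (k + 2 * s) * (floorConst η 3 ^ (-ρ)) ^ 2 * (z.1.im * z.2.im) ^ (-(k + 2 * s - ρ)) *
        (z.1.im⁻¹ + z.2.im⁻¹))
  rw [← (hP.sub hA).tsum_eq]
  refine (tsum_of_norm_bounded hbs.hasSum fun d => ?_).trans ?_
  · have e : pterm k s z d = ∫ x in unitCell, pterm k s z d := by
      simp [volume_unitCell, Measure.real]
    have hc : Integrable (fun _ => pterm k s z d) (volume.restrict unitCell) :=
      integrableOn_const (by simp [volume_unitCell])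
    rw [e, ← integral_sub hc (hI d)]
    refine (norm_setIntegral_le_of_norm_le_const (by simp [volume_unitCell]) fun x hx =>
      norm_pterm_sub_le hs hη h1 h2 (zero_le_one.trans hρ.le) hσ (abs_coord_le hx).1
        (abs_coord_le hx).2 d).trans_eq ?_
    simp [volume_unitCell, Measure.real]
  · rw [tsum_mul_left]
    refine (mul_le_mul_of_nonneg_left (tsum_lterm_le hρ _ _) ?_).trans_eq (by ring)
    have := floorConst_pos hη (by norm_num : (0 : ℝ) ≤ 3)
    positivity

/-- Each of the two line integrals is O(s), which gives the double zero special to two variables. -/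
lemma norm_pMean_le {s : ℝ} {z : ℂ × ℂ} (hs : 0 ≤ s) (hz : z ∈ H2) :
    ‖pMean 2 s z‖ ≤ (2 * π * s) ^ 2 * (z.1.im * z.2.im) ^ (-(1 + 2 * s)) := by
  have hz1 : 0 < z.1.im := hz.1
  have hz2 : 0 < z.2.im := hz.2
  have a := norm_integral_eterm_le hs hz1
  have b := norm_integral_eterm_le hs hz2
  rw [pMean, norm_smul, norm_mul, Real.mul_rpow hz1.le hz2.le]
  have c : ‖(√5)⁻¹‖ ≤ 1 := by
    rw [norm_inv, Real.norm_of_nonneg (Real.sqrt_nonneg 5)]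
    exact inv_le_one_of_one_le₀ (Real.one_le_sqrt.mpr (by norm_num))
  refine (mul_le_of_le_one_left (by positivity) c).trans ?_
  refine (mul_le_mul a b (norm_nonneg _) ((norm_nonneg _).trans a)).trans_eq ?_
  ring

end HilbertModular

end

/-! ### Hecke's limit in weight 2. -/

section

open Complex MeasureTheory Filter Set Function
open scoped Real goldenRatio

namespace HilbertModular

lemma rpow_neg_add_le {a τ s : ℝ} (ha : 0 < a) (hs : 0 ≤ s) (hs1 : s ≤ 1) :
    a ^ (-(τ + 2 * s)) ≤ a ^ (-τ) * (1 + a ^ (-2 : ℝ)) := by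
  rw [neg_add, Real.rpow_add ha]
  refine mul_le_mul_of_nonneg_left ?_ (by positivity)
  rcases le_total 1 a with h | h
  · have := Real.rpow_le_one_of_one_le_of_nonpos h (by linarith : -(2 * s) ≤ 0)
    have : 0 ≤ a ^ (-2 : ℝ) := by positivity
    linarith
  · have := Real.rpow_le_rpow_of_exponent_ge ha h (by linarith : -2 ≤ -(2 * s))
    linarith

namespace Rep

variable {z : ℂ × ℂ}

/-- The constant in the bound for the difference between `pSum` and its mean. -/
noncomputable def diffConst (z : ℂ × ℂ) : ℝ :=
  12 * (floorConst (minIm z) 3 ^ (-(5 / 4) : ℝ)) ^ 2 * lattBound (5 / 4) *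
    ((z.1.im * z.2.im) ^ (-(3 / 4) : ℝ) * (1 + (z.1.im * z.2.im) ^ (-2 : ℝ))) *
    (3 * (z.1.im⁻¹ + z.2.im⁻¹))

lemma norm_sub_mean_le (hz : z ∈ H2) {s : ℝ} (hs : 0 ≤ s) (hs1 : s ≤ 1) (c : Rep) :
    ‖pSum 2 s (c.mulPt z) - pMean 2 s (c.mulPt z)‖ ≤ diffConst z * c.nm ^ (-(5 / 4) : ℝ) := by
  have hz1 : 0 < z.1.im := hz.1
  have hz2 : 0 < z.2.im := hz.2
  have ha : 0 < z.1.im * z.2.im := mul_pos hz1 hz2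
  have hη := minIm_pos hz
  have hN : 0 < c.nm := c.nm_pos
  have hL := lattBound_nonneg (5 / 4)
  have hκ := floorConst_pos hη (by norm_num : (0 : ℝ) ≤ 3)
  -- Using 5/4 of the exponent 2 for the lattice leaves 3/4 for the norm of `c`; the inverse heights
  -- add 1/2. The total 5/4 exceeds 1, so the differences are summable over `c` uniformly in `s`.
  have h := norm_pSum_sub_pMean_le (k := 2) (ρ := 5 / 4) le_rfl hs hη (c.minIm_le_fst hz)
    (c.minIm_le_snd hz) (by norm_num) (by push_cast; linarith)
  refine h.trans ?_
  have e1 : -(((2 : ℕ) : ℝ) + 2 * s - 5 / 4) = -(3 / 4 + 2 * s) := by push_cast; ring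
  rw [im_mul_im, e1, Real.mul_rpow hN.le ha.le]
  have h1 : c.nm ^ (-(3 / 4 + 2 * s)) ≤ c.nm ^ (-(3 / 4) : ℝ) :=
    Real.rpow_le_rpow_of_exponent_le c.one_le_nm (by linarith)
  have h2 := rpow_neg_add_le (τ := 3 / 4) ha hs hs1
  have h3 : (c.mulPt z).1.im⁻¹ + (c.mulPt z).2.im⁻¹ ≤
      c.nm ^ (-(1 / 2) : ℝ) * (3 * (z.1.im⁻¹ + z.2.im⁻¹)) := by
    rw [mulPt_fst_im, mulPt_snd_im, mul_inv, mul_inv]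
    have a := mul_le_mul_of_nonneg_right c.inv_l1_le (inv_nonneg.mpr hz1.le)
    have b := mul_le_mul_of_nonneg_right c.inv_l2_le (inv_nonneg.mpr hz2.le)
    linarith
  have h4 : 3 * (((2 : ℕ) : ℝ) + 2 * s) ≤ 12 := by push_cast; linarith
  have e2 : c.nm ^ (-(5 / 4) : ℝ) = c.nm ^ (-(3 / 4) : ℝ) * c.nm ^ (-(1 / 2) : ℝ) := by
    rw [← Real.rpow_add hN]; norm_num
  have h5 : 0 ≤ (c.mulPt z).1.im⁻¹ + (c.mulPt z).2.im⁻¹ := by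
    have := (c.mulPt_mem hz).1
    have := (c.mulPt_mem hz).2
    positivity
  have h6 : 0 ≤ 3 * (((2 : ℕ) : ℝ) + 2 * s) := by positivity
  rw [diffConst, e2]
  calc _ ≤ 12 * (floorConst (minIm z) 3 ^ (-(5 / 4) : ℝ)) ^ 2 * lattBound (5 / 4) *
      (c.nm ^ (-(3 / 4) : ℝ) * ((z.1.im * z.2.im) ^ (-(3 / 4) : ℝ) *
        (1 + (z.1.im * z.2.im) ^ (-2 : ℝ)))) *
      (c.nm ^ (-(1 / 2) : ℝ) * (3 * (z.1.im⁻¹ + z.2.im⁻¹))) := by gcongr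
    _ = _ := by ring

lemma norm_mean_le (hz : z ∈ H2) {s : ℝ} (hs : 0 ≤ s) (c : Rep) :
    ‖pMean 2 s (c.mulPt z)‖ ≤
      (2 * π * s) ^ 2 * (z.1.im * z.2.im) ^ (-(1 + 2 * s)) * c.nm ^ (-(1 + 2 * s)) := by
  refine (norm_pMean_le hs (c.mulPt_mem hz)).trans_eq ?_
  rw [im_mul_im, Real.mul_rpow c.nm_pos.le (mul_pos hz.1 hz.2).le]
  ring

lemma summable_sub_mean_bound (z : ℂ × ℂ) :
    Summable fun c : Rep => diffConst z * c.nm ^ (-(5 / 4) : ℝ) :=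
  (summable_nm (by norm_num)).mul_left _

/-- The means are O(s²) times a sum over norms that grows at most like 1/s. No nonholomorphic
correction survives. -/
lemma tendsto_tsum_mean (hz : z ∈ H2) :
    Tendsto (fun s : ℝ => ∑' c : Rep, pMean 2 s (c.mulPt z)) (𝓝[>] 0) (𝓝 0) := by
  have ha : 0 < z.1.im * z.2.im := mul_pos hz.1 hz.2
  set K : ℝ := (2 * π) ^ 2 * ((z.1.im * z.2.im) ^ (-1 : ℝ) * (1 + (z.1.im * z.2.im) ^ (-2 : ℝ)))
  have h := tendsto_sq_mul_tsum_nm.const_mul K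
  rw [mul_zero] at h
  refine squeeze_zero_norm' ?_ h
  filter_upwards [Ioc_mem_nhdsGT (zero_lt_one' ℝ)] with s hs
  have h1 : 1 < 1 + 2 * s := by linarith [hs.1]
  refine (tsum_of_norm_bounded ((summable_nm h1).mul_left _).hasSum
    (norm_mean_le hz hs.1.le)).trans ?_
  rw [tsum_mul_left, ← mul_assoc]
  refine mul_le_mul_of_nonneg_right ?_ (tsum_nonneg fun c => Real.rpow_nonneg c.nm_pos.le _)
  have h2 := rpow_neg_add_le (τ := 1) ha hs.1.le hs.2
  calc _ = (2 * π) ^ 2 * (z.1.im * z.2.im) ^ (-(1 + 2 * s)) * s ^ 2 := by ring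
    _ ≤ _ := by
      refine mul_le_mul_of_nonneg_right ?_ (sq_nonneg s)
      exact mul_le_mul_of_nonneg_left h2 (by positivity)

lemma tendsto_eterm (k : ℕ) {w : ℂ} (hw : w ≠ 0) :
    Tendsto (fun s : ℝ => eterm k s w) (𝓝[>] 0) (𝓝 (eterm k 0 w)) := by
  have h : Continuous fun s : ℝ => eterm k s w := by
    have h1 : Continuous fun s : ℝ => ‖w‖ ^ (-(2 * s)) :=
      continuous_const.rpow (by fun_prop) fun _ => Or.inl (norm_ne_zero_iff.mpr hw)
    exact continuous_const.mul (continuous_ofReal.comp h1)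
  exact (h.tendsto 0).mono_left nhdsWithin_le_nhds

lemma tendsto_pSum (hz : z ∈ H2) :
    Tendsto (fun s : ℝ => pSum 2 s z) (𝓝[>] 0) (𝓝 (pSum 2 0 z)) := by
  have hz1 : 0 < z.1.im := hz.1
  have hz2 : 0 < z.2.im := hz.2
  have ha : 0 < z.1.im * z.2.im := mul_pos hz1 hz2
  have hη : 0 < min z.1.im z.2.im := lt_min hz1 hz2
  have hκ := floorConst_pos hη le_rfl
  refine tendsto_tsum_of_dominated_convergence
    ((summable_lterm (ρ := 3 / 2) (by norm_num) z.1.re z.2.re).mul_left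
      ((floorConst (min z.1.im z.2.im) 0 ^ (-(3 / 2) : ℝ)) ^ 2 *
        ((z.1.im * z.2.im) ^ (-(1 / 2) : ℝ) * (1 + (z.1.im * z.2.im) ^ (-2 : ℝ))))) (fun d => ?_) ?_
  · exact (tendsto_eterm 2 (ne_zero_of_im (by simpa))).mul
      (tendsto_eterm 2 (ne_zero_of_im (by simpa)))
  · filter_upwards [Ioc_mem_nhdsGT (zero_lt_one' ℝ)] with s hs d
    refine (norm_pterm_le (k := 2) (s := s) (ρ := 3 / 2) hη le_rfl (min_le_left _ _)
      (min_le_right _ _) le_rfl le_rfl (ξ₁ := z.1.re) (ξ₂ := z.2.re) (by simp) (by simp)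
      (by norm_num) (by push_cast; linarith [hs.1]) d).trans ?_
    have h0 : 0 ≤ lterm (3 / 2) z.1.re z.2.re d :=
      mul_nonneg (Real.rpow_nonneg (absOne_pos _).le _) (Real.rpow_nonneg (absOne_pos _).le _)
    refine mul_le_mul_of_nonneg_right (mul_le_mul_of_nonneg_left ?_ (by positivity)) h0
    have := rpow_neg_add_le (τ := 1 / 2) ha hs.1.le hs.2
    refine (Eq.trans_le ?_ this)
    congr 1; push_cast; ring

/-- Separate each lattice sum into its mean and the difference. The differences are dominated
uniformly, so the limit passes inside; the means tend to zero both termwise and in total. -/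
theorem tendsto_tsum_pSum (hz : z ∈ H2) :
    Tendsto (fun s : ℝ => ∑' c : Rep, pSum 2 s (c.mulPt z)) (𝓝[>] 0)
      (𝓝 (∑' c : Rep, pSum 2 0 (c.mulPt z))) := by
  have hm : ∀ c : Rep, Tendsto (fun s : ℝ => pMean 2 s (c.mulPt z)) (𝓝[>] 0) (𝓝 0) := fun c => by
    have ha : 0 < (c.mulPt z).1.im * (c.mulPt z).2.im :=
      mul_pos (c.mulPt_mem hz).1 (c.mulPt_mem hz).2
    have h1 : Continuous fun s : ℝ => (2 * π * s) ^ 2 *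
        ((c.mulPt z).1.im * (c.mulPt z).2.im) ^ (-(1 + 2 * s)) :=
      (by fun_prop : Continuous fun s : ℝ => (2 * π * s) ^ 2).mul
        (continuous_const.rpow (by fun_prop) fun _ => Or.inl ha.ne')
    have h2 := (h1.tendsto 0).mono_left (nhdsWithin_le_nhds (s := Ioi 0))
    simp only [mul_zero, ne_eq, OfNat.ofNat_ne_zero, not_false_eq_true, zero_pow, zero_mul] at h2
    refine squeeze_zero_norm' ?_ h2
    filter_upwards [self_mem_nhdsWithin] with s hs
    exact norm_pMean_le (Set.mem_Ioi.mp hs).le (c.mulPt_mem hz)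
  have hR : Tendsto (fun s : ℝ => ∑' c : Rep, (pSum 2 s (c.mulPt z) - pMean 2 s (c.mulPt z)))
      (𝓝[>] 0) (𝓝 (∑' c : Rep, pSum 2 0 (c.mulPt z))) := by
    refine tendsto_tsum_of_dominated_convergence (summable_sub_mean_bound z) (fun c => ?_) ?_
    · simpa using (tendsto_pSum (c.mulPt_mem hz)).sub (hm c)
    · filter_upwards [Ioc_mem_nhdsGT (zero_lt_one' ℝ)] with s hs c
      exact norm_sub_mean_le hz hs.1.le hs.2 c
  have h := hR.add (tendsto_tsum_mean hz)
  rw [add_zero] at h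
  refine h.congr' ?_
  filter_upwards [Ioc_mem_nhdsGT (zero_lt_one' ℝ)] with s hs
  have h1 : 1 < 1 + 2 * s := by linarith [hs.1]
  have s1 : Summable fun c : Rep => pSum 2 s (c.mulPt z) - pMean 2 s (c.mulPt z) :=
    .of_norm_bounded (summable_sub_mean_bound z) (norm_sub_mean_le hz hs.1.le hs.2)
  have s2 : Summable fun c : Rep => pMean 2 s (c.mulPt z) :=
    .of_norm_bounded ((summable_nm h1).mul_left _) (norm_mean_le hz hs.1.le)
  rw [← s1.tsum_add s2]
  simp

/-- The sum of the `k + 2s`-th inverse powers of the norms. -/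
noncomputable def zeta (τ : ℝ) : ℝ := ∑' c : Rep, c.nm ^ (-τ)

lemma tendsto_zeta : Tendsto (fun s : ℝ => zeta (2 + 2 * s)) (𝓝[>] 0) (𝓝 (zeta 2)) := by
  refine tendsto_tsum_of_dominated_convergence (summable_nm (by norm_num : (1 : ℝ) < 2))
    (fun c => ?_) ?_
  · have h1 : Continuous fun s : ℝ => c.nm ^ (-(2 + 2 * s)) :=
      continuous_const.rpow (by fun_prop) fun _ => Or.inl c.nm_pos.ne'
    have h2 := (h1.tendsto 0).mono_left (nhdsWithin_le_nhds (s := Ioi 0))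
    simpa using h2
  · filter_upwards [self_mem_nhdsWithin] with s hs c
    rw [Real.norm_of_nonneg (Real.rpow_nonneg c.nm_pos.le _)]
    exact Real.rpow_le_rpow_of_exponent_le c.one_le_nm (by linarith [Set.mem_Ioi.mp hs])

lemma zeta_pos {τ : ℝ} (hτ : 1 < τ) : 0 < zeta τ :=
  (summable_nm hτ).tsum_pos (fun c => Real.rpow_nonneg c.nm_pos.le _)
    ⟨(1, 0), by simp [latt1, latt2]; exact one_lt_pow₀ Real.one_lt_goldenRatio (by norm_num)⟩
    (Real.rpow_pos_of_pos (nm_pos _) _)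

end Rep

end HilbertModular

end

/-! ### Orbits of units on pairs of integers. -/

section

open Complex Filter Set Function
open scoped Real goldenRatio

namespace HilbertModular

variable {F : Type*} [Field F] {σ₁ σ₂ : F →+* ℝ}

namespace Coords

variable (K : Coords σ₁ σ₂)

lemma h1' (x : 𝓞 F) : latt1 (K.O.symm x) = intEmb σ₁ x := by
  rw [← K.h1, Equiv.apply_symm_apply]

lemma h2' (x : 𝓞 F) : latt2 (K.O.symm x) = intEmb σ₂ x := by
  rw [← K.h2, Equiv.apply_symm_apply]

lemma exists_int_norm (K : Coords σ₁ σ₂) (x : 𝓞 F) :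
    ∃ n : ℤ, intEmb σ₁ x * intEmb σ₂ x = n := by
  rw [← K.h1', ← K.h2', latt_mul]
  exact ⟨_, rfl⟩

lemma norm_unit (K : Coords σ₁ σ₂) (u : (𝓞 F)ˣ) :
    intEmb σ₁ u * intEmb σ₂ u = 1 ∨ intEmb σ₁ u * intEmb σ₂ u = -1 := by
  obtain ⟨n, hn⟩ := K.exists_int_norm u
  obtain ⟨m, hm⟩ := K.exists_int_norm (u⁻¹ : (𝓞 F)ˣ)
  have e1 : intEmb σ₁ u * intEmb σ₁ (u⁻¹ : (𝓞 F)ˣ) = 1 := by rw [← map_mul, u.mul_inv, map_one]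
  have e2 : intEmb σ₂ u * intEmb σ₂ (u⁻¹ : (𝓞 F)ˣ) = 1 := by rw [← map_mul, u.mul_inv, map_one]
  have h : n * m = 1 := by
    have : (n : ℝ) * m = 1 := by
      rw [← hn, ← hm]
      linear_combination (intEmb σ₂ u * intEmb σ₂ (u⁻¹ : (𝓞 F)ˣ)) * e1 + e2
    exact_mod_cast this
  rw [hn]
  rcases Int.eq_one_or_neg_one_of_mul_eq_one h with h | h <;> simp [h]

lemma O_ne_zero (c : Rep) : K.O c.1 ≠ 0 := fun h => by
  have h1 := K.h1 c.1
  rw [h, map_zero] at h1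
  exact c.l1_pos.ne h1

/-- The fundamental unit. -/
noncomputable def fundUnit (K : Coords σ₁ σ₂) : (𝓞 F)ˣ :=
  Units.mkOfMulEqOne (K.O (0, 1)) (K.O (-1, 1)) <| by
    apply intEmb_injective σ₁
    rw [map_mul, K.h1, K.h1, map_one, latt1_zero_one, latt1]
    have := Real.goldenRatio_sq
    push_cast
    linear_combination this

lemma intEmb_fundUnit_fst : intEmb σ₁ (K.fundUnit : 𝓞 F) = φ := by
  rw [fundUnit, Units.val_mkOfMulEqOne, K.h1, latt1_zero_one]

lemma intEmb_fundUnit_snd : intEmb σ₂ (K.fundUnit : 𝓞 F) = ψ := by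
  rw [fundUnit, Units.val_mkOfMulEqOne, K.h2, latt2_zero_one]

lemma intEmb_zpow (σ : F →+* ℝ) (u : (𝓞 F)ˣ) (n : ℤ) :
    intEmb σ (u ^ n : (𝓞 F)ˣ) = intEmb σ u ^ n := by
  have := map_zpow (Units.map (intEmb σ : 𝓞 F →* ℝ)) u n
  have h := congrArg Units.val this
  rwa [Units.val_zpow_eq_zpow_val] at h

/-- One of ±1, ±φ makes the element totally positive, as φ has norm −1. Multiplication by φ^(−2n)
then divides the ratio of the embeddings by φ^(4n), bringing it into [1, φ⁴). -/
lemma exists_unit_mul_rep {x : 𝓞 F} (hx : x ≠ 0) :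
    ∃ (u : (𝓞 F)ˣ) (c : Rep), K.O c.1 = u * x := by
  have hx1 : intEmb σ₁ x ≠ 0 := (map_ne_zero_iff _ (intEmb_injective σ₁)).mpr hx
  have hx2 : intEmb σ₂ x ≠ 0 := (map_ne_zero_iff _ (intEmb_injective σ₂)).mpr hx
  obtain ⟨u₀, h1, h2⟩ : ∃ u₀ : (𝓞 F)ˣ, 0 < intEmb σ₁ (u₀ * x) ∧ 0 < intEmb σ₂ (u₀ * x) := by
    have p2 := Real.goldenRatio_pos
    have p3 := Real.goldenConj_neg
    rcases lt_or_gt_of_ne hx1 with a | a <;> rcases lt_or_gt_of_ne hx2 with b | b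
    · exact ⟨-1, by simpa, by simpa⟩
    · refine ⟨-K.fundUnit, ?_, ?_⟩
      · rw [Units.val_neg, map_mul, map_neg, intEmb_fundUnit_fst]; nlinarith
      · rw [Units.val_neg, map_mul, map_neg, intEmb_fundUnit_snd]; nlinarith
    · refine ⟨K.fundUnit, ?_, ?_⟩
      · rw [map_mul, intEmb_fundUnit_fst]; nlinarith
      · rw [map_mul, intEmb_fundUnit_snd]; nlinarith
    · exact ⟨1, by simpa, by simpa⟩
  set y := (u₀ : 𝓞 F) * x
  obtain ⟨n, hn1, hn2⟩ := exists_mem_Ico_zpow (div_pos h1 h2)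
    (one_lt_pow₀ Real.one_lt_goldenRatio (by norm_num : 4 ≠ 0))
  set v : (𝓞 F)ˣ := K.fundUnit ^ (-(2 * n))
  have v1 : intEmb σ₁ (v : 𝓞 F) = φ ^ (-(2 * n)) := by
    rw [intEmb_zpow, intEmb_fundUnit_fst]
  have v2 : intEmb σ₂ (v : 𝓞 F) = φ ^ (2 * n) := by
    rw [intEmb_zpow, intEmb_fundUnit_snd, zpow_neg, ← inv_zpow, Real.inv_goldenConj, zpow_mul,
      zpow_mul]
    congr 1
    rw [zpow_ofNat, zpow_ofNat, neg_sq]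
  have hp : 0 < φ ^ (2 * n) := zpow_pos Real.goldenRatio_pos _
  have e4 : (φ ^ 4) ^ n = φ ^ (2 * n) * φ ^ (2 * n) := by
    rw [← zpow_natCast, ← zpow_mul, ← zpow_add₀ Real.goldenRatio_pos.ne']
    congr 1; push_cast; ring
  have l1 : latt1 (K.O.symm (v * y)) = (φ ^ (2 * n))⁻¹ * intEmb σ₁ y := by
    rw [K.h1', map_mul, v1, zpow_neg]
  have l2 : latt2 (K.O.symm (v * y)) = φ ^ (2 * n) * intEmb σ₂ y := by
    rw [K.h2', map_mul, v2]
  refine ⟨v * u₀, ⟨K.O.symm (v * y), ?_, ?_, ?_⟩, ?_⟩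
  · rw [l2]; positivity
  · rw [l1, l2, le_inv_mul_iff₀ hp]
    rw [e4, le_div_iff₀ h2] at hn1
    linarith
  · rw [l1, l2, inv_mul_lt_iff₀ hp]
    rw [zpow_add_one₀ (by positivity), e4, div_lt_iff₀ h2] at hn2
    linarith
  · rw [Equiv.apply_symm_apply, Units.val_mul, mul_assoc]

/-- Such a unit is totally positive of norm 1, and both embeddings lie below φ². Its trace is an
integer in [2, 3), hence 2, and the only such unit is 1. -/
lemma unit_eq_one {u : (𝓞 F)ˣ} {c c' : Rep} (h : K.O c'.1 = u * K.O c.1) : u = 1 := by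
  have e1 : c'.l1 = intEmb σ₁ u * c.l1 := by
    rw [Rep.l1, Rep.l1, ← K.h1, ← K.h1, h, map_mul]
  have e2 : c'.l2 = intEmb σ₂ u * c.l2 := by
    rw [Rep.l2, Rep.l2, ← K.h2, ← K.h2, h, map_mul]
  have p1 : 0 < intEmb σ₁ u := by
    have := c'.l1_pos; rw [e1] at this; exact pos_of_mul_pos_left this c.l1_pos.le
  have p2 : 0 < intEmb σ₂ u := by
    have := c'.l2_pos; rw [e2] at this; exact pos_of_mul_pos_left this c.l2_pos.le
  have hN : intEmb σ₁ u * intEmb σ₂ u = 1 := by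
    rcases K.norm_unit u with h | h
    · exact h
    · have := mul_pos p1 p2
      linarith
  have h1 : c.l2 ≤ c.l1 := c.l2_le_l1
  have h2 : c.l1 < φ ^ 4 * c.l2 := c.2.2.2
  have h3 : c'.l2 ≤ c'.l1 := c'.l2_le_l1
  have h4 : c'.l1 < φ ^ 4 * c'.l2 := c'.2.2.2
  have q1 := c.l1_pos
  have q2 := c.l2_pos
  set x := intEmb σ₁ u
  set y := intEmb σ₂ u
  rw [e1, e2] at h3 h4
  have a1 : x < φ ^ 2 := by
    have : x ^ 2 < (φ ^ 2) ^ 2 := by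
      have b1 : x * c.l2 < φ ^ 4 * y * c.l2 := by nlinarith
      have b2 : x < φ ^ 4 * y := lt_of_mul_lt_mul_right b1 q2.le
      calc x ^ 2 = x * x := by ring
        _ < x * (φ ^ 4 * y) := by gcongr
        _ = φ ^ 4 * (x * y) := by ring
        _ = (φ ^ 2) ^ 2 := by rw [hN]; ring
    exact lt_of_pow_lt_pow_left₀ 2 (by positivity) this
  have a2 : y < φ ^ 2 := by
    have : y ^ 2 < (φ ^ 2) ^ 2 := by
      have b1 : y * c.l2 < φ ^ 4 * x * c.l2 := by nlinarith
      have b2 : y < φ ^ 4 * x := lt_of_mul_lt_mul_right b1 q2.le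
      calc y ^ 2 = y * y := by ring
        _ < y * (φ ^ 4 * x) := by gcongr
        _ = φ ^ 4 * (x * y) := by ring
        _ = (φ ^ 2) ^ 2 := by rw [hN]; ring
    exact lt_of_pow_lt_pow_left₀ 2 (by positivity) this
  have a3 : x + y < 3 := by
    have g := Real.goldenRatio_sq
    have b : (φ ^ 2 - x) * (φ ^ 2 - y) > 0 := mul_pos (by linarith) (by linarith)
    have g2 : φ ^ 2 * φ ^ 2 = 3 * φ ^ 2 - 1 := by
      linear_combination (φ ^ 2 + φ - 1) * g
    have : φ ^ 2 * (3 - (x + y)) > 0 := by nlinarith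
    have := pos_of_mul_pos_right this (by positivity)
    linarith
  have a4 : 2 ≤ x + y := by nlinarith [sq_nonneg (x - y)]
  obtain ⟨n, hn⟩ : ∃ n : ℤ, x + y = n := by
    refine ⟨2 * (K.O.symm u).1 + (K.O.symm u).2, ?_⟩
    have b := Real.goldenRatio_add_goldenConj
    change intEmb σ₁ u + intEmb σ₂ u = _
    rw [← K.h1', ← K.h2', latt1, latt2]
    push_cast
    linear_combination ((K.O.symm u).2 : ℝ) * b
  have hn2 : n = 2 := by
    rw [hn] at a3 a4
    have : n < 3 := by exact_mod_cast a3
    have : 2 ≤ n := by exact_mod_cast a4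
    omega
  have hx : x = 1 := by
    rw [hn2] at hn
    push_cast at hn
    have : (x - 1) ^ 2 = 0 := by
      have : y = 2 - x := by linarith
      rw [this] at hN
      linarith
    have := pow_eq_zero_iff (two_ne_zero) |>.mp this
    linarith
  refine Units.ext (intEmb_injective σ₁ ?_)
  rw [Units.val_one, map_one]
  exact hx

/-- Representatives of the orbits of units on pairs of integers. -/
noncomputable def pairRep : Rep ⊕ Rep × (ℤ × ℤ) → 𝓞 F × 𝓞 F
  | .inl c => (0, K.O c.1)
  | .inr x => (K.O x.1.1, K.O x.2)

lemma pairRep_ne_zero (x : Rep ⊕ Rep × (ℤ × ℤ)) : K.pairRep x ≠ 0 := by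
  rcases x with c | ⟨c, d⟩ <;> intro h <;> simp [pairRep, Prod.ext_iff, K.O_ne_zero] at h

lemma mk_ne_mk_zero {p : 𝓞 F × 𝓞 F} (hp : p ≠ 0) :
    (Quotient.mk (MulAction.orbitRel (𝓞 F)ˣ (𝓞 F × 𝓞 F)) p) ≠ Quotient.mk _ 0 := by
  intro h
  obtain ⟨u, hu⟩ := MulAction.orbitRel_apply.mp (Quotient.exact h)
  exact hp (by simpa using hu.symm)

/-- The parametrization of the index set of the Eisenstein series. -/
noncomputable def indexEquiv : Rep ⊕ Rep × (ℤ × ℤ) ≃ EisIndex F :=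
  Equiv.ofBijective (fun x => ⟨Quotient.mk _ (K.pairRep x), mk_ne_mk_zero (K.pairRep_ne_zero x)⟩) <| by
    have key : ∀ {u : (𝓞 F)ˣ} {c c' : Rep}, u • K.O c.1 = K.O c'.1 → u = 1 :=
      fun {_ c c'} h => K.unit_eq_one (c := c) (c' := c') h.symm
    constructor
    · intro x y h
      obtain ⟨u, hu⟩ := MulAction.orbitRel_apply.mp (Quotient.exact (Subtype.ext_iff.mp h))
      rcases x with c | ⟨c, d⟩ <;> rcases y with c' | ⟨c', d'⟩ <;>
        simp only [pairRep, Prod.smul_mk, Prod.mk.injEq, smul_zero] at hu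
      · obtain rfl := key hu.2
        rw [one_smul] at hu
        rw [Subtype.ext (K.O.injective hu.2)]
      · exact absurd hu.1 (by simpa [Units.smul_def] using K.O_ne_zero c')
      · exact absurd hu.1.symm (K.O_ne_zero c)
      · obtain rfl := key hu.1
        rw [one_smul, one_smul] at hu
        rw [Subtype.ext (K.O.injective hu.1), K.O.injective hu.2]
    · rintro ⟨q, hq⟩
      induction q using Quotient.inductionOn with
      | h p =>
        obtain ⟨a, b⟩ := p
        have hp : (a, b) ≠ 0 := fun h => hq (by rw [h])
        by_cases ha : a = 0
        · have hb : b ≠ 0 := fun hb => hp (by rw [ha, hb]; rfl)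
          obtain ⟨u, c, hc⟩ := K.exists_unit_mul_rep hb
          refine ⟨.inl c, Subtype.ext (Quotient.sound (MulAction.orbitRel_apply.mpr ⟨u, ?_⟩))⟩
          simp [pairRep, ha, hc, Units.smul_def]
        · obtain ⟨u, c, hc⟩ := K.exists_unit_mul_rep ha
          refine ⟨.inr (c, K.O.symm (u * b)),
            Subtype.ext (Quotient.sound (MulAction.orbitRel_apply.mpr ⟨u, ?_⟩))⟩
          simp [pairRep, hc, Units.smul_def]

end Coords

/-- The summand of the Eisenstein series for a pair of integers. -/
noncomputable def eisVal (σ₁ σ₂ : F →+* ℝ) (k : ℕ) (s : ℝ) (z : ℍ × ℍ) (p : 𝓞 F × 𝓞 F) : ℂ :=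
  eterm k s (normFactor σ₁ σ₂ p.1 p.2 z)

lemma eisVal_smul (K : Coords σ₁ σ₂) {k : ℕ} (hk : Even k) (s : ℝ) (z : ℍ × ℍ) (u : (𝓞 F)ˣ)
    (p : 𝓞 F × 𝓞 F) : eisVal σ₁ σ₂ k s z (u • p) = eisVal σ₁ σ₂ k s z p := by
  have e : normFactor σ₁ σ₂ (u • p).1 (u • p).2 z =
      ((intEmb σ₁ u * intEmb σ₂ u : ℝ) : ℂ) * normFactor σ₁ σ₂ p.1 p.2 z := by
    simp only [normFactor, Prod.smul_fst, Prod.smul_snd, Units.smul_def, smul_eq_mul, map_mul]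
    push_cast
    ring
  rw [eisVal, eisVal, e, eterm_mul]
  rcases K.norm_unit u with h | h <;> rw [h] <;> simp [eterm, hk.neg_one_pow]

lemma eisTerm_eq (K : Coords σ₁ σ₂) {k : ℕ} (hk : Even k) (s : ℝ) (z : ℍ × ℍ) {q : EisIndex F}
    {p : 𝓞 F × 𝓞 F} (h : q.1 = Quotient.mk _ p) :
    eisTerm σ₁ σ₂ k s z q = eisVal σ₁ σ₂ k s z p := by
  have h1 : MulAction.orbitRel (𝓞 F)ˣ (𝓞 F × 𝓞 F) q.1.out p :=
    Quotient.exact ((Quotient.out_eq _).trans h)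
  obtain ⟨u, hu⟩ := MulAction.orbitRel_apply.mp h1
  rw [← eisVal_smul K hk s z u p]
  change eisVal σ₁ σ₂ k s z q.1.out = _
  rw [← hu]

end HilbertModular

end

/-! ### Modularity and symmetry of the Eisenstein series. -/

section

open Complex Filter Set Function
open scoped Real goldenRatio

namespace HilbertModular

variable {F : Type*} [Field F] {σ₁ σ₂ : F →+* ℝ}

/-- A point of `ℍ × ℍ` as a pair of complex numbers. -/
def coePair (z : ℍ × ℍ) : ℂ × ℂ := (z.1, z.2)

lemma coePair_mem (z : ℍ × ℍ) : coePair z ∈ H2 := ⟨z.1.im_pos, z.2.im_pos⟩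

section

variable (K : Coords σ₁ σ₂) (k : ℕ) (s : ℝ) (z : ℍ × ℍ)

lemma eisVal_pairRep_inl (c : Rep) :
    eisVal σ₁ σ₂ k s z (K.pairRep (.inl c)) = ((c.nm ^ (-(k + 2 * s)) : ℝ) : ℂ) := by
  have e : normFactor σ₁ σ₂ (K.pairRep (.inl c)).1 (K.pairRep (.inl c)).2 z = (c.nm : ℂ) := by
    simp [Coords.pairRep, normFactor, K.h1, K.h2, Rep.nm, Rep.l1, Rep.l2]
  have hN : 0 < c.nm := c.nm_pos
  rw [eisVal, e, eterm, norm_real, Real.norm_of_nonneg hN.le, neg_add, Real.rpow_add hN,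
    Real.rpow_neg hN.le (k : ℝ), Real.rpow_natCast]
  push_cast
  rfl

lemma eisVal_pairRep_inr (x : Rep × (ℤ × ℤ)) :
    eisVal σ₁ σ₂ k s z (K.pairRep (.inr x)) = pterm k s (x.1.mulPt (coePair z)) x.2 := by
  rw [eisVal, pterm, ← eterm_mul]
  simp [Coords.pairRep, normFactor, K.h1, K.h2, Rep.mulPt, Rep.l1, Rep.l2, coePair]

end

lemma eisTerm_indexEquiv (K : Coords σ₁ σ₂) {k : ℕ} (hk : Even k) (s : ℝ) (z : ℍ × ℍ)
    (x : Rep ⊕ Rep × (ℤ × ℤ)) :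
    eisTerm σ₁ σ₂ k s z (K.indexEquiv x) = eisVal σ₁ σ₂ k s z (K.pairRep x) :=
  eisTerm_eq K hk s z rfl

/-- Orbits of pairs `(0, d)` contribute the zeta value. The other orbits have a unique member with
first entry a chosen representative `c`, and second entry arbitrary, contributing `pSum` at `cz`. -/
lemma hasSum_eisTerm (K : Coords σ₁ σ₂) {k : ℕ} (hk : Even k) {s : ℝ} (hs : 2 < k + 2 * s)
    (z : ℍ × ℍ) : HasSum (eisTerm σ₁ σ₂ k s z)
      (Rep.zeta (k + 2 * s) + ∑' c : Rep, pSum k s (c.mulPt (coePair z))) := by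
  rw [← K.indexEquiv.hasSum_iff]
  have h1 : HasSum (fun c : Rep => ((c.nm ^ (-(k + 2 * s)) : ℝ) : ℂ))
      (Rep.zeta (k + 2 * s) : ℂ) :=
    hasSum_ofReal.mpr (Rep.summable_nm (by linarith)).hasSum
  have hsum := (Rep.summable_pterm_mulPt (coePair_mem z) hs).of_norm
  have h2 : HasSum (fun x : Rep × (ℤ × ℤ) => pterm k s (x.1.mulPt (coePair z)) x.2)
      (∑' c : Rep, pSum k s (c.mulPt (coePair z))) := by
    have := hsum.tsum_prod
    exact this ▸ hsum.hasSum
  refine HasSum.sum (h1.congr_fun fun c => ?_) (h2.congr_fun fun x => ?_)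
  · rw [comp_apply, comp_apply, eisTerm_indexEquiv K hk, eisVal_pairRep_inl]
  · rw [comp_apply, comp_apply, eisTerm_indexEquiv K hk, eisVal_pairRep_inr]

/-- The Eisenstein series of weight `k` as a function on `ℍ²`. -/
noncomputable def eis (k : ℕ) (z : ℂ × ℂ) : ℂ := Rep.zeta k + ∑' c : Rep, pSum k 0 (c.mulPt z)

lemma tendsto_eisTerm (K : Coords σ₁ σ₂) (z : ℍ × ℍ) :
    Tendsto (fun s : ℝ => ∑' q, eisTerm σ₁ σ₂ 2 s z q) (𝓝[>] 0) (𝓝 (eis 2 (coePair z))) := by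
  have h := ((continuous_ofReal.tendsto _).comp Rep.tendsto_zeta).add
    (Rep.tendsto_tsum_pSum (coePair_mem z))
  rw [eis]
  push_cast
  refine h.congr' ?_
  filter_upwards [self_mem_nhdsWithin] with s hs
  rw [(hasSum_eisTerm K even_two (s := s) (by push_cast; linarith [Set.mem_Ioi.mp hs]) z).tsum_eq]
  push_cast
  rfl

lemma eisG_eq (K : Coords σ₁ σ₂) {k : ℕ} (hk : Even k) (hk2 : 2 ≤ k) (z : ℍ × ℍ) :
    eisG σ₁ σ₂ k z = eis k (coePair z) := by
  rw [eisG]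
  split_ifs with h
  · have h' : (2 : ℝ) < k := by exact_mod_cast h
    rw [(hasSum_eisTerm K hk (s := 0) (by linarith) z).tsum_eq]
    simp [eis]
  · obtain rfl : k = 2 := by omega
    exact (tendsto_eisTerm K z).limUnder_eq

lemma tendsto_eisG (K : Coords σ₁ σ₂) (z : ℍ × ℍ) :
    Tendsto (fun s : ℝ => ∑' q, eisTerm σ₁ σ₂ 2 s z q) (𝓝[>] 0) (𝓝 (eisG σ₁ σ₂ 2 z)) := by
  rw [eisG_eq K even_two le_rfl]
  exact tendsto_eisTerm K z

/-- A relation between the terms of the Eisenstein series that is compatible with a permutation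
of the index set gives a relation between the Eisenstein series. -/
lemma eisG_eq_mul (K : Coords σ₁ σ₂) {k : ℕ} (hk : Even k) (hk2 : 2 ≤ k) {z w : ℍ × ℍ} {v : ℂ}
    (hv : v ≠ 0) (e : 𝓞 F × 𝓞 F ≃ 𝓞 F × 𝓞 F) (he0 : e 0 = 0)
    (he : ∀ p q, MulAction.orbitRel (𝓞 F)ˣ (𝓞 F × 𝓞 F) p q ↔
      MulAction.orbitRel (𝓞 F)ˣ (𝓞 F × 𝓞 F) (e p) (e q))
    (h : ∀ p, v * normFactor σ₁ σ₂ p.1 p.2 w = normFactor σ₁ σ₂ (e p).1 (e p).2 z) :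
    eisG σ₁ σ₂ k w = v ^ k * eisG σ₁ σ₂ k z := by
  let E : MulAction.orbitRel.Quotient (𝓞 F)ˣ (𝓞 F × 𝓞 F) ≃
      MulAction.orbitRel.Quotient (𝓞 F)ˣ (𝓞 F × 𝓞 F) := Quotient.congr e he
  have hE0 : E (Quotient.mk _ 0) = Quotient.mk _ 0 := by
    change Quotient.mk _ (e 0) = _
    rw [he0]
  let E' : EisIndex F ≃ EisIndex F := E.subtypeEquiv fun q => by
    have h1 := E.apply_eq_iff_eq (x := q) (y := Quotient.mk _ 0)
    rw [hE0] at h1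
    exact (not_congr h1).symm
  -- Before the limit the automorphy factor carries an extra `‖v‖ ^ (2 * s)`, which tends to 1.
  have hT : ∀ s : ℝ, ∑' q, eisTerm σ₁ σ₂ k s w q =
      (v ^ k * (‖v‖ ^ (2 * s) : ℝ)) * ∑' q, eisTerm σ₁ σ₂ k s z q := fun s => by
    rw [← tsum_mul_left,
      ← E'.tsum_eq fun q => v ^ k * (‖v‖ ^ (2 * s) : ℝ) * eisTerm σ₁ σ₂ k s z q]
    refine tsum_congr fun q => ?_
    obtain ⟨q, hq⟩ := q
    induction q using Quotient.inductionOn with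
    | h p =>
      rw [eisTerm_eq K hk s w (p := p) rfl, eisTerm_eq K hk s z (p := e p) rfl, eisVal, eisVal,
        ← h, eterm_mul, ← mul_assoc]
      have h1 : (v ^ k * (‖v‖ ^ (2 * s) : ℝ)) * eterm k s v = 1 := by
        have hn : 0 < ‖v‖ := norm_pos_iff.mpr hv
        rw [eterm, Real.rpow_neg hn.le, ofReal_inv]
        have := (Real.rpow_pos_of_pos hn (2 * s)).ne'
        have h2 : ((‖v‖ ^ (2 * s) : ℝ) : ℂ) ≠ 0 := ofReal_ne_zero.mpr this
        field_simp
      rw [h1, one_mul]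
  by_cases h2 : 2 < k
  · rw [eisG, eisG, if_pos h2, if_pos h2, hT]
    simp
  · obtain rfl : k = 2 := by omega
    refine tendsto_nhds_unique (tendsto_eisG K w) ?_
    simp only [hT]
    refine Tendsto.mul ?_ (tendsto_eisG K z)
    have h1 : Continuous fun s : ℝ => v ^ 2 * ((‖v‖ ^ (2 * s) : ℝ) : ℂ) :=
      continuous_const.mul (continuous_ofReal.comp
        (continuous_const.rpow (by fun_prop) fun _ => Or.inl (norm_ne_zero_iff.mpr hv)))
    have := (h1.tendsto 0).mono_left (nhdsWithin_le_nhds (s := Ioi 0))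
    simpa using this

lemma normFactor_act (γ : SL(2, 𝓞 F)) (z : ℍ × ℍ) (c d : 𝓞 F) :
    normFactor σ₁ σ₂ (γ 1 0) (γ 1 1) z * normFactor σ₁ σ₂ c d (act σ₁ σ₂ γ z) =
      normFactor σ₁ σ₂ (c * γ 0 0 + d * γ 1 0) (c * γ 0 1 + d * γ 1 1) z := by
  have key : ∀ (σ : F →+* ℝ) (τ : ℍ), ((intEmb σ (γ 1 0) : ℝ) * (τ : ℂ) + (intEmb σ (γ 1 1) : ℝ)) *
      ((intEmb σ c : ℝ) * ((Matrix.SpecialLinearGroup.map (intEmb σ) γ • τ : ℍ) : ℂ) +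
        (intEmb σ d : ℝ)) =
      (intEmb σ (c * γ 0 0 + d * γ 1 0) : ℝ) * (τ : ℂ) + (intEmb σ (c * γ 0 1 + d * γ 1 1) : ℝ) := by
    intro σ τ
    have h0 : ((intEmb σ (γ 1 0) : ℝ) * (τ : ℂ) + (intEmb σ (γ 1 1) : ℝ) : ℂ) ≠ 0 := by
      have := normFactor_ne_zero σ σ (γ 1 0) (γ 1 1) (row_ne_zero γ) (τ, τ)
      exact left_ne_zero_of_mul this
    rw [coe_map_smul]
    simp only [map_add, map_mul]
    push_cast
    field_simp
    ring
  simp only [normFactor, act]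
  rw [← key, ← key]
  ring

lemma eisG_act (K : Coords σ₁ σ₂) {k : ℕ} (hk : Even k) (hk2 : 2 ≤ k) (γ : SL(2, 𝓞 F))
    (z : ℍ × ℍ) : eisG σ₁ σ₂ k (act σ₁ σ₂ γ z) =
      normFactor σ₁ σ₂ (γ 1 0) (γ 1 1) z ^ k * eisG σ₁ σ₂ k z := by
  have hdet : γ 0 0 * γ 1 1 - γ 0 1 * γ 1 0 = 1 := by
    rw [← Matrix.det_fin_two]; exact γ.det_coe
  refine eisG_eq_mul K hk hk2 (normFactor_ne_zero σ₁ σ₂ _ _ (row_ne_zero γ) z)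
    { toFun := fun p => (p.1 * γ 0 0 + p.2 * γ 1 0, p.1 * γ 0 1 + p.2 * γ 1 1)
      invFun := fun p => (p.1 * γ 1 1 - p.2 * γ 1 0, p.2 * γ 0 0 - p.1 * γ 0 1)
      left_inv := fun p => Prod.ext (by linear_combination p.1 * hdet)
        (by linear_combination p.2 * hdet)
      right_inv := fun p => Prod.ext (by linear_combination p.1 * hdet)
        (by linear_combination p.2 * hdet) } (by simp) (fun p q => ?_)
    (fun p => normFactor_act γ z p.1 p.2)
  rw [MulAction.orbitRel_apply, MulAction.orbitRel_apply, MulAction.mem_orbit_iff,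
    MulAction.mem_orbit_iff]
  refine exists_congr fun u => ?_
  simp only [Equiv.coe_fn_mk, Prod.ext_iff, Prod.smul_fst, Prod.smul_snd, Units.smul_def,
    smul_eq_mul]
  constructor
  · rintro ⟨h1, h2⟩
    constructor <;> rw [← h1, ← h2] <;> ring
  · rintro ⟨h1, h2⟩
    constructor
    · linear_combination γ 1 1 * h1 - γ 1 0 * h2 - (u * q.1 - p.1) * hdet
    · linear_combination γ 0 0 * h2 - γ 0 1 * h1 - (u * q.2 - p.2) * hdet

namespace Coords

/-- The Galois conjugation on the ring of integers. -/
noncomputable def conj (K : Coords σ₁ σ₂) (x : 𝓞 F) : 𝓞 F :=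
  K.O ((K.O.symm x).1 + (K.O.symm x).2, -(K.O.symm x).2)

lemma intEmb_conj_fst (K : Coords σ₁ σ₂) (x : 𝓞 F) : intEmb σ₁ (K.conj x) = intEmb σ₂ x := by
  have b := Real.goldenRatio_add_goldenConj
  rw [conj, K.h1, ← K.h2', latt1, latt2]
  push_cast
  linear_combination -((K.O.symm x).2 : ℝ) * b

lemma intEmb_conj_snd (K : Coords σ₁ σ₂) (x : 𝓞 F) : intEmb σ₂ (K.conj x) = intEmb σ₁ x := by
  have b := Real.goldenRatio_add_goldenConj
  rw [conj, K.h2, ← K.h1', latt1, latt2]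
  push_cast
  linear_combination -((K.O.symm x).2 : ℝ) * b

lemma conj_conj (K : Coords σ₁ σ₂) (x : 𝓞 F) : K.conj (K.conj x) = x :=
  intEmb_injective σ₁ (by rw [intEmb_conj_fst, intEmb_conj_snd])

lemma conj_mul (K : Coords σ₁ σ₂) (x y : 𝓞 F) : K.conj (x * y) = K.conj x * K.conj y :=
  intEmb_injective σ₁ (by simp only [map_mul, intEmb_conj_fst])

lemma conj_zero (K : Coords σ₁ σ₂) : K.conj 0 = 0 :=
  intEmb_injective σ₁ (by simp only [map_zero, intEmb_conj_fst])

lemma conj_one (K : Coords σ₁ σ₂) : K.conj 1 = 1 :=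
  intEmb_injective σ₁ (by simp only [map_one, intEmb_conj_fst])

/-- The conjugate of a unit. -/
noncomputable def conjUnit (K : Coords σ₁ σ₂) (u : (𝓞 F)ˣ) : (𝓞 F)ˣ :=
  Units.mkOfMulEqOne (K.conj u) (K.conj (u⁻¹ : (𝓞 F)ˣ)) <| by
    rw [← conj_mul, u.mul_inv, conj_one]

end Coords

/-- Galois conjugation permutes the orbits of pairs and exchanges the two embeddings. -/
lemma eisG_swap (K : Coords σ₁ σ₂) {k : ℕ} (hk : Even k) (hk2 : 2 ≤ k) (z₁ z₂ : ℍ) :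
    eisG σ₁ σ₂ k (z₂, z₁) = eisG σ₁ σ₂ k (z₁, z₂) := by
  have key : ∀ p q : 𝓞 F × 𝓞 F, MulAction.orbitRel (𝓞 F)ˣ (𝓞 F × 𝓞 F) p q →
      MulAction.orbitRel (𝓞 F)ˣ (𝓞 F × 𝓞 F) (K.conj p.1, K.conj p.2) (K.conj q.1, K.conj q.2) := by
    intro p q h
    obtain ⟨u, rfl⟩ := MulAction.orbitRel_apply.mp h
    refine MulAction.orbitRel_apply.mpr ⟨K.conjUnit u, ?_⟩
    simp only [Prod.smul_mk, Units.smul_def, smul_eq_mul, Coords.conjUnit,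
      Units.val_mkOfMulEqOne, ← K.conj_mul, Prod.smul_fst, Prod.smul_snd]
  have h := eisG_eq_mul K hk hk2 (z := (z₁, z₂)) (w := (z₂, z₁)) one_ne_zero
    { toFun := fun p => (K.conj p.1, K.conj p.2)
      invFun := fun p => (K.conj p.1, K.conj p.2)
      left_inv := fun p => by simp [K.conj_conj]
      right_inv := fun p => by simp [K.conj_conj] } (by simp [K.conj_zero]) (fun p q =>
        ⟨key p q, fun h => by simpa [K.conj_conj] using key _ _ h⟩) (fun p => by
        simp only [normFactor, Equiv.coe_fn_mk, K.intEmb_conj_fst, K.intEmb_conj_snd]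
        ring)
  rwa [one_pow, one_mul] at h

end HilbertModular

end

/-! ### Fourier coefficients of the lattice sums. -/

section

open Complex MeasureTheory Filter Set Function
open scoped Real goldenRatio

namespace HilbertModular

section

variable {k : ℕ}

lemma exists_bound_pterm (hk : 2 ≤ k) {z₀ : ℂ × ℂ} (hz : z₀ ∈ H2) :
    ∃ U : Set (ℂ × ℂ), IsOpen U ∧ z₀ ∈ U ∧ U ⊆ H2 ∧ ∃ u : ℤ × ℤ → ℝ, Summable u ∧
      ∀ d, ∀ z ∈ U, ‖pterm k 0 z d‖ ≤ u d := by
  set η := min z₀.1.im z₀.2.im / 2 with hηd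
  have hη : 0 < η := half_pos (lt_min hz.1 hz.2)
  have hk' : (2 : ℝ) ≤ k := by exact_mod_cast hk
  have c1 : Continuous fun z : ℂ × ℂ => z.1.im := by fun_prop
  have c2 : Continuous fun z : ℂ × ℂ => z.2.im := by fun_prop
  have c3 : Continuous fun z : ℂ × ℂ => |z.1.re - z₀.1.re| := by fun_prop
  have c4 : Continuous fun z : ℂ × ℂ => |z.2.re - z₀.2.re| := by fun_prop
  refine ⟨{z | η < z.1.im} ∩ {z | η < z.2.im} ∩ ({z | |z.1.re - z₀.1.re| < 1} ∩
    {z | |z.2.re - z₀.2.re| < 1}), ?_, ⟨⟨?_, ?_⟩, ?_, ?_⟩, ?_, _,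
    (summable_lterm (ρ := 2) one_lt_two z₀.1.re z₀.2.re).mul_left
      ((floorConst η 1 ^ (-2 : ℝ)) ^ 2 * (η * η) ^ (-(k + 2 * 0 - 2) : ℝ)), ?_⟩
  · exact ((isOpen_lt continuous_const c1).inter (isOpen_lt continuous_const c2)).inter
      ((isOpen_lt c3 continuous_const).inter (isOpen_lt c4 continuous_const))
  · have := min_le_left z₀.1.im z₀.2.im
    simp only [Set.mem_ofPred_eq]
    linarith
  · have := min_le_right z₀.1.im z₀.2.im
    simp only [Set.mem_ofPred_eq]
    linarith
  · simp
  · simp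
  · exact fun z hz => ⟨hη.trans hz.1.1, hη.trans hz.1.2⟩
  · intro d z hz
    exact norm_pterm_le hη zero_le_one le_rfl le_rfl hz.1.1.le hz.1.2.le hz.2.1.le hz.2.2.le
      zero_le_two (by linarith) d

lemma pterm_zero_right (z : ℂ × ℂ) (d : ℤ × ℤ) :
    pterm k 0 z d = ((z.1 + latt1 d) ^ k)⁻¹ * ((z.2 + latt2 d) ^ k)⁻¹ := by
  rw [pterm, eterm_zero_right, eterm_zero_right]

lemma latt_add_ne_zero {z : ℂ × ℂ} (hz : z ∈ H2) (d : ℤ × ℤ) :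
    z.1 + latt1 d ≠ 0 ∧ z.2 + latt2 d ≠ 0 :=
  ⟨ne_zero_of_im (by simpa using hz.1), ne_zero_of_im (by simpa using hz.2)⟩

lemma differentiableOn_pterm (d : ℤ × ℤ) : DifferentiableOn ℂ (fun z => pterm k 0 z d) H2 := by
  simp only [pterm_zero_right]
  intro z hz
  have h := latt_add_ne_zero hz d
  refine DifferentiableAt.differentiableWithinAt ?_
  refine DifferentiableAt.mul (DifferentiableAt.inv (by fun_prop) (pow_ne_zero _ h.1))
    (DifferentiableAt.inv (by fun_prop) (pow_ne_zero _ h.2))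

lemma continuousOn_pSum (hk : 2 ≤ k) : ContinuousOn (pSum k 0) H2 := by
  intro z hz
  obtain ⟨U, hU, hzU, hUH, u, hu, hb⟩ := exists_bound_pterm hk hz
  have h := continuousOn_tsum (fun d => (differentiableOn_pterm (k := k) d).continuousOn.mono hUH)
    hu hb
  exact (h.continuousAt (hU.mem_nhds hzU)).continuousWithinAt

lemma differentiableAt_pSum_comp (hk : 2 ≤ k) {g : ℂ → ℂ × ℂ} (hg : Differentiable ℂ g) {t : ℂ}
    (ht : g t ∈ H2) : DifferentiableAt ℂ (fun t => pSum k 0 (g t)) t := by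
  obtain ⟨U, hU, hzU, hUH, u, hu, hb⟩ := exists_bound_pterm hk ht
  have hV : IsOpen (g ⁻¹' U) := hU.preimage hg.continuous
  have h := differentiableOn_tsum_of_summable_norm (F := fun d t => pterm k 0 (g t) d) hu
    (fun d => (differentiableOn_pterm d).comp hg.differentiableOn fun t ht => hUH ht) hV
    fun d t ht => hb d _ ht
  exact h.differentiableAt (hV.mem_nhds hzU)

lemma pSum_add_latt (e : ℤ × ℤ) (s : ℝ) (z : ℂ × ℂ) :
    pSum k s (z.1 + latt1 e, z.2 + latt2 e) = pSum k s z := by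
  rw [pSum, pSum, ← (Equiv.addRight e).tsum_eq (pterm k s z)]
  refine tsum_congr fun d => ?_
  simp only [pterm, Equiv.coe_addRight, latt1_add, latt2_add]
  push_cast
  congr 2 <;> ring

lemma perHol_pSum (hk : 2 ≤ k) : PerHol (pSum k 0) where
  cont := (continuousOn_pSum hk).comp
    (by fun_prop : ContinuousOn (fun w : ℂ × ℂ => (w.1 + (φ : ℝ) * w.2, w.1 + (ψ : ℝ) * w.2)) _)
    fun w hw => inBasis_mem hw
  hol1 u v h := differentiableAt_pSum_comp hk (g := fun u => (u + (φ : ℝ) * v, u + (ψ : ℝ) * v))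
    (by fun_prop) (inBasis_mem h)
  hol2 u v h := differentiableAt_pSum_comp hk (g := fun v => (u + (φ : ℝ) * v, u + (ψ : ℝ) * v))
    (by fun_prop) (inBasis_mem h)
  per1 u v _ := by
    have := pSum_add_latt (k := k) (1, 0) 0 (u + (φ : ℝ) * v, u + (ψ : ℝ) * v)
    simp only [latt1, latt2, Int.cast_one, Int.cast_zero, zero_mul, add_zero, ofReal_one] at this
    simp only [inBasis, add_right_comm _ (1 : ℂ), this]
  per2 u v _ := by
    have := pSum_add_latt (k := k) (0, 1) 0 (u + (φ : ℝ) * v, u + (ψ : ℝ) * v)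
    simp only [latt1_zero_one, latt2_zero_one] at this
    simp only [inBasis, mul_add, mul_one, ← add_assoc, this]

/-- The bound for `pSum` on horizontal lines. -/
noncomputable def pConst (η : ℝ) : ℝ :=
  (floorConst η 0 ^ (-(3 / 2) : ℝ)) ^ 2 * lattBound (3 / 2)

lemma norm_pSum_le_pConst (hk : 2 ≤ k) {η : ℝ} {z : ℂ × ℂ} (hη : 0 < η) (h1 : η ≤ z.1.im)
    (h2 : η ≤ z.2.im) :
    ‖pSum k 0 z‖ ≤ pConst η * (z.1.im * z.2.im) ^ (-(k - 3 / 2) : ℝ) := by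
  have hk' : (2 : ℝ) ≤ k := by exact_mod_cast hk
  have := norm_pSum_le (k := k) (s := 0) hη h1 h2 (ρ := 3 / 2) (by norm_num) (by linarith)
  simpa [pConst] using this

/-- Push to infinity the height in a variable where the frequency is nonpositive: the exponential
stays bounded while the function decays like `t^(−(k − 3/2))`. -/
lemma fcoef_pSum_eq_zero (hk : 2 ≤ k) {ν : ℤ × ℤ} (h : dual1 ν ≤ 0 ∨ dual2 ν ≤ 0) :
    fcoef (pSum k 0) ν = 0 := by
  have hk' : (2 : ℝ) ≤ k := by exact_mod_cast hk
  have key : ∀ (C : ℝ), Tendsto (fun t : ℝ => C * t ^ (-(k - 3 / 2) : ℝ)) atTop (𝓝 0) :=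
    fun C => by
    have := (tendsto_rpow_neg_atTop (y := (k : ℝ) - 3 / 2) (by linarith)).const_mul C
    rwa [mul_zero] at this
  rw [← norm_le_zero_iff]
  rcases h with h | h
  · refine ge_of_tendsto (key (pConst 1 * Real.exp (2 * π * dual2 ν))) ?_
    filter_upwards [eventually_ge_atTop (1 : ℝ)] with t ht
    have ht0 : 0 < t := by linarith
    have hM : ∀ x₁ x₂ : ℝ, ‖pSum k 0 (x₁ + t * I, x₂ + (1 : ℝ) * I)‖ ≤
        pConst 1 * t ^ (-(k - 3 / 2) : ℝ) := fun x₁ x₂ => by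
      have := norm_pSum_le_pConst hk (z := (x₁ + t * I, x₂ + (1 : ℝ) * I)) one_pos
        (by simpa using ht) (by simp)
      simpa using this
    refine ((perHol_pSum hk).norm_fcoef_le ht0 one_pos hM ν).trans ?_
    conv_rhs => rw [mul_right_comm]
    have h0 : 0 ≤ pConst 1 := mul_nonneg (sq_nonneg _) (lattBound_nonneg _)
    have : dual1 ν * t ≤ 0 := mul_nonpos_of_nonpos_of_nonneg h ht0.le
    gcongr
    linarith
  · refine ge_of_tendsto (key (pConst 1 * Real.exp (2 * π * dual1 ν))) ?_
    filter_upwards [eventually_ge_atTop (1 : ℝ)] with t ht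
    have ht0 : 0 < t := by linarith
    have hM : ∀ x₁ x₂ : ℝ, ‖pSum k 0 (x₁ + (1 : ℝ) * I, x₂ + t * I)‖ ≤
        pConst 1 * t ^ (-(k - 3 / 2) : ℝ) := fun x₁ x₂ => by
      have := norm_pSum_le_pConst hk (z := (x₁ + (1 : ℝ) * I, x₂ + t * I)) one_pos
        (by simp) (by simpa using ht)
      simpa using this
    refine ((perHol_pSum hk).norm_fcoef_le one_pos ht0 hM ν).trans ?_
    conv_rhs => rw [mul_right_comm]
    have h0 : 0 ≤ pConst 1 := mul_nonneg (sq_nonneg _) (lattBound_nonneg _)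
    have : dual2 ν * t ≤ 0 := mul_nonpos_of_nonpos_of_nonneg h ht0.le
    gcongr
    linarith

lemma norm_fcoef_pSum_le (hk : 2 ≤ k) {η : ℝ} (hη : 0 < η) (ν : ℤ × ℤ) :
    ‖fcoef (pSum k 0) ν‖ ≤ pConst η * (η * η) ^ (-(k - 3 / 2) : ℝ) *
      Real.exp (2 * π * (dual1 ν * η + dual2 ν * η)) := by
  refine (perHol_pSum hk).norm_fcoef_le hη hη (fun x₁ x₂ => ?_) ν
  have := norm_pSum_le_pConst hk (z := (x₁ + η * I, x₂ + η * I)) hη (by simp) (by simp)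
  simpa using this

/-- The Fourier integral of `w ^ (-k)` along a horizontal line. -/
noncomputable def lineInt (k : ℕ) (δ Y : ℝ) : ℂ :=
  ∫ x : ℝ, eterm k 0 (x + Y * I) * ee (-(δ * (x + Y * I)))

lemma lineInt_scale (k : ℕ) (δ Y : ℝ) {l : ℝ} (hl : 0 < l) :
    lineInt (k + 1) (l * δ) (Y / l) = l ^ k * lineInt (k + 1) δ Y := by
  have h := Measure.integral_comp_div (fun x : ℝ => eterm (k + 1) 0 (x + (Y / l : ℝ) * I) *
    ee (-((l * δ : ℝ) * (x + (Y / l : ℝ) * I)))) l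
  have hl' : (l : ℂ) ≠ 0 := ofReal_ne_zero.mpr hl.ne'
  have e : ∀ x : ℝ, eterm (k + 1) 0 ((x / l : ℝ) + (Y / l : ℝ) * I) *
      ee (-((l * δ : ℝ) * ((x / l : ℝ) + (Y / l : ℝ) * I))) =
      l ^ (k + 1) * (eterm (k + 1) 0 (x + Y * I) * ee (-(δ * (x + Y * I)))) := fun x => by
    have e1 : ((x / l : ℝ) : ℂ) + (Y / l : ℝ) * I = (x + Y * I) / l := by push_cast; ring
    have e2 : -((l * δ : ℝ) * ((x + Y * I : ℂ) / l)) = -(δ * (x + Y * I)) := by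
      push_cast; field_simp
    rw [e1, e2, eterm_zero_right, eterm_zero_right, div_pow, inv_div]
    ring
  simp only [e] at h
  rw [integral_const_mul, abs_of_pos hl, real_smul] at h
  rw [lineInt, lineInt]
  refine mul_left_cancel₀ hl' ?_
  rw [← h]
  ring

lemma integrable_lineInt (hk : 2 ≤ k) (δ : ℝ) {Y : ℝ} (hY : 0 < Y) :
    Integrable fun x : ℝ => eterm k 0 (x + Y * I) * ee (-(δ * (x + Y * I))) := by
  refine ((integrable_eterm hk le_rfl hY).mul_bdd (c := Real.exp (2 * π * (δ * Y))) ?_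
    (Eventually.of_forall fun x => ?_))
  · exact (continuous_ee.comp (by fun_prop)).aestronglyMeasurable
  · rw [norm_ee]
    simp

lemma integral_unitCell_eq {k : ℝ × ℝ → ℂ} (hk : Continuous k) :
    ∫ x in unitCell, k x = ∫ v in (0 : ℝ)..1, ∫ u in (0 : ℝ)..1, k (u, v) := by
  simp only [intervalIntegral.integral_of_le zero_le_one]
  rw [unitCell, Measure.volume_eq_prod, ← Measure.prod_restrict, integral_prod_symm]
  rw [Measure.prod_restrict]
  exact (hk.continuousOn.integrableOn_compact (isCompact_Icc.prod isCompact_Icc)).mono_set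
    (Set.prod_mono Ioc_subset_Icc_self Ioc_subset_Icc_self)

/-- Unfolding: the sum over the lattice and the integral over a cell combine to a product of two
line integrals. -/
lemma fcoef_pSum_eq (hk : 2 ≤ k) (ν : ℤ × ℤ) {Y₁ Y₂ : ℝ} (h1 : 0 < Y₁) (h2 : 0 < Y₂) :
    fcoef (pSum k 0) ν =
      ((√5)⁻¹ : ℝ) • (lineInt k (dual1 ν) Y₁ * lineInt k (dual2 ν) Y₂) := by
  obtain ⟨α, β, h3, h4⟩ := exists_coord Y₁ Y₂
  have hc : (α, β) ∈ coneUV := by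
    constructor <;> simp only
    · rwa [h3]
    · rwa [h4]
  rw [fcoef_eq_tubeC (perHol_pSum hk) hc, tubeC_eq, lineInt, lineInt,
    ← integral_tsum_unitCell (integrable_lineInt hk _ h1) (integrable_lineInt hk _ h2)]
  have hcont : Continuous fun x : ℝ × ℝ => inBasis (pSum k 0) (x.1 + α * I) (x.2 + β * I) *
      ee (-(ν.1 * (x.1 + α * I) + ν.2 * (x.2 + β * I))) :=
    (continuous_tube (perHol_pSum hk) hc).mul (continuous_ee.comp (by fun_prop))
  rw [← integral_unitCell_eq hcont]
  refine setIntegral_congr_fun measurableSet_unitCell fun x _ => ?_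
  have e1 : (x.1 + α * I : ℂ) + (φ : ℝ) * (x.2 + β * I) = (x.1 + φ * x.2 : ℝ) + Y₁ * I := by
    rw [← h3]; push_cast; ring
  have e2 : (x.1 + α * I : ℂ) + (ψ : ℝ) * (x.2 + β * I) = (x.1 + ψ * x.2 : ℝ) + Y₂ * I := by
    rw [← h4]; push_cast; ring
  have e3 := gexp_coord ν (x.1 + α * I) (x.2 + β * I)
  rw [ee_neg, ← e3, inBasis, e1, e2, gexp, ← ee_neg, pSum, ← tsum_mul_right]
  refine tsum_congr fun d => ?_
  rw [pterm]
  -- Translation by a lattice point changes the exponent by an integer, by `dual_mul_latt`, so the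
  -- exponential can be moved inside the sum.
  have e4 : -(dual1 ν * (((x.1 + φ * x.2 + latt1 d : ℝ) : ℂ) + Y₁ * I)) +
      -(dual2 ν * (((x.1 + ψ * x.2 + latt2 d : ℝ) : ℂ) + Y₂ * I)) =
      -(dual1 ν * ((x.1 + φ * x.2 : ℝ) + Y₁ * I) + dual2 ν * ((x.1 + ψ * x.2 : ℝ) + Y₂ * I)) +
        ((-(ν.1 * d.1 + ν.2 * d.2) : ℤ) : ℂ) := by
    have h5 : ((dual1 ν * latt1 d + dual2 ν * latt2 d : ℝ) : ℂ) = ((ν.1 * d.1 + ν.2 * d.2 : ℤ) : ℂ) := by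
      rw [dual_mul_latt]; push_cast; rfl
    push_cast at h5 ⊢
    linear_combination -h5
  have e5 := congrArg ee e4
  rw [ee_add_int, ee_add] at e5
  rw [← e5]
  simp only [ofReal_add]
  rw [add_right_comm _ (Y₁ * I : ℂ), add_right_comm _ (Y₂ * I : ℂ)]
  ring

end

/-- Multiplication by `c` on the inverse different. -/
def lmul (c ν : ℤ × ℤ) : ℤ × ℤ := (c.1 * ν.1 + c.2 * ν.2, c.1 * ν.2 + c.2 * (ν.2 + ν.1))

lemma dual1_lmul (c ν : ℤ × ℤ) : dual1 (lmul c ν) = latt1 c * dual1 ν := by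
  have a := Real.goldenRatio_mul_goldenConj
  have b := Real.goldenRatio_add_goldenConj
  rw [dual1, dual1, latt1, div_eq_iff sqrt_five_ne_zero, mul_assoc, div_mul_cancel₀ _ sqrt_five_ne_zero]
  simp only [lmul]
  push_cast
  linear_combination (c.2 : ℝ) * ν.1 * a - (c.2 : ℝ) * ν.2 * b

lemma dual2_lmul (c ν : ℤ × ℤ) : dual2 (lmul c ν) = latt2 c * dual2 ν := by
  have a := Real.goldenRatio_mul_goldenConj
  have b := Real.goldenRatio_add_goldenConj
  rw [dual2, dual2, latt2, div_eq_iff sqrt_five_ne_zero, mul_assoc, div_mul_cancel₀ _ sqrt_five_ne_zero]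
  simp only [lmul]
  push_cast
  linear_combination -(c.2 : ℝ) * ν.1 * a + (c.2 : ℝ) * ν.2 * b

lemma gexp_lmul (c : Rep) (ν : ℤ × ℤ) (z : ℂ × ℂ) : gexp (lmul c.1 ν) z = gexp ν (c.mulPt z) := by
  rw [gexp, gexp, dual1_lmul, dual2_lmul, Rep.mulPt, Rep.l1, Rep.l2]
  push_cast
  congr 1
  ring

/-- Substituting in each line integral scales it by `l^(k − 1)`. The ratio of coefficients is thus
known without evaluating the integrals in closed form. -/
lemma fcoef_pSum_lmul {k : ℕ} (hk : 2 ≤ k) (c : Rep) (ν : ℤ × ℤ) :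
    fcoef (pSum k 0) (lmul c.1 ν) = (c.nm : ℂ) ^ (k - 1) * fcoef (pSum k 0) ν := by
  obtain ⟨k, rfl⟩ : ∃ j, k = j + 1 := ⟨k - 1, by omega⟩
  rw [fcoef_pSum_eq hk ν one_pos one_pos,
    fcoef_pSum_eq hk _ (div_pos one_pos c.l1_pos) (div_pos one_pos c.l2_pos), dual1_lmul,
    dual2_lmul, Nat.add_sub_cancel]
  change _ • (lineInt (k + 1) (c.l1 * dual1 ν) (1 / c.l1) *
    lineInt (k + 1) (c.l2 * dual2 ν) (1 / c.l2)) = _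
  rw [lineInt_scale k _ _ c.l1_pos, lineInt_scale k _ _ c.l2_pos, Rep.nm, real_smul, real_smul]
  push_cast
  ring

end HilbertModular

end

/-! ### Fourier expansion and holomorphy of the Eisenstein series, and its first coefficients. -/

section

open Complex MeasureTheory Filter Set Function
open scoped Real goldenRatio

namespace HilbertModular

/-- The norm form on the inverse different. -/
def nmDual (ν : ℤ × ℤ) : ℤ := ν.1 ^ 2 + ν.1 * ν.2 - ν.2 ^ 2

lemma dual1_mul_dual2 (ν : ℤ × ℤ) : 5 * (dual1 ν * dual2 ν) = nmDual ν := by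
  have a := Real.goldenRatio_mul_goldenConj
  have b := Real.goldenRatio_add_goldenConj
  have h5 : √5 * √5 = (5 : ℝ) := Real.mul_self_sqrt (by norm_num)
  rw [dual1, dual2, div_mul_div_comm, h5, nmDual, mul_div_cancel₀ _ (by norm_num)]
  push_cast
  linear_combination (ν.1 * ν.2 : ℝ) * b - (ν.1 : ℝ) ^ 2 * a

lemma one_le_nmDual {ν : ℤ × ℤ} (h1 : 0 < dual1 ν) (h2 : 0 < dual2 ν) : 1 ≤ nmDual ν := by
  have h := dual1_mul_dual2 ν
  have : (0 : ℝ) < nmDual ν := by rw [← h]; positivity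
  have : 0 < nmDual ν := by exact_mod_cast this
  omega

lemma abs_add_abs_le {ν : ℤ × ℤ} (h1 : 0 < dual1 ν) (h2 : 0 < dual2 ν) :
    |(ν.1 : ℝ)| + |(ν.2 : ℝ)| ≤ 3 * (dual1 ν + dual2 ν) := by
  rw [← dual1_add_dual2, ← dual1_mul_add_dual2_mul]
  have p1 := Real.goldenRatio_lt_two
  have p2 := Real.goldenRatio_pos
  have p3 := Real.goldenConj_neg
  have p4 := Real.neg_one_lt_goldenConj
  have e1 : |dual1 ν + dual2 ν| = dual1 ν + dual2 ν := abs_of_pos (add_pos h1 h2)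
  have e2 : |dual1 ν * φ + dual2 ν * ψ| ≤ 2 * (dual1 ν + dual2 ν) := by
    rw [abs_le]; constructor <;> nlinarith
  linarith

/-- A Fourier series on `ℍ²` with coefficients supported in the closed cone is holomorphic. -/
lemma differentiableOn_of_hasSum {a : ℤ × ℤ → ℂ} {f : ℂ × ℂ → ℂ}
    (h : ∀ z ∈ H2, HasSum (fun ν => a ν * gexp ν z) (f z))
    (h0 : ∀ ν, a ν ≠ 0 → 0 ≤ dual1 ν ∧ 0 ≤ dual2 ν) : DifferentiableOn ℂ f H2 := by
  intro z₀ hz₀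
  set δ := min z₀.1.im z₀.2.im / 4
  have hm : 0 < min z₀.1.im z₀.2.im := lt_min hz₀.1 hz₀.2
  have hδ : 0 < δ := by positivity
  have hδ1 : 4 * δ ≤ z₀.1.im := by
    have := min_le_left z₀.1.im z₀.2.im
    simp only [δ]; linarith
  have hδ2 : 4 * δ ≤ z₀.2.im := by
    have := min_le_right z₀.1.im z₀.2.im
    simp only [δ]; linarith
  -- The ball stays above the height of `w₀` by `δ` in both variables. The resulting factor
  -- exp(−2πδ(ν₁ + ν₂)), with ν₁, ν₂ the two embeddings, absorbs the linear factor from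
  -- differentiation.
  set w₀ : ℂ × ℂ := (z₀.1 - (2 * δ : ℝ) * I, z₀.2 - (2 * δ : ℝ) * I)
  have w1 : w₀.1.im = z₀.1.im - 2 * δ := by simp [w₀]
  have w2 : w₀.2.im = z₀.2.im - 2 * δ := by simp [w₀]
  have hw₀ : w₀ ∈ H2 := ⟨by rw [w1]; linarith, by rw [w2]; linarith⟩
  have hball : ∀ z ∈ Metric.ball z₀ δ, z₀.1.im - δ < z.1.im ∧ z₀.2.im - δ < z.2.im := by
    intro z hz
    rw [mem_ball_iff_norm, Prod.norm_def, max_lt_iff] at hz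
    have a1 := (abs_im_le_norm (z.1 - z₀.1)).trans_lt hz.1
    have a2 := (abs_im_le_norm (z.2 - z₀.2)).trans_lt hz.2
    rw [sub_im, abs_lt] at a1 a2
    exact ⟨by linarith [a1.1], by linarith [a2.1]⟩
  have hsub : Metric.ball z₀ δ ⊆ H2 := fun z hz =>
    ⟨by linarith [(hball z hz).1], by linarith [(hball z hz).2]⟩
  set L : ℤ × ℤ → ℂ × ℂ →L[ℂ] ℂ := fun ν =>
    (dual1 ν : ℂ) • ContinuousLinearMap.fst ℂ ℂ ℂ + (dual2 ν : ℂ) • ContinuousLinearMap.snd ℂ ℂ ℂ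
  have hL : ∀ ν, 0 ≤ dual1 ν → 0 ≤ dual2 ν → ‖L ν‖ ≤ dual1 ν + dual2 ν := fun ν h1 h2 => by
    refine (norm_add_le _ _).trans ?_
    rw [norm_smul, norm_smul, norm_real, norm_real, Real.norm_of_nonneg h1, Real.norm_of_nonneg h2]
    exact add_le_add (mul_le_of_le_one_right h1 (ContinuousLinearMap.norm_fst_le ..))
      (mul_le_of_le_one_right h2 (ContinuousLinearMap.norm_snd_le ..))
  have hd : ∀ ν z, HasFDerivAt (fun z => a ν * gexp ν z)
      ((a ν * (gexp ν z * (2 * π * I))) • L ν) z := fun ν z => by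
    have hg : ∀ z, gexp ν z = cexp (2 * π * I * L ν z) := fun z => by simp [gexp, ee, L]
    simp only [hg]
    have h1 : HasFDerivAt (fun z : ℂ × ℂ => 2 * π * I * L ν z) ((2 * π * I) • L ν) z :=
      (L ν).hasFDerivAt.const_mul _
    have h2 := (h1.cexp).const_mul (a ν)
    rw [smul_smul, smul_smul, mul_assoc (a ν)] at h2
    exact h2
  have hb : ∀ ν z, z ∈ Metric.ball z₀ δ →
      ‖(a ν * (gexp ν z * (2 * π * I))) • L ν‖ ≤ δ⁻¹ * ‖a ν * gexp ν w₀‖ := fun ν z hz => by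
    by_cases ha : a ν = 0
    · rw [ha, zero_mul, zero_mul, norm_zero, mul_zero, norm_smul, norm_zero, zero_mul]
    obtain ⟨h1, h2⟩ := h0 ν ha
    obtain ⟨b1, b2⟩ := hball z hz
    have e1 : ‖(2 * π * I : ℂ)‖ = 2 * π := by simp [abs_of_pos Real.pi_pos]
    rw [norm_smul, norm_mul, norm_mul (gexp ν z), e1, norm_gexp ν z]
    have e2 : 2 * π * δ * (dual1 ν + dual2 ν) ≤
        Real.exp (2 * π * δ * (dual1 ν + dual2 ν)) := by
      linarith [Real.add_one_le_exp (2 * π * δ * (dual1 ν + dual2 ν))]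
    have hg2 : ‖a ν * gexp ν w₀‖ = ‖a ν‖ * ‖gexp ν w₀‖ := norm_mul _ _
    rw [hg2, norm_gexp, w1, w2]
    have e3 : Real.exp (-2 * π * (dual1 ν * z.1.im + dual2 ν * z.2.im)) ≤
        Real.exp (-2 * π * (dual1 ν * (z₀.1.im - 2 * δ) + dual2 ν * (z₀.2.im - 2 * δ))) *
          (Real.exp (2 * π * δ * (dual1 ν + dual2 ν)))⁻¹ := by
      rw [← Real.exp_neg, ← Real.exp_add, Real.exp_le_exp]
      have c1 := mul_le_mul_of_nonneg_left b1.le h1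
      have c2 := mul_le_mul_of_nonneg_left b2.le h2
      nlinarith [Real.pi_pos]
    set X := Real.exp (2 * π * δ * (dual1 ν + dual2 ν))
    have hX : 0 < X := Real.exp_pos _
    set E := Real.exp (-2 * π * (dual1 ν * (z₀.1.im - 2 * δ) + dual2 ν * (z₀.2.im - 2 * δ)))
    calc _ ≤ ‖a ν‖ * (E * X⁻¹ * (2 * π)) * (dual1 ν + dual2 ν) := by
          have := hL ν h1 h2
          have := add_nonneg h1 h2
          gcongr
      _ = δ⁻¹ * (‖a ν‖ * E) * (X⁻¹ * (2 * π * δ * (dual1 ν + dual2 ν))) := by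
          field_simp
      _ ≤ δ⁻¹ * (‖a ν‖ * E) * 1 := by
          gcongr
          rw [inv_mul_le_iff₀ hX, mul_one]
          exact e2
      _ = _ := by rw [mul_one]
  have hmem : z₀ ∈ Metric.ball z₀ δ := Metric.mem_ball_self hδ
  have hfd := hasFDerivAt_tsum_of_isPreconnected ((h w₀ hw₀).summable.norm.mul_left δ⁻¹)
    Metric.isOpen_ball (convex_ball z₀ δ).isPreconnected (fun ν z _ => hd ν z) hb hmem
    (h z₀ hz₀).summable hmem
  refine (hfd.differentiableAt.congr_of_eventuallyEq ?_).differentiableWithinAt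
  filter_upwards [isOpen_H2.mem_nhds hz₀] with z hz
  exact (h z hz).tsum_eq.symm

section

variable {k : ℕ}

/-- An integrable majorant for the double family over `c` and `ν`, needed because in weight 2 the
original double series does not supply one. Exponential decay at `cz` is shared between `ν` and the
norm of `c`. -/
lemma exists_bound_fcoef_mul (hk : 2 ≤ k) {z : ℂ × ℂ} (hz : z ∈ H2) :
    ∃ K c : ℝ, 0 < c ∧ ∀ x : Rep × (ℤ × ℤ), ‖fcoef (pSum k 0) x.2 * gexp (lmul x.1.1 x.2) z‖ ≤
      K * (x.1.nm ^ (-2 : ℝ) * Real.exp (-c * (|(x.2.1 : ℝ)| + |(x.2.2 : ℝ)|))) := by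
  set y := min z.1.im z.2.im
  have hy : 0 < y := lt_min hz.1 hz.2
  set M := pConst (y / 12) * (y / 12 * (y / 12)) ^ (-(k - 3 / 2) : ℝ)
  have hM : 0 ≤ M := mul_nonneg (mul_nonneg (sq_nonneg _) (lattBound_nonneg _)) (by positivity)
  refine ⟨M * (25 * 24 / (16 * (π * y) ^ 4)), 2 * π * y / 36, by positivity, fun x => ?_⟩
  obtain ⟨c, ν⟩ := x
  simp only
  have hN : 0 < c.nm := c.nm_pos
  by_cases hν : 0 < dual1 ν ∧ 0 < dual2 ν
  · obtain ⟨h1, h2⟩ := hν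
    have l1 := c.third_le_l1
    have l2 := c.third_le_l2
    set A := c.l1 * dual1 ν with hA
    set B := c.l2 * dual2 ν with hB
    have hA1 : dual1 ν ≤ 3 * A := by nlinarith
    have hB1 : dual2 ν ≤ 3 * B := by nlinarith
    have hA0 : 0 < A := by linarith
    have hB0 : 0 < B := by linarith
    have hy1 : y ≤ z.1.im := min_le_left _ _
    have hy2 : y ≤ z.2.im := min_le_right _ _
    -- Since the embeddings of `c` are at least 1/3, each embedding of `ν` is at most three times
    -- `A` or `B`. The height y/12 and the rate 2πy/36 each consume at most πy(A + B) of the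
    -- available exponent 2πy(A + B) when counted together, leaving πy(A + B).
    have b1 := norm_fcoef_pSum_le hk (by positivity : 0 < y / 12) ν
    have b2 : ‖gexp (lmul c.1 ν) z‖ ≤ Real.exp (-2 * π * (y * (A + B))) := by
      rw [norm_gexp, dual1_lmul, dual2_lmul, Real.exp_le_exp]
      change -2 * π * (A * z.1.im + B * z.2.im) ≤ _
      have c1 := mul_le_mul_of_nonneg_left hy1 hA0.le
      have c2 := mul_le_mul_of_nonneg_left hy2 hB0.le
      nlinarith [Real.pi_pos]
    have b3 : Real.exp (2 * π * (dual1 ν * (y / 12) + dual2 ν * (y / 12))) *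
        Real.exp (-2 * π * (y * (A + B))) ≤
        Real.exp (-(2 * π * y / 36) * (|(ν.1 : ℝ)| + |(ν.2 : ℝ)|)) *
          Real.exp (-(π * y * (A + B))) := by
      rw [← Real.exp_add, ← Real.exp_add, Real.exp_le_exp]
      have e := abs_add_abs_le h1 h2
      have hπ : 0 < π * y := by positivity
      have : 2 * ((dual1 ν + dual2 ν) / 12) - 2 * (A + B) +
          (2 / 36) * (|(ν.1 : ℝ)| + |(ν.2 : ℝ)|) + (A + B) ≤ 0 := by linarith
      nlinarith
    -- By the arithmetic-geometric mean inequality and 5ν₁ν₂ ≥ 1 for the embeddings, (A + B)² ≥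
    -- (4/5) nm(c). The fourth-order term of the exponential then gives the power nm(c)⁻².
    have b4 : Real.exp (-(π * y * (A + B))) ≤
        25 * 24 / (16 * (π * y) ^ 4) * c.nm ^ (-2 : ℝ) := by
      have e := Real.pow_div_factorial_le_exp (π * y * (A + B)) (by positivity) 4
      have e1 : (4 / 5) * c.nm ≤ (A + B) ^ 2 := by
        have n1 : (1 : ℝ) ≤ nmDual ν := by exact_mod_cast one_le_nmDual h1 h2
        rw [← dual1_mul_dual2] at n1
        have n2 : A * B = c.nm * (dual1 ν * dual2 ν) := by rw [hA, hB, Rep.nm]; ring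
        have n3 : c.nm * 1 ≤ c.nm * (5 * (dual1 ν * dual2 ν)) :=
          mul_le_mul_of_nonneg_left n1 hN.le
        nlinarith [sq_nonneg (A - B)]
      have e2 : (16 / 25) * c.nm ^ 2 ≤ (A + B) ^ 4 := by
        calc (16 / 25) * c.nm ^ 2 = ((4 / 5) * c.nm) ^ 2 := by ring
          _ ≤ ((A + B) ^ 2) ^ 2 := by gcongr
          _ = _ := by ring
      have e3 : 16 * (π * y) ^ 4 * c.nm ^ 2 / (25 * 24) ≤ Real.exp (π * y * (A + B)) := by
        refine le_trans ?_ e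
        rw [mul_pow, show ((Nat.factorial 4 : ℕ) : ℝ) = 24 by norm_num [Nat.factorial]]
        have := mul_le_mul_of_nonneg_left e2 (by positivity : 0 ≤ (π * y) ^ 4)
        linarith
      rw [Real.exp_neg, Real.rpow_neg hN.le, Real.rpow_two]
      refine (inv_anti₀ (by positivity) e3).trans_eq ?_
      field_simp
    rw [norm_mul]
    calc _ ≤ M * Real.exp (2 * π * (dual1 ν * (y / 12) + dual2 ν * (y / 12))) *
          Real.exp (-2 * π * (y * (A + B))) :=
          mul_le_mul b1 b2 (norm_nonneg _) (by positivity)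
      _ ≤ M * (Real.exp (-(2 * π * y / 36) * (|(ν.1 : ℝ)| + |(ν.2 : ℝ)|)) *
          (25 * 24 / (16 * (π * y) ^ 4) * c.nm ^ (-2 : ℝ))) := by
          rw [mul_assoc]
          refine mul_le_mul_of_nonneg_left (b3.trans ?_) hM
          exact mul_le_mul_of_nonneg_left b4 (Real.exp_pos _).le
      _ = _ := by ring
  · have : fcoef (pSum k 0) ν = 0 := by
      refine fcoef_pSum_eq_zero hk ?_
      by_contra! h
      exact hν h
    rw [this, zero_mul, norm_zero]
    positivity

lemma summable_fcoef_mul (hk : 2 ≤ k) {z : ℂ × ℂ} (hz : z ∈ H2) :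
    Summable fun x : Rep × (ℤ × ℤ) => fcoef (pSum k 0) x.2 * gexp (lmul x.1.1 x.2) z := by
  obtain ⟨K, c, hc, hb⟩ := exists_bound_fcoef_mul hk hz
  refine .of_norm_bounded (Summable.mul_left K ?_) hb
  exact (Rep.summable_nm (by norm_num : (1 : ℝ) < 2)).mul_of_nonneg (summable_exp_neg_abs hc)
    (fun c => Rep.nm_pos c |>.le |> (Real.rpow_nonneg · _)) (fun _ => (Real.exp_pos _).le)

/-- The sum of the coefficients of the lattice sums contributing to a Fourier coefficient of the
Eisenstein series. -/
noncomputable def eisSum (k : ℕ) (μ : ℤ × ℤ) : ℂ :=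
  ∑' x : (fun x : Rep × (ℤ × ℤ) => lmul x.1.1 x.2) ⁻¹' {μ}, fcoef (pSum k 0) x.1.2

/-- Expand each lattice sum at `cz` and collect the pairs `(c, ν)` according to the product `μ =
cν`. -/
lemma hasSum_eis (hk : 2 ≤ k) {z : ℂ × ℂ} (hz : z ∈ H2) :
    HasSum (fun μ => ((if μ = 0 then (Rep.zeta k : ℂ) else 0) + eisSum k μ) * gexp μ z)
      (eis k z) := by
  have hs := summable_fcoef_mul hk hz
  have h1 : ∑' x : Rep × (ℤ × ℤ), fcoef (pSum k 0) x.2 * gexp (lmul x.1.1 x.2) z =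
      ∑' c : Rep, pSum k 0 (c.mulPt z) := by
    rw [hs.tsum_prod]
    refine tsum_congr fun c => ?_
    simp only [gexp_lmul]
    exact ((perHol_pSum hk).hasSum (c.mulPt_mem hz)).tsum_eq
  have h2 := hs.hasSum.tsum_fiberwise fun x : Rep × (ℤ × ℤ) => lmul x.1.1 x.2
  rw [h1] at h2
  have h3 : HasSum (fun μ : ℤ × ℤ => (if μ = 0 then (Rep.zeta k : ℂ) else 0) * gexp μ z)
      (Rep.zeta k) := by
    convert hasSum_ite_eq (0 : ℤ × ℤ) (Rep.zeta k : ℂ) using 2 with μ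
    split_ifs with h
    · rw [h, gexp]
      simp [dual1, dual2, ee_zero]
    · rw [zero_mul]
  refine (h3.add h2).congr_fun fun μ => ?_
  rw [add_mul]
  congr 1
  rw [eisSum, ← tsum_mul_right]
  refine tsum_congr fun x => ?_
  have : lmul x.1.1.1 x.1.2 = μ := x.2
  rw [this]

lemma eisSum_eq_tsum (k : ℕ) (μ : ℤ × ℤ) : eisSum k μ =
    ∑' x : Rep × (ℤ × ℤ), if lmul x.1.1 x.2 = μ then fcoef (pSum k 0) x.2 else 0 := by
  rw [eisSum, tsum_subtype ((fun x : Rep × (ℤ × ℤ) => lmul x.1.1 x.2) ⁻¹' {μ})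
    (fun x => fcoef (pSum k 0) x.2)]
  refine tsum_congr fun x => ?_
  split_ifs with hx
  exacts [Set.indicator_of_mem (by exact hx) _, Set.indicator_of_notMem (by exact hx) _]

lemma eisSum_eq_zero (hk : 2 ≤ k) {μ : ℤ × ℤ} (h : dual1 μ ≤ 0 ∨ dual2 μ ≤ 0) :
    eisSum k μ = 0 := by
  rw [eisSum_eq_tsum]
  refine (tsum_congr fun x => ?_).trans tsum_zero
  split_ifs with hx
  · refine fcoef_pSum_eq_zero hk ?_
    rw [← hx, dual1_lmul, dual2_lmul] at h
    exact h.imp (fun h => nonpos_of_mul_nonpos_right h x.1.l1_pos)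
      (fun h => nonpos_of_mul_nonpos_right h x.1.l2_pos)
  · rfl

/-- The defining series does not converge absolutely in weight 2; holomorphy comes from the Fourier
expansion, whose frequencies lie in the closed cone. -/
lemma differentiableOn_eis (hk : 2 ≤ k) : DifferentiableOn ℂ (eis k) H2 := by
  refine differentiableOn_of_hasSum (fun z hz => hasSum_eis hk hz) fun μ hμ => ?_
  by_contra h
  refine hμ ?_
  have h1 : dual1 μ ≤ 0 ∨ dual2 μ ≤ 0 := by
    by_contra! h'
    exact h ⟨h'.1.le, h'.2.le⟩
  rw [eisSum_eq_zero hk h1, add_zero, if_neg]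
  rintro rfl
  exact h (by simp [dual1, dual2])

end

namespace Rep

/-- The representative `1`. -/
def one : Rep := ⟨(1, 0), by simp [latt2], by simp [latt1, latt2], by
  simp [latt1, latt2]; exact one_lt_pow₀ Real.one_lt_goldenRatio (by norm_num)⟩

/-- The representative `2`. -/
def two : Rep := ⟨(2, 0), by simp [latt2], by simp [latt1, latt2], by
  simp [latt1, latt2]; exact one_lt_pow₀ Real.one_lt_goldenRatio (by norm_num)⟩

/-- The representative `(5 + √5) / 2` of norm `5`. -/
def five : Rep := ⟨(2, 1), by
    have := Real.neg_one_lt_goldenConj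
    simp [latt2]; linarith, by
    have := Real.goldenConj_neg
    have := Real.goldenRatio_pos
    simp [latt1, latt2]; linarith, by
    have a := Real.goldenRatio_mul_goldenConj
    have b := Real.goldenRatio_add_goldenConj
    have g := Real.goldenRatio_sq
    have p := Real.goldenRatio_pos
    have e : φ ^ 4 * (2 + ψ) = 4 * φ + 3 := by
      have e1 : φ ^ 4 = 3 * φ + 2 := by linear_combination (φ ^ 2 + φ + 2) * g
      rw [e1]
      linear_combination 3 * a + 2 * b
    simp only [latt1, latt2, Int.cast_ofNat, Int.cast_one, one_mul]
    rw [e]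
    linarith⟩

lemma nm_eq (c : Rep) : c.nm = ((c.1.1 ^ 2 + c.1.1 * c.1.2 - c.1.2 ^ 2 : ℤ) : ℝ) := latt_mul c.1

lemma eq_of_nm_le (c : Rep) (h : c.nm ≤ 5) : c = one ∨ c = two ∨ c = five := by
  have h1 := c.l1_lt
  have h2 := c.l2_le_l1
  have h3 := c.l2_pos
  have hs : φ - ψ = √5 := goldenRatio_sub_goldenConj'
  have b := Real.goldenRatio_add_goldenConj
  have s1 : 2.2 < √5 := by rw [Real.lt_sqrt (by norm_num)]; norm_num
  have s2 : √5 < 2.3 := by rw [Real.sqrt_lt' (by norm_num)]; norm_num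
  have h4 : c.l1 < 6 := by rw [nm] at h; nlinarith
  have h5 : c.l2 < 2.3 := by rw [nm] at h; nlinarith
  have hd : c.l1 - c.l2 = c.1.2 * √5 := by rw [l1, l2, latt1, latt2, ← hs]; ring
  have h6 : 0 ≤ c.1.2 := by
    have : (0 : ℝ) ≤ c.1.2 := by
      by_contra! hc
      nlinarith
    exact_mod_cast this
  have h7 : c.1.2 < 3 := by
    have : (c.1.2 : ℝ) < 3 := by
      by_contra! hc
      nlinarith
    exact_mod_cast this
  have hl : c.l2 = c.1.1 + c.1.2 * ψ := rfl
  have h6' : (0 : ℝ) ≤ c.1.2 := by exact_mod_cast h6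
  have h7' : (c.1.2 : ℝ) ≤ 2 := by exact_mod_cast (by omega : c.1.2 ≤ 2)
  have h8 : 0 < c.1.1 := by
    have : (0 : ℝ) < c.1.1 := by nlinarith
    exact_mod_cast this
  have h9 : c.1.1 < 4 := by
    have : (c.1.1 : ℝ) < 4 := by nlinarith
    exact_mod_cast this
  have hN := c.nm_eq
  have hN5 : c.1.1 ^ 2 + c.1.1 * c.1.2 - c.1.2 ^ 2 ≤ 5 := by
    rw [hN] at h; exact_mod_cast h
  have hN1 : 1 ≤ c.1.1 ^ 2 + c.1.1 * c.1.2 - c.1.2 ^ 2 := by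
    have := c.one_le_nm
    rw [hN] at this; exact_mod_cast this
  -- These elements are n(1 + φ) = nφ², associated to n. Their embeddings have ratio exactly φ⁴,
  -- excluded by the strict inequality in `Rep`.
  have key : ∀ n : ℤ, 0 < n → c.1 = (n, n) → False := fun n hn hc => by
    have h := c.2.2.2
    rw [hc, latt1, latt2] at h
    have g := Real.goldenRatio_sq
    have a := Real.goldenRatio_mul_goldenConj
    have e : φ ^ 4 * (n + n * ψ) = n + n * φ := by
      have e1 : φ ^ 4 = 3 * φ + 2 := by linear_combination (φ ^ 2 + φ + 2) * g
      rw [e1]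
      linear_combination 3 * (n : ℝ) * a + 2 * (n : ℝ) * b
    simp only at h
    linarith
  obtain ⟨⟨a, d⟩, hc⟩ := c
  simp only at h6 h7 h8 h9 hN5 hN1 key
  have hk1 := key 1 one_pos
  have hk2 := key 2 two_pos
  simp only [Prod.mk.injEq, imp_false] at hk1 hk2
  have : (a = 1 ∧ d = 0) ∨ (a = 2 ∧ d = 0) ∨ (a = 2 ∧ d = 1) := by
    interval_cases d <;> interval_cases a <;> simp_all
  rcases this with ⟨rfl, rfl⟩ | ⟨rfl, rfl⟩ | ⟨rfl, rfl⟩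
  exacts [Or.inl rfl, Or.inr (Or.inl rfl), Or.inr (Or.inr rfl)]

end Rep

section

variable {k : ℕ}

lemma nmDual_lmul (c ν : ℤ × ℤ) :
    nmDual (lmul c ν) = (c.1 ^ 2 + c.1 * c.2 - c.2 ^ 2) * nmDual ν := by
  simp only [nmDual, lmul]; ring

/-- The terms contributing to the coefficients of small norm. -/
lemma eq_of_lmul_eq {c : Rep} {ν μ : ℤ × ℤ} (hμ : lmul c.1 ν = μ) (h5 : nmDual μ ≤ 5)
    (h1 : 0 < dual1 ν) (h2 : 0 < dual2 ν) : c = .one ∨ c = .two ∨ c = .five := by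
  refine c.eq_of_nm_le ?_
  rw [c.nm_eq]
  have hn := one_le_nmDual h1 h2
  have hc : 1 ≤ c.1.1 ^ 2 + c.1.1 * c.1.2 - c.1.2 ^ 2 := by
    have := c.one_le_nm
    rw [c.nm_eq] at this
    exact_mod_cast this
  have : c.1.1 ^ 2 + c.1.1 * c.1.2 - c.1.2 ^ 2 ≤ 5 := by
    rw [← hμ, nmDual_lmul] at h5
    nlinarith
  exact_mod_cast this

/-- The norm form is multiplicative, so a divisor `c` of a frequency with `nmDual` at most 5 has
norm at most 5, leaving three representatives. -/
lemma eisSum_eq_sum (hk : 2 ≤ k) {μ : ℤ × ℤ} (h5 : nmDual μ ≤ 5) {S : Finset (Rep × (ℤ × ℤ))}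
    (hS : ∀ x ∈ S, lmul x.1.1 x.2 = μ)
    (h : ∀ (c : Rep) ν, lmul c.1 ν = μ → c = .one ∨ c = .two ∨ c = .five → (c, ν) ∈ S) :
    eisSum k μ = ∑ x ∈ S, fcoef (pSum k 0) x.2 := by
  rw [eisSum_eq_tsum, tsum_eq_sum (s := S)]
  · exact Finset.sum_congr rfl fun x hx => if_pos (hS x hx)
  · rintro ⟨c, ν⟩ hx
    split_ifs with hμ
    · refine fcoef_pSum_eq_zero hk ?_
      by_contra! hν
      exact hx (h c ν hμ (eq_of_lmul_eq hμ h5 hν.1 hν.2))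
    · rfl

lemma eisSum_zero (hk : 2 ≤ k) : eisSum k 0 = 0 :=
  eisSum_eq_zero hk (Or.inl (by simp [dual1]))

lemma eisSum_one (hk : 2 ≤ k) : eisSum k (1, 0) = fcoef (pSum k 0) (1, 0) := by
  rw [eisSum_eq_sum hk (S := {(Rep.one, (1, 0))}) (by simp [nmDual]), Finset.sum_singleton]
  · simp [lmul, Rep.one]
  · rintro c ⟨p, r⟩ hμ (rfl | rfl | rfl) <;>
      simp only [lmul, Rep.one, Rep.two, Rep.five, Prod.mk.injEq] at hμ
    · simp; omega
    · omega
    · omega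

/-- A divisor sum: `c = 1` contributes the coefficient at `(2, 0)`, which is 4^(k − 1) times the one
at `(1, 0)` by scaling, and `c = 2` contributes the latter itself. -/
lemma eisSum_two (hk : 2 ≤ k) :
    eisSum k (2, 0) = (4 ^ (k - 1) + 1) * fcoef (pSum k 0) (1, 0) := by
  classical
  have h := fcoef_pSum_lmul hk Rep.two (1, 0)
  have e : lmul Rep.two.1 (1, 0) = (2, 0) := by simp [lmul, Rep.two]
  have n : Rep.two.nm = 4 := by rw [Rep.nm_eq]; norm_num [Rep.two]
  rw [e, n] at h
  have hne : (Rep.one, ((2, 0) : ℤ × ℤ)) ≠ (Rep.two, (1, 0)) := by simp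
  rw [eisSum_eq_sum hk (S := {(Rep.one, ((2, 0) : ℤ × ℤ)), (Rep.two, (1, 0))}) (by simp [nmDual]),
    Finset.sum_pair hne, h]
  · push_cast; ring
  · simp [lmul, Rep.one, Rep.two]
  · rintro c ⟨p, r⟩ hμ (rfl | rfl | rfl) <;>
      simp only [lmul, Rep.one, Rep.two, Rep.five, Prod.mk.injEq] at hμ
    · have : p = 2 ∧ r = 0 := by omega
      simp [this]
    · have : p = 1 ∧ r = 0 := by omega
      simp [this]
    · omega

lemma eisSum_five (hk : 2 ≤ k) :
    eisSum k (2, 1) = (5 ^ (k - 1) + 1) * fcoef (pSum k 0) (1, 0) := by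
  classical
  have h := fcoef_pSum_lmul hk Rep.five (1, 0)
  have e : lmul Rep.five.1 (1, 0) = (2, 1) := by simp [lmul, Rep.five]
  have n : Rep.five.nm = 5 := by rw [Rep.nm_eq]; norm_num [Rep.five]
  rw [e, n] at h
  have hne : (Rep.one, ((2, 1) : ℤ × ℤ)) ≠ (Rep.five, (1, 0)) := by simp
  rw [eisSum_eq_sum hk (S := {(Rep.one, ((2, 1) : ℤ × ℤ)), (Rep.five, (1, 0))}) (by simp [nmDual]),
    Finset.sum_pair hne, h]
  · push_cast; ring
  · simp [lmul, Rep.one, Rep.five]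
  · rintro c ⟨p, r⟩ hμ (rfl | rfl | rfl) <;>
      simp only [lmul, Rep.one, Rep.two, Rep.five, Prod.mk.injEq] at hμ
    · have : p = 2 ∧ r = 1 := by omega
      simp [this]
    · omega
    · have : p = 1 ∧ r = 0 := by omega
      simp [this]

end

end HilbertModular

end

/-! ### Normalisation by the Dedekind zeta function and the conclusion. -/

section

open Filter NumberField Ideal
open scoped ComplexOrder

namespace HilbertModular

/-- The Dirichlet coefficients count ideals, so they are nonnegative and the first is 1. The linear
asymptotic for the number of ideals of bounded norm gives convergence to the right of 1. -/
theorem dedekindZeta_pos (K : Type*) [Field K] [NumberField K] {x : ℝ} (hx : 1 < x) :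
    0 < dedekindZeta K x := by
  refine LSeries.positive (a := fun n => (Nat.card {I : Ideal (𝓞 K) // absNorm I = n} : ℂ))
    (fun n => Nat.cast_nonneg _) ?_ (lt_of_le_of_lt
    (LSeries.abscissaOfAbsConv_le_of_forall_lt_LSeriesSummable (x := 1) fun y hy => ?_)
    (by exact_mod_cast hx))
  · have h : Nat.card {I : Ideal (𝓞 K) // absNorm I = 1} = 1 := by simp [absNorm_eq_one_iff]
    simp only [h]; simp
  · have := LSeriesSummable_of_sum_norm_bigO_and_nonneg (r := 1) (s := (y : ℂ))
      (f := fun n => (Nat.card {I : Ideal (𝓞 K) // absNorm I = n} : ℝ))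
      (Asymptotics.isBigO_atTop_natCast_rpow_of_tendsto_div_rpow
        (a := dedekindZeta_residue K) ?_) (fun _ => Nat.cast_nonneg _) zero_le_one (by simpa)
    · simpa using this
    simp only [Real.rpow_one]
    refine ((Ideal.tendsto_norm_le_div_atTop₀ K).comp tendsto_natCast_atTop_atTop).congr fun n ↦ ?_
    simp only [Function.comp_apply, Nat.cast_le, ← Nat.cast_sum]
    congr
    rw [← add_left_inj 1, ← card_norm_le_eq_card_norm_le_add_one,
      show Finset.Icc 1 n = Finset.Ioc 0 n from Finset.Icc_succ_left_eq_Ioc _ _,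
      show 1 = Nat.card {I : Ideal (𝓞 K) // absNorm I = 0} by simp [Ideal.absNorm_eq_zero_iff],
      Finset.sum_Ioc_add_eq_sum_Icc (n.zero_le),
      ← Finset.card_preimage_eq_sum_card_image_eq (fun k _ ↦ finite_setOfPred_absNorm_eq k)]
    simp [Set.coe_eq_subtype]

section

variable {F : Type*} [Field F] {σ₁ σ₂ : F →+* ℝ}

lemma lift_eisG (K : Coords σ₁ σ₂) {k : ℕ} (hk : Even k) (hk2 : 2 ≤ k) {z : ℂ × ℂ} (hz : z ∈ H2) :
    lift (eisG σ₁ σ₂ k) z = eis k z := by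
  obtain ⟨z₁, z₂⟩ := z
  rw [lift_apply_of_mem hz, eisG_eq K hk hk2]
  rfl

lemma eisG_mem (K : Coords σ₁ σ₂) {k : ℕ} (hk : Even k) (hk2 : 2 ≤ k) :
    eisG σ₁ σ₂ k ∈ symForms σ₁ σ₂ k := by
  refine ⟨⟨?_, fun γ z => ?_⟩, fun z₁ z₂ => eisG_swap K hk hk2 z₁ z₂⟩
  · exact (differentiableOn_eis hk2).congr fun z hz => lift_eisG K hk hk2 hz
  · rw [zpow_natCast]
    exact eisG_act K hk hk2 γ z

/-- The constant `C` is left as a quotient; the lemmas on weights 2, 6 and 10 compute it by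
restriction to the diagonal. -/
lemma eisCoef_eisG (K : Coords σ₁ σ₂) {k : ℕ} (hk2 : 2 ≤ k) {m : ℕ} (hm : k = 2 * m) :
    EisCoef (lift (((Rep.zeta k : ℂ)⁻¹) • eisG σ₁ σ₂ k)) k
      ((Rep.zeta k : ℂ)⁻¹ * fcoef (pSum k 0) (1, 0)) := by
  have hk : Even k := ⟨m, by omega⟩
  have hmem : ((Rep.zeta k : ℂ)⁻¹) • eisG σ₁ σ₂ k ∈ evenSymForms σ₁ σ₂ (m : ℤ) := by
    have := Submodule.smul_mem _ ((Rep.zeta k : ℂ)⁻¹) (eisG_mem K hk hk2)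
    rw [evenSymForms, show (2 * (m : ℤ)) = (k : ℤ) by rw [hm]; push_cast; rfl]
    exact this
  have hz : (Rep.zeta k : ℂ) ≠ 0 := by
    have : (1 : ℝ) < k := by exact_mod_cast (by omega : 1 < k)
    exact_mod_cast (Rep.zeta_pos this).ne'
  have hc := (isSymHMF_lift K hmem).perHol.fcoef_eq_of_hasSum
    (a := fun μ => (Rep.zeta k : ℂ)⁻¹ *
      ((if μ = 0 then (Rep.zeta k : ℂ) else 0) + eisSum k μ)) fun z hz => by
    have h := (hasSum_eis hk2 hz).mul_left (Rep.zeta k : ℂ)⁻¹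
    rw [← lift_eisG K hk hk2 hz] at h
    simp only [← mul_assoc] at h
    exact h
  rw [← Prod.mk_zero_zero] at hc
  constructor <;> rw [hc] <;> simp only
  · rw [if_pos trivial, Prod.mk_zero_zero, eisSum_zero hk2, add_zero, inv_mul_cancel₀ hz]
  · rw [if_neg (by simp), zero_add, eisSum_one hk2]
  · rw [if_neg (by simp), zero_add, eisSum_two hk2]; ring
  · rw [if_neg (by simp), zero_add, eisSum_five hk2]; ring

variable [NumberField F]

lemma eisg_eq_smul (σ₁ σ₂ : F →+* ℝ) (k : ℕ) :
    eisg σ₁ σ₂ k = (dedekindZeta F k)⁻¹ • eisG σ₁ σ₂ k := rfl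

/-- Both zeta values are nonzero, so the two normalisations differ by a nonzero scalar. Their
equality is not needed, since a rescaling of generators does not affect the structure theorem. -/
lemma eisg_eq_smul_normalized (σ₁ σ₂ : F →+* ℝ) {k : ℕ} (hk2 : 2 ≤ k) :
    ∃ t : ℂ, t ≠ 0 ∧ eisg σ₁ σ₂ k = t • ((Rep.zeta k : ℂ)⁻¹ • eisG σ₁ σ₂ k) := by
  have hk : (1 : ℝ) < k := by exact_mod_cast (by omega : 1 < k)
  have hz : (Rep.zeta k : ℂ) ≠ 0 := by exact_mod_cast (Rep.zeta_pos hk).ne'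
  have hd : dedekindZeta F (k : ℂ) ≠ 0 := by
    have := (dedekindZeta_pos F hk).ne'
    simpa using this
  refine ⟨(dedekindZeta F k)⁻¹ * Rep.zeta k, mul_ne_zero (inv_ne_zero hd) hz, ?_⟩
  rw [smul_smul, mul_assoc, mul_inv_cancel₀ hz, mul_one, eisg_eq_smul]

end

end HilbertModular

end

theorem mainTheorem6 {F : Type*} [Field F] [NumberField F]
    (hF : Module.finrank ℚ F = 2) (h5 : ∃ x : F, x ^ 2 = 5)
    (σ₁ σ₂ : F →+* ℝ) (hσ : σ₁ ≠ σ₂) :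
    -- the Eisenstein series of weights 2, 6, 10 are well defined
    (∀ z : ℍ × ℍ, (∀ s : ℝ, 0 < s → Summable (HilbertModular.eisTerm σ₁ σ₂ 2 s z)) ∧
      Filter.Tendsto (fun s : ℝ => ∑' q, HilbertModular.eisTerm σ₁ σ₂ 2 s z q) (𝓝[>] 0)
        (𝓝 (HilbertModular.eisG σ₁ σ₂ 2 z)) ∧
      Summable (HilbertModular.eisTerm σ₁ σ₂ 6 0 z) ∧
      Summable (HilbertModular.eisTerm σ₁ σ₂ 10 0 z)) ∧
    -- they are symmetric modular forms, and they generate freely, compatibly with the gradings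
    ∃ (h₂ : HilbertModular.eisg σ₁ σ₂ 2 ∈ HilbertModular.evenSymForms σ₁ σ₂ 1)
      (h₆ : HilbertModular.eisg σ₁ σ₂ 6 ∈ HilbertModular.evenSymForms σ₁ σ₂ 3)
      (h₁₀ : HilbertModular.eisg σ₁ σ₂ 10 ∈ HilbertModular.evenSymForms σ₁ σ₂ 5)
      (Φ : MvPolynomial (Fin 3) ℂ ≃ₐ[ℂ] HilbertModular.EvenSymAlgebra σ₁ σ₂),
      Φ (MvPolynomial.X 0) =
        DirectSum.of (fun m : ℤ => HilbertModular.evenSymForms σ₁ σ₂ m) 1 ⟨_, h₂⟩ ∧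
      Φ (MvPolynomial.X 1) =
        DirectSum.of (fun m : ℤ => HilbertModular.evenSymForms σ₁ σ₂ m) 3 ⟨_, h₆⟩ ∧
      Φ (MvPolynomial.X 2) =
        DirectSum.of (fun m : ℤ => HilbertModular.evenSymForms σ₁ σ₂ m) 5 ⟨_, h₁₀⟩ ∧
      ∀ m : ℕ,
        (MvPolynomial.weightedHomogeneousSubmodule ℂ (![2, 6, 10] : Fin 3 → ℕ) (2 * m)).map
            Φ.toLinearMap =
          LinearMap.range
            (DirectSum.lof ℂ ℤ (fun m : ℤ => HilbertModular.evenSymForms σ₁ σ₂ m) (m : ℤ)) := by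
  obtain ⟨K⟩ := HilbertModular.exists_coords hF h5 hσ
  have hs : ∀ (k : ℕ) (s : ℝ), Even k → (2 : ℝ) < k + 2 * s → ∀ z,
      Summable (HilbertModular.eisTerm σ₁ σ₂ k s z) :=
    fun k s hk h z => (HilbertModular.hasSum_eisTerm K hk h z).summable
  refine ⟨fun z => ⟨fun s h => hs 2 s even_two (by push_cast; linarith) z,
    HilbertModular.tendsto_eisG K z, hs 6 0 (by decide) (by norm_num) z,
    hs 10 0 (by decide) (by norm_num) z⟩, ?_⟩
  have m₂ : HilbertModular.eisG σ₁ σ₂ 2 ∈ HilbertModular.evenSymForms σ₁ σ₂ 1 :=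
    HilbertModular.eisG_mem K even_two le_rfl
  have m₆ : HilbertModular.eisG σ₁ σ₂ 6 ∈ HilbertModular.evenSymForms σ₁ σ₂ 3 :=
    HilbertModular.eisG_mem K (by decide) (by norm_num)
  have m₁₀ : HilbertModular.eisG σ₁ σ₂ 10 ∈ HilbertModular.evenSymForms σ₁ σ₂ 5 :=
    HilbertModular.eisG_mem K (by decide) (by norm_num)
  obtain ⟨t₀, ht₀, e₀⟩ := HilbertModular.eisg_eq_smul_normalized σ₁ σ₂ (k := 2) le_rfl
  obtain ⟨t₁, ht₁, e₁⟩ := HilbertModular.eisg_eq_smul_normalized σ₁ σ₂ (k := 6) (by norm_num)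
  obtain ⟨t₂, ht₂, e₂⟩ := HilbertModular.eisg_eq_smul_normalized σ₁ σ₂ (k := 10) (by norm_num)
  exact ⟨Submodule.smul_mem _ _ m₂, Submodule.smul_mem _ _ m₆, Submodule.smul_mem _ _ m₁₀,
    HilbertModular.exists_algEquiv (fun m f hf => HilbertModular.isSymHMF_lift K hf)
      (Submodule.smul_mem _ _ m₂) (Submodule.smul_mem _ _ m₆) (Submodule.smul_mem _ _ m₁₀)
      (HilbertModular.eisCoef_eisG K le_rfl (m := 1) rfl)
      (HilbertModular.eisCoef_eisG K (by norm_num) (m := 3) rfl)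
      (HilbertModular.eisCoef_eisG K (by norm_num) (m := 5) rfl)
      ht₀ ht₁ ht₂ _ _ _ e₀ e₁ e₂⟩
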